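/- **Conventions.** A knot is an embedded circle in $\mathbb R^3$, considered up to ambient isotopy; a knot $K$ *has* a given diagram if $K$ is ambient isotopic to a knot projecting to that diagram with the prescribed over/undercrossings. The sign of a crossing is the sign of $\det(a,b)$, where $a$ and $b$ are the directions of the over- and understrand in an orientation of the knot. **Potholder diagrams.** Let $n_1,n_2$ be odd positive integers. A *potholder diagram* of width $n_1$ and height $n_2$ is a knot diagram obtained from a grid of $n_1$ vertical and $n_2$ horizontal line segments by joining neighboring loose ends so that the horizontal segments form a zigzag arc and the vertical segments form a zigzag arc, both running from the bottom-left corner to the top-right corner, where the two arcs are joined, and by choosing over/undercrossings at each of the $n_1n_2$ intersections. **Weaver diagrams.** A *weaver diagram* of width $n$ is drawn in a rectangle and consists of $n$ vertical lines (the warp), numbered from left to right and running from the bottom side to the top side, and of an embedded arc (the weft) that is transverse to the warp, whose two endpoints lie on the left side of the rectangle, and whose height is nondecreasing from the lower endpoint to the upper one, together with over/undercrossings at all intersections of the weft with the warp. **Knotholder diagrams.** Let $m\ge 1$. A *knotholder diagram* with $m$ $\cup$-shapes is a knot diagram of the following form. It contains a weaver diagram $W$ of width $2m$, and a long horizontal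 segment above $W$. The warp lines $2j-1$ and $2j$ of $W$ are joined by a $\cup$-shape below $W$, for $1\le j\le m$. The upper end of the warp line $2m$ is joined to the right end of the horizontal segment. The warp lines $1,\dots,2m-1$ continue upwards across the horizontal segment, and so does one more vertical strand, in position $0$ to the left of $W$, which starts at the upper endpoint of the weft. Above the horizontal segment, the strands in positions $2j$ and $2j+1$ are joined by a $\cap$-shape, for $0\le j\le m-1$. Finally, the left end of the horizontal segment is joined to the lower endpoint of the weft by an arc to the left of everything else, without further crossings. The $2m$ crossings on the horizontal segment are numbered $1,\dots,2m$ from right to left, and it is required that for each $i\in\{1,\dots,m\}$ the crossings $2i-1$ and $2i$ have the same sign $\varepsilon_i\in\{+,-\}$. The tuple $(\varepsilon_1,\dots,\varepsilon_m)$ is the *sign tuple* of the knotholder diagram. **Proposition (Potholder to knotholder).** Let $m\ge 1$, let $K$ be a knot that has a potholder diagram of width $2m-1$, and let $\varepsilon=(\varepsilon_1,\dots,\varepsilon_m)$ be an $m$-tuple of signs. Then $K$ has a knotholder diagram with $m$ $\cup$-shapes and sign tuple $\varepsilon$. -/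

import Mathlib

noncomputable section

namespace Knotholder

/-! ### Knots in three-space

Points are `(x, y, z)`.  Diagrams are drawn in the `(x, y)`-plane and seen from `z = +∞`, so that at a
crossing the strand with the larger `z`-coordinate is the overstrand. -/

/-- Euclidean three-space (with its usual topology). -/
abbrev Space : Type := ℝ × ℝ × ℝ

/-- A knot: a subset of three-space that is the image of an embedding of the circle. -/
structure Knot where
  carrier : Set Space
  isKnot : ∃ f : Circle → Space, Continuous f ∧ Function.Injective f ∧ Set.range f = carrier

/-- Ambient isotopy of subsets of three-space: a continuous family of homeomorphisms of the
space that starts at the identity and ends with a homeomorphism taking `A` to `B`. -/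
def AmbientIsotopic (A B : Set Space) : Prop :=
  ∃ H : unitInterval → (Space ≃ₜ Space),
    Continuous (fun p : unitInterval × Space => H p.1 p.2) ∧
    (∀ p, H 0 p = p) ∧ (H 1) '' A = B

/-- The polygonal line through a list of points. -/
def polyline : List Space → Set Space
  | [] => ∅
  | [p] => {p}
  | p :: q :: l => segment ℝ p q ∪ polyline (q :: l)

/-- The height of a strand at a crossing with a strand of height `0`: it is `1` if it passes over and
`-1` if it passes under. -/
def level (isOver : Bool) : ℝ := if isOver then 1 else -1

/-! ### Potholder diagrams -/

/-- A potholder diagram of width `w` and height `h`, both odd.  The underlying curve is determined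
by `w` and `h`, so the data are the over/undercrossings: `verticalOver i j` says whether the `i`-th
vertical segment (from the left) passes over the `j`-th horizontal segment (from the bottom). -/
structure PotholderDiagram (w h : ℕ) where
  odd_width : Odd w
  odd_height : Odd h
  verticalOver : Fin w → Fin h → Bool

namespace PotholderDiagram

variable {w h : ℕ}

/-- The `j`-th horizontal segment, from `x = 0` to `x = w + 1` at `y = j + 1`, traversed to the
right for `j = 0, 2, 4, …` and to the left for `j = 1, 3, 5, …`. -/
def row (w : ℕ) (j : ℕ) : List Space :=
  if Even j then [((0 : ℝ), (j + 1 : ℝ), (0 : ℝ)), ((w + 1 : ℝ), (j + 1 : ℝ), (0 : ℝ))]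
  else [((w + 1 : ℝ), (j + 1 : ℝ), (0 : ℝ)), ((0 : ℝ), (j + 1 : ℝ), (0 : ℝ))]

/-- The horizontal zigzag, from the bottom-left corner to the top-right corner. -/
def rowPath (w h : ℕ) : List Space :=
  [((0 : ℝ), (0 : ℝ), (0 : ℝ))] ++ (List.range h).flatMap (row w) ++
    [((w + 1 : ℝ), (h + 1 : ℝ), (0 : ℝ))]

/-- The `i`-th vertical segment, from `y = 0` to `y = h + 1` at `x = i + 1`, listed upwards. -/
def columnUp (D : PotholderDiagram w h) (i : Fin w) : List Space :=
  [((i + 1 : ℝ), (0 : ℝ), (0 : ℝ))] ++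
    (List.finRange h).map (fun j : Fin h => ((i + 1 : ℝ), (j + 1 : ℝ), level (D.verticalOver i j))) ++
    [((i + 1 : ℝ), (h + 1 : ℝ), (0 : ℝ))]

/-- The `i`-th vertical segment, traversed upwards for `i = 0, 2, 4, …` and downwards for
`i = 1, 3, 5, …`. -/
def column (D : PotholderDiagram w h) (i : Fin w) : List Space :=
  if Even (i : ℕ) then D.columnUp i else (D.columnUp i).reverse

/-- The vertical zigzag, from the bottom-left corner to the top-right corner. -/
def columnPath (D : PotholderDiagram w h) : List Space :=
  [((0 : ℝ), (0 : ℝ), (0 : ℝ))] ++ (List.finRange w).flatMap D.column ++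
    [((w + 1 : ℝ), (h + 1 : ℝ), (0 : ℝ))]

/-- A polygonal knot that projects to the potholder diagram. -/
def realization (D : PotholderDiagram w h) : Set Space :=
  polyline (rowPath w h) ∪ polyline D.columnPath

end PotholderDiagram

/-- The knot `K` has a potholder diagram of width `w` (and some height). -/
def Knot.HasPotholderDiagram (K : Knot) (w : ℕ) : Prop :=
  ∃ (h : ℕ) (D : PotholderDiagram w h), AmbientIsotopic K.carrier D.realization

/-! ### Weaver diagrams

The warp consists of the vertical lines `x = 1, …, x = n`.  The weft is an embedded arc, rising from
its lower endpoint to its upper endpoint, both on the left side `x = 0`.  Up to isotopy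
of the plane it is given by the sequence of its crossings with the warp: between crossings
it sits in one of the gaps `0, …, n`, gap `g` lying between the lines `x = g` and `x = g + 1`. -/

/-- A crossing of the weft with a line of the warp: whether the weft, traversed upwards, goes to the
right or to the left there, and whether it passes over or under the warp. -/
structure WeftStep where
  toRight : Bool
  isOver : Bool

/-- The gap reached from gap `g` by a step. -/
def WeftStep.next (s : WeftStep) (g : ℕ) : ℕ := if s.toRight then g + 1 else g - 1

/-- The index in `1, …, n` of the line of the warp that is crossed by a step from gap `g`. -/
def WeftStep.crossed (s : WeftStep) (g : ℕ) : ℕ := if s.toRight then g + 1 else g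

/-- Starting in gap `g`, the steps cross only existing lines of the warp and end in gap `0`. -/
def IsWeft (n : ℕ) : ℕ → List WeftStep → Prop
  | g, [] => g = 0
  | g, s :: l => (1 ≤ s.crossed g ∧ s.crossed g ≤ n) ∧ IsWeft n (s.next g) l

/-- A weaver diagram of width `n`. -/
structure WeaverDiagram (n : ℕ) where
  steps : List WeftStep
  isWeft : IsWeft n 0 steps

/-- The part of the weft from `y` upwards, starting in gap `g`, with crossings at heights
`y, y + 1, …` and the warp lying in the plane `z = 0`. -/
def weftFrom : ℕ → ℕ → List WeftStep → List Space
  | g, y, [] => [((g + 1 / 2 : ℝ), (y : ℝ), (0 : ℝ))]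
  | g, y, s :: l =>
      ((g + 1 / 2 : ℝ), (y : ℝ), (0 : ℝ)) ::
      ((s.crossed g : ℝ), (y : ℝ), level s.isOver) ::
      ((s.next g + 1 / 2 : ℝ), (y : ℝ), (0 : ℝ)) ::
      weftFrom (s.next g) (y + 1) l

/-- The weft of a weaver diagram with `N` crossings, from its lower endpoint `(0, 0, 0)` to its
upper endpoint `(0, N + 1, 0)`. -/
def WeaverDiagram.weft {n : ℕ} (W : WeaverDiagram n) : List Space :=
  [((0 : ℝ), (0 : ℝ), (0 : ℝ)), ((1 / 2 : ℝ), (0 : ℝ), (0 : ℝ))] ++ weftFrom 0 1 W.steps ++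
    [((0 : ℝ), (W.steps.length + 1 : ℝ), (0 : ℝ))]

/-! ### Knotholder diagrams -/

/-- The sign of a crossing, where `a` and `b` are the directions of the overstrand and the
understrand in the plane: the sign of the determinant of `(a, b)`. -/
def crossingSign (a b : ℤ × ℤ) : SignType := SignType.sign (a.1 * b.2 - a.2 * b.1)

/-- The sign of the crossing of number `k` on the long horizontal segment of a knotholder
diagram, given whether the vertical strand passes over.  In the orientation in which the knot is traversed
by `KnotholderDiagram.vertices`, the horizontal segment points to the left, and the vertical
strand points up if `k` is even and down if `k` is odd. -/
def armSign (k : ℕ) (verticalOver : Bool) : SignType :=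
  let vertical : ℤ × ℤ := if Even k then (0, 1) else (0, -1)
  let horizontal : ℤ × ℤ := (-1, 0)
  if verticalOver then crossingSign vertical horizontal else crossingSign horizontal vertical

/-- A knotholder diagram with `m` cups.  The crossings on the long horizontal segment are numbered
`1, …, 2 m` from right to left, and `verticalOver k` (used only for `1 ≤ k ≤ 2 m`) says whether
the vertical strand passes over in crossing `k`. -/
structure KnotholderDiagram (m : ℕ) where
  weaver : WeaverDiagram (2 * m)
  verticalOver : ℕ → Bool
  same_sign : ∀ i, 1 ≤ i → i ≤ m →
    armSign (2 * i - 1) (verticalOver (2 * i - 1)) = armSign (2 * i) (verticalOver (2 * i))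

namespace KnotholderDiagram

variable {m : ℕ}

/-- The sign tuple: the entry with (zero-based) index `i` is the common sign of the crossings
`2 (i + 1) - 1` and `2 (i + 1)`. -/
def signTuple (D : KnotholderDiagram m) (i : Fin m) : SignType :=
  armSign (2 * (i + 1)) (D.verticalOver (2 * (i + 1)))

/-- The height of the long horizontal segment, which lies just above the weaver diagram. -/
def armHeight (D : KnotholderDiagram m) : ℝ := D.weaver.steps.length + 2

/-- The point of the vertical strand at `x = p` above or below the horizontal segment. The
crossing there has number `2 m - p`. -/
def crossingPoint (D : KnotholderDiagram m) (p : ℕ) : Space :=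
  ((p : ℝ), D.armHeight, level (D.verticalOver (2 * m - p)))

/-- The piece of the knot consisting of the strand going up at `x = 2 j`, a cap above the horizontal
segment, the strand going down at `x = 2 j + 1` through the weaver diagram, and a cup below the weaver
diagram, ending at `x = 2 j + 2`. -/
def capCup (D : KnotholderDiagram m) (j : ℕ) : List Space :=
  [((2 * j : ℝ), D.armHeight - 1, (0 : ℝ)),
   D.crossingPoint (2 * j),
   ((2 * j : ℝ), D.armHeight + 1, (0 : ℝ)),
   ((2 * j + 1 : ℝ), D.armHeight + 1, (0 : ℝ)),
   D.crossingPoint (2 * j + 1),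
   ((2 * j + 1 : ℝ), D.armHeight - 1, (0 : ℝ)),
   ((2 * j + 1 : ℝ), (-1 : ℝ), (0 : ℝ)),
   ((2 * j + 2 : ℝ), (-1 : ℝ), (0 : ℝ))]

/-- The closed polygon of a knotholder diagram.  From the left end of the long horizontal segment it
goes down, outside of the rest of the diagram, to the lower endpoint of the weft, follows
the weft to its upper endpoint, continues as the left-most vertical strand, passes through
all caps and cups from left to right, goes up along the last line of the warp to the right end of the
horizontal segment, and traverses this segment to the left. -/
def vertices (D : KnotholderDiagram m) : List Space :=
  [((-1 : ℝ), D.armHeight, (0 : ℝ)), ((-1 : ℝ), (0 : ℝ), (0 : ℝ))] ++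
    D.weaver.weft ++
    (List.range m).flatMap D.capCup ++
    [((2 * m : ℝ), D.armHeight, (0 : ℝ)), ((-1 : ℝ), D.armHeight, (0 : ℝ))]

/-- A polygonal knot that projects to the knotholder diagram. -/
def realization (D : KnotholderDiagram m) : Set Space := polyline D.vertices

end KnotholderDiagram

/-- The knot `K` has a knotholder diagram with `m` cups and sign tuple `ε`. -/
def Knot.HasKnotholderDiagram (K : Knot) (m : ℕ) (ε : Fin m → SignType) : Prop :=
  ∃ D : KnotholderDiagram m, D.signTuple = ε ∧ AmbientIsotopic K.carrier D.realization

end Knotholder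

end

noncomputable section

namespace Knotholder

/-! ### Ambient isotopies that move points along coordinate lines -/

/-! The knot is brought into a normal form `form m A C` with three constituents. The frame is fixed:
the straight strands at x = 1, …, 2m-1, the cups at y = -1, the caps at y = 3, and a vertical strand
at x = -2. The arm `A` leaves the bottom at x = 2m and ends at x = -2. The weft `C` leaves the lower
end of the strand at x = -2, wanders among the straight strands, and ends as the strand at x = 0.
Arm and weft are strands: their height y is monotone, so each is a moving point of the xz-plane, and
the straight strands are punctures of that plane.

A strand may be moved by any homotopy that avoids the rest of the knot
(`isotopic_strand_of_homotopy`). Hence, apart from the arm, a weft matters only through its homotopy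
class in a half plane with 2m punctures, the last one being the arm in its rest position x = 2m. By
a subdivision argument such a class is a word: a sequence of moves from gap to gap, each passing one
puncture in front or behind (`exists_isWord`). A word is a weaver diagram, so a knot in normal form
is a knotholder (`HasForm.exists_knotholder`); for this the polygon of the knotholder is itself
normalized (`KnotholderDiagram.exists_image_normalize`).

A potholder reaches the normal form as follows. Its vertical zigzag is straightened into strands,
caps and cups, and its horizontal zigzag is tilted into a rising strand, the lace. A long finger is
pulled towards the viewer out of the lower end of the lace and unfolded in front of everything; it
becomes the arm, the strand at x = -2, and the beginning of the weft (`IsLace.hasForm`,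
`PotholderDiagram.hasForm`). This arm passes in front of all strands.

It remains to change the crossings of the arm with the strands 0, …, 2m-1 at will. Strands 2j and
2j+1 are joined by a cap: if both pass the arm on the same side, the cap can be pulled back past the
arm and put down on the other side (`isotopic_form_capFlip`). Strands 2j-1 and 2j are joined by a
cup: the same works once the arm has been lowered below the weft, which only drags the weft along
(`exists_isotopic_low`, `isotopic_form_cupFlip`, `exists_isotopic_high`). Strand 0 is the end of the
weft, so its crossing can be changed by itself at the price of a different weft
(`isotopic_form_strandZeroFlip`). Caps and cups link the strands into a chain that starts at strand
0, and an induction along the chain changes any crossing (`HasForm.change_of_agree`). Every choice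
of crossings, and in particular every sign tuple, is therefore available. -/

theorem AmbientIsotopic.refl (A : Set Space) : AmbientIsotopic A A :=
  ⟨fun _ => Homeomorph.refl _, continuous_snd, fun _ => rfl, by simp⟩

theorem AmbientIsotopic.symm {A B : Set Space} (h : AmbientIsotopic A B) :
    AmbientIsotopic B A := by
  obtain ⟨H, hc, h0, h1⟩ := h
  -- The reversed family starts at `H 1`, so the inverse of `H 1` is applied first. Inverting only
  -- this one map avoids the joint continuity of all inverses.
  refine ⟨fun t => (H 1).symm.trans (H (unitInterval.symm t)), ?_, ?_, ?_⟩
  · exact hc.comp ((unitInterval.continuous_symm.comp continuous_fst).prodMk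
      ((H 1).symm.continuous.comp continuous_snd))
  · intro p; simp
  · rw [← h1]
    ext p
    simp only [Homeomorph.trans_apply, unitInterval.symm_one, h0, Set.mem_image]
    constructor
    · rintro ⟨q, ⟨r, hr, rfl⟩, rfl⟩; simpa using hr
    · intro hp; exact ⟨_, ⟨p, hp, rfl⟩, by simp⟩

theorem AmbientIsotopic.trans {A B C : Set Space} (h : AmbientIsotopic A B)
    (h' : AmbientIsotopic B C) : AmbientIsotopic A C := by
  obtain ⟨H, hc, h0, h1⟩ := h
  obtain ⟨G, gc, g0, g1⟩ := h'
  refine ⟨fun t => (H t).trans (G t), ?_, ?_, ?_⟩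
  · exact gc.comp (continuous_fst.prodMk hc)
  · intro p; simp [h0, g0]
  · rw [← g1, ← h1, Set.image_image]; rfl

/-- A continuous family of increasing bijections of the line is a homeomorphism. -/
def fiberHomeomorph {Q : Type*} [TopologicalSpace Q] (φ : Q × ℝ → ℝ) (hφ : Continuous φ)
    (hm : ∀ q, StrictMono fun z => φ (q, z)) (hs : ∀ q, Function.Surjective fun z => φ (q, z)) :
    Q × ℝ ≃ₜ Q × ℝ where
  toFun p := (p.1, φ p)
  invFun p := (p.1, ((hm p.1).orderIsoOfSurjective _ (hs p.1)).symm p.2)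
  left_inv p := by
    refine Prod.ext rfl ?_
    exact ((hm p.1).orderIsoOfSurjective _ (hs p.1)).symm_apply_apply p.2
  right_inv p := by
    refine Prod.ext rfl ?_
    exact ((hm p.1).orderIsoOfSurjective _ (hs p.1)).apply_symm_apply p.2
  continuous_toFun := continuous_fst.prodMk hφ
  continuous_invFun := by
    refine continuous_fst.prodMk ?_
    -- The preimage of an open ray with end `a` under the inverse is cut out by comparing the last
    -- coordinate with `φ (q, a)`; this is an open condition because `φ` is continuous.
    rw [OrderTopology.continuous_iff]
    intro a
    constructor
    · have : IsOpen {p : Q × ℝ | φ (p.1, a) < p.2} :=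
        isOpen_lt (hφ.comp (continuous_fst.prodMk continuous_const)) continuous_snd
      convert this using 1
      ext p
      exact ((hm p.1).orderIsoOfSurjective _ (hs p.1)).lt_symm_apply
    · have : IsOpen {p : Q × ℝ | p.2 < φ (p.1, a)} :=
        isOpen_lt continuous_snd (hφ.comp (continuous_fst.prodMk continuous_const))
      convert this using 1
      ext p
      exact ((hm p.1).orderIsoOfSurjective _ (hs p.1)).symm_apply_lt

theorem surjective_add_of_bounded {f : ℝ → ℝ} (hf : Continuous f) {M : ℝ} (hM : ∀ x, |f x| ≤ M) :
    Function.Surjective fun x => x + f x := by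
  refine Continuous.surjective (f := fun x => x + f x) (continuous_id.add hf) ?_ ?_
  · refine Filter.tendsto_atTop_mono (f := fun x => x - M) (fun x => ?_) ?_
    · have := abs_le.1 (hM x); linarith
    · exact Filter.tendsto_atTop_add_const_right _ _ Filter.tendsto_id
  · refine Filter.tendsto_atBot_mono (f := fun x => x + M) (fun x => ?_) ?_
    · have := abs_le.1 (hM x); linarith
    · exact Filter.tendsto_atBot_add_const_right _ _ Filter.tendsto_id

/-- The maps z ↦ z + t u(q, z) are convex combinations of the identity and an increasing map, hence
increasing, and they are onto because u is bounded. So the straight-line family is an ambient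
isotopy. The homeomorphism `e` selects the coordinate that moves. -/
theorem isotopic_image_of_fiber {Q : Type*} [TopologicalSpace Q] (e : Space ≃ₜ Q × ℝ)
    {u : Q × ℝ → ℝ} (hu : Continuous u) {M : ℝ} (hM : ∀ p, |u p| ≤ M)
    (hm : ∀ q, StrictMono fun z => z + u (q, z)) (A : Set Space) :
    AmbientIsotopic A ((fun p => e.symm ((e p).1, (e p).2 + u (e p))) '' A) := by
  have hM0 : ∀ (t : unitInterval) p, |(t : ℝ) * u p| ≤ M := by
    intro t p
    rw [abs_mul, abs_of_nonneg t.2.1]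
    exact (mul_le_of_le_one_left (abs_nonneg _) t.2.2).trans (hM p)
  have hmt : ∀ (t : unitInterval) q, StrictMono fun z => z + (t : ℝ) * u (q, z) := by
    intro t q a b hab
    have h1 := hm q hab
    have ht0 := t.2.1
    have ht1 := t.2.2
    simp only at h1 ⊢
    rcases eq_or_lt_of_le ht0 with h | h
    · rw [← h]; linarith
    · nlinarith
  have hct : ∀ t : unitInterval, Continuous fun p : Q × ℝ => p.2 + (t : ℝ) * u p := fun t => by
    fun_prop
  have hst : ∀ (t : unitInterval) q, Function.Surjective fun z => z + (t : ℝ) * u (q, z) :=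
    fun t q => surjective_add_of_bounded (f := fun z => (t : ℝ) * u (q, z)) (by fun_prop)
      (fun z => hM0 t _)
  refine ⟨fun t => e.trans ((fiberHomeomorph (fun p => p.2 + (t : ℝ) * u p) (hct t) (hmt t)
    (hst t)).trans e.symm), ?_, ?_, ?_⟩
  · change Continuous fun p : unitInterval × Space =>
      e.symm ((e p.2).1, (e p.2).2 + (p.1 : ℝ) * u (e p.2))
    fun_prop
  · intro p
    change e.symm ((e p).1, (e p).2 + ((0 : unitInterval) : ℝ) * u (e p)) = p
    simp
  · refine Set.image_congr fun p _ => ?_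
    change e.symm ((e p).1, (e p).2 + ((1 : unitInterval) : ℝ) * u (e p)) = _
    simp

/-- Move the points of space in the `x`-direction. -/
def moveX (u : Space → ℝ) (p : Space) : Space := (p.1 + u p, p.2.1, p.2.2)

/-- Move the points of space in the `y`-direction. -/
def moveY (u : Space → ℝ) (p : Space) : Space := (p.1, p.2.1 + u p, p.2.2)

/-- Move the points of space in the `z`-direction. -/
def moveZ (u : Space → ℝ) (p : Space) : Space := (p.1, p.2.1, p.2.2 + u p)

theorem isotopic_moveX {u : Space → ℝ} (hu : Continuous u) {M : ℝ} (hM : ∀ p, |u p| ≤ M)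
    (hm : ∀ y z, StrictMono fun x => x + u (x, y, z)) (A : Set Space) :
    AmbientIsotopic A (moveX u '' A) := by
  let e : Space ≃ₜ (ℝ × ℝ) × ℝ := Homeomorph.prodComm _ _
  exact isotopic_image_of_fiber e (u := fun q => u (q.2, q.1.1, q.1.2)) (by fun_prop)
    (fun p => hM _) (fun q => hm q.1 q.2) A

theorem isotopic_moveY {u : Space → ℝ} (hu : Continuous u) {M : ℝ} (hM : ∀ p, |u p| ≤ M)
    (hm : ∀ x z, StrictMono fun y => y + u (x, y, z)) (A : Set Space) :
    AmbientIsotopic A (moveY u '' A) := by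
  let e : Space ≃ₜ (ℝ × ℝ) × ℝ :=
    { toFun := fun p => ((p.1, p.2.2), p.2.1)
      invFun := fun q => (q.1.1, q.2, q.1.2)
      left_inv := fun _ => rfl
      right_inv := fun _ => rfl
      continuous_toFun := by fun_prop
      continuous_invFun := by fun_prop }
  exact isotopic_image_of_fiber e (u := fun q => u (q.1.1, q.2, q.1.2)) (by fun_prop)
    (fun p => hM _) (fun q => hm q.1 q.2) A

theorem isotopic_moveZ {u : Space → ℝ} (hu : Continuous u) {M : ℝ} (hM : ∀ p, |u p| ≤ M)
    (hm : ∀ x y, StrictMono fun z => z + u (x, y, z)) (A : Set Space) :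
    AmbientIsotopic A (moveZ u '' A) := by
  let e : Space ≃ₜ (ℝ × ℝ) × ℝ := (Homeomorph.prodAssoc ℝ ℝ ℝ).symm
  exact isotopic_image_of_fiber e (u := fun q => u (q.1.1, q.1.2, q.2)) (by fun_prop)
    (fun p => hM _) (fun q => hm q.1 q.2) A

/-- A shear in the `z`-direction. -/
theorem isotopic_shearZ {f : ℝ → ℝ → ℝ} (hf : Continuous fun q : ℝ × ℝ => f q.1 q.2) {M : ℝ}
    (hM : ∀ x y, |f x y| ≤ M) (A : Set Space) :
    AmbientIsotopic A (moveZ (fun p => f p.1 p.2.1) '' A) :=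
  isotopic_moveZ (u := fun p => f p.1 p.2.1)
    (hf.comp (f := fun p : Space => (p.1, p.2.1)) (by fun_prop)) (fun _ => hM _ _)
    (fun x y => strictMono_id.add_const (f x y)) A

/-- Half a turn about a line parallel to the `y`-axis. -/
theorem isotopic_halfTurn (a : ℝ) (A : Set Space) :
    AmbientIsotopic A ((fun p : Space => (a - p.1, p.2.1, -p.2.2)) '' A) := by
  -- The axis is the line x = a/2, z = 0; the isotopy rotates by the angle πt.
  let b := a / 2
  let H : ℝ → Space ≃ₜ Space := fun θ =>
    { toFun := fun p => (b + Real.cos θ * (p.1 - b) - Real.sin θ * p.2.2, p.2.1,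
        Real.sin θ * (p.1 - b) + Real.cos θ * p.2.2)
      invFun := fun p => (b + Real.cos θ * (p.1 - b) + Real.sin θ * p.2.2, p.2.1,
        -Real.sin θ * (p.1 - b) + Real.cos θ * p.2.2)
      left_inv := fun p => by
        have h := Real.sin_sq_add_cos_sq θ
        refine Prod.ext ?_ (Prod.ext rfl ?_)
        · simp only; linear_combination (p.1 - b) * h
        · simp only; linear_combination p.2.2 * h
      right_inv := fun p => by
        have h := Real.sin_sq_add_cos_sq θ
        refine Prod.ext ?_ (Prod.ext rfl ?_)
        · simp only; linear_combination (p.1 - b) * h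
        · simp only; linear_combination p.2.2 * h
      continuous_toFun := by fun_prop
      continuous_invFun := by fun_prop }
  refine ⟨fun t => H (Real.pi * t), ?_, ?_, ?_⟩
  · change Continuous fun p : unitInterval × Space =>
      ((b + Real.cos (Real.pi * p.1) * (p.2.1 - b) - Real.sin (Real.pi * p.1) * p.2.2.2, p.2.2.1,
        Real.sin (Real.pi * p.1) * (p.2.1 - b) + Real.cos (Real.pi * p.1) * p.2.2.2) : Space)
    fun_prop
  · intro p
    change ((_, _, _) : Space) = p
    refine Prod.ext ?_ (Prod.ext rfl ?_) <;> simp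
  · refine Set.image_congr fun p _ => ?_
    change ((_, _, _) : Space) = _
    refine Prod.ext ?_ (Prod.ext rfl ?_) <;> simp [b]
    ring

/-! ### Piecewise linear functions of one variable -/

/-- `clamp a b x` is the point of `[a, b]` next to `x`. -/
def clamp (a b x : ℝ) : ℝ := max a (min b x)

@[fun_prop] theorem continuous_clamp (a b : ℝ) : Continuous (clamp a b) := by
  unfold clamp; fun_prop

theorem clamp_of_le {a b x : ℝ} (h : x ≤ a) : clamp a b x = a := by
  unfold clamp; exact max_eq_left ((min_le_right _ _).trans h)

theorem clamp_of_ge {a b x : ℝ} (hab : a ≤ b) (h : b ≤ x) : clamp a b x = b := by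
  unfold clamp; rw [min_eq_left h, max_eq_right hab]

theorem clamp_of_mem {a b x : ℝ} (h : a ≤ x) (h' : x ≤ b) : clamp a b x = x := by
  unfold clamp; rw [min_eq_right h', max_eq_right h]

theorem le_clamp (a b x : ℝ) : a ≤ clamp a b x := le_max_left _ _

theorem clamp_le {a b : ℝ} (hab : a ≤ b) (x : ℝ) : clamp a b x ≤ b :=
  max_le hab (min_le_left _ _)

theorem monotone_clamp (a b : ℝ) : Monotone (clamp a b) := fun _ _ h =>
  max_le_max le_rfl (min_le_min le_rfl h)

/-- The function that is `0` up to `a`, `1` from `b` on, and linear in between. -/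
def ramp (a b y : ℝ) : ℝ := clamp 0 1 ((y - a) / (b - a))

@[fun_prop] theorem continuous_ramp (a b : ℝ) : Continuous (ramp a b) := by
  unfold ramp; fun_prop

theorem ramp_nonneg (a b y : ℝ) : 0 ≤ ramp a b y := le_clamp _ _ _

theorem ramp_le_one (a b y : ℝ) : ramp a b y ≤ 1 := clamp_le zero_le_one _

theorem ramp_of_le {a b y : ℝ} (hab : a < b) (h : y ≤ a) : ramp a b y = 0 :=
  clamp_of_le (div_nonpos_of_nonpos_of_nonneg (by linarith) (by linarith))

theorem ramp_of_ge {a b y : ℝ} (hab : a < b) (h : b ≤ y) : ramp a b y = 1 :=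
  clamp_of_ge zero_le_one ((one_le_div (by linarith)).2 (by linarith))

theorem ramp_of_mem {a b y : ℝ} (hab : a < b) (h : a ≤ y) (h' : y ≤ b) :
    ramp a b y = (y - a) / (b - a) :=
  clamp_of_mem (div_nonneg (by linarith) (by linarith)) ((div_le_one (by linarith)).2 (by linarith))

/-- The tent function with support `[-1, 1]` and value `1` at `0`. -/
def tent (x : ℝ) : ℝ := max 0 (1 - |x|)

@[fun_prop] theorem continuous_tent : Continuous tent := by unfold tent; fun_prop

theorem tent_nonneg (x : ℝ) : 0 ≤ tent x := le_max_left _ _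

theorem tent_le_one (x : ℝ) : tent x ≤ 1 := max_le zero_le_one (by linarith [abs_nonneg x])

theorem tent_zero : tent 0 = 1 := by simp [tent]

theorem tent_of_one_le {x : ℝ} (h : 1 ≤ |x|) : tent x = 0 := max_eq_left (by linarith)

theorem clamp_add_le {a b x d : ℝ} (hd : 0 ≤ d) : clamp a b (x + d) ≤ clamp a b x + d := by
  refine max_le (by linarith [le_clamp a b x]) ?_
  have h : min b (x + d) ≤ min b x + d := by
    rw [← min_add_add_right]; exact min_le_min (by linarith) le_rfl
  exact h.trans (by gcongr; exact le_max_right _ _)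

/-- As a difference of two shifted clamps, tents at consecutive integers have a telescoping sum, and
tents inherit monotonicity bounds from clamps. -/
theorem tent_eq_clamp (x : ℝ) : tent x = clamp 0 1 (x + 1) - clamp 0 1 x := by
  rcases le_total x 0 with h | h
  · rw [clamp_of_le h]
    rcases le_total x (-1) with h' | h'
    · rw [clamp_of_le (by linarith), tent_of_one_le (by rw [abs_of_nonpos h]; linarith)]; ring
    · rw [clamp_of_mem (by linarith) (by linarith), tent, abs_of_nonpos h,
        max_eq_right (by linarith)]; ring
  · rw [clamp_of_ge zero_le_one (by linarith : 1 ≤ x + 1)]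
    rcases le_total x 1 with h' | h'
    · rw [clamp_of_mem h h', tent, abs_of_nonneg h, max_eq_right (by linarith)]
    · rw [clamp_of_ge zero_le_one h', tent_of_one_le (by rwa [abs_of_nonneg h])]; ring

theorem sum_clamp_sub (n : ℕ) (x : ℝ) :
    ∑ i ∈ Finset.range n, clamp 0 1 (x - i) = clamp 0 n x := by
  induction n with
  | zero => simp [clamp]
  | succ n ih =>
    rw [Finset.sum_range_succ, ih]
    have hn : (0 : ℝ) ≤ n := Nat.cast_nonneg n
    push_cast
    rcases le_total x n with h | h
    · rw [clamp_of_le (a := 0) (b := 1) (by linarith), add_zero]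
      rcases le_total x 0 with h0 | h0
      · rw [clamp_of_le h0, clamp_of_le h0]
      · rw [clamp_of_mem h0 h, clamp_of_mem h0 (by linarith)]
    · rw [clamp_of_ge hn h]
      rcases le_total x (n + 1) with h1 | h1
      · rw [clamp_of_mem (a := 0) (b := 1) (by linarith) (by linarith),
          clamp_of_mem (by linarith) h1]; ring
      · rw [clamp_of_ge zero_le_one (by linarith), clamp_of_ge (by linarith) h1]

/-- All integer translates of the tent form a partition of unity, and only finitely many of them are
summed. This bounds every interpolation of values in [-1, 1]. -/
theorem sum_tent_le_one (n : ℕ) (x : ℝ) : ∑ k ∈ Finset.range n, tent (x - k) ≤ 1 := by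
  have : ∀ k : ℕ, tent (x - k) = clamp 0 1 ((x + 1) - k) - clamp 0 1 (x - k) := fun k => by
    rw [tent_eq_clamp]; congr 2; ring
  simp_rw [this]
  rw [Finset.sum_sub_distrib, sum_clamp_sub, sum_clamp_sub]
  linarith [clamp_add_le (a := 0) (b := n) (x := x) zero_le_one]

/-! ### Slides -/

/-- The piecewise linear function that is `1` at `b` and `0` outside of `(lo, hi)`. -/
def slideWeight (lo hi b x : ℝ) : ℝ := max 0 (min ((x - lo) / (b - lo)) ((hi - x) / (hi - b)))

/-- The displacement of the piecewise linear homeomorphism of the line that takes `b` to `b'` and is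
the identity outside of `(lo, hi)`. -/
def slide (lo hi b b' x : ℝ) : ℝ := (b' - b) * slideWeight lo hi b x

section slide
variable {lo hi b b' : ℝ}

theorem slideWeight_nonneg (x : ℝ) : 0 ≤ slideWeight lo hi b x := le_max_left _ _

theorem slideWeight_le_one (h1 : lo < b) (h2 : b < hi) (x : ℝ) : slideWeight lo hi b x ≤ 1 := by
  refine max_le zero_le_one ?_
  rcases le_total x b with h | h
  · exact (min_le_left _ _).trans ((div_le_one (by linarith)).2 (by linarith))
  · exact (min_le_right _ _).trans ((div_le_one (by linarith)).2 (by linarith))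

theorem slideWeight_self (h1 : lo < b) (h2 : b < hi) : slideWeight lo hi b b = 1 := by
  unfold slideWeight
  rw [div_self (by linarith), div_self (by linarith)]; simp

theorem slideWeight_of_le (h1 : lo < b) {x : ℝ} (hx : x ≤ lo) : slideWeight lo hi b x = 0 :=
  max_eq_left ((min_le_left _ _).trans (div_nonpos_of_nonpos_of_nonneg (by linarith) (by linarith)))

theorem slideWeight_of_ge (h2 : b < hi) {x : ℝ} (hx : hi ≤ x) : slideWeight lo hi b x = 0 :=
  max_eq_left ((min_le_right _ _).trans (div_nonpos_of_nonpos_of_nonneg (by linarith) (by linarith)))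

theorem slide_self (h1 : lo < b) (h2 : b < hi) : slide lo hi b b' b = b' - b := by
  rw [slide, slideWeight_self h1 h2, mul_one]

theorem slide_of_le (h1 : lo < b) {x : ℝ} (hx : x ≤ lo) : slide lo hi b b' x = 0 := by
  rw [slide, slideWeight_of_le h1 hx, mul_zero]

theorem slide_of_ge (h2 : b < hi) {x : ℝ} (hx : hi ≤ x) : slide lo hi b b' x = 0 := by
  rw [slide, slideWeight_of_ge h2 hx, mul_zero]

theorem slide_same (x : ℝ) : slide lo hi b b x = 0 := by simp [slide]

theorem abs_slide_le (h1 : lo < b) (h2 : b < hi) (h3 : lo < b') (h4 : b' < hi) (x : ℝ) :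
    |slide lo hi b b' x| ≤ hi - lo := by
  rw [slide, abs_mul, abs_of_nonneg (slideWeight_nonneg x)]
  calc |b' - b| * slideWeight lo hi b x ≤ |b' - b| * 1 :=
        mul_le_mul_of_nonneg_left (slideWeight_le_one h1 h2 x) (abs_nonneg _)
    _ ≤ hi - lo := by rw [mul_one, abs_le]; constructor <;> linarith

theorem slideWeight_sub_le (h1 : lo < b) (h2 : b < hi) {x x' : ℝ} (h : x ≤ x') :
    slideWeight lo hi b x' - slideWeight lo hi b x ≤ (x' - x) / (b - lo) := by
  have hp : 0 ≤ (x' - x) / (b - lo) := div_nonneg (by linarith) (by linarith)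
  rw [sub_le_iff_le_add']
  refine max_le (add_nonneg (slideWeight_nonneg x) hp) ?_
  refine le_trans ?_ (add_le_add_left (le_max_right _ _) _)
  rw [← min_add_add_right]
  refine min_le_min (le_of_eq ?_) ?_
  · rw [← add_div]; congr 1; ring
  · have : (hi - x') / (hi - b) ≤ (hi - x) / (hi - b) :=
      div_le_div_of_nonneg_right (by linarith) (by linarith)
    linarith

theorem le_slideWeight_sub (h1 : lo < b) (h2 : b < hi) {x x' : ℝ} (h : x ≤ x') :
    slideWeight lo hi b x - slideWeight lo hi b x' ≤ (x' - x) / (hi - b) := by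
  have hp : 0 ≤ (x' - x) / (hi - b) := div_nonneg (by linarith) (by linarith)
  rw [sub_le_iff_le_add']
  refine max_le (add_nonneg (slideWeight_nonneg x') hp) ?_
  refine le_trans ?_ (add_le_add_left (le_max_right _ _) _)
  rw [← min_add_add_right]
  refine min_le_min ?_ (le_of_eq ?_)
  · have : (x - lo) / (b - lo) ≤ (x' - lo) / (b - lo) :=
      div_le_div_of_nonneg_right (by linarith) (by linarith)
    linarith
  · rw [← add_div]; congr 1; ring

/-- Only one flank of the weight can work against monotonicity. For b ≤ b' it is the right one, of
slope -1/(hi - b), and b' - b < hi - b keeps the total slope positive; the other case is symmetric.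
-/
theorem strictMono_slide (h1 : lo < b) (h2 : b < hi) (h3 : lo < b') (h4 : b' < hi) :
    StrictMono fun x => x + slide lo hi b b' x := by
  intro x x' h
  simp only [slide]
  rcases le_total b b' with hb | hb
  · have := le_slideWeight_sub h1 h2 h.le
    have h5 : (b' - b) * ((x' - x) / (hi - b)) < x' - x := by
      rw [mul_div_assoc', div_lt_iff₀ (by linarith), mul_comm]
      exact mul_lt_mul_of_pos_left (by linarith) (by linarith)
    nlinarith [mul_le_mul_of_nonneg_left this (sub_nonneg.2 hb)]
  · have := slideWeight_sub_le h1 h2 h.le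
    have h5 : (b - b') * ((x' - x) / (b - lo)) < x' - x := by
      rw [mul_div_assoc', div_lt_iff₀ (by linarith), mul_comm]
      exact mul_lt_mul_of_pos_left (by linarith) (by linarith)
    nlinarith [mul_le_mul_of_nonneg_left this (sub_nonneg.2 hb)]

end slide

theorem continuous_slide {T : Type*} [TopologicalSpace T] {lo hi : ℝ} {b b' f : T → ℝ}
    (hb : Continuous b) (hb' : Continuous b') (hf : Continuous f) (h1 : ∀ t, lo < b t)
    (h2 : ∀ t, b t < hi) : Continuous fun t => slide lo hi (b t) (b' t) (f t) := by
  have h3 : ∀ t, b t - lo ≠ 0 := fun t => by linarith [h1 t]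
  have h4 : ∀ t, hi - b t ≠ 0 := fun t => by linarith [h2 t]
  unfold slide slideWeight
  fun_prop (disch := assumption)

/-! ### Strands and their homotopies -/

/-- The part over `J` of the arc that is in position `c y` in the plane at height `y`. -/
def strand (c : ℝ → ℝ × ℝ) (J : Set ℝ) : Set Space := (fun y => ((c y).1, y, (c y).2)) '' J

theorem strand_congr {c c' : ℝ → ℝ × ℝ} {J : Set ℝ} (h : ∀ y ∈ J, c y = c' y) :
    strand c J = strand c' J :=
  Set.image_congr fun y hy => by rw [h y hy]

theorem abs_bump_sub_le {k : ℝ} (hk : 0 < k) (r r' : ℝ) :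
    |max 0 (1 - r / k) - max 0 (1 - r' / k)| ≤ |r - r'| / k := by
  refine (abs_max_sub_max_le_max 0 (1 - r / k) 0 (1 - r' / k)).trans ?_
  rw [sub_zero, abs_zero, max_eq_right (abs_nonneg _), ← abs_of_pos hk, ← abs_div, abs_of_pos hk,
    abs_sub_comm]
  exact le_of_eq (congrArg _ (by ring))

/-- The bump is Lipschitz with constant 1/k, and |d| ≤ k/2, so the displacement varies at most half
as fast as x. -/
theorem strictMono_add_bump {k d : ℝ} (hk : 0 < k) (hd : |d| ≤ k / 2) {r : ℝ → ℝ}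
    (hr : ∀ x x', |r x - r x'| ≤ |x - x'|) :
    StrictMono fun x => x + d * max 0 (1 - r x / k) := by
  intro x x' h
  have h1 : |d * max 0 (1 - r x / k) - d * max 0 (1 - r x' / k)| ≤ (x' - x) / 2 := by
    rw [← mul_sub, abs_mul]
    calc |d| * |max 0 (1 - r x / k) - max 0 (1 - r x' / k)|
        ≤ k / 2 * ((x' - x) / k) := by
          refine mul_le_mul hd ((abs_bump_sub_le hk _ _).trans ?_) (abs_nonneg _) (by linarith)
          refine div_le_div_of_nonneg_right ((hr x x').trans ?_) hk.le
          rw [abs_sub_comm, abs_of_pos (by linarith)]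
      _ = (x' - x) / 2 := by field_simp
  have := (abs_le.1 h1).2
  simp only
  linarith

/-- At each height the points are pushed by `d y`, damped by a bump of radius k in the maximum norm
around the strand. The strand moves by the full amount, and `R`, being at distance at least k, does
not move. -/
theorem isotopic_strand_moveX {R : Set Space} {J : Set ℝ} {a b k : ℝ} {c : ℝ → ℝ × ℝ} {d : ℝ → ℝ}
    (hc : Continuous c) (hd : Continuous d) (hk : 0 < k) (hdk : ∀ y, |d y| ≤ k / 2)
    (hd0 : ∀ y ∉ Set.Icc a b, d y = 0)
    (hR : ∀ p ∈ R, p.2.1 ∈ Set.Icc a b → k ≤ max |p.1 - (c p.2.1).1| |p.2.2 - (c p.2.1).2|) :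
    AmbientIsotopic (R ∪ strand c J) (R ∪ strand (fun y => ((c y).1 + d y, (c y).2)) J) := by
  let u : Space → ℝ := fun p =>
    d p.2.1 * max 0 (1 - max |p.1 - (c p.2.1).1| |p.2.2 - (c p.2.1).2| / k)
  have hb : ∀ r : ℝ, 0 ≤ r → max 0 (1 - r / k) ≤ 1 := fun r hr =>
    max_le zero_le_one (by linarith [div_nonneg hr hk.le])
  have h := isotopic_moveX (u := u) (by fun_prop) (M := k / 2) (fun p => ?_) (fun y z => ?_)
    (R ∪ strand c J)
  · convert h using 1
    rw [Set.image_union]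
    congr 1
    · rw [Set.image_congr (g := id), Set.image_id]
      intro p hp
      have : u p = 0 := by
        by_cases hy : p.2.1 ∈ Set.Icc a b
        · have := hR p hp hy
          simp only [u]
          rw [max_eq_left, mul_zero]
          rw [sub_nonpos, one_le_div hk]; exact this
        · simp [u, hd0 _ hy]
      simp [moveX, this]
    · rw [strand, strand, Set.image_image]
      refine Set.image_congr fun y _ => ?_
      simp [moveX, u]
  · simp only [u]
    rw [abs_mul, abs_of_nonneg (le_max_left 0 (_ : ℝ))]
    calc _ ≤ |d p.2.1| * 1 := mul_le_mul_of_nonneg_left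
          (hb _ (le_max_of_le_left (abs_nonneg _))) (abs_nonneg _)
      _ ≤ k / 2 := by rw [mul_one]; exact hdk _
  · refine strictMono_add_bump hk (hdk y) (r := fun x => max |x - (c y).1| |z - (c y).2|) ?_
    intro x x'
    refine (abs_max_sub_max_le_max _ _ _ _).trans ?_
    rw [sub_self, abs_zero, max_eq_left (abs_nonneg _)]
    refine (abs_abs_sub_abs_le_abs_sub _ _).trans (le_of_eq ?_)
    congr 1; ring

theorem isotopic_strand_moveZ {R : Set Space} {J : Set ℝ} {a b k : ℝ} {c : ℝ → ℝ × ℝ} {d : ℝ → ℝ}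
    (hc : Continuous c) (hd : Continuous d) (hk : 0 < k) (hdk : ∀ y, |d y| ≤ k / 2)
    (hd0 : ∀ y ∉ Set.Icc a b, d y = 0)
    (hR : ∀ p ∈ R, p.2.1 ∈ Set.Icc a b → k ≤ max |p.1 - (c p.2.1).1| |p.2.2 - (c p.2.1).2|) :
    AmbientIsotopic (R ∪ strand c J) (R ∪ strand (fun y => ((c y).1, (c y).2 + d y)) J) := by
  let u : Space → ℝ := fun p =>
    d p.2.1 * max 0 (1 - max |p.1 - (c p.2.1).1| |p.2.2 - (c p.2.1).2| / k)
  have hb : ∀ r : ℝ, 0 ≤ r → max 0 (1 - r / k) ≤ 1 := fun r hr =>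
    max_le zero_le_one (by linarith [div_nonneg hr hk.le])
  have h := isotopic_moveZ (u := u) (by fun_prop) (M := k / 2) (fun p => ?_) (fun x y => ?_)
    (R ∪ strand c J)
  · convert h using 1
    rw [Set.image_union]
    congr 1
    · rw [Set.image_congr (g := id), Set.image_id]
      intro p hp
      have : u p = 0 := by
        by_cases hy : p.2.1 ∈ Set.Icc a b
        · have := hR p hp hy
          simp only [u]
          rw [max_eq_left, mul_zero]
          rw [sub_nonpos, one_le_div hk]; exact this
        · simp [u, hd0 _ hy]
      simp [moveZ, this]
    · rw [strand, strand, Set.image_image]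
      refine Set.image_congr fun y _ => ?_
      simp [moveZ, u]
  · simp only [u]
    rw [abs_mul, abs_of_nonneg (le_max_left 0 (_ : ℝ))]
    calc _ ≤ |d p.2.1| * 1 := mul_le_mul_of_nonneg_left
          (hb _ (le_max_of_le_left (abs_nonneg _))) (abs_nonneg _)
      _ ≤ k / 2 := by rw [mul_one]; exact hdk _
  · refine strictMono_add_bump hk (hdk y) (r := fun z => max |x - (c y).1| |z - (c y).2|) ?_
    intro x x'
    refine (abs_max_sub_max_le_max _ _ _ _).trans ?_
    rw [sub_self, abs_zero, max_eq_right (abs_nonneg _)]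
    refine (abs_abs_sub_abs_le_abs_sub _ _).trans (le_of_eq ?_)
    congr 1; ring

/-- The strand is moved first in the x-direction and then in the z-direction. The first move uses up
at most k/2 of the clearance 2k, so at least k is left for the second. -/
theorem isotopic_strand_of_close {R : Set Space} {J : Set ℝ} {a b k : ℝ} {c c' : ℝ → ℝ × ℝ}
    (hc : Continuous c) (hc' : Continuous c') (hk : 0 < k)
    (hcc : ∀ y ∈ Set.Icc a b, dist (c' y) (c y) ≤ k / 2) (hout : ∀ y ∉ Set.Icc a b, c' y = c y)
    (hR : ∀ p ∈ R, p.2.1 ∈ Set.Icc a b →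
      2 * k ≤ max |p.1 - (c p.2.1).1| |p.2.2 - (c p.2.1).2|) :
    AmbientIsotopic (R ∪ strand c J) (R ∪ strand c' J) := by
  have h1 : ∀ y, |(c' y).1 - (c y).1| ≤ k / 2 ∧ |(c' y).2 - (c y).2| ≤ k / 2 := by
    intro y
    by_cases hy : y ∈ Set.Icc a b
    · have := hcc y hy
      rw [Prod.dist_eq, max_le_iff, Real.dist_eq, Real.dist_eq] at this
      exact this
    · rw [hout y hy]; simp; linarith
  have s1 := isotopic_strand_moveX (R := R) (J := J) (a := a) (b := b) (k := k) hc
    (d := fun y => (c' y).1 - (c y).1) (by fun_prop) hk (fun y => (h1 y).1)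
    (fun y hy => by rw [hout y hy, sub_self])
    (fun p hp hy => by linarith [hR p hp hy])
  have s2 := isotopic_strand_moveZ (R := R) (J := J) (a := a) (b := b) (k := k)
    (c := fun y => ((c y).1 + ((c' y).1 - (c y).1), (c y).2)) (by fun_prop)
    (d := fun y => (c' y).2 - (c y).2) (by fun_prop) hk (fun y => (h1 y).2)
    (fun y hy => by rw [hout y hy, sub_self])
    (fun p hp hy => by
      have h2 := hR p hp hy
      have h3 := abs_le.1 (h1 p.2.1).1
      rcases le_max_iff.1 h2 with h | h
      · refine le_max_of_le_left ?_
        rcases le_abs.1 h with h | h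
        · exact le_abs.2 (Or.inl (by simp only; linarith))
        · exact le_abs.2 (Or.inr (by simp only; linarith))
      · exact le_max_of_le_right (by linarith))
  refine s1.trans ?_
  convert s2 using 4
  ext <;> simp

/-- A strand may be moved by a homotopy in the complement of the rest of the knot. -/
theorem isotopic_strand_of_homotopy {R : Set Space} (hR : IsClosed R) {J : Set ℝ} {a b : ℝ}
    {c : ℝ → ℝ → ℝ × ℝ} (hc : Continuous fun q : ℝ × ℝ => c q.1 q.2)
    (hout : ∀ t ∈ Set.Icc (0 : ℝ) 1, ∀ y ∉ Set.Icc a b, c t y = c 0 y)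
    (hav : ∀ t ∈ Set.Icc (0 : ℝ) 1, ∀ y ∈ Set.Icc a b, ((c t y).1, y, (c t y).2) ∉ R) :
    AmbientIsotopic (R ∪ strand (c 0) J) (R ∪ strand (c 1) J) := by
  let K : Set (ℝ × ℝ) := Set.Icc 0 1 ×ˢ Set.Icc a b
  have hK : IsCompact K := isCompact_Icc.prod isCompact_Icc
  let F : ℝ × ℝ → Space := fun q => ((c q.1 q.2).1, q.2, (c q.1 q.2).2)
  have hF : Continuous F := by fun_prop
  -- The track of the homotopy is compact and disjoint from the closed set `R`, so it has a uniform
  -- clearance δ.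
  obtain ⟨δ, hδ, hsub⟩ := (hK.image hF).exists_thickening_subset_open hR.isOpen_compl
    (by rintro _ ⟨q, ⟨hq, hq'⟩, rfl⟩; exact hav q.1 hq q.2 hq')
  have hdist : ∀ t ∈ Set.Icc (0 : ℝ) 1, ∀ p ∈ R, p.2.1 ∈ Set.Icc a b →
      δ ≤ max |p.1 - (c t p.2.1).1| |p.2.2 - (c t p.2.1).2| := by
    intro t ht p hp hy
    by_contra hlt
    rw [not_le] at hlt
    refine hsub (Metric.mem_thickening_iff.2 ⟨F (t, p.2.1), ⟨_, ⟨ht, hy⟩, rfl⟩, ?_⟩) hp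
    rw [Prod.dist_eq, Prod.dist_eq, Real.dist_eq, Real.dist_eq, Real.dist_eq]
    simp only [F, sub_self, abs_zero]
    rw [max_eq_right (abs_nonneg (p.2.2 - (c t p.2.1).2))]
    exact hlt
  -- Uniform continuity divides the time interval into n steps, in each of which the strand moves by
  -- less than δ/4. Every step is then a small move with k = δ/2.
  have huc := hK.uniformContinuousOn_of_continuous hc.continuousOn
  rw [Metric.uniformContinuousOn_iff] at huc
  obtain ⟨η, hη, huc⟩ := huc (δ / 4) (by linarith)
  obtain ⟨n, hn⟩ := exists_nat_gt (1 / η)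
  have hn0 : (0 : ℝ) < n := lt_trans (by positivity) hn
  have step : ∀ i : ℕ, i ≤ n →
      AmbientIsotopic (R ∪ strand (c 0) J) (R ∪ strand (c (i / n)) J) := by
    intro i
    induction i with
    | zero => intro _; simpa using AmbientIsotopic.refl _
    | succ i ih =>
      intro hi
      refine (ih (by omega)).trans ?_
      have hi' : ((i : ℝ) + 1) ≤ n := by exact_mod_cast hi
      have m1 : (i / n : ℝ) ∈ Set.Icc (0 : ℝ) 1 :=
        ⟨by positivity, (div_le_one hn0).2 (by linarith)⟩
      have m2 : ((i + 1 : ℕ) / n : ℝ) ∈ Set.Icc (0 : ℝ) 1 := by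
        push_cast
        exact ⟨by positivity, (div_le_one hn0).2 hi'⟩
      refine isotopic_strand_of_close (a := a) (b := b) (k := δ / 2) (by fun_prop) (by fun_prop)
        (by linarith) (fun y hy => ?_) (fun y hy => by rw [hout _ m2 y hy, hout _ m1 y hy])
        (fun p hp hy => by linarith [hdist _ m1 p hp hy])
      have := huc (((i + 1 : ℕ) / n : ℝ), y) ⟨m2, hy⟩ ((i / n : ℝ), y) ⟨m1, hy⟩ (by
        rw [Prod.dist_eq, dist_self, max_eq_left dist_nonneg, Real.dist_eq]
        push_cast
        rw [← sub_div, add_sub_cancel_left, abs_of_pos (by positivity)]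
        rw [div_lt_iff₀ hn0]
        rw [div_lt_iff₀ hη] at hn
        linarith)
      simp only at this
      linarith
  have := step n le_rfl
  rwa [div_self hn0.ne'] at this

/-! ### The normal form of a knotholder -/

theorem abs_level (b : Bool) : |level b| = 1 := by cases b <;> simp [level]

theorem level_sq (b : Bool) : level b * level b = 1 := by cases b <;> simp [level]

theorem level_mul_le (b b' : Bool) : -1 ≤ level b * level b' := by
  cases b <;> cases b' <;> simp [level]

/-- The piecewise linear interpolation of the heights of the strands `0, …, 2 m - 1`. -/
def amp (m : ℕ) (P : ℕ → Bool) (x : ℝ) : ℝ := ∑ k ∈ Finset.range (2 * m), level (P k) * tent (x - k)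

/-- The position at `x` of an arm that passes the straight strands as prescribed by `P`. -/
def armPt (m : ℕ) (P : ℕ → Bool) (x : ℝ) : ℝ × ℝ := (x, -amp m P x)

section amp
variable {m : ℕ} {P P' : ℕ → Bool}

@[fun_prop] theorem continuous_amp : Continuous (amp m P) := by unfold amp; fun_prop

@[fun_prop] theorem continuous_armPt : Continuous (armPt m P) := by unfold armPt; fun_prop

theorem tent_sub_nat {k l : ℕ} (h : l ≠ k) : tent ((k : ℝ) - l) = 0 := by
  apply tent_of_one_le
  have : (1 : ℤ) ≤ |(k : ℤ) - l| := Int.one_le_abs (by omega)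
  exact_mod_cast this

theorem amp_nat {k : ℕ} (hk : k < 2 * m) : amp m P k = level (P k) := by
  unfold amp
  rw [Finset.sum_eq_single k]
  · simp [tent_zero]
  · intro l _ h; rw [tent_sub_nat h, mul_zero]
  · intro h; exact absurd (Finset.mem_range.2 hk) h

theorem amp_of_le {x : ℝ} (hx : x ≤ -1) : amp m P x = 0 := by
  refine Finset.sum_eq_zero fun k _ => ?_
  have : (0 : ℝ) ≤ k := Nat.cast_nonneg k
  rw [tent_of_one_le (by rw [abs_of_nonpos] <;> linarith), mul_zero]

theorem amp_of_ge {x : ℝ} (hx : 2 * m ≤ x) : amp m P x = 0 := by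
  refine Finset.sum_eq_zero fun k hk => ?_
  have h1 := Finset.mem_range.1 hk
  have : (k : ℝ) + 1 ≤ 2 * m := by exact_mod_cast h1
  rw [tent_of_one_le (by rw [abs_of_nonneg] <;> linarith), mul_zero]

theorem amp_congr {x : ℝ} (h : ∀ k < 2 * m, P k = P' k ∨ 1 ≤ |x - k|) : amp m P x = amp m P' x := by
  refine Finset.sum_congr rfl fun k hk => ?_
  rcases h k (Finset.mem_range.1 hk) with h | h
  · rw [h]
  · rw [tent_of_one_le h, mul_zero, mul_zero]

theorem abs_amp_le (x : ℝ) : |amp m P x| ≤ 1 := by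
  refine (Finset.abs_sum_le_sum_abs _ _).trans (le_trans (le_of_eq ?_) (sum_tent_le_one (2 * m) x))
  refine Finset.sum_congr rfl fun k _ => ?_
  rw [abs_mul, abs_level, one_mul, abs_of_nonneg (tent_nonneg _)]

/-- The distance of `x` from the interval `[a, a + 1]`. -/
def gapDist (a : ℕ) (x : ℝ) : ℝ := max 0 (max (a - x) (x - (a + 1)))

theorem gapDist_nonneg (a : ℕ) (x : ℝ) : 0 ≤ gapDist a x := le_max_left _ _

@[fun_prop] theorem continuous_gapDist (a : ℕ) : Continuous (gapDist a) := by
  unfold gapDist; fun_prop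

theorem gapDist_of_mem {a : ℕ} {x : ℝ} (h : a ≤ x) (h' : x ≤ a + 1) : gapDist a x = 0 :=
  max_eq_left (max_le (by linarith) (by linarith))

theorem tent_add_tent_ge (a : ℕ) (x : ℝ) :
    1 - gapDist a x ≤ tent (x - a) + tent (x - (a + 1)) := by
  have h0 := tent_nonneg (x - a)
  have h1 := tent_nonneg (x - (a + 1))
  rcases le_total x a with h | h
  · have : (a : ℝ) - x ≤ gapDist a x := le_max_of_le_right (le_max_left _ _)
    have h2 : 1 - |x - a| ≤ tent (x - a) := le_max_right _ _
    rw [abs_of_nonpos (by linarith)] at h2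
    linarith
  · rcases le_total x (a + 1) with h' | h'
    · have h2 : 1 - |x - a| ≤ tent (x - a) := le_max_right _ _
      have h3 : 1 - |x - (a + 1)| ≤ tent (x - (a + 1)) := le_max_right _ _
      rw [abs_of_nonneg (by linarith)] at h2
      rw [abs_of_nonpos (by linarith)] at h3
      linarith [gapDist_nonneg a x]
    · have : x - (a + 1) ≤ gapDist a x := le_max_of_le_right (le_max_right _ _)
      have h2 : 1 - |x - (a + 1)| ≤ tent (x - (a + 1)) := le_max_right _ _
      rw [abs_of_nonneg (by linarith)] at h2
      linarith

/-- Between two neighboring strands that are passed on the same side, the arm stays on that side. -/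
theorem one_le_abs_amp_add {a : ℕ} (ha : a + 1 < 2 * m) (hP : P a = P (a + 1)) (x : ℝ) :
    1 ≤ |amp m P x| + 2 * gapDist a x := by
  let T : ℕ → ℝ := fun k => tent (x - k)
  have hT : ∀ k, 0 ≤ T k := fun k => tent_nonneg _
  have h1 : level (P a) * amp m P x =
      ∑ k ∈ Finset.range (2 * m), level (P a) * level (P k) * T k := by
    unfold amp; rw [Finset.mul_sum]; exact Finset.sum_congr rfl fun k _ => by simp [T]; ring
  -- After multiplication with the common sign of a and a+1, these two tents count positively, and
  -- every other one counts at worst negatively. The total is at least -1 plus twice the two tents,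
  -- that is, at least 1 minus twice the distance from the gap.
  have h2 : ∑ k ∈ Finset.range (2 * m), (-T k + if k = a ∨ k = a + 1 then 2 * T k else 0)
      ≤ level (P a) * amp m P x := by
    rw [h1]
    refine Finset.sum_le_sum fun k _ => ?_
    split_ifs with h
    · rcases h with rfl | rfl
      · rw [level_sq]; linarith
      · rw [hP, level_sq]; linarith
    · nlinarith [level_mul_le (P a) (P k), hT k]
  rw [Finset.sum_add_distrib, Finset.sum_neg_distrib, ← Finset.sum_filter] at h2
  have h3 : Finset.filter (fun k => k = a ∨ k = a + 1) (Finset.range (2 * m)) = {a, a + 1} := by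
    ext k; simp only [Finset.mem_filter, Finset.mem_range, Finset.mem_insert,
      Finset.mem_singleton]; omega
  rw [h3, Finset.sum_pair (by omega)] at h2
  have h4 := sum_tent_le_one (2 * m) x
  have h5 := tent_add_tent_ge a x
  have h6 : level (P a) * amp m P x ≤ |amp m P x| := by
    rw [← one_mul |amp m P x|, ← abs_level (P a), ← abs_mul]; exact le_abs_self _
  simp only [T, Nat.cast_add, Nat.cast_one] at h2
  linarith

end amp

/-- The parts of the normal form that never move: the straight strands `1, …, 2 m - 1`, the cups at
`y = -1`, the caps at `y = 3`, and the strand on the left. -/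
def frame (m : ℕ) : Set Space :=
  {p | (∃ k : ℕ, (1 ≤ k ∧ k < 2 * m) ∧ p.1 = k ∧ p.2.1 ∈ Set.Icc (-1 : ℝ) 3 ∧ p.2.2 = 0) ∨
    (∃ j : ℕ, (1 ≤ j ∧ j ≤ m) ∧ p.1 ∈ Set.Icc (2 * j - 1 : ℝ) (2 * j) ∧ p.2.1 = -1 ∧ p.2.2 = 0) ∨
    (∃ j : ℕ, j < m ∧ p.1 ∈ Set.Icc (2 * j : ℝ) (2 * j + 1) ∧ p.2.1 = 3 ∧ p.2.2 = 0) ∨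
    (p.1 = -2 ∧ p.2.1 ∈ Set.Icc (-3 / 4 : ℝ) (5 / 2) ∧ p.2.2 = 0)}

/-- The union of the frame, an arm `A`, and a weft `C`. -/
def form (m : ℕ) (A C : ℝ → ℝ × ℝ) : Set Space :=
  frame m ∪ strand A (Set.Icc (-1) (5 / 2)) ∪ strand C (Set.Icc (-3 / 4) 3)

theorem isClosed_frame (m : ℕ) : IsClosed (frame m) := by
  have e : frame m = (⋃ k ∈ {k : ℕ | 1 ≤ k ∧ k < 2 * m},
        {p : Space | p.1 = k ∧ p.2.1 ∈ Set.Icc (-1 : ℝ) 3 ∧ p.2.2 = 0}) ∪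
      ((⋃ j ∈ {j : ℕ | 1 ≤ j ∧ j ≤ m},
        {p : Space | p.1 ∈ Set.Icc (2 * j - 1 : ℝ) (2 * j) ∧ p.2.1 = -1 ∧ p.2.2 = 0}) ∪
      ((⋃ j ∈ {j : ℕ | j < m},
        {p : Space | p.1 ∈ Set.Icc (2 * j : ℝ) (2 * j + 1) ∧ p.2.1 = 3 ∧ p.2.2 = 0}) ∪
      {p : Space | p.1 = -2 ∧ p.2.1 ∈ Set.Icc (-3 / 4 : ℝ) (5 / 2) ∧ p.2.2 = 0})) := by
    ext p; simp only [frame, Set.mem_union, Set.mem_iUnion, Set.mem_ofPred_eq, exists_prop]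
  rw [e]
  have c1 : ∀ (a : ℝ), IsClosed {p : Space | p.1 = a} := fun a =>
    isClosed_eq continuous_fst continuous_const
  have c2 : ∀ (a : ℝ), IsClosed {p : Space | p.2.1 = a} := fun a =>
    isClosed_eq (by fun_prop) continuous_const
  have c3 : IsClosed {p : Space | p.2.2 = 0} := isClosed_eq (by fun_prop) continuous_const
  have c4 : ∀ (a b : ℝ), IsClosed {p : Space | p.2.1 ∈ Set.Icc a b} := fun a b =>
    isClosed_Icc.preimage (f := fun p : Space => p.2.1) (by fun_prop)
  have c5 : ∀ (a b : ℝ), IsClosed {p : Space | p.1 ∈ Set.Icc a b} := fun a b =>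
    isClosed_Icc.preimage (f := fun p : Space => p.1) (by fun_prop)
  refine IsClosed.union (Set.Finite.isClosed_biUnion ?_ fun k _ => ?_)
    (IsClosed.union (Set.Finite.isClosed_biUnion ?_ fun k _ => ?_)
    (IsClosed.union (Set.Finite.isClosed_biUnion ?_ fun k _ => ?_) ?_))
  · exact (Set.finite_lt_nat (2 * m)).subset fun k hk => hk.2
  · exact (c1 _).inter ((c4 _ _).inter c3)
  · exact (Set.finite_le_nat m).subset fun k hk => hk.2
  · exact (c5 _ _).inter ((c2 _).inter c3)
  · exact Set.finite_lt_nat m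
  · exact (c5 _ _).inter ((c2 _).inter c3)
  · exact (c1 _).inter ((c4 _ _).inter c3)

theorem isClosed_strand {c : ℝ → ℝ × ℝ} (hc : Continuous c) (a b : ℝ) :
    IsClosed (strand c (Set.Icc a b)) :=
  (isCompact_Icc.image (by fun_prop)).isClosed

theorem image_form {m : ℕ} {A C A' C' : ℝ → ℝ × ℝ} {f : Space → Space}
    (h1 : ∀ p ∈ frame m, f p = p)
    (h2 : ∀ y ∈ Set.Icc (-1 : ℝ) (5 / 2), f ((A y).1, y, (A y).2) = ((A' y).1, y, (A' y).2))
    (h3 : ∀ y ∈ Set.Icc (-3 / 4 : ℝ) 3, f ((C y).1, y, (C y).2) = ((C' y).1, y, (C' y).2)) :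
    f '' form m A C = form m A' C' := by
  unfold form strand
  rw [Set.image_union, Set.image_union, Set.image_image, Set.image_image, Set.image_congr h2,
    Set.image_congr h3, Set.image_congr (g := id) h1, Set.image_id]

theorem image_form_eq {m : ℕ} {A C A' C' : ℝ → ℝ × ℝ} {f g : Space → Space}
    (h1 : ∀ p ∈ frame m, f p = g p)
    (h2 : ∀ y ∈ Set.Icc (-1 : ℝ) (5 / 2), f ((A y).1, y, (A y).2) = g ((A' y).1, y, (A' y).2))
    (h3 : ∀ y ∈ Set.Icc (-3 / 4 : ℝ) 3, f ((C y).1, y, (C y).2) = g ((C' y).1, y, (C' y).2)) :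
    f '' form m A C = g '' form m A' C' := by
  unfold form strand
  rw [Set.image_union, Set.image_union, Set.image_image, Set.image_image, Set.image_congr h2,
    Set.image_congr h3, Set.image_congr h1, Set.image_union, Set.image_union, Set.image_image,
    Set.image_image]

theorem frame_avoid {m : ℕ} {v : ℝ × ℝ} {y : ℝ} (h1 : -1 < y) (h2 : y < 3) (hx : -2 < v.1)
    (hv : ∀ k : ℕ, 1 ≤ k → k < 2 * m → v ≠ ((k : ℝ), 0)) : (v.1, y, v.2) ∉ frame m := by
  rintro (⟨k, hk, h, -, h'⟩ | ⟨j, -, -, h, -⟩ | ⟨j, -, -, h, -⟩ | ⟨h, -, -⟩)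
  · exact hv k hk.1 hk.2 (Prod.ext h h')
  · simp only at h; linarith
  · simp only at h; linarith
  · simp only at h; linarith

/-- The weft may be moved by a homotopy. -/
theorem isotopic_form_weft {m : ℕ} {A : ℝ → ℝ × ℝ} (hA : Continuous A) {a b : ℝ} (ha : -1 < a)
    (hb : b < 3) {c : ℝ → ℝ → ℝ × ℝ} (hc : Continuous fun q : ℝ × ℝ => c q.1 q.2)
    (hout : ∀ t ∈ Set.Icc (0 : ℝ) 1, ∀ y ∉ Set.Icc a b, c t y = c 0 y)
    (hx : ∀ t ∈ Set.Icc (0 : ℝ) 1, ∀ y ∈ Set.Icc a b, -2 < (c t y).1)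
    (hk : ∀ t ∈ Set.Icc (0 : ℝ) 1, ∀ y ∈ Set.Icc a b, ∀ k : ℕ, 1 ≤ k → k < 2 * m →
      c t y ≠ ((k : ℝ), 0))
    (hav : ∀ t ∈ Set.Icc (0 : ℝ) 1, ∀ y ∈ Set.Icc a b, c t y ≠ A y) :
    AmbientIsotopic (form m A (c 0)) (form m A (c 1)) := by
  refine isotopic_strand_of_homotopy ((isClosed_frame m).union (isClosed_strand hA _ _)) hc hout ?_
  rintro t ht y hy (h | ⟨y', -, h⟩)
  · exact frame_avoid (by linarith [hy.1]) (by linarith [hy.2]) (hx t ht y hy) (hk t ht y hy) h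
  · obtain ⟨h1, h2, h3⟩ : (A y').1 = (c t y).1 ∧ y' = y ∧ (A y').2 = (c t y).2 := by
      simpa [Prod.ext_iff] using h
    subst h2
    exact hav t ht y' hy (Prod.ext h1.symm h3.symm)

/-- The arm may be moved by a homotopy. -/
theorem isotopic_form_arm {m : ℕ} {C : ℝ → ℝ × ℝ} (hC : Continuous C) {a b : ℝ} (ha : -1 < a)
    (hb : b < 3) {c : ℝ → ℝ → ℝ × ℝ} (hc : Continuous fun q : ℝ × ℝ => c q.1 q.2)
    (hout : ∀ t ∈ Set.Icc (0 : ℝ) 1, ∀ y ∉ Set.Icc a b, c t y = c 0 y)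
    (hx : ∀ t ∈ Set.Icc (0 : ℝ) 1, ∀ y ∈ Set.Icc a b, -2 < (c t y).1)
    (hk : ∀ t ∈ Set.Icc (0 : ℝ) 1, ∀ y ∈ Set.Icc a b, ∀ k : ℕ, 1 ≤ k → k < 2 * m →
      c t y ≠ ((k : ℝ), 0))
    (hav : ∀ t ∈ Set.Icc (0 : ℝ) 1, ∀ y ∈ Set.Icc a b, -3 / 4 ≤ y → c t y ≠ C y) :
    AmbientIsotopic (form m (c 0) C) (form m (c 1) C) := by
  have h := isotopic_strand_of_homotopy (J := Set.Icc (-1) (5 / 2))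
    ((isClosed_frame m).union (isClosed_strand hC (-3 / 4) 3)) hc hout ?_
  · unfold form
    rwa [Set.union_right_comm, Set.union_right_comm (frame m) (strand (c 1) _)]
  rintro t ht y hy (h | ⟨y', hy', h⟩)
  · exact frame_avoid (by linarith [hy.1]) (by linarith [hy.2]) (hx t ht y hy) (hk t ht y hy) h
  · obtain ⟨h1, h2, h3⟩ : (C y').1 = (c t y).1 ∧ y' = y ∧ (C y').2 = (c t y).2 := by
      simpa [Prod.ext_iff] using h
    subst h2
    exact hav t ht y' hy hy'.1 (Prod.ext h1.symm h3.symm)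

/-! ### Flipping the crossings on the arm -/

/-- The arm that is swung to the left above the weft, without its last part. -/
def highArm (m : ℕ) (y : ℝ) : ℝ := 2 * m - (2 * m + 1) * ramp (3 / 2) (9 / 4) y

/-- The arm that is swung to the left below the weft, without its last part. -/
def lowArm (m : ℕ) (y : ℝ) : ℝ := 2 * m - (2 * m + 1) * ramp (-1 / 2) (-1 / 4) y

/-- The last part of the arm joins it to the strand on the left. -/
def armTail (y : ℝ) : ℝ := ramp (9 / 4) (5 / 2) y

/-- The first part of the weft. -/
def weftStart (y : ℝ) : ℝ × ℝ := (-2 + 8 * clamp 0 (1 / 4) (y + 3 / 4), 0)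

@[fun_prop] theorem continuous_highArm (m : ℕ) : Continuous (highArm m) := by
  unfold highArm; fun_prop

@[fun_prop] theorem continuous_lowArm (m : ℕ) : Continuous (lowArm m) := by unfold lowArm; fun_prop

@[fun_prop] theorem continuous_armTail : Continuous armTail := by unfold armTail; fun_prop

theorem sub_mul_ramp_mem (m : ℕ) (a b y : ℝ) :
    -1 ≤ 2 * m - (2 * m + 1) * ramp a b y ∧ 2 * m - (2 * m + 1) * ramp a b y ≤ 2 * m := by
  have h0 := ramp_nonneg a b y
  have h1 := ramp_le_one a b y
  have hm : (0 : ℝ) ≤ m := Nat.cast_nonneg m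
  constructor <;> nlinarith

theorem highArm_mem (m : ℕ) (y : ℝ) : -1 ≤ highArm m y ∧ highArm m y ≤ 2 * m :=
  sub_mul_ramp_mem _ _ _ _

theorem lowArm_mem (m : ℕ) (y : ℝ) : -1 ≤ lowArm m y ∧ lowArm m y ≤ 2 * m :=
  sub_mul_ramp_mem _ _ _ _

theorem highArm_of_le {m : ℕ} {y : ℝ} (h : y ≤ 3 / 2) : highArm m y = 2 * m := by
  rw [highArm, ramp_of_le (by norm_num) h]; ring

theorem highArm_of_ge {m : ℕ} {y : ℝ} (h : 9 / 4 ≤ y) : highArm m y = -1 := by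
  rw [highArm, ramp_of_ge (by norm_num) h]; ring

theorem lowArm_of_le {m : ℕ} {y : ℝ} (h : y ≤ -1 / 2) : lowArm m y = 2 * m := by
  rw [lowArm, ramp_of_le (by norm_num) h]; ring

theorem lowArm_of_ge {m : ℕ} {y : ℝ} (h : -1 / 4 ≤ y) : lowArm m y = -1 := by
  rw [lowArm, ramp_of_ge (by norm_num) h]; ring

theorem armTail_of_le {y : ℝ} (h : y ≤ 9 / 4) : armTail y = 0 := ramp_of_le (by norm_num) h

theorem armTail_nonneg (y : ℝ) : 0 ≤ armTail y := ramp_nonneg _ _ _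

theorem weftStart_fst_le (y : ℝ) : (weftStart y).1 ≤ 0 := by
  have := clamp_le (a := 0) (b := 1 / 4) (by norm_num) (y + 3 / 4)
  simp only [weftStart]; linarith

theorem weftStart_of_ge {y : ℝ} (h : -1 / 2 ≤ y) : weftStart y = (0, 0) := by
  rw [weftStart, clamp_of_ge (by norm_num) (by linarith)]; norm_num

/-- The complete arm. -/
def arm (m : ℕ) (P : ℕ → Bool) (X : ℝ → ℝ) (y : ℝ) : ℝ × ℝ := armPt m P (X y - armTail y)

theorem continuous_arm {m : ℕ} {P : ℕ → Bool} {X : ℝ → ℝ} (hX : Continuous X) :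
    Continuous (arm m P X) := by
  unfold arm; fun_prop

/-- A weft that moves only for `0 ≤ y ≤ T` and avoids the points of `F` then. -/
structure IsFreeWeft (F : Set (ℝ × ℝ)) (T : ℝ) (C : ℝ → ℝ × ℝ) : Prop where
  continuous : Continuous C
  eq_start : ∀ y ≤ 0, C y = weftStart y
  eq_zero : ∀ y, T ≤ y → C y = 0
  lt_fst : ∀ y ∈ Set.Icc 0 T, -2 < (C y).1
  avoid : ∀ y ∈ Set.Icc 0 T, C y ∉ F

/-- The strands `1, …, 2 m` in the plane. -/
def warpPts (m : ℕ) : Set (ℝ × ℝ) := {v | ∃ k : ℕ, 1 ≤ k ∧ k ≤ 2 * m ∧ v = ((k : ℝ), 0)}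

/-- The strands `1, …, 2 m - 1` and the one on the left in the plane. -/
def warpPts' (m : ℕ) : Set (ℝ × ℝ) :=
  {v | (∃ k : ℕ, 1 ≤ k ∧ k < 2 * m ∧ v = ((k : ℝ), 0)) ∨ v = (-1, 0)}

/-! ### Moving the arm through the straight strands' gaps at a fixed height, dragging the weft along
-/

section transfer

/-- The homeomorphism that moves the arm from `X` to `X'` and respects the straight strands. -/
def transfer (m : ℕ) (P : ℕ → Bool) (X X' : ℝ → ℝ) (p : Space) : Space :=
  -- Conjugation by the shear puts the arm at level 0 and the straight strand k at level ±1. The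
  -- weight max 0 (1 - |z|) is 1 at the first and 0 at the second, so the arm can be slid across the
  -- strands without moving them.
  moveZ (fun p => -amp m P p.1)
    (moveX (fun p => slide (-2) (2 * m + 1) (X p.2.1)
      (X p.2.1 + max 0 (1 - |p.2.2|) * (X' p.2.1 - X p.2.1)) p.1)
      (moveZ (fun p => amp m P p.1) p))

variable {m : ℕ} {P : ℕ → Bool} {X X' : ℝ → ℝ}

theorem interpolation_mem {a b x x' t : ℝ} (h1 : a < x) (h2 : x < b) (h3 : a < x') (h4 : x' < b)
    (ht : 0 ≤ t) (ht' : t ≤ 1) : a < x + t * (x' - x) ∧ x + t * (x' - x) < b := by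
  rcases le_total x x' with h | h
  · constructor <;> nlinarith
  · constructor <;> nlinarith

theorem max_one_sub_abs_le (z : ℝ) : max 0 (1 - |z|) ≤ 1 :=
  max_le zero_le_one (by linarith [abs_nonneg z])

theorem transfer_slide_mem (hX : ∀ y, -1 ≤ X y ∧ X y ≤ 2 * m) (hX' : ∀ y, -1 ≤ X' y ∧ X' y ≤ 2 * m)
    (y z : ℝ) : -2 < X y + max 0 (1 - |z|) * (X' y - X y) ∧
      X y + max 0 (1 - |z|) * (X' y - X y) < 2 * m + 1 :=
  interpolation_mem (by linarith [(hX y).1]) (by linarith [(hX y).2])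
    (by linarith [(hX' y).1]) (by linarith [(hX' y).2]) (le_max_left _ _) (max_one_sub_abs_le z)

theorem transfer_strictMono (hX : ∀ y, -1 ≤ X y ∧ X y ≤ 2 * m)
    (hX' : ∀ y, -1 ≤ X' y ∧ X' y ≤ 2 * m) (y z : ℝ) :
    StrictMono fun x => x + slide (-2) (2 * m + 1) (X y)
      (X y + max 0 (1 - |z|) * (X' y - X y)) x :=
  strictMono_slide (by linarith [(hX y).1]) (by linarith [(hX y).2])
    (transfer_slide_mem hX hX' y z).1 (transfer_slide_mem hX hX' y z).2

theorem isotopic_transfer (hXc : Continuous X) (hXc' : Continuous X')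
    (hX : ∀ y, -1 ≤ X y ∧ X y ≤ 2 * m) (hX' : ∀ y, -1 ≤ X' y ∧ X' y ≤ 2 * m) (A : Set Space) :
    AmbientIsotopic A ((transfer m P X X') '' A) := by
  have s1 := isotopic_shearZ (f := fun x _ => amp m P x) (by fun_prop)
    (fun x _ => abs_amp_le x) A
  have s2 := isotopic_moveX (u := fun p => slide (-2) (2 * m + 1) (X p.2.1)
      (X p.2.1 + max 0 (1 - |p.2.2|) * (X' p.2.1 - X p.2.1)) p.1)
    (continuous_slide (by fun_prop) (by fun_prop) (by fun_prop)
      (fun p => by linarith [(hX p.2.1).1]) (fun p => by linarith [(hX p.2.1).2]))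
    (fun p => abs_slide_le (by linarith [(hX p.2.1).1]) (by linarith [(hX p.2.1).2])
      (transfer_slide_mem hX hX' p.2.1 p.2.2).1 (transfer_slide_mem hX hX' p.2.1 p.2.2).2 _)
    (transfer_strictMono hX hX') (moveZ (fun p => amp m P p.1) '' A)
  have s3 := isotopic_shearZ (f := fun x _ => -amp m P x) (by fun_prop) (M := 1)
    (fun x _ => by rw [abs_neg]; exact abs_amp_le x) (moveX (fun p => slide (-2) (2 * m + 1) (X p.2.1)
      (X p.2.1 + max 0 (1 - |p.2.2|) * (X' p.2.1 - X p.2.1)) p.1) ''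
      (moveZ (fun p => amp m P p.1) '' A))
  have := s1.trans (s2.trans s3)
  rwa [Set.image_image, Set.image_image] at this

theorem transfer_of_weight {x y z : ℝ}
    (h : slide (-2) (2 * m + 1) (X y) (X y + max 0 (1 - |z + amp m P x|) * (X' y - X y)) x = 0) :
    transfer m P X X' (x, y, z) = (x, y, z) := by
  simp only [transfer, moveX, moveZ, h]
  simp

theorem transfer_of_eq {p : Space} (h : X p.2.1 = X' p.2.1) : transfer m P X X' p = p :=
  transfer_of_weight (by rw [h, sub_self, mul_zero, add_zero, slide_same])

theorem transfer_of_le {p : Space} (hX : ∀ y, -1 ≤ X y ∧ X y ≤ 2 * m) (h : p.1 ≤ -2) :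
    transfer m P X X' p = p :=
  transfer_of_weight (slide_of_le (by linarith [(hX p.2.1).1]) h)

theorem transfer_nat {k : ℕ} (hk : k < 2 * m) (y : ℝ) :
    transfer m P X X' ((k : ℝ), y, 0) = ((k : ℝ), y, 0) := by
  refine transfer_of_weight ?_
  rw [amp_nat hk, zero_add, abs_level, sub_self, max_self, zero_mul, add_zero, slide_same]

theorem transfer_armPt (hX : ∀ y, -1 ≤ X y ∧ X y ≤ 2 * m) (y : ℝ) :
    transfer m P X X' ((armPt m P (X y)).1, y, (armPt m P (X y)).2) =
      ((armPt m P (X' y)).1, y, (armPt m P (X' y)).2) := by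
  have h1 : slide (-2) (2 * m + 1) (X y) (X' y) (X y) = X' y - X y :=
    slide_self (by linarith [(hX y).1]) (by linarith [(hX y).2])
  simp only [transfer, moveX, moveZ, armPt]
  simp [h1]

theorem transfer_injective (hX : ∀ y, -1 ≤ X y ∧ X y ≤ 2 * m)
    (hX' : ∀ y, -1 ≤ X' y ∧ X' y ≤ 2 * m) : Function.Injective (transfer m P X X') := by
  have hz : ∀ f : ℝ → ℝ, Function.Injective (moveZ fun p => f p.1) := by
    rintro f ⟨x, y, z⟩ ⟨x', y', z'⟩ h
    simp only [moveZ, Prod.mk.injEq] at h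
    obtain ⟨rfl, rfl, h⟩ := h
    simpa using h
  suffices h : Function.Injective (moveX fun p : Space => slide (-2) (2 * m + 1) (X p.2.1)
      (X p.2.1 + max 0 (1 - |p.2.2|) * (X' p.2.1 - X p.2.1)) p.1) from
    (hz fun x => -amp m P x).comp (h.comp (hz (amp m P)))
  rintro ⟨x, y, z⟩ ⟨x', y', z'⟩ h
  simp only [moveX, Prod.mk.injEq] at h
  obtain ⟨h, rfl, rfl⟩ := h
  rw [(transfer_strictMono hX hX' y z).injective h]

/-- The plane x = -2 lies at the fixed end of the slide, and the slide is increasing on each line.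
-/
theorem lt_transfer_fst (hX : ∀ y, -1 ≤ X y ∧ X y ≤ 2 * m)
    (hX' : ∀ y, -1 ≤ X' y ∧ X' y ≤ 2 * m) {p : Space} (h : -2 < p.1) :
    -2 < (transfer m P X X' p).1 := by
  have h1 := transfer_strictMono hX hX' p.2.1 (p.2.2 + amp m P p.1) h
  simp only at h1
  rw [slide_of_le (by linarith [(hX p.2.1).1]) le_rfl, add_zero] at h1
  exact h1

/-- The weft after the arm has been moved from `X` to `X'`. -/
def transferWeft (m : ℕ) (P : ℕ → Bool) (X X' : ℝ → ℝ) (C : ℝ → ℝ × ℝ) (y : ℝ) : ℝ × ℝ :=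
  ((transfer m P X X' ((C y).1, y, (C y).2)).1, (transfer m P X X' ((C y).1, y, (C y).2)).2.2)

theorem continuous_transfer (hXc : Continuous X) (hXc' : Continuous X')
    (hX : ∀ y, -1 ≤ X y ∧ X y ≤ 2 * m) : Continuous (transfer m P X X') := by
  have h2 : Continuous fun p : Space => slide (-2) (2 * m + 1) (X p.2.1)
      (X p.2.1 + max 0 (1 - |p.2.2|) * (X' p.2.1 - X p.2.1)) p.1 :=
    continuous_slide (by fun_prop) (by fun_prop) (by fun_prop)
      (fun p => by linarith [(hX p.2.1).1]) (fun p => by linarith [(hX p.2.1).2])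
  have hz : ∀ f : ℝ → ℝ, Continuous f → Continuous (moveZ fun p => f p.1) := fun f hf => by
    unfold moveZ; fun_prop
  have hx : Continuous (moveX fun p : Space => slide (-2) (2 * m + 1) (X p.2.1)
      (X p.2.1 + max 0 (1 - |p.2.2|) * (X' p.2.1 - X p.2.1)) p.1) := by
    unfold moveX; fun_prop
  exact (hz (fun x => -amp m P x) (by fun_prop)).comp (hx.comp (hz _ (by fun_prop)))

theorem continuous_transferWeft (hXc : Continuous X) (hXc' : Continuous X')
    (hX : ∀ y, -1 ≤ X y ∧ X y ≤ 2 * m) {C : ℝ → ℝ × ℝ} (hC : Continuous C) :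
    Continuous (transferWeft m P X X' C) := by
  have h := (continuous_transfer (P := P) hXc hXc' hX).comp
    (f := fun y => ((C y).1, y, (C y).2)) (by fun_prop)
  exact (continuous_fst.comp h).prodMk (continuous_snd.comp (continuous_snd.comp h))

/-- The map preserves heights. Equality of `X` and `X'` at y = -1 fixes the cups, including the one
that ends at the foot of the arm; equality from y = 9/4 on fixes the caps and the tail of the arm.
The strand at x = -2 is outside of the slide. -/
theorem isotopic_form_transfer (hXc : Continuous X) (hXc' : Continuous X')
    (hX : ∀ y, -1 ≤ X y ∧ X y ≤ 2 * m) (hX' : ∀ y, -1 ≤ X' y ∧ X' y ≤ 2 * m)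
    (hlo : X (-1) = X' (-1)) (hhi : ∀ y, 9 / 4 ≤ y → X y = X' y) (C : ℝ → ℝ × ℝ) :
    AmbientIsotopic (form m (arm m P X) C) (form m (arm m P X') (transferWeft m P X X' C)) := by
  have h := isotopic_transfer (P := P) hXc hXc' hX hX' (form m (arm m P X) C)
  rwa [image_form (A' := arm m P X') (C' := transferWeft m P X X' C)] at h
  · rintro ⟨x, y, z⟩ (⟨k, hk, h1, -, h2⟩ | ⟨j, -, -, h1, -⟩ | ⟨j, -, -, h1, -⟩ | ⟨h1, -, -⟩)
    · simp only at h1 h2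
      rw [h1, h2]
      exact transfer_nat hk.2 y
    · exact transfer_of_eq (by simp only at h1 ⊢; rw [h1, hlo])
    · exact transfer_of_eq (hhi _ (by simp only at h1 ⊢; rw [h1]; norm_num))
    · exact transfer_of_le hX (by simp only at h1 ⊢; rw [h1])
  · intro y hy
    rcases le_total y (9 / 4) with h' | h'
    · simp only [arm, armTail_of_le h', sub_zero]
      exact transfer_armPt hX y
    · rw [transfer_of_eq (hhi y h')]
      simp only [arm, hhi y h']
  · intro y _; rfl

theorem transferWeft_of_eq {C : ℝ → ℝ × ℝ} {y : ℝ} (h : X y = X' y) :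
    transferWeft m P X X' C y = C y := by
  rw [transferWeft, transfer_of_eq h]

theorem transferWeft_of_zero (hm : 1 ≤ m) {C : ℝ → ℝ × ℝ} {y : ℝ} (h : C y = 0) :
    transferWeft m P X X' C y = 0 := by
  have := transfer_nat (P := P) (X := X) (X' := X') (m := m) (k := 0) (by omega) y
  rw [transferWeft, h]
  simp only [Prod.fst_zero, Prod.snd_zero]
  rw [Nat.cast_zero] at this
  rw [this]; rfl

/-- By injectivity, a weft that avoids a point avoids the image of that point afterwards. This
transports the list of forbidden points. -/
theorem transferWeft_ne {C : ℝ → ℝ × ℝ} {y : ℝ} (hX : ∀ y, -1 ≤ X y ∧ X y ≤ 2 * m)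
    (hX' : ∀ y, -1 ≤ X' y ∧ X' y ≤ 2 * m) {v w : ℝ × ℝ}
    (hv : transfer m P X X' (v.1, y, v.2) = (w.1, y, w.2)) (h : C y ≠ v) :
    transferWeft m P X X' C y ≠ w := by
  intro h'
  apply h
  have : transfer m P X X' ((C y).1, y, (C y).2) = transfer m P X X' (v.1, y, v.2) := by
    rw [hv, ← h']; rfl
  have := transfer_injective hX hX' this
  simp only [Prod.mk.injEq] at this
  exact Prod.ext this.1 this.2.2

end transfer

theorem lowArm_eq_highArm_neg_one (m : ℕ) : lowArm m (-1) = highArm m (-1) := by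
  rw [lowArm_of_le (by norm_num), highArm_of_le (by norm_num)]

theorem lowArm_eq_highArm {m : ℕ} {y : ℝ} (h : 9 / 4 ≤ y) : lowArm m y = highArm m y := by
  rw [lowArm_of_ge (by linarith), highArm_of_ge h]

theorem armPt_two_mul (m : ℕ) (P : ℕ → Bool) : armPt m P (2 * m) = (2 * (m : ℝ), 0) := by
  rw [armPt, amp_of_ge le_rfl, neg_zero]

theorem armPt_neg_one (m : ℕ) (P : ℕ → Bool) : armPt m P (-1) = (-1, 0) := by
  rw [armPt, amp_of_le le_rfl, neg_zero]

/-- The arm can be lowered below the weft. -/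
theorem exists_isotopic_low {m : ℕ} (hm : 1 ≤ m) (P : ℕ → Bool) {C : ℝ → ℝ × ℝ}
    (hC : IsFreeWeft (warpPts m) 1 C) : ∃ C', IsFreeWeft (warpPts' m) 1 C' ∧
      AmbientIsotopic (form m (arm m P (highArm m)) C) (form m (arm m P (lowArm m)) C') := by
  refine ⟨transferWeft m P (highArm m) (lowArm m) C, ⟨?_, ?_, ?_, ?_, ?_⟩,
    isotopic_form_transfer (by fun_prop) (by fun_prop) (highArm_mem m) (lowArm_mem m)
      (lowArm_eq_highArm_neg_one m).symm (fun y h => (lowArm_eq_highArm h).symm) C⟩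
  · exact continuous_transferWeft (by fun_prop) (by fun_prop) (highArm_mem m) hC.continuous
  · intro y hy
    rcases le_total y (-1 / 2) with h | h
    · rw [transferWeft_of_eq, hC.eq_start y hy]
      rw [lowArm_of_le h, highArm_of_le (by linarith)]
    · rw [transferWeft_of_zero hm, weftStart_of_ge h]; · rfl
      rw [hC.eq_start y hy, weftStart_of_ge h]; rfl
  · intro y hy; exact transferWeft_of_zero hm (hC.eq_zero y hy)
  · intro y hy; exact lt_transfer_fst (highArm_mem m) (lowArm_mem m) (hC.lt_fst y hy)
  · rintro y hy (⟨k, hk, hk', h⟩ | h)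
    · refine transferWeft_ne (highArm_mem m) (lowArm_mem m) (v := ((k : ℝ), 0))
        (transfer_nat hk' y) (fun h' => hC.avoid y hy ⟨k, hk, hk'.le, h'⟩) h
    -- The forbidden point -1 is the place of the lowered arm; it is the image of the point 2m,
    -- where the raised arm waits during 0 ≤ y ≤ 1.
    · refine transferWeft_ne (highArm_mem m) (lowArm_mem m) (v := ((2 * m : ℕ), 0)) ?_
        (fun h' => hC.avoid y hy ⟨2 * m, by omega, le_rfl, h'⟩) h
      have := transfer_armPt (P := P) (X' := lowArm m) (highArm_mem m) y
      rw [highArm_of_le (by linarith [hy.2]), lowArm_of_ge (by linarith [hy.1]), armPt_two_mul,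
        armPt_neg_one] at this
      push_cast
      exact this

/-- The arm can be raised above the weft. -/
theorem exists_isotopic_high {m : ℕ} (hm : 1 ≤ m) (P : ℕ → Bool) {C : ℝ → ℝ × ℝ}
    (hC : IsFreeWeft (warpPts' m) 1 C) : ∃ C', IsFreeWeft (warpPts m) 1 C' ∧
      AmbientIsotopic (form m (arm m P (lowArm m)) C) (form m (arm m P (highArm m)) C') := by
  refine ⟨transferWeft m P (lowArm m) (highArm m) C, ⟨?_, ?_, ?_, ?_, ?_⟩,
    isotopic_form_transfer (by fun_prop) (by fun_prop) (lowArm_mem m) (highArm_mem m)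
      (lowArm_eq_highArm_neg_one m) (fun y h => lowArm_eq_highArm h) C⟩
  · exact continuous_transferWeft (by fun_prop) (by fun_prop) (lowArm_mem m) hC.continuous
  · intro y hy
    rcases le_total y (-1 / 2) with h | h
    · rw [transferWeft_of_eq, hC.eq_start y hy]
      rw [lowArm_of_le h, highArm_of_le (by linarith)]
    · rw [transferWeft_of_zero hm, weftStart_of_ge h]; · rfl
      rw [hC.eq_start y hy, weftStart_of_ge h]; rfl
  · intro y hy; exact transferWeft_of_zero hm (hC.eq_zero y hy)
  · intro y hy; exact lt_transfer_fst (lowArm_mem m) (highArm_mem m) (hC.lt_fst y hy)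
  · rintro y hy ⟨k, hk, hk', h⟩
    rcases hk'.lt_or_eq with hk' | rfl
    · refine transferWeft_ne (lowArm_mem m) (highArm_mem m) (v := ((k : ℝ), 0))
        (transfer_nat hk' y) (fun h' => hC.avoid y hy (Or.inl ⟨k, hk, hk', h'⟩)) h
    · refine transferWeft_ne (lowArm_mem m) (highArm_mem m) (v := (-1, 0)) ?_
        (fun h' => hC.avoid y hy (Or.inr h')) h
      have := transfer_armPt (P := P) (X' := highArm m) (lowArm_mem m) y
      rw [highArm_of_le (by linarith [hy.2]), lowArm_of_ge (by linarith [hy.1]), armPt_two_mul,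
        armPt_neg_one] at this
      push_cast
      exact this

/-! ### Pulling a cap or a cup past the arm -/

section archFlip

variable {m a : ℕ} {P P' : ℕ → Bool}

/-- The weight with which an arch over the interval `[a, a + 1]` is moved. -/
def archWeight (a : ℕ) (p : Space) : ℝ := max 0 (1 - |p.2.2| - 2 * gapDist a p.1)

theorem archWeight_le_one (a : ℕ) (p : Space) : archWeight a p ≤ 1 :=
  max_le zero_le_one (by linarith [abs_nonneg p.2.2, gapDist_nonneg a p.1])

theorem archWeight_of_mem {x y : ℝ} (h : (a : ℝ) ≤ x) (h' : x ≤ a + 1) :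
    archWeight a (x, y, 0) = 1 := by
  simp [archWeight, gapDist_of_mem h h']

/-- Two neighbors that are passed on the same side keep the arm away from level 0 over the gap
between them (`one_le_abs_amp_add`), so the arm misses the support of the weight. -/
theorem archWeight_armPt (ha : a + 1 < 2 * m) (hP : P a = P (a + 1)) (x y : ℝ) :
    archWeight a ((armPt m P x).1, y, (armPt m P x).2) = 0 := by
  refine max_eq_left ?_
  simp only [armPt, abs_neg]
  linarith [one_le_abs_amp_add ha hP x]

/-- The height to which an arch of height `b` is moved. -/
def archShift (a : ℕ) (lo hi b b' : ℝ) (p : Space) : ℝ :=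
  slide lo hi b (b + archWeight a p * (b' - b)) p.2.1

/-- The arch is pulled past the arm, the arm is sheared from `P` to `P'` in the place that has
become free, and the arch is put back. The same vertical motion serves for both arms because it
fixes both. The cutoff `χ` confines the shear to heights near the arm: `harm` says that the arm
feels the full shear, `hfix` that nothing else does once the arch is out of the way. -/
theorem isotopic_form_archFlip (ha : a + 1 < 2 * m) (hP : P a = P (a + 1)) (hP' : P' a = P' (a + 1))
    {lo hi b b' : ℝ} (h1 : lo < b) (h2 : b < hi) (h3 : lo < b') (h4 : b' < hi)
    {χ : ℝ → ℝ} (hχ : Continuous χ) (hχ1 : ∀ y, |χ y| ≤ 1) {X : ℝ → ℝ} {C : ℝ → ℝ × ℝ}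
    (hfix : ∀ p ∈ frame m ∪ strand C (Set.Icc (-3 / 4) 3),
      (amp m P p.1 - amp m P' p.1) * χ (p.2.1 + archShift a lo hi b b' p) = 0)
    (harm : ∀ y, (amp m P (X y - armTail y) - amp m P' (X y - armTail y)) * χ y =
      amp m P (X y - armTail y) - amp m P' (X y - armTail y)) :
    AmbientIsotopic (form m (arm m P X) C) (form m (arm m P' X) C) := by
  have hmem : ∀ p, lo < b + archWeight a p * (b' - b) ∧ b + archWeight a p * (b' - b) < hi :=
    fun p => interpolation_mem h1 h2 h3 h4 (le_max_left _ _) (archWeight_le_one a p)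
  have hcont : Continuous (archShift a lo hi b b') := by
    refine continuous_slide continuous_const ?_ (by fun_prop) (fun _ => h1) (fun _ => h2)
    unfold archWeight; fun_prop
  have hmono : ∀ x z, StrictMono fun y => y + archShift a lo hi b b' (x, y, z) := fun x z =>
    strictMono_slide h1 h2 (hmem (x, 0, z)).1 (hmem (x, 0, z)).2
  have hbd : ∀ p, |archShift a lo hi b b' p| ≤ hi - lo := fun p =>
    abs_slide_le h1 h2 (hmem p).1 (hmem p).2 _
  have i1 := isotopic_moveY hcont hbd hmono (form m (arm m P X) C)
  have i2 := isotopic_moveY hcont hbd hmono (form m (arm m P' X) C)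
  have i3 := isotopic_shearZ (f := fun x y => (amp m P x - amp m P' x) * χ y) (by fun_prop) (M := 2)
    (fun x y => by
      rw [abs_mul]
      have := abs_sub (amp m P x) (amp m P' x)
      have := abs_amp_le (m := m) (P := P) x
      have := abs_amp_le (m := m) (P := P') x
      nlinarith [hχ1 y, abs_nonneg (χ y), abs_nonneg (amp m P x - amp m P' x)])
    (moveY (archShift a lo hi b b') '' form m (arm m P X) C)
  refine (i1.trans i3).trans ?_
  rw [Set.image_image, image_form_eq (A' := arm m P' X) (C' := C)
    (g := moveY (archShift a lo hi b b'))]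
  · exact i2.symm
  · intro p hp
    have := hfix p (Or.inl hp)
    simp only [moveZ, moveY] at this ⊢
    rw [this, add_zero]
  · intro y _
    have e1 : archShift a lo hi b b' ((arm m P X y).1, y, (arm m P X y).2) = 0 := by
      rw [archShift, arm, archWeight_armPt ha hP, zero_mul, add_zero, slide_same]
    have e2 : archShift a lo hi b b' ((arm m P' X y).1, y, (arm m P' X y).2) = 0 := by
      rw [archShift, arm, archWeight_armPt ha hP', zero_mul, add_zero, slide_same]
    simp only [moveZ, moveY, e1, e2, add_zero]
    simp only [arm, armPt, harm]
    ring_nf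
  · intro y hy
    have := hfix _ (Or.inr ⟨y, hy, rfl⟩)
    simp only [moveZ, moveY] at this ⊢
    rw [this, add_zero]

theorem archShift_of_mem {lo hi b b' x y : ℝ} (h : (a : ℝ) ≤ x) (h' : x ≤ a + 1) :
    archShift a lo hi b b' (x, y, 0) = slide lo hi b b' y := by
  rw [archShift, archWeight_of_mem h h', one_mul, add_sub_cancel]

theorem amp_sub_eq_zero (hPP : ∀ k, k ≠ a → k ≠ a + 1 → P k = P' k) {x : ℝ}
    (h : x ≤ a - 1 ∨ a + 2 ≤ x) : amp m P x - amp m P' x = 0 := by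
  rw [sub_eq_zero]
  refine amp_congr fun k _ => ?_
  by_cases hk : k = a
  · right; subst hk
    rcases h with h | h
    · exact le_abs.2 (Or.inr (by linarith))
    · exact le_abs.2 (Or.inl (by linarith))
  by_cases hk' : k = a + 1
  · right; subst hk'; push_cast
    rcases h with h | h
    · exact le_abs.2 (Or.inr (by linarith))
    · exact le_abs.2 (Or.inl (by linarith))
  exact Or.inl (hPP k hk hk')

theorem cast_le_sub_one {k l : ℕ} (h : k < l) : (k : ℝ) ≤ l - 1 := by
  have : (k : ℝ) + 1 ≤ l := by exact_mod_cast h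
  linarith

/-- The signs of two neighboring strands that are joined by a cup may be changed. -/
theorem isotopic_form_cupFlip {j : ℕ} (hjm : j < m) (haj : a + 1 = 2 * j)
    (hP : P a = P (a + 1)) (hP' : P' a = P' (a + 1))
    (hPP : ∀ k, k ≠ a → k ≠ a + 1 → P k = P' k) {C : ℝ → ℝ × ℝ}
    (hC : ∀ y ≤ 0, C y = weftStart y) :
    AmbientIsotopic (form m (arm m P (lowArm m)) C) (form m (arm m P' (lowArm m)) C) := by
  have ha1 : (1 : ℝ) ≤ a := by exact_mod_cast (show 1 ≤ a by omega)
  have hja : (a : ℝ) + 1 = 2 * j := by exact_mod_cast haj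
  have hχ0 : ∀ y : ℝ, -1 / 8 ≤ y → 1 - ramp (-1 / 4) (-1 / 8) y = 0 := fun y hy => by
    rw [ramp_of_ge (by norm_num) hy, sub_self]
  -- The low arm travels at heights between -1/2 and -1/4. The cup goes from -1 to -1/8, above the
  -- arm, and the shear is cut off between -1/4 and -1/8. The motion stops at height 0, where the
  -- weft begins to wander.
  refine isotopic_form_archFlip (a := a) (lo := -2) (hi := 0) (b := -1) (b' := -1 / 8)
    (χ := fun y => 1 - ramp (-1 / 4) (-1 / 8) y) (by omega) hP hP' (by norm_num) (by norm_num)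
    (by norm_num) (by norm_num) (by fun_prop) (fun y => ?_) ?_ (fun y => ?_)
  · have := ramp_nonneg (-1 / 4) (-1 / 8) y
    have := ramp_le_one (-1 / 4) (-1 / 8) y
    exact abs_le.2 ⟨by linarith, by linarith⟩
  · have hup : ∀ p : Space, (a : ℝ) ≤ p.1 → p.1 ≤ a + 1 → -1 ≤ p.2.1 → p.2.2 = 0 →
        1 - ramp (-1 / 4) (-1 / 8) (p.2.1 + archShift a (-2) 0 (-1) (-1 / 8) p) = 0 := by
      rintro ⟨x, y, z⟩ h1 h2 h3 h4
      simp only at h1 h2 h3 h4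
      subst h4
      rw [archShift_of_mem h1 h2]
      refine hχ0 _ ?_
      have := (strictMono_slide (lo := -2) (hi := 0) (b := -1) (b' := -1 / 8) (by norm_num)
        (by norm_num) (by norm_num) (by norm_num)).monotone h3
      rw [slide_self (by norm_num) (by norm_num)] at this
      linarith
    have hhigh : ∀ p : Space, 0 ≤ p.2.1 →
        1 - ramp (-1 / 4) (-1 / 8) (p.2.1 + archShift a (-2) 0 (-1) (-1 / 8) p) = 0 := by
      intro p hp
      rw [archShift, slide_of_ge (by norm_num) hp, add_zero]
      exact hχ0 _ (by linarith)
    rintro p ((⟨k, hk, h1, h2, h3⟩ | ⟨i, hi, h1, h2, h3⟩ | ⟨i, hi, h1, h2, h3⟩ | ⟨h1, h2, h3⟩) |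
      ⟨y, hy, rfl⟩)
    · rcases lt_trichotomy k a with h | h | h
      · rw [amp_sub_eq_zero hPP, zero_mul]
        left; rw [h1]; exact cast_le_sub_one h
      · rw [hup p (by rw [h1, h]) (by rw [h1, h]; linarith) h2.1 h3, mul_zero]
      · rcases (Nat.succ_le_of_lt h).eq_or_lt with h | h
        · have : (k : ℝ) = a + 1 := by exact_mod_cast h.symm
          rw [hup p (by rw [h1, this]; linarith) (by rw [h1, this]) h2.1 h3, mul_zero]
        · rw [amp_sub_eq_zero hPP, zero_mul]
          right; rw [h1]; have := cast_le_sub_one h; push_cast at this; linarith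
    · rcases lt_trichotomy i j with h | h | h
      · rw [amp_sub_eq_zero hPP, zero_mul]
        left; have := cast_le_sub_one h; linarith [h1.2]
      · rw [hup p (by linarith [h1.1, h ▸ hja]) (by linarith [h1.2, h ▸ hja]) h2.ge h3, mul_zero]
      · rw [amp_sub_eq_zero hPP, zero_mul]
        right; have := cast_le_sub_one h; linarith [h1.1]
    · rw [hhigh p (by rw [h2]; norm_num), mul_zero]
    · rw [amp_sub_eq_zero hPP, zero_mul]
      left; linarith
    -- Up to height 0 the weft stays at x ≤ 0 ≤ a - 1, where the two interpolations agree; above it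
    -- the shear is cut off.
    · rcases le_total y 0 with h | h
      · rw [amp_sub_eq_zero hPP, zero_mul]
        left; simp only; rw [hC y h]; linarith [weftStart_fst_le y]
      · rw [hhigh _ h, mul_zero]
  · rcases le_total y (-1 / 4) with h | h
    · rw [ramp_of_le (by norm_num) h]; ring
    · rw [amp_sub_eq_zero hPP, zero_mul]
      left; rw [lowArm_of_ge h]; linarith [armTail_nonneg y]

/-- The signs of two neighboring strands that are joined by a cap may be changed. -/
theorem isotopic_form_capFlip {j : ℕ} (hjm : j < m) (haj : a = 2 * j)
    (hP : P a = P (a + 1)) (hP' : P' a = P' (a + 1))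
    (hPP : ∀ k, k ≠ a → k ≠ a + 1 → P k = P' k) {C : ℝ → ℝ × ℝ} (hC : ∀ y, 1 ≤ y → C y = 0) :
    AmbientIsotopic (form m (arm m P (highArm m)) C) (form m (arm m P' (highArm m)) C) := by
  have hja : (a : ℝ) = 2 * j := by exact_mod_cast haj
  have ha0 : (0 : ℝ) ≤ a := Nat.cast_nonneg a
  have hχ0 : ∀ y : ℝ, y ≤ 5 / 4 → ramp (5 / 4) (3 / 2) y = 0 := fun y hy =>
    ramp_of_le (by norm_num) hy
  -- The high arm travels at heights between 3/2 and 9/4. The cap goes from 3 to 5/4, below the arm,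
  -- and the shear is cut off between 3/2 and 5/4. The motion starts at height 1, where the weft has
  -- come to rest.
  refine isotopic_form_archFlip (a := a) (lo := 1) (hi := 4) (b := 3) (b' := 5 / 4)
    (χ := fun y => ramp (5 / 4) (3 / 2) y) (by omega) hP hP' (by norm_num) (by norm_num)
    (by norm_num) (by norm_num) (by fun_prop) (fun y => ?_) ?_ (fun y => ?_)
  · have := ramp_nonneg (5 / 4) (3 / 2) y
    have := ramp_le_one (5 / 4) (3 / 2) y
    exact abs_le.2 ⟨by linarith, by linarith⟩
  · have hup : ∀ p : Space, (a : ℝ) ≤ p.1 → p.1 ≤ a + 1 → p.2.1 ≤ 3 → p.2.2 = 0 →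
        ramp (5 / 4) (3 / 2) (p.2.1 + archShift a 1 4 3 (5 / 4) p) = 0 := by
      rintro ⟨x, y, z⟩ h1 h2 h3 h4
      simp only at h1 h2 h3 h4
      subst h4
      rw [archShift_of_mem h1 h2]
      refine hχ0 _ ?_
      have := (strictMono_slide (lo := 1) (hi := 4) (b := 3) (b' := 5 / 4) (by norm_num)
        (by norm_num) (by norm_num) (by norm_num)).monotone h3
      rw [slide_self (by norm_num) (by norm_num)] at this
      linarith
    have hlow : ∀ p : Space, p.2.1 ≤ 1 →
        ramp (5 / 4) (3 / 2) (p.2.1 + archShift a 1 4 3 (5 / 4) p) = 0 := by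
      intro p hp
      rw [archShift, slide_of_le (by norm_num) hp, add_zero]
      exact hχ0 _ (by linarith)
    rintro p ((⟨k, hk, h1, h2, h3⟩ | ⟨i, hi, h1, h2, h3⟩ | ⟨i, hi, h1, h2, h3⟩ | ⟨h1, h2, h3⟩) |
      ⟨y, hy, rfl⟩)
    · rcases lt_trichotomy k a with h | h | h
      · rw [amp_sub_eq_zero hPP, zero_mul]
        left; rw [h1]; exact cast_le_sub_one h
      · rw [hup p (by rw [h1, h]) (by rw [h1, h]; linarith) h2.2 h3, mul_zero]
      · rcases (Nat.succ_le_of_lt h).eq_or_lt with h | h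
        · have : (k : ℝ) = a + 1 := by exact_mod_cast h.symm
          rw [hup p (by rw [h1, this]; linarith) (by rw [h1, this]) h2.2 h3, mul_zero]
        · rw [amp_sub_eq_zero hPP, zero_mul]
          right; rw [h1]; have := cast_le_sub_one h; push_cast at this; linarith
    · rw [hlow p (by rw [h2]; norm_num), mul_zero]
    · rcases lt_trichotomy i j with h | h | h
      · rw [amp_sub_eq_zero hPP, zero_mul]
        left; have := cast_le_sub_one h; linarith [h1.2]
      · rw [hup p (by linarith [h1.1, h ▸ hja]) (by linarith [h1.2, h ▸ hja]) h2.le h3, mul_zero]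
      · rw [amp_sub_eq_zero hPP, zero_mul]
        right; have := cast_le_sub_one h; linarith [h1.1]
    · rw [amp_sub_eq_zero hPP, zero_mul]
      left; linarith
    · rcases le_total y 1 with h | h
      · rw [hlow _ h, mul_zero]
      · simp only [hC y h, Prod.fst_zero, Prod.snd_zero]
        -- For a = 0 the left leg of the cap is the end of the weft itself, so it is pulled down
        -- together with the cap.
        rcases Nat.eq_zero_or_pos a with h0 | h0
        · rw [hup (0, y, 0) (by simp [h0]) (by simp [h0]) hy.2 rfl, mul_zero]
        · rw [amp_sub_eq_zero hPP, zero_mul]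
          left
          have : (1 : ℝ) ≤ a := by exact_mod_cast h0
          linarith
  · rcases le_total y (3 / 2) with h | h
    · rw [amp_sub_eq_zero hPP, zero_mul]
      right; rw [highArm_of_le h, armTail_of_le (by linarith)]
      have := cast_le_sub_one hjm
      linarith
    · rw [ramp_of_ge (by norm_num) h]; ring

end archFlip

/-- The sign of the left-most strand may be changed. -/
theorem isotopic_form_strandZeroFlip {m : ℕ} (hm : 1 ≤ m) {P P' : ℕ → Bool}
    (hPP : ∀ k, k ≠ 0 → P k = P' k) {C : ℝ → ℝ × ℝ} (hC : IsFreeWeft (warpPts m) 1 C) :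
    ∃ C', IsFreeWeft (warpPts m) 1 C' ∧
      AmbientIsotopic (form m (arm m P (highArm m)) C) (form m (arm m P' (highArm m)) C') := by
  have hm1 : (1 : ℝ) ≤ m := by exact_mod_cast hm
  -- The cutoff is 1 where the arm travels, between 3/2 and 9/4, and vanishes up to 5/4 and from 5/2
  -- on. So the shear fixes the caps and the wandering part of the weft.
  let χ : ℝ → ℝ := fun y => ramp (5 / 4) (3 / 2) y * (1 - ramp (9 / 4) (5 / 2) y)
  have hχ : Continuous χ := by fun_prop
  have hχlow : ∀ y ≤ 5 / 4, χ y = 0 := fun y h => by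
    simp only [χ]; rw [ramp_of_le (by norm_num) h, zero_mul]
  have hχhigh : ∀ y, 5 / 2 ≤ y → χ y = 0 := fun y h => by
    simp only [χ]; rw [ramp_of_ge (a := 9 / 4) (by norm_num) h, sub_self, mul_zero]
  have hχmid : ∀ y, 3 / 2 ≤ y → y ≤ 9 / 4 → χ y = 1 := fun y h h' => by
    simp only [χ]
    rw [ramp_of_ge (by norm_num) h, ramp_of_le (by norm_num) h', sub_zero, mul_one]
  have hχ1 : ∀ y, |χ y| ≤ 1 := fun y => by
    have a1 := ramp_nonneg (5 / 4) (3 / 2) y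
    have a2 := ramp_le_one (5 / 4) (3 / 2) y
    have a3 := ramp_nonneg (9 / 4) (5 / 2) y
    have a4 := ramp_le_one (9 / 4) (5 / 2) y
    refine abs_le.2 ⟨?_, ?_⟩ <;> simp only [χ] <;> nlinarith
  let D : ℝ → ℝ := fun x => amp m P x - amp m P' x
  have hD : ∀ x, 1 ≤ |x| → D x = 0 := fun x h => by
    refine sub_eq_zero.2 (amp_congr fun k _ => ?_)
    rcases Nat.eq_zero_or_pos k with rfl | hk
    · right; simpa using h
    · exact Or.inl (hPP k hk.ne')
  have hD0 : D 0 = level (P 0) - level (P' 0) := by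
    have h1 := amp_nat (m := m) (P := P) (k := 0) (by omega)
    have h2 := amp_nat (m := m) (P := P') (k := 0) (by omega)
    rw [Nat.cast_zero] at h1 h2
    simp only [D]; rw [h1, h2]
  -- The shear gives the arm its new crossings, and strand 0 takes part in it near the arm. The weft
  -- acquires a kink at the heights of the arm, which keeps the old crossing.
  let C1 : ℝ → ℝ × ℝ := fun y => ((C y).1, (C y).2 + D (C y).1 * χ y)
  have hC1c : Continuous C1 := by
    have := hC.continuous
    have : Continuous D := by fun_prop
    fun_prop
  have hC1low : ∀ y ≤ 1, C1 y = C y := fun y h => by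
    simp only [C1]; rw [hχlow y (by linarith), mul_zero, add_zero]
  have hC1high : ∀ y, 1 ≤ y → C1 y = (0, D 0 * χ y) := fun y h => by
    simp only [C1]; rw [hC.eq_zero y h]; simp
  have i1 := isotopic_shearZ (f := fun x y => D x * χ y) (by fun_prop) (M := 2)
    (fun x y => by
      rw [abs_mul]
      have := abs_sub (amp m P x) (amp m P' x)
      have := abs_amp_le (m := m) (P := P) x
      have := abs_amp_le (m := m) (P := P') x
      nlinarith [hχ1 y, abs_nonneg (χ y), abs_nonneg (amp m P x - amp m P' x)])
    (form m (arm m P (highArm m)) C)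
  rw [image_form (A' := arm m P' (highArm m)) (C' := C1)] at i1
  rotate_left
  · rintro ⟨x, y, z⟩ hp
    have : D x * χ y = 0 := by
      rcases hp with (⟨k, hk, h1, h2, h3⟩ | ⟨i, hi, h1, h2, h3⟩ | ⟨i, hi, h1, h2, h3⟩ | ⟨h1, h2, h3⟩)
      · rw [hD, zero_mul]
        simp only at h1
        rw [h1]
        exact le_abs.2 (Or.inl (by exact_mod_cast hk.1))
      · simp only at h2; rw [hχlow y (by rw [h2]; norm_num), mul_zero]
      · simp only at h2; rw [hχhigh y (by rw [h2]; norm_num), mul_zero]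
      · simp only at h1; rw [hD, zero_mul]; rw [h1]; norm_num
    simp only [moveZ]; rw [this, add_zero]
  · intro y _
    have : D (highArm m y - armTail y) * χ y = D (highArm m y - armTail y) := by
      rcases le_total y (3 / 2) with h | h
      · rw [hD, zero_mul]
        rw [highArm_of_le h, armTail_of_le (by linarith)]
        exact le_abs.2 (Or.inl (by linarith))
      · rcases le_total y (9 / 4) with h' | h'
        · rw [hχmid y h h', mul_one]
        · rw [hD, zero_mul]
          rw [highArm_of_ge h']
          exact le_abs.2 (Or.inr (by linarith [armTail_nonneg y]))
    simp only [moveZ, arm, armPt, this, D]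
    ring_nf
  · intro y _; rfl
  -- Lowering the arm past the kink turns the kink into a further excursion of the weft around the
  -- new place -1 of the arm. The weft is now at rest only from height 5/2 on.
  let C2 := transferWeft m P' (highArm m) (lowArm m) C1
  have hC2c : Continuous C2 :=
    continuous_transferWeft (by fun_prop) (by fun_prop) (highArm_mem m) hC1c
  have i2 := isotopic_form_transfer (P := P') (by fun_prop) (by fun_prop) (highArm_mem m)
    (lowArm_mem m) (lowArm_eq_highArm_neg_one m).symm (fun y h => (lowArm_eq_highArm h).symm) C1
  have hC2fst : ∀ y, 9 / 4 ≤ y → (C2 y).1 = 0 := fun y h => by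
    simp only [C2]
    rw [transferWeft_of_eq (lowArm_eq_highArm h).symm, hC1high y (by linarith)]
  have hC2 : IsFreeWeft (warpPts' m) (5 / 2) C2 := by
    refine ⟨hC2c, fun y hy => ?_, fun y hy => ?_, fun y hy => ?_, ?_⟩
    · rcases le_total y (-1 / 2) with h | h
      · simp only [C2]
        rw [transferWeft_of_eq, hC1low y (by linarith), hC.eq_start y hy]
        rw [lowArm_of_le h, highArm_of_le (by linarith)]
      · simp only [C2]
        rw [transferWeft_of_zero hm, weftStart_of_ge h]; · rfl
        rw [hC1low y (by linarith), hC.eq_start y hy, weftStart_of_ge h]; rfl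
    · refine transferWeft_of_zero hm ?_
      rw [hC1high y (by linarith), hχhigh y hy, mul_zero]; rfl
    · refine lt_transfer_fst (highArm_mem m) (lowArm_mem m) ?_
      rcases le_total y 1 with h | h
      · simp only; rw [hC1low y h]; exact hC.lt_fst y ⟨hy.1, h⟩
      · simp only; rw [hC1high y h]; norm_num
    · rintro y hy (⟨k, hk, hk', h⟩ | h)
      · refine transferWeft_ne (highArm_mem m) (lowArm_mem m) (v := ((k : ℝ), 0))
          (transfer_nat hk' y) (fun h' => ?_) h
        rcases le_total y 1 with h1 | h1
        · rw [hC1low y h1] at h'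
          exact hC.avoid y ⟨hy.1, h1⟩ ⟨k, hk, hk'.le, h'⟩
        · rw [hC1high y h1] at h'
          have : (0 : ℝ) = k := congrArg Prod.fst h'
          have : k = 0 := by exact_mod_cast this.symm
          omega
      · rcases le_total y (9 / 4) with h2 | h2
        · refine transferWeft_ne (highArm_mem m) (lowArm_mem m) (v := armPt m P' (highArm m y))
            (w := (-1, 0)) ?_ (fun h' => ?_) h
          · rw [transfer_armPt (highArm_mem m), lowArm_of_ge (by linarith [hy.1]), armPt_neg_one]
          · rcases le_total y (3 / 2) with h1 | h1
            · rw [highArm_of_le h1, armPt_two_mul] at h'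
              rcases le_total y 1 with h3 | h3
              · rw [hC1low y h3] at h'
                refine hC.avoid y ⟨hy.1, h3⟩ ⟨2 * m, by omega, le_rfl, ?_⟩
                rw [h']; push_cast; rfl
              · rw [hC1high y h3] at h'
                have : (0 : ℝ) = 2 * m := congrArg Prod.fst h'
                linarith
            · rw [hC1high y (by linarith), hχmid y h1 h2, mul_one, armPt] at h'
              have e1 : 0 = highArm m y := congrArg Prod.fst h'
              have e2 : D 0 = -amp m P' (highArm m y) := congrArg Prod.snd h'
              have e3 := amp_nat (m := m) (P := P') (k := 0) (by omega)
              rw [← e1, hD0] at e2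
              rw [Nat.cast_zero] at e3
              rw [e3] at e2
              -- If the kink met the arm, the difference of the old and the new level would be minus
              -- the new one, and the old level would vanish.
              have e4 : level (P 0) = 0 := by linarith
              have := abs_level (P 0)
              rw [e4] at this; simp at this
        · have := hC2fst y h2
          rw [h] at this; norm_num at this
  -- The weft is reparametrized so that its motion up to height 5/2 is over at height 1. Up to
  -- height 9/4 the low arm stands still at -1, so a change of pace cannot cause a collision; above
  -- that the weft has x = 0 and the arm is farther left.
  let c : ℝ → ℝ → ℝ × ℝ := fun t y => C2 (y + t * (3 / 2 * clamp 0 1 y))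
  have hclamp : ∀ y, 0 ≤ clamp 0 1 y := fun y => le_clamp 0 1 y
  have hin : ∀ t ∈ Set.Icc (0 : ℝ) 1, ∀ y ∈ Set.Icc (0 : ℝ) (5 / 2),
      0 ≤ y + t * (3 / 2 * clamp 0 1 y) ∧ y ≤ y + t * (3 / 2 * clamp 0 1 y) := by
    intro t ht y hy
    have := mul_nonneg ht.1 (mul_nonneg (by norm_num : (0 : ℝ) ≤ 3 / 2) (hclamp y))
    exact ⟨by linarith [hy.1], by linarith⟩
  have hval : ∀ u, 0 ≤ u → -2 < (C2 u).1 ∧ C2 u ∉ warpPts' m := by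
    intro u hu
    rcases le_total u (5 / 2) with h | h
    · exact ⟨hC2.lt_fst u ⟨hu, h⟩, hC2.avoid u ⟨hu, h⟩⟩
    · have h1 := hC2.lt_fst (5 / 2) ⟨by norm_num, le_rfl⟩
      have h2 := hC2.avoid (5 / 2) ⟨by norm_num, le_rfl⟩
      rw [hC2.eq_zero _ le_rfl] at h1 h2
      rw [hC2.eq_zero u h]
      exact ⟨h1, h2⟩
  have i3 : AmbientIsotopic (form m (arm m P' (lowArm m)) (c 0))
      (form m (arm m P' (lowArm m)) (c 1)) := by
    refine isotopic_form_weft (continuous_arm (by fun_prop)) (a := 0) (b := 5 / 2) (by norm_num)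
      (by norm_num) (c := c) (by fun_prop) ?_ (fun t ht y hy => (hval _ (hin t ht y hy).1).1)
      (fun t ht y hy k hk hk' h => (hval _ (hin t ht y hy).1).2 (Or.inl ⟨k, hk, hk', h⟩))
      (fun t ht y hy h => ?_)
    · intro t ht y hy
      rw [Set.mem_Icc, not_and_or, not_le, not_le] at hy
      simp only [c]
      rcases hy with hy | hy
      · rw [clamp_of_le hy.le]; simp
      · have := mul_nonneg ht.1 (mul_nonneg (by norm_num : (0 : ℝ) ≤ 3 / 2) (hclamp y))
        rw [hC2.eq_zero _ (by linarith), hC2.eq_zero _ (by linarith)]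
    · rcases le_total y (9 / 4) with h' | h'
      · refine (hval _ (hin t ht y hy).1).2 (Or.inr ?_)
        simp only [c] at h
        rw [h, arm, lowArm_of_ge (by linarith [hy.1]), armTail_of_le h', sub_zero, armPt_neg_one]
      · have h1 := congrArg Prod.fst h
        simp only [c] at h1
        rw [hC2fst _ (by linarith [(hin t ht y hy).2]), arm, lowArm_of_ge (by linarith)] at h1
        simp only [armPt] at h1
        linarith [armTail_nonneg y]
  have hc0 : c 0 = C2 := by funext y; simp [c]
  rw [hc0] at i3
  have hc1 : IsFreeWeft (warpPts' m) 1 (c 1) := by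
    refine ⟨by fun_prop, fun y hy => ?_, fun y hy => ?_,
      fun y hy => (hval _ (hin 1 ⟨zero_le_one, le_rfl⟩ y ⟨hy.1, by linarith [hy.2]⟩).1).1,
      fun y hy => (hval _ (hin 1 ⟨zero_le_one, le_rfl⟩ y ⟨hy.1, by linarith [hy.2]⟩).1).2⟩
    · simp only [c]
      rw [clamp_of_le hy, mul_zero, mul_zero, add_zero, hC2.eq_start y hy]
    · simp only [c]
      rw [clamp_of_ge zero_le_one hy, hC2.eq_zero _ (by linarith)]
  obtain ⟨C', hC', i4⟩ := exists_isotopic_high hm P' hc1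
  exact ⟨C', hC', ((i1.trans i2).trans i3).trans i4⟩

/-- The set `S` has a normal form in which the straight strands pass the arm as prescribed. -/
def HasForm (m : ℕ) (P : ℕ → Bool) (S : Set Space) : Prop :=
  ∃ C, IsFreeWeft (warpPts m) 1 C ∧ AmbientIsotopic S (form m (arm m P (highArm m)) C)

theorem HasForm.pairFlip {m : ℕ} (hm : 1 ≤ m) {S : Set Space} {P P' : ℕ → Bool} {a : ℕ}
    (ha : a + 1 < 2 * m) (hP : P a = P (a + 1)) (hP' : P' a = P' (a + 1))
    (hPP : ∀ k, k ≠ a → k ≠ a + 1 → P k = P' k) (h : HasForm m P S) : HasForm m P' S := by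
  obtain ⟨C, hC, hS⟩ := h
  -- For even a the pair is joined by a cap, which the raised arm lets pass. For odd a it is joined
  -- by a cup, and the arm has to be lowered for the flip and raised afterwards.
  rcases Nat.even_or_odd' a with ⟨j, hj | hj⟩
  · exact ⟨C, hC, hS.trans (isotopic_form_capFlip (j := j) (by omega) hj hP hP' hPP hC.eq_zero)⟩
  · obtain ⟨C', hC', i1⟩ := exists_isotopic_low hm P hC
    have i2 := isotopic_form_cupFlip (m := m) (j := j + 1) (by omega) (by omega) hP hP'
      hPP hC'.eq_start
    obtain ⟨C'', hC'', i3⟩ := exists_isotopic_high hm P' hC'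
    exact ⟨C'', hC'', ((hS.trans i1).trans i2).trans i3⟩

theorem HasForm.congr {m : ℕ} {S : Set Space} {P P' : ℕ → Bool} (hP : ∀ k < 2 * m, P k = P' k)
    (h : HasForm m P S) : HasForm m P' S := by
  have : arm m P (highArm m) = arm m P' (highArm m) := by
    funext y
    simp only [arm, armPt]
    rw [amp_congr fun k hk => Or.inl (hP k hk)]
  unfold HasForm at h ⊢
  rwa [← this]

/-- To change the crossing n, the induction hypothesis first makes the crossing n-1 equal to it, the
pair is flipped, and the induction hypothesis then restores everything below n. The chain ends at
strand 0, which can be flipped alone. -/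
theorem HasForm.change_of_agree {m : ℕ} (hm : 1 ≤ m) {S : Set Space} (n : ℕ) :
    ∀ {P P' : ℕ → Bool}, (∀ k < 2 * m, n ≤ k → P k = P' k) → HasForm m P S → HasForm m P' S := by
  induction n with
  | zero => exact fun hP h => h.congr fun k hk => hP k hk (Nat.zero_le k)
  | succ n ih =>
    intro P P' hP h
    by_cases hn : P n = P' n ∨ 2 * m ≤ n
    · refine ih (fun k hk hnk => ?_) h
      rcases hnk.eq_or_lt with rfl | hnk
      · exact hn.resolve_right (by omega)
      · exact hP k hk hnk
    · push Not at hn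
      rcases Nat.eq_zero_or_pos n with rfl | hn0
      · obtain ⟨C, hC, hS⟩ := h
        obtain ⟨C', hC', i⟩ := isotopic_form_strandZeroFlip (P := P)
          (P' := fun k => if k = 0 then P' 0 else P k) hm (fun k hk => by simp [hk]) hC
        refine HasForm.congr (fun k hk => ?_) ⟨C', hC', hS.trans i⟩
        by_cases h0 : k = 0
        · simp [h0]
        · simp only [h0, if_false]; exact hP k hk (by omega)
      -- `P1` prepares the pair n-1, n on the same side, and `P2` is the result of flipping this
      -- pair.
      · let P1 : ℕ → Bool := fun k => if k = n - 1 then P n else P k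
        let P2 : ℕ → Bool := fun k => if k = n - 1 ∨ k = n then P' n else P k
        have e : n - 1 + 1 = n := by omega
        have h1 : HasForm m P1 S := ih (fun k _ hk => by
          simp only [P1]; rw [if_neg (by omega)]) h
        have h2 : HasForm m P2 S := by
          refine h1.pairFlip hm (a := n - 1) (by omega) ?_ ?_ ?_
          · rw [e]; simp only [P1, if_true]; rw [if_neg (by omega)]
          · rw [e]; simp [P2]
          · rw [e]; intro k hk hk'; simp [P1, P2, hk, hk']
        refine ih (fun k hk hnk => ?_) h2
        simp only [P2]
        split_ifs with h'
        · rcases h' with h' | h'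
          · omega
          · rw [h']
        · exact hP k hk (by omega)

/-- All crossings on the arm may be changed. -/
theorem HasForm.change {m : ℕ} (hm : 1 ≤ m) {S : Set Space} {P : ℕ → Bool} (h : HasForm m P S)
    (P' : ℕ → Bool) : HasForm m P' S :=
  h.change_of_agree hm (2 * m) fun k hk hk' => by omega

/-! ### Paths in the complement of the straight strands -/

section arcs

variable {Y : Type*} [TopologicalSpace Y]

/-- The restriction of a curve to an interval. -/
def arcPath (c : C(ℝ, Y)) {a b : ℝ} {x y : Y} (hx : c a = x) (hy : c b = y) : Path x y where
  toFun t := c (a + t * (b - a))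
  continuous_toFun := by fun_prop
  source' := by simp [hx]
  target' := by simp [hy]

/-- The class of the restriction of a curve to an interval. -/
def arcClass (c : C(ℝ, Y)) {a b : ℝ} {x y : Y} (hx : c a = x) (hy : c b = y) :
    Path.Homotopic.Quotient x y :=
  .mk (arcPath c hx hy)

/-- The line is simply connected, so the two ways from a to d in it are homotopic, and the curve
carries this homotopy over. -/
theorem arcClass_trans (c : C(ℝ, Y)) {a b d : ℝ} {x y z : Y} (hx : c a = x) (hy : c b = y)
    (hz : c d = z) : (arcClass c hx hy).trans (arcClass c hy hz) = arcClass c hx hz := by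
  subst hx hy hz
  let r : ∀ u v : ℝ, Path u v := fun u v =>
    { toFun := fun t => u + t * (v - u)
      continuous_toFun := by fun_prop
      source' := by simp
      target' := by simp }
  have h := (SimplyConnectedSpace.paths_homotopic ((r a b).trans (r b d)) (r a d)).map c
  rw [Path.map_trans] at h
  exact Path.Homotopic.Quotient.eq.2 h

end arcs

section paths

variable {E : Type*} [AddCommGroup E] [Module ℝ E] [TopologicalSpace E] [IsTopologicalAddGroup E]
  [ContinuousSMul ℝ E] {X : Set E}

/-- The straight path from `x` to `y`. -/
def linePath {x y : X} (h : segment ℝ (x : E) y ⊆ X) : Path x y where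
  toFun t := ⟨(1 - (t : ℝ)) • (x : E) + (t : ℝ) • (y : E),
    h ⟨1 - t, t, by linarith [t.2.2], t.2.1, by ring, rfl⟩⟩
  continuous_toFun := by fun_prop
  source' := by simp
  target' := by simp

theorem homotopic_of_convex {U : Set E} (hU : Convex ℝ U) (hUX : U ⊆ X) {x y : X} {p q : Path x y}
    (hp : ∀ t, (p t : E) ∈ U) (hq : ∀ t, (q t : E) ∈ U) : p.Homotopic q :=
  ⟨{ toFun := fun s => ⟨(1 - (s.1 : ℝ)) • (p s.2 : E) + (s.1 : ℝ) • (q s.2 : E),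
        hUX (hU (hp _) (hq _) (by linarith [s.1.2.2]) s.1.2.1 (by ring))⟩
     continuous_toFun := by fun_prop
     map_zero_left := fun t => by simp
     map_one_left := fun t => by simp
     prop' := by
      rintro s t (rfl | ht)
      · simp [← add_smul]
      · rw [Set.mem_singleton_iff] at ht
        subst ht
        simp [← add_smul] }⟩

/-- The class of the straight path from `x` to `y`. -/
def lineClass {x y : X} (h : segment ℝ (x : E) y ⊆ X) : Path.Homotopic.Quotient x y :=
  .mk (linePath h)

theorem mk_eq_lineClass {U : Set E} (hU : Convex ℝ U) (hUX : U ⊆ X) {x y : X} {p : Path x y}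
    (hp : ∀ t, (p t : E) ∈ U) (h : segment ℝ (x : E) y ⊆ X) :
    Path.Homotopic.Quotient.mk p = lineClass h := by
  refine Path.Homotopic.Quotient.eq.2 (homotopic_of_convex hU hUX hp fun t => ?_)
  have h0 := hp 0
  have h1 := hp 1
  rw [p.source] at h0
  rw [p.target] at h1
  exact hU h0 h1 (by linarith [t.2.2]) t.2.1 (by ring)

theorem lineClass_trans {U : Set E} (hU : Convex ℝ U) (hUX : U ⊆ X) {x y z : X} (hx : (x : E) ∈ U)
    (hy : (y : E) ∈ U) (hz : (z : E) ∈ U) (h1 : segment ℝ (x : E) y ⊆ X)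
    (h2 : segment ℝ (y : E) z ⊆ X) (h3 : segment ℝ (x : E) z ⊆ X) :
    (lineClass h1).trans (lineClass h2) = lineClass h3 := by
  refine mk_eq_lineClass (p := (linePath h1).trans (linePath h2)) hU hUX (fun t => ?_) h3
  have key : ∀ {u v : X} (h : segment ℝ (u : E) v ⊆ X), (u : E) ∈ U → (v : E) ∈ U →
      ∀ t, (linePath h t : E) ∈ U := fun h hu hv t =>
    hU hu hv (by linarith [t.2.2]) t.2.1 (by ring)
  rw [Path.trans_apply]
  split_ifs
  · exact key h1 hx hy _
  · exact key h2 hy hz _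

theorem arcClass_eq_lineClass {U : Set E} (hU : Convex ℝ U) (hUX : U ⊆ X) (c : C(ℝ, X)) {a b : ℝ}
    (hab : a ≤ b) (hc : ∀ s ∈ Set.Icc a b, (c s : E) ∈ U) {x y : X} (hx : c a = x) (hy : c b = y)
    (h : segment ℝ (x : E) y ⊆ X) : arcClass c hx hy = lineClass h :=
  mk_eq_lineClass hU hUX (fun t => hc _ ⟨by nlinarith [t.2.1], by nlinarith [t.2.2]⟩) h

end paths

open Path.Homotopic.Quotient in
theorem quotient_trans_assoc {X : Type*} [TopologicalSpace X] {x y z w : X}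
    (p : Path.Homotopic.Quotient x y) (q : Path.Homotopic.Quotient y z)
    (r : Path.Homotopic.Quotient z w) : (p.trans q).trans r = p.trans (q.trans r) := by
  induction p with | mk p => ?_
  induction q with | mk q => ?_
  induction r with | mk r => ?_
  exact Path.Homotopic.Quotient.eq.2 ⟨Path.Homotopy.transAssoc p q r⟩

/-! ### The word of a weft -/

/-- The half plane in which the weft moves, without the straight strands. -/
def plane (m : ℕ) : Set (ℝ × ℝ) := {v | -2 < v.1 ∧ v ∉ warpPts m}

/-- The strip between the strands `g` and `g + 1`. -/
def strip (m g : ℕ) : Set (ℝ × ℝ) :=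
  {v | -2 < v.1 ∧ (1 ≤ g → (g : ℝ) < v.1) ∧ (g < 2 * m → v.1 < g + 1)}

/-- An open half plane together with a piece of its boundary between two strands. -/
def halfPlane (m : ℕ) (b : Bool) (g : ℕ) : Set (ℝ × ℝ) :=
  {v | -2 < v.1 ∧ (0 < level b * v.2 ∨ v.2 = 0 ∧ v ∈ strip m g)}

theorem convex_strip (m g : ℕ) : Convex ℝ (strip m g) := by
  have h1 : ∀ a : ℝ, Convex ℝ {v : ℝ × ℝ | a < v.1} := fun a =>
    convex_halfSpace_gt (f := fun v : ℝ × ℝ => v.1) ⟨fun _ _ => rfl, fun _ _ => rfl⟩ a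
  have h2 : ∀ a : ℝ, Convex ℝ {v : ℝ × ℝ | v.1 < a} := fun a =>
    convex_halfSpace_lt (f := fun v : ℝ × ℝ => v.1) ⟨fun _ _ => rfl, fun _ _ => rfl⟩ a
  intro v hv w hw a b ha hb hab
  exact ⟨h1 _ hv.1 hw.1 ha hb hab, fun hg => h1 _ (hv.2.1 hg) (hw.2.1 hg) ha hb hab,
    fun hg => h2 _ (hv.2.2 hg) (hw.2.2 hg) ha hb hab⟩

theorem isOpen_strip (m g : ℕ) : IsOpen (strip m g) := by
  have h1 : ∀ a : ℝ, IsOpen {v : ℝ × ℝ | a < v.1} := fun a =>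
    isOpen_lt continuous_const continuous_fst
  have h2 : ∀ a : ℝ, IsOpen {v : ℝ × ℝ | v.1 < a} := fun a =>
    isOpen_lt continuous_fst continuous_const
  have h3 : ∀ (p : Prop) (U : Set (ℝ × ℝ)), IsOpen U → IsOpen {v | p → v ∈ U} := by
    intro p U hU
    by_cases hp : p <;> simp [hp, hU]
  exact (h1 _).inter ((h3 _ _ (h1 _)).inter (h3 _ _ (h2 _)))

theorem exists_mem_strip {m : ℕ} {v : ℝ × ℝ} (hv : v ∈ plane m) (hv0 : v.2 = 0) :
    ∃ g ≤ 2 * m, v ∈ strip m g := by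
  have h1 := hv.1
  by_cases h0 : v.1 < 1
  · exact ⟨0, by omega, h1, fun h => absurd h (by norm_num), fun _ => by simpa using h0⟩
  rw [not_lt] at h0
  have h2 : ((⌊v.1⌋₊ : ℕ) : ℝ) ≤ v.1 := Nat.floor_le (by linarith)
  by_cases hg : ⌊v.1⌋₊ < 2 * m
  · refine ⟨⌊v.1⌋₊, hg.le, h1, fun h => lt_of_le_of_ne h2 fun h' => hv.2 ⟨_, h, hg.le, ?_⟩,
      fun _ => Nat.lt_floor_add_one _⟩
    exact Prod.ext h'.symm hv0
  · rw [not_lt] at hg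
    have h3 : ((2 * m : ℕ) : ℝ) ≤ v.1 := le_trans (by exact_mod_cast hg) h2
    refine ⟨2 * m, le_rfl, h1, fun h => lt_of_le_of_ne h3 fun h' => hv.2 ⟨_, h, le_rfl, ?_⟩,
      fun h => absurd h (lt_irrefl _)⟩
    exact Prod.ext h'.symm hv0

theorem exists_level_mul_pos {z : ℝ} (hz : z ≠ 0) : ∃ b, 0 < level b * z := by
  rcases lt_or_gt_of_ne hz with h | h
  · exact ⟨false, by simpa [level] using h⟩
  · exact ⟨true, by simpa [level] using h⟩

/-- A proper convex combination stays in the open half plane unless both points are on the boundary,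
where the strip is convex. The set contains an anchor and all peaks of its side, so straight paths
among these points compose as expected there. -/
theorem convex_halfPlane (m : ℕ) (b : Bool) (g : ℕ) : Convex ℝ (halfPlane m b g) := by
  intro v hv w hw s t hs ht hst
  rcases hs.eq_or_lt with rfl | hs'
  · rw [zero_add] at hst; subst hst; simpa using hw
  rcases ht.eq_or_lt with rfl | ht'
  · rw [add_zero] at hst; subst hst; simpa using hv
  have h1 : -2 < (s • v + t • w).1 := by
    simp only [Prod.fst_add, Prod.smul_fst, smul_eq_mul]
    nlinarith [hv.1, hw.1]
  have h2 : level b * (s • v + t • w).2 = s * (level b * v.2) + t * (level b * w.2) := by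
    simp only [Prod.snd_add, Prod.smul_snd, smul_eq_mul]; ring
  refine ⟨h1, ?_⟩
  rcases hv.2 with hv2 | ⟨hv2, hv3⟩ <;> rcases hw.2 with hw2 | ⟨hw2, hw3⟩
  · left; rw [h2]; positivity
  · left; rw [h2, hw2]; simp only [mul_zero, add_zero]; positivity
  · left; rw [h2, hv2]; simp only [mul_zero, zero_add]; positivity
  · right; exact ⟨by simp [hv2, hw2], convex_strip m g hv3 hw3 hs ht hst⟩

theorem strip_subset {m g : ℕ} (hg : g ≤ 2 * m) : strip m g ⊆ plane m := by
  rintro v ⟨h1, h2, h3⟩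
  refine ⟨h1, ?_⟩
  rintro ⟨k, hk, hk', rfl⟩
  simp only at h2 h3
  have h2' : 1 ≤ g → g < k := fun h => by exact_mod_cast h2 h
  have h3' : g < 2 * m → k < g + 1 := fun h => by exact_mod_cast h3 h
  omega

theorem halfPlane_subset {m g : ℕ} (hg : g ≤ 2 * m) (b : Bool) : halfPlane m b g ⊆ plane m := by
  rintro v ⟨h1, h2 | ⟨-, h2⟩⟩
  · refine ⟨h1, ?_⟩
    rintro ⟨k, hk, hk', rfl⟩
    simp at h2
  · exact strip_subset hg h2

theorem eq_of_mem_strip {m g g' : ℕ} (hg : g ≤ 2 * m) (hg' : g' ≤ 2 * m) {v : ℝ × ℝ}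
    (h : v ∈ strip m g) (h' : v ∈ strip m g') : g = g' := by
  by_contra hne
  rcases Nat.lt_or_gt_of_ne hne with hlt | hlt
  · have h1 := h.2.2 (by omega)
    have h2 := h'.2.1 (by omega)
    have : (g : ℝ) + 1 ≤ g' := by exact_mod_cast hlt
    linarith
  · have h1 := h'.2.2 (by omega)
    have h2 := h.2.1 (by omega)
    have : (g' : ℝ) + 1 ≤ g := by exact_mod_cast hlt
    linarith

theorem anchor_mem_plane (m g : ℕ) : ((g + 1 / 2 : ℝ), (0 : ℝ)) ∈ plane m := by
  have hg : (0 : ℝ) ≤ g := Nat.cast_nonneg g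
  refine ⟨by simp only; linarith, ?_⟩
  rintro ⟨k, -, -, h⟩
  have h1 : (g + 1 / 2 : ℝ) = k := congrArg Prod.fst h
  have h2 : ((2 * g + 1 : ℕ) : ℝ) = (2 * k : ℕ) := by push_cast; linarith
  have h3 : 2 * g + 1 = 2 * k := by exact_mod_cast h2
  omega

theorem level_ne_zero (b : Bool) : level b ≠ 0 := by
  intro h; have := abs_level b; rw [h] at this; simp at this

theorem peak_mem_plane (m k : ℕ) (b : Bool) : ((k : ℝ), level b) ∈ plane m := by
  have hk : (0 : ℝ) ≤ k := Nat.cast_nonneg k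
  refine ⟨by simp only; linarith, ?_⟩
  rintro ⟨l, -, -, h⟩
  exact level_ne_zero b (congrArg Prod.snd h)

theorem origin_mem_plane (m : ℕ) : ((0 : ℝ), (0 : ℝ)) ∈ plane m := by
  refine ⟨by norm_num, ?_⟩
  rintro ⟨k, hk, -, h⟩
  have h1 : (0 : ℝ) = k := congrArg Prod.fst h
  have : k = 0 := by exact_mod_cast h1.symm
  omega

/-- The position of the weft in the gap `g`. -/
def anchor (m g : ℕ) : plane m := ⟨_, anchor_mem_plane m g⟩

/-- The position of the weft when it crosses the strand `k`. -/
def peak (m k : ℕ) (b : Bool) : plane m := ⟨_, peak_mem_plane m k b⟩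

/-- The end points of the weft. -/
def origin (m : ℕ) : plane m := ⟨_, origin_mem_plane m⟩

theorem anchor_mem_strip (m g : ℕ) : (anchor m g : ℝ × ℝ) ∈ strip m g := by
  refine ⟨(anchor_mem_plane m g).1, fun _ => ?_, fun _ => ?_⟩ <;> simp only [anchor] <;> linarith

theorem anchor_mem_halfPlane (m g : ℕ) (b : Bool) : (anchor m g : ℝ × ℝ) ∈ halfPlane m b g :=
  ⟨(anchor_mem_plane m g).1, Or.inr ⟨rfl, anchor_mem_strip m g⟩⟩

theorem peak_mem_halfPlane (m k g : ℕ) (b : Bool) : (peak m k b : ℝ × ℝ) ∈ halfPlane m b g :=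
  ⟨(peak_mem_plane m k b).1, Or.inl (by simp only [peak]; rw [level_sq]; norm_num)⟩

theorem origin_mem_strip (m : ℕ) : (origin m : ℝ × ℝ) ∈ strip m 0 :=
  ⟨(origin_mem_plane m).1, fun h => absurd h (by norm_num), fun _ => by simp [origin]⟩

theorem segment_anchor_subset {m g : ℕ} (hg : g ≤ 2 * m) {v : ℝ × ℝ} {b : Bool}
    (hv : v ∈ halfPlane m b g) : segment ℝ v (anchor m g) ⊆ plane m :=
  ((convex_halfPlane m b g).segment_subset hv (anchor_mem_halfPlane m g b)).trans
    (halfPlane_subset hg b)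

/-- The classes of paths from the gap `g` to the end of the weft that are described by a list of
steps. -/
inductive IsWord (m : ℕ) : ∀ g, List WeftStep →
    Path.Homotopic.Quotient (anchor m g) (origin m) → Prop
  | nil (h : segment ℝ (anchor m 0 : ℝ × ℝ) (origin m) ⊆ plane m) : IsWord m 0 [] (lineClass h)
  | cons {g : ℕ} {s : WeftStep} {l : List WeftStep}
      {q : Path.Homotopic.Quotient (anchor m (s.next g)) (origin m)}
      (h : 1 ≤ s.crossed g ∧ s.crossed g ≤ 2 * m)
      (h1 : segment ℝ (anchor m g : ℝ × ℝ) (peak m (s.crossed g) s.isOver) ⊆ plane m)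
      (h2 : segment ℝ (peak m (s.crossed g) s.isOver : ℝ × ℝ) (anchor m (s.next g)) ⊆ plane m)
      (hq : IsWord m (s.next g) l q) :
      IsWord m g (s :: l) ((lineClass h1).trans ((lineClass h2).trans q))

theorem IsWord.isWeft {m g : ℕ} {l : List WeftStep}
    {q : Path.Homotopic.Quotient (anchor m g) (origin m)} (h : IsWord m g l q) :
    IsWeft (2 * m) g l := by
  induction h with
  | nil => rfl
  | cons h _ _ _ ih => exact ⟨h, ih⟩

theorem anchor_peak_subset {m g : ℕ} (hg : g ≤ 2 * m) (k : ℕ) (b : Bool) :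
    segment ℝ (anchor m g : ℝ × ℝ) (peak m k b) ⊆ plane m := by
  rw [segment_symm]; exact segment_anchor_subset hg (peak_mem_halfPlane m k g b)

/-- From a point in front of all strands (or behind them) one may go straight to either of two
neighboring gaps. The two routes differ by passing the strand between the gaps on that same side,
which is one step; the triangles involved lie in half planes without punctures. -/
theorem IsWord.step {m g g' : ℕ} (hg : g ≤ 2 * m) (hg' : g' ≤ 2 * m) {s : WeftStep}
    (hs : s.next g' = g) (hc : 1 ≤ s.crossed g' ∧ s.crossed g' ≤ 2 * m) {x : plane m}
    (hx : 0 < level s.isOver * (x : ℝ × ℝ).2) {l : List WeftStep}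
    {q : Path.Homotopic.Quotient (anchor m g) (origin m)} (h : IsWord m g l q)
    (h1 : segment ℝ (x : ℝ × ℝ) (anchor m g) ⊆ plane m) :
    ∃ q', IsWord m g' (s :: l) q' ∧
      ∀ h2 : segment ℝ (x : ℝ × ℝ) (anchor m g') ⊆ plane m,
        (lineClass h1).trans q = (lineClass h2).trans q' := by
  subst hs
  have a1 := anchor_peak_subset hg' (s.crossed g') s.isOver
  have a2 := segment_anchor_subset hg (peak_mem_halfPlane m (s.crossed g') _ s.isOver)
  have hxh : ∀ g, (x : ℝ × ℝ) ∈ halfPlane m s.isOver g := fun g => ⟨x.2.1, Or.inl hx⟩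
  have a3 : segment ℝ (x : ℝ × ℝ) (peak m (s.crossed g') s.isOver) ⊆ plane m :=
    ((convex_halfPlane m s.isOver g').segment_subset (hxh g')
      (peak_mem_halfPlane m _ g' _)).trans (halfPlane_subset hg' _)
  refine ⟨_, IsWord.cons hc a1 a2 h, fun h2 => ?_⟩
  rw [← quotient_trans_assoc, lineClass_trans (convex_halfPlane m s.isOver g')
    (halfPlane_subset hg' _) (hxh g') (anchor_mem_halfPlane m g' _) (peak_mem_halfPlane m _ g' _)
    h2 a1 a3, ← quotient_trans_assoc, lineClass_trans (convex_halfPlane m s.isOver (s.next g'))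
    (halfPlane_subset hg _) (hxh _) (peak_mem_halfPlane m _ _ _) (anchor_mem_halfPlane m _ _)
    a3 a2 h1]

/-- The class of a path from `x` to the end of the weft is described by a word that starts in the
gap `g`. -/
def WordFrom (m g : ℕ) (x : plane m) (r : Path.Homotopic.Quotient x (origin m)) : Prop :=
  ∃ (l : List WeftStep) (q : Path.Homotopic.Quotient (anchor m g) (origin m)), IsWord m g l q ∧
    ∃ h : segment ℝ (x : ℝ × ℝ) (anchor m g) ⊆ plane m, r = (lineClass h).trans q

theorem WordFrom.step {m g g' : ℕ} (hg : g ≤ 2 * m) (hg' : g' ≤ 2 * m) {s : WeftStep}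
    (hs : s.next g' = g) (hc : 1 ≤ s.crossed g' ∧ s.crossed g' ≤ 2 * m) {x : plane m}
    (hx : 0 < level s.isOver * (x : ℝ × ℝ).2) {r : Path.Homotopic.Quotient x (origin m)}
    (h : WordFrom m g x r) : WordFrom m g' x r := by
  obtain ⟨l, q, hq, h1, rfl⟩ := h
  obtain ⟨q', hq', h2⟩ := hq.step hg hg' hs hc hx h1
  have h3 : segment ℝ (x : ℝ × ℝ) (anchor m g') ⊆ plane m :=
    segment_anchor_subset hg' (b := s.isOver) ⟨x.2.1, Or.inl hx⟩
  exact ⟨_, q', hq', h3, h2 h3⟩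

/-- Inside an open half plane the gap in which the word begins is immaterial: it is shifted to any
other by adding one step at a time. -/
theorem WordFrom.change {m g g' : ℕ} (hg : g ≤ 2 * m) (hg' : g' ≤ 2 * m) {x : plane m} {b : Bool}
    (hx : 0 < level b * (x : ℝ × ℝ).2) {r : Path.Homotopic.Quotient x (origin m)}
    (h : WordFrom m g x r) : WordFrom m g' x r := by
  have key : ∀ n, n ≤ 2 * m → ∀ g' ≤ n, (WordFrom m n x r ↔ WordFrom m g' x r) := by
    intro n
    induction n with
    | zero => intro _ g' hg'; rw [Nat.le_zero.1 hg']
    | succ n ih =>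
      intro hn g' hg'
      rcases hg'.eq_or_lt with rfl | hlt
      · rfl
      rw [← ih (by omega) g' (by omega)]
      constructor
      · refine WordFrom.step (s := ⟨true, b⟩) hn (by omega) rfl ?_ hx
        exact ⟨Nat.le_add_left 1 n, hn⟩
      · refine WordFrom.step (s := ⟨false, b⟩) (g := n) (by omega) hn rfl ?_ hx
        exact ⟨Nat.le_add_left 1 n, hn⟩
  rcases le_total g' g with h' | h'
  · exact (key g hg g' h').1 h
  · exact (key g' hg' g h').2 h

/-- Strips between strands and the two open half planes cover the punctured plane. A subdivision of
the curve subordinate to this cover is read from the end backwards, and a word for the remaining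
path is extended over each piece. The pieces lie in convex sets, so each one may be replaced by a
straight path. -/
theorem exists_isWord {m : ℕ} {a b : ℝ} (hab : a ≤ b) (c : C(ℝ, plane m)) {x : plane m}
    (hx : x = origin m) (ha : c a = x) (hb : c b = origin m) : ∃ l q, IsWord m 0 l q ∧
      ∃ h : segment ℝ (x : ℝ × ℝ) (anchor m 0) ⊆ plane m,
        arcClass c ha hb = (lineClass h).trans q := by
  subst ha
  let S : Bool ⊕ Fin (2 * m + 1) → Set (Set.Icc a b) := fun i =>
    {t | i.elim (fun b => 0 < level b * (c t : ℝ × ℝ).2) 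
      (fun g : Fin (2 * m + 1) => (c t : ℝ × ℝ) ∈ strip m g)}
  have hS1 : ∀ i, IsOpen (S i) := by
    rintro (i | i)
    · exact isOpen_lt continuous_const (by fun_prop)
    · exact (isOpen_strip m i).preimage (by fun_prop : Continuous fun t : Set.Icc a b =>
        (c t : ℝ × ℝ))
  have hS2 : Set.univ ⊆ ⋃ i, S i := by
    intro t _
    by_cases h0 : (c t : ℝ × ℝ).2 = 0
    · obtain ⟨g, hg, h⟩ := exists_mem_strip (c t).2 h0
      exact Set.mem_iUnion.2 ⟨Sum.inr ⟨g, by omega⟩, h⟩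
    · obtain ⟨b, h⟩ := exists_level_mul_pos h0
      exact Set.mem_iUnion.2 ⟨Sum.inl b, h⟩
  obtain ⟨t, ht0, htm, ⟨N, hN⟩, ht⟩ := exists_monotone_Icc_subset_open_cover_Icc hab hS1 hS2
  -- The invariant remembers a starting gap g. On the axis it has to be the actual gap of the curve;
  -- off the axis it is arbitrary.
  let Q : ℝ → Prop := fun u => ∃ g ≤ 2 * m, ((c u : ℝ × ℝ) ∈ strip m g ∨ (c u : ℝ × ℝ).2 ≠ 0) ∧
    WordFrom m g (c u) (arcClass c rfl hb)
  have hoa : segment ℝ (origin m : ℝ × ℝ) (anchor m 0) ⊆ plane m :=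
    ((convex_strip m 0).segment_subset (origin_mem_strip m) (anchor_mem_strip m 0)).trans
      (strip_subset (by omega))
  have hao : segment ℝ (anchor m 0 : ℝ × ℝ) (origin m) ⊆ plane m := by rwa [segment_symm]
  have hQb : Q b := by
    have hcb : (c b : ℝ × ℝ) ∈ strip m 0 := by rw [hb]; exact origin_mem_strip m
    have hca : segment ℝ (c b : ℝ × ℝ) (anchor m 0) ⊆ plane m := by rw [hb]; exact hoa
    have hco : segment ℝ (c b : ℝ × ℝ) (origin m) ⊆ plane m := by
      rw [hb, segment_same, Set.singleton_subset_iff]; exact (origin m).2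
    refine ⟨0, by omega, Or.inl hcb, [], _, IsWord.nil hao, hca, ?_⟩
    rw [lineClass_trans (convex_strip m 0) (strip_subset (by omega)) hcb (anchor_mem_strip m 0)
      (origin_mem_strip m) hca hao hco]
    refine arcClass_eq_lineClass (convex_strip m 0) (strip_subset (by omega)) c le_rfl ?_ rfl hb hco
    intro s hs
    rwa [le_antisymm hs.2 hs.1]
  have hstep : ∀ u v : ℝ, u ≤ v → ∀ g ≤ 2 * m, ∀ U : Set (ℝ × ℝ), Convex ℝ U → U ⊆ plane m →
      (anchor m g : ℝ × ℝ) ∈ U → (∀ s ∈ Set.Icc u v, (c s : ℝ × ℝ) ∈ U) →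
      WordFrom m g (c v) (arcClass c rfl hb) → WordFrom m g (c u) (arcClass c rfl hb) := by
    rintro u v huv g hg U hU hUm hUa hUc ⟨l, q, hq, h1, h2⟩
    have h3 : segment ℝ (c u : ℝ × ℝ) (c v) ⊆ plane m :=
      (hU.segment_subset (hUc u ⟨le_rfl, huv⟩) (hUc v ⟨huv, le_rfl⟩)).trans hUm
    have h4 : segment ℝ (c u : ℝ × ℝ) (anchor m g) ⊆ plane m :=
      (hU.segment_subset (hUc u ⟨le_rfl, huv⟩) hUa).trans hUm
    refine ⟨l, q, hq, h4, ?_⟩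
    rw [← arcClass_trans c rfl (rfl : c v = c v) hb, h2,
      arcClass_eq_lineClass hU hUm c huv hUc rfl rfl h3, ← quotient_trans_assoc,
      lineClass_trans hU hUm (hUc u ⟨le_rfl, huv⟩) (hUc v ⟨huv, le_rfl⟩) hUa h3 h1 h4]
  have key : ∀ n, Q (t (N - n)) := by
    intro n
    induction n with
    | zero => rw [Nat.sub_zero, hN N le_rfl]; exact hQb
    | succ n ih =>
      by_cases hn : N ≤ n
      · rwa [show N - (n + 1) = N - n by omega]
      obtain ⟨k, hk⟩ : ∃ k, N - n = k + 1 := ⟨N - n - 1, by omega⟩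
      rw [hk] at ih
      rw [show N - (n + 1) = k by omega]
      have huv : (t k : ℝ) ≤ t (k + 1) := htm (Nat.le_succ k)
      obtain ⟨i, hi⟩ := ht k
      have hi' : ∀ s ∈ Set.Icc (t k : ℝ) (t (k + 1)), ∃ hs : s ∈ Set.Icc a b, ⟨s, hs⟩ ∈ S i :=
        fun s hs => ⟨⟨(t k).2.1.trans hs.1, hs.2.trans (t (k + 1)).2.2⟩, hi hs⟩
      obtain ⟨g, hg, hgv, hw⟩ := ih
      rcases i with i | i
      · have h0 : ∀ s ∈ Set.Icc (t k : ℝ) (t (k + 1)), 0 < level i * (c s : ℝ × ℝ).2 :=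
          fun s hs => (hi' s hs).2
        have hu := h0 (t k) ⟨le_rfl, huv⟩
        refine ⟨g, hg, Or.inr fun h => ?_, hstep _ _ huv g hg _ (convex_halfPlane m i g)
          (halfPlane_subset hg i) (anchor_mem_halfPlane m g i)
          (fun s hs => ⟨(c s).2.1, Or.inl (h0 s hs)⟩) hw⟩
        rw [h, mul_zero] at hu; exact lt_irrefl _ hu
      · have h0 : ∀ s ∈ Set.Icc (t k : ℝ) (t (k + 1)), (c s : ℝ × ℝ) ∈ strip m i :=
          fun s hs => (hi' s hs).2
        have hi2 : (i : ℕ) ≤ 2 * m := by omega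
        -- On entering a strip from the right end of the piece, the remembered gap is either already
        -- that of the strip, or the curve is off the axis there and the gap may be changed.
        have hw' : WordFrom m i (c (t (k + 1))) (arcClass c rfl hb) := by
          rcases hgv with hgv | hgv
          · rwa [← eq_of_mem_strip hg hi2 hgv (h0 _ ⟨huv, le_rfl⟩)]
          · obtain ⟨b, hb⟩ := exists_level_mul_pos hgv
            exact hw.change hg hi2 hb
        exact ⟨i, hi2, Or.inl (h0 _ ⟨le_rfl, huv⟩), hstep _ _ huv i hi2 _ (convex_strip m i)
          (strip_subset hi2) (anchor_mem_strip m i) h0 hw'⟩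
  have hQa := key N
  rw [Nat.sub_self, ht0] at hQa
  obtain ⟨g, hg, hga, l, q, hq, h1, h2⟩ := hQa
  -- The curve starts at the origin, which is on the axis in the gap 0; this excludes the case of an
  -- arbitrary gap.
  have : g = 0 := by
    rw [hx] at hga
    rcases hga with h | h
    · exact eq_of_mem_strip hg (by omega) h (origin_mem_strip m)
    · exact absurd rfl h
  subst this
  exact ⟨l, q, hq, h1, h2⟩

theorem arcClass_comp {Y : Type*} [TopologicalSpace Y] (c : C(ℝ, Y)) (ψ : C(ℝ, ℝ)) {a b a' b' : ℝ}
    (ha : ψ a = a') (hb : ψ b = b') {x y : Y} (hx : c a' = x) (hy : c b' = y)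
    (hx' : (c.comp ψ) a = x) (hy' : (c.comp ψ) b = y) :
    arcClass (c.comp ψ) hx' hy' = arcClass c hx hy := by
  subst ha hb hx hy
  let r : ∀ u v : ℝ, Path u v := fun u v =>
    { toFun := fun t => u + t * (v - u)
      continuous_toFun := by fun_prop
      source' := by simp
      target' := by simp }
  exact Path.Homotopic.Quotient.eq.2
    ((SimplyConnectedSpace.paths_homotopic ((r a b).map ψ.continuous) (r (ψ a) (ψ b))).map c)

/-- A weft in the plane, made constant before `a` and after `b`. -/
def planeCurve {m : ℕ} {a b : ℝ} (hab : a ≤ b) {C : ℝ → ℝ × ℝ} (hC : Continuous C)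
    (h : ∀ y ∈ Set.Icc a b, C y ∈ plane m) : C(ℝ, plane m) :=
  ⟨fun y => ⟨C (clamp a b y), h _ ⟨le_clamp a b y, clamp_le hab y⟩⟩, by fun_prop⟩

theorem planeCurve_apply {m : ℕ} {a b : ℝ} (hab : a ≤ b) {C : ℝ → ℝ × ℝ} (hC : Continuous C)
    (h : ∀ y ∈ Set.Icc a b, C y ∈ plane m) {y : ℝ} (hy : y ∈ Set.Icc a b) :
    (planeCurve hab hC h y : ℝ × ℝ) = C y := by
  simp only [planeCurve, ContinuousMap.coe_mk]; rw [clamp_of_mem hy.1 hy.2]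

/-- Homotopic wefts lead to isotopic forms. -/
theorem isotopic_form_of_arcClass_eq {m : ℕ} {A : ℝ → ℝ × ℝ} (hA : Continuous A) {a b : ℝ}
    (ha : -1 < a) (hb : b < 3) (hab : a ≤ b) (hA2 : ∀ y ∈ Set.Icc a b, A y = (((2 * m : ℕ) : ℝ), 0))
    (hm : 1 ≤ m) {C C' : ℝ → ℝ × ℝ} (hC : Continuous C) (hC' : Continuous C')
    (hout : ∀ y ∈ Set.Icc (-3 / 4 : ℝ) 3, y ∉ Set.Icc a b → C y = C' y)
    (h : ∀ y ∈ Set.Icc a b, C y ∈ plane m) (h' : ∀ y ∈ Set.Icc a b, C' y ∈ plane m)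
    {x x' : plane m} (h1 : planeCurve hab hC h a = x) (h2 : planeCurve hab hC h b = x')
    (h1' : planeCurve hab hC' h' a = x) (h2' : planeCurve hab hC' h' b = x')
    (heq : arcClass _ h1 h2 = arcClass _ h1' h2') :
    AmbientIsotopic (form m A C) (form m A C') := by
  rcases hab.eq_or_lt with rfl | hlt
  · have : ∀ y ∈ Set.Icc (-3 / 4 : ℝ) 3, C y = C' y := fun y hy => by
      by_cases hya : y ∈ Set.Icc a a
      · have e : y = a := le_antisymm hya.2 hya.1
        rw [e, ← planeCurve_apply hab hC h ⟨le_rfl, le_rfl⟩, h1,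
          ← planeCurve_apply hab hC' h' ⟨le_rfl, le_rfl⟩, h1']
      · exact hout y hy hya
    unfold form
    rw [strand_congr this]
    exact AmbientIsotopic.refl _
  obtain ⟨F⟩ := Path.Homotopic.Quotient.eq.1 heq
  let π : ℝ → unitInterval := Set.projIcc 0 1 zero_le_one
  have hπ : Continuous π := continuous_projIcc
  -- The homotopy of paths is extended to all heights by adding its deviation from `C`, frozen at
  -- the ends. Outside [a, b] the deviation is zero because the end points are kept.
  let c : ℝ → ℝ → ℝ × ℝ := fun t y =>
    C y + ((F (π t, π ((y - a) / (b - a))) : ℝ × ℝ) - C (clamp a b y))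
  have hba : 0 < b - a := by linarith
  have hlo : ∀ y ≤ a, π ((y - a) / (b - a)) = 0 := fun y hy =>
    Set.projIcc_of_le_left _ (div_nonpos_of_nonpos_of_nonneg (by linarith) hba.le)
  have hhi : ∀ y, b ≤ y → π ((y - a) / (b - a)) = 1 := fun y hy =>
    Set.projIcc_of_right_le _ ((one_le_div hba).2 (by linarith))
  have hmid : ∀ y ∈ Set.Icc a b, (π ((y - a) / (b - a)) : ℝ) = (y - a) / (b - a) := fun y hy => by
    have : (y - a) / (b - a) ∈ Set.Icc (0 : ℝ) 1 :=
      ⟨div_nonneg (by linarith [hy.1]) hba.le, (div_le_one hba).2 (by linarith [hy.2])⟩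
    simp only [π]; rw [Set.projIcc_of_mem _ this]
  have hCa : C a = x := by rw [← h1, planeCurve_apply hab hC h ⟨le_rfl, hab⟩]
  have hCb : C b = x' := by rw [← h2, planeCurve_apply hab hC h ⟨hab, le_rfl⟩]
  have hin : ∀ t, ∀ y ∈ Set.Icc a b, c t y = F (π t, π ((y - a) / (b - a))) := fun t y hy => by
    simp only [c]; rw [clamp_of_mem hy.1 hy.2]; simp
  have hcout : ∀ t, ∀ y ∉ Set.Icc a b, c t y = C y := fun t y hy => by
    rw [Set.mem_Icc, not_and_or, not_le, not_le] at hy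
    simp only [c]
    rcases hy with hy | hy
    · rw [hlo y hy.le, clamp_of_le hy.le, F.source, hCa, sub_self, add_zero]
    · rw [hhi y hy.le, clamp_of_ge hab hy.le, F.target, hCb, sub_self, add_zero]
  have hpar : ∀ y ∈ Set.Icc a b, a + (π ((y - a) / (b - a)) : ℝ) * (b - a) = y := fun y hy => by
    rw [hmid y hy, div_mul_cancel₀ _ hba.ne']; ring
  have hc0 : c 0 = C := by
    funext y
    by_cases hy : y ∈ Set.Icc a b
    · have : π 0 = 0 := Set.projIcc_of_le_left _ le_rfl
      rw [hin 0 y hy, this, F.apply_zero]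
      change ((planeCurve hab hC h (a + (π ((y - a) / (b - a)) : ℝ) * (b - a)) : plane m) : ℝ × ℝ) = C y
      rw [hpar y hy, planeCurve_apply hab hC h hy]
    · exact hcout 0 y hy
  have hc1 : ∀ y ∈ Set.Icc (-3 / 4 : ℝ) 3, c 1 y = C' y := by
    intro y hy3
    by_cases hy : y ∈ Set.Icc a b
    · have : π 1 = 1 := Set.projIcc_of_right_le _ le_rfl
      rw [hin 1 y hy, this, F.apply_one]
      change ((planeCurve hab hC' h' (a + (π ((y - a) / (b - a)) : ℝ) * (b - a)) : plane m) : ℝ × ℝ) =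
        C' y
      rw [hpar y hy, planeCurve_apply hab hC' h' hy]
    · rw [hcout 1 y hy, hout y hy3 hy]
  have hplane : ∀ t, ∀ y ∈ Set.Icc a b, c t y ∈ plane m := fun t y hy => by
    rw [hin t y hy]; exact (F _).2
  -- The puncture 2m belongs to the arm: `hA2` says that the arm stands there during the whole
  -- homotopy, so avoiding all punctures avoids the frame and the arm.
  have key := isotopic_form_weft (m := m) hA ha hb (c := c) (by fun_prop)
    (fun t _ y hy => by rw [hcout t y hy, hcout 0 y hy]) (fun t _ y hy => (hplane t y hy).1)
    (fun t _ y hy k hk hk' he => (hplane t y hy).2 ⟨k, hk, hk'.le, he⟩)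
    (fun t _ y hy he => (hplane t y hy).2 ⟨2 * m, by omega, le_rfl, by rw [he, hA2 y hy]⟩)
  rw [hc0] at key
  unfold form at key ⊢
  rwa [strand_congr hc1] at key

/-! ### Moving heights -/

/-- A vertical segment. -/
def upright (x z a b : ℝ) : Set Space := {p | p.1 = x ∧ p.2.1 ∈ Set.Icc a b ∧ p.2.2 = z}

theorem image_moveY_upright {u : Space → ℝ} (hu : Continuous u)
    (hm : ∀ x z, StrictMono fun y => y + u (x, y, z)) (x z : ℝ) {a b : ℝ} (hab : a ≤ b) :
    moveY u '' upright x z a b = upright x z (a + u (x, a, z)) (b + u (x, b, z)) := by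
  ext ⟨x', y', z'⟩
  constructor
  · rintro ⟨⟨x1, y1, z1⟩, ⟨rfl, hy, rfl⟩, h⟩
    simp only [moveY, Prod.mk.injEq] at h
    obtain ⟨rfl, rfl, rfl⟩ := h
    exact ⟨rfl, ⟨(hm x1 z1).monotone hy.1, (hm x1 z1).monotone hy.2⟩, rfl⟩
  · rintro ⟨rfl, hy, rfl⟩
    have hc : ContinuousOn (fun y => y + u (x', y, z')) (Set.Icc a b) := by fun_prop
    obtain ⟨y1, hy1, h⟩ := intermediate_value_Icc hab hc hy
    refine ⟨(x', y1, z'), ⟨rfl, hy1, rfl⟩, ?_⟩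
    simp only [moveY] at h ⊢
    rw [h]

theorem image_segment_eq_strand {f : Space → Space} {p q : Space} {C : ℝ → ℝ × ℝ} {a b : ℝ}
    {θ : ℝ → ℝ} (hθ : Continuous θ) (h0 : θ 0 = a) (h1 : θ 1 = b)
    (hmem : ∀ t ∈ Set.Icc (0 : ℝ) 1, θ t ∈ Set.Icc a b)
    (h : ∀ t ∈ Set.Icc (0 : ℝ) 1, f ((1 - t) • p + t • q) = ((C (θ t)).1, θ t, (C (θ t)).2)) :
    f '' segment ℝ p q = strand C (Set.Icc a b) := by
  rw [segment_eq_image, Set.image_image]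
  ext w
  constructor
  · rintro ⟨t, ht, rfl⟩
    exact ⟨θ t, hmem t ht, (h t ht).symm⟩
  · rintro ⟨y, hy, rfl⟩
    obtain ⟨t, ht, rfl⟩ := intermediate_value_Icc zero_le_one hθ.continuousOn
      (by rw [h0, h1]; exact hy)
    exact ⟨t, ht, h t ht⟩

theorem strand_union {C : ℝ → ℝ × ℝ} {a b c : ℝ} (hab : a ≤ b) (hbc : b ≤ c) :
    strand C (Set.Icc a b) ∪ strand C (Set.Icc b c) = strand C (Set.Icc a c) := by
  unfold strand
  rw [← Set.image_union, Set.Icc_union_Icc_eq_Icc hab hbc]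

theorem upright_eq_strand {C : ℝ → ℝ × ℝ} {x z a b : ℝ} (h : ∀ y ∈ Set.Icc a b, C y = (x, z)) :
    upright x z a b = strand C (Set.Icc a b) := by
  ext ⟨x', y', z'⟩
  constructor
  · rintro ⟨rfl, hy, rfl⟩
    exact ⟨y', hy, by simp only [h y' hy]⟩
  · rintro ⟨y, hy, he⟩
    simp only [h y hy, Prod.mk.injEq] at he
    obtain ⟨rfl, rfl, rfl⟩ := he
    exact ⟨rfl, hy, rfl⟩

/-- The displacement that tilts the rows at the heights `0, …, n - 1`. -/
def tiltShift (n : ℕ) (v : ℕ → ℝ → ℝ) (p : Space) : ℝ :=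
  ∑ i ∈ Finset.range n, v i p.1 * tent (p.2.1 - i)

section tilt

variable {n : ℕ} {v : ℕ → ℝ → ℝ}

theorem continuous_tiltShift (hv : ∀ i, Continuous (v i)) : Continuous (tiltShift n v) := by
  unfold tiltShift; fun_prop

theorem tiltShift_nat {i : ℕ} (hi : i < n) (x z : ℝ) : tiltShift n v (x, (i : ℝ), z) = v i x := by
  unfold tiltShift
  rw [Finset.sum_eq_single i]
  · simp [tent_zero]
  · intro l _ h; simp only; rw [tent_sub_nat h, mul_zero]
  · intro h; exact absurd (Finset.mem_range.2 hi) h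

theorem tiltShift_of_le {p : Space} (h : p.2.1 ≤ -1) : tiltShift n v p = 0 := by
  refine Finset.sum_eq_zero fun k _ => ?_
  have : (0 : ℝ) ≤ k := Nat.cast_nonneg k
  rw [tent_of_one_le (by rw [abs_of_nonpos] <;> linarith), mul_zero]

theorem tiltShift_of_ge {p : Space} (h : n ≤ p.2.1) : tiltShift n v p = 0 := by
  refine Finset.sum_eq_zero fun k hk => ?_
  have := cast_le_sub_one (Finset.mem_range.1 hk)
  rw [tent_of_one_le (by rw [abs_of_nonneg] <;> linarith), mul_zero]

theorem abs_tiltShift_le (h0 : ∀ i x, 0 ≤ v i x) (h1 : ∀ i x, v i x ≤ 1 / 2) (p : Space) :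
    |tiltShift n v p| ≤ 1 := by
  refine (Finset.abs_sum_le_sum_abs _ _).trans (le_trans ?_ (sum_tent_le_one n p.2.1))
  refine Finset.sum_le_sum fun i _ => ?_
  rw [abs_mul, abs_of_nonneg (h0 _ _), abs_of_nonneg (tent_nonneg _)]
  nlinarith [h1 i p.1, tent_nonneg (p.2.1 - i)]

/-- At any height at most one tent is descending, with slope -1 and a coefficient at most 1/2. The
displacement therefore falls at most at half the speed at which y rises. -/
theorem strictMono_tiltShift (h0 : ∀ i x, 0 ≤ v i x) (h1 : ∀ i x, v i x ≤ 1 / 2) (x z : ℝ) :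
    StrictMono fun y => y + tiltShift n v (x, y, z) := by
  intro y y' h
  have e : ∀ (i : ℕ) (y : ℝ), tent (y - i) = clamp 0 1 ((y + 1) - i) - clamp 0 1 (y - i) :=
    fun i y => by rw [tent_eq_clamp]; congr 2; ring
  have h2 : tiltShift n v (x, y, z) - tiltShift n v (x, y', z) ≤
      ∑ i ∈ Finset.range n, 1 / 2 * (clamp 0 1 (y' - i) - clamp 0 1 (y - i)) := by
    unfold tiltShift
    rw [← Finset.sum_sub_distrib]
    refine Finset.sum_le_sum fun i _ => ?_
    simp only [e]
    have a1 : clamp 0 1 (y - i) ≤ clamp 0 1 (y' - i) := monotone_clamp 0 1 (by linarith)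
    have a2 : clamp 0 1 (y + 1 - i) ≤ clamp 0 1 (y' + 1 - i) := monotone_clamp 0 1 (by linarith)
    nlinarith [h0 i x, h1 i x]
  rw [← Finset.mul_sum, Finset.sum_sub_distrib, sum_clamp_sub, sum_clamp_sub] at h2
  have h3 := clamp_add_le (a := 0) (b := n) (x := y) (d := y' - y) (by linarith)
  rw [add_sub_cancel] at h3
  simp only
  linarith

theorem isotopic_tilt (hv : ∀ i, Continuous (v i)) (h0 : ∀ i x, 0 ≤ v i x)
    (h1 : ∀ i x, v i x ≤ 1 / 2) (A : Set Space) :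
    AmbientIsotopic A (moveY (tiltShift n v) '' A) :=
  isotopic_moveY (continuous_tiltShift hv) (abs_tiltShift_le h0 h1) (strictMono_tiltShift h0 h1) A

end tilt

/-- The displacement of the piecewise linear map that takes `a i` to `b i`. -/
def plShift (n : ℕ) (a b : ℕ → ℝ) (y : ℝ) : ℝ :=
  ∑ i ∈ Finset.range n, ((b (i + 1) - b i) - (a (i + 1) - a i)) * ramp (a i) (a (i + 1)) y

section pl

variable {n : ℕ} {a b : ℕ → ℝ}

theorem continuous_plShift : Continuous (plShift n a b) := by unfold plShift; fun_prop

/-- Ramps below the interval in question are saturated and telescope to the accumulated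
displacement, those above it vanish, and the remaining one interpolates linearly. -/
theorem add_plShift (ha : ∀ i < n, a i < a (i + 1)) (h0 : a 0 = b 0) {i : ℕ} (hi : i < n) {y : ℝ}
    (hy : a i ≤ y) (hy' : y ≤ a (i + 1)) :
    y + plShift n a b y = b i + (b (i + 1) - b i) * ((y - a i) / (a (i + 1) - a i)) := by
  have hmono : ∀ k l, k ≤ l → l ≤ n → a k ≤ a l := by
    intro k l hkl
    induction l, hkl using Nat.le_induction with
    | base => exact fun _ => le_rfl
    | succ l hl ih => exact fun hln => (ih (by omega)).trans (ha l (by omega)).le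
  have h1 : plShift n a b y = ∑ k ∈ Finset.range (i + 1),
      ((b (k + 1) - b k) - (a (k + 1) - a k)) * ramp (a k) (a (k + 1)) y := by
    unfold plShift
    refine (Finset.sum_subset (fun k hk => ?_) fun k hk hk' => ?_).symm
    · simp only [Finset.mem_range] at hk ⊢; omega
    · simp only [Finset.mem_range] at hk hk'
      rw [ramp_of_le (ha k hk) (hy'.trans (hmono _ _ (by omega) (by omega))), mul_zero]
  have h2 : ∑ k ∈ Finset.range i, ((b (k + 1) - b k) - (a (k + 1) - a k)) * ramp (a k) (a (k + 1)) y
      = ∑ k ∈ Finset.range i, ((b (k + 1) - a (k + 1)) - (b k - a k)) := by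
    refine Finset.sum_congr rfl fun k hk => ?_
    have hk := Finset.mem_range.1 hk
    rw [ramp_of_ge (ha k (by omega)) ((hmono _ _ (by omega) (by omega)).trans hy)]
    ring
  rw [h1, Finset.sum_range_succ, h2, Finset.sum_range_sub (fun k => b k - a k),
    ramp_of_mem (ha i hi) hy hy', h0]
  have : a (i + 1) - a i ≠ 0 := by linarith [ha i hi]
  field_simp
  ring

theorem abs_plShift_le (n : ℕ) (a b : ℕ → ℝ) (y : ℝ) :
    |plShift n a b y| ≤ ∑ i ∈ Finset.range n, |(b (i + 1) - b i) - (a (i + 1) - a i)| := by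
  refine (Finset.abs_sum_le_sum_abs _ _).trans (Finset.sum_le_sum fun i _ => ?_)
  rw [abs_mul, abs_of_nonneg (ramp_nonneg _ _ _)]
  exact mul_le_of_le_one_right (abs_nonneg _) (ramp_le_one _ _ _)

theorem monotone_ramp {a b : ℝ} (hab : a < b) : Monotone (ramp a b) := fun y y' h =>
  monotone_clamp 0 1 (div_le_div_of_nonneg_right (by linarith) (by linarith))

theorem sub_mul_ramp {a b : ℝ} (hab : a < b) (y : ℝ) : (b - a) * ramp a b y = clamp a b y - a := by
  rcases le_total y a with h | h
  · rw [ramp_of_le hab h, clamp_of_le h]; ring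
  · rcases le_total y b with h' | h'
    · rw [ramp_of_mem hab h h', clamp_of_mem h h', mul_div_cancel₀ _ (by linarith)]
    · rw [ramp_of_ge hab h', clamp_of_ge hab.le h']; ring

theorem sum_sub_mul_ramp (n : ℕ) (ha : ∀ i < n, a i < a (i + 1)) (y : ℝ) : a 0 ≤ a n ∧
    ∑ i ∈ Finset.range n, (a (i + 1) - a i) * ramp (a i) (a (i + 1)) y =
      clamp (a 0) (a n) y - a 0 := by
  induction n with
  | zero =>
    refine ⟨le_rfl, ?_⟩
    have := clamp_le (le_refl (a 0)) y
    rw [Finset.sum_range_zero]; linarith [le_clamp (a 0) (a 0) y]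
  | succ n ih =>
    obtain ⟨h0, h1⟩ := ih fun i hi => ha i (by omega)
    have h2 := ha n (by omega)
    refine ⟨by linarith, ?_⟩
    rw [Finset.sum_range_succ, h1, sub_mul_ramp h2]
    rcases le_total y (a n) with h | h
    · rw [clamp_of_le h]
      rcases le_total y (a 0) with h' | h'
      · rw [clamp_of_le h', clamp_of_le h']; ring
      · rw [clamp_of_mem h' h, clamp_of_mem h' (by linarith)]; ring
    · rw [clamp_of_ge h0 h]
      rcases le_total y (a (n + 1)) with h' | h'
      · rw [clamp_of_mem h h', clamp_of_mem (by linarith) h']; ring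
      · rw [clamp_of_ge h2.le h', clamp_of_ge (by linarith) h']; ring

theorem strictMono_plShift (ha : ∀ i < n, a i < a (i + 1)) (hb : ∀ i < n, b i < b (i + 1)) :
    StrictMono fun y => y + plShift n a b y := by
  -- κ is a common positive lower bound for the slopes of all pieces. Being at most 1, it is also a
  -- bound outside of the nodes, where the slope is 1.
  obtain ⟨κ, hκ, hκ1, hκ2⟩ : ∃ κ : ℝ, 0 < κ ∧ κ ≤ 1 ∧
      ∀ i < n, κ * (a (i + 1) - a i) ≤ b (i + 1) - b i := by
    induction n with
    | zero => exact ⟨1, one_pos, le_rfl, fun i hi => absurd hi (by omega)⟩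
    | succ n ih =>
      obtain ⟨κ, h1, h2, h3⟩ := ih (fun i hi => ha i (by omega)) fun i hi => hb i (by omega)
      have ha' : 0 < a (n + 1) - a n := by linarith [ha n (by omega)]
      have hb' : 0 < b (n + 1) - b n := by linarith [hb n (by omega)]
      refine ⟨min κ ((b (n + 1) - b n) / (a (n + 1) - a n)), lt_min h1 (div_pos hb' ha'),
        (min_le_left _ _).trans h2, fun i hi => ?_⟩
      rcases Nat.lt_succ_iff_lt_or_eq.1 hi with hi | rfl
      · refine le_trans (mul_le_mul_of_nonneg_right (min_le_left _ _) ?_) (h3 i hi)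
        linarith [ha i (by omega)]
      · exact (mul_le_mul_of_nonneg_right (min_le_right _ _) ha'.le).trans
          (le_of_eq (div_mul_cancel₀ _ ha'.ne'))
  intro y y' h
  have e1 := (sum_sub_mul_ramp n ha y).2
  have e2 := (sum_sub_mul_ramp n ha y').2
  have e3 := clamp_add_le (a := a 0) (b := a n) (x := y) (d := y' - y) (by linarith)
  rw [add_sub_cancel] at e3
  have e4 : ∑ i ∈ Finset.range n, (κ - 1) * ((a (i + 1) - a i) * ramp (a i) (a (i + 1)) y' -
      (a (i + 1) - a i) * ramp (a i) (a (i + 1)) y) ≤ plShift n a b y' - plShift n a b y := by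
    unfold plShift
    rw [← Finset.sum_sub_distrib]
    refine Finset.sum_le_sum fun i hi => ?_
    have hi := Finset.mem_range.1 hi
    have h1 := monotone_ramp (ha i hi) h.le
    nlinarith [hκ2 i hi]
  rw [← Finset.mul_sum, Finset.sum_sub_distrib, e1, e2] at e4
  simp only
  nlinarith

end pl

/-- The inverse of an increasing map of the line that is at bounded distance from the identity. -/
theorem exists_inverse {u : ℝ → ℝ} (hu : Continuous u) {M : ℝ} (hM : ∀ y, |u y| ≤ M)
    (hm : StrictMono fun y => y + u y) :
    ∃ ψ : C(ℝ, ℝ), (∀ y, ψ (y + u y) = y) ∧ ∀ y, ψ y + u (ψ y) = y := by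
  let e := hm.orderIsoOfSurjective _ (surjective_add_of_bounded hu hM)
  exact ⟨⟨e.symm, e.symm.toHomeomorph.continuous⟩, e.symm_apply_apply, e.apply_symm_apply⟩

theorem image_moveY_strand {u : ℝ → ℝ} (hu : Continuous u) (hm : StrictMono fun y => y + u y)
    {ψ : ℝ → ℝ} (hψ : ∀ y, ψ (y + u y) = y) (C : ℝ → ℝ × ℝ) {a b : ℝ} (hab : a ≤ b) :
    moveY (fun p => u p.2.1) '' strand C (Set.Icc a b) =
      strand (fun y => C (ψ y)) (Set.Icc (a + u a) (b + u b)) := by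
  unfold strand
  rw [Set.image_image]
  ext w
  constructor
  · rintro ⟨y, hy, rfl⟩
    refine ⟨y + u y, ⟨hm.monotone hy.1, hm.monotone hy.2⟩, ?_⟩
    simp only [moveY, hψ]
  · rintro ⟨y, hy, rfl⟩
    have hc : ContinuousOn (fun y => y + u y) (Set.Icc a b) := by fun_prop
    obtain ⟨y1, hy1, rfl⟩ := intermediate_value_Icc hab hc hy
    refine ⟨y1, hy1, ?_⟩
    simp only [moveY, hψ]

/-! ### Polygonal lines -/

theorem polyline_append_cons (l : List Space) (p : Space) (l' : List Space) :
    polyline (l ++ p :: l') = polyline (l ++ [p]) ∪ polyline (p :: l') := by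
  have hp : ∀ l', p ∈ polyline (p :: l') := by
    rintro (_ | ⟨q, l'⟩)
    · exact Set.mem_singleton p
    · exact Or.inl (left_mem_segment ℝ p q)
  induction l with
  | nil =>
    simp only [List.nil_append, polyline, Set.singleton_union]
    exact (Set.insert_eq_of_mem (hp l')).symm
  | cons q l ih =>
    rcases l with _ | ⟨r, l⟩
    · simp only [List.cons_append, List.nil_append, polyline]
      rw [Set.union_assoc, Set.singleton_union, Set.insert_eq_of_mem (hp l')]
    · simp only [List.cons_append, polyline] at ih ⊢
      rw [ih, Set.union_assoc]

/-- The part of a vertical plane below or above a piece of a vertical line. -/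
def column (x : ℝ) (f : ℝ → ℝ) (a b : ℝ) : Set Space :=
  {p | p.1 = x ∧ p.2.1 ∈ Set.Icc a b ∧ p.2.2 = f p.2.1}

theorem column_union (x : ℝ) (f : ℝ → ℝ) {a b c : ℝ} (hab : a ≤ b) (hbc : b ≤ c) :
    column x f a b ∪ column x f b c = column x f a c := by
  ext p
  have h := Set.ext_iff.1 (Set.Icc_union_Icc_eq_Icc hab hbc) p.2.1
  rw [Set.mem_union] at h
  change (_ ∧ _ ∧ _) ∨ (_ ∧ _ ∧ _) ↔ _ ∧ _ ∧ _
  rw [← h]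
  tauto

theorem column_congr {x : ℝ} {f g : ℝ → ℝ} {a b : ℝ} (h : ∀ y ∈ Set.Icc a b, f y = g y) :
    column x f a b = column x g a b := by
  ext p
  exact and_congr_right fun _ => and_congr_right fun hp => by rw [h _ hp]

theorem segment_eq_column {x a b : ℝ} {f : ℝ → ℝ} (hab : a ≤ b)
    (hf : ∀ t ∈ Set.Icc (0 : ℝ) 1, f ((1 - t) * a + t * b) = (1 - t) * f a + t * f b) :
    segment ℝ ((x, a, f a) : Space) (x, b, f b) = column x f a b := by
  ext ⟨x', y', z'⟩
  rw [segment_eq_image]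
  constructor
  · rintro ⟨t, ht, h⟩
    simp only [Prod.smul_mk, smul_eq_mul, Prod.mk_add_mk, Prod.mk.injEq] at h
    obtain ⟨rfl, rfl, rfl⟩ := h
    exact ⟨by simp only; ring, ⟨by nlinarith [ht.1], by nlinarith [ht.2]⟩, (hf t ht).symm⟩
  · rintro ⟨h1, hy, h2⟩
    simp only at h1 hy h2
    rw [← segment_eq_Icc hab, segment_eq_image] at hy
    obtain ⟨t, ht, rfl⟩ := hy
    refine ⟨t, ht, ?_⟩
    simp only [smul_eq_mul] at h2
    simp only [Prod.smul_mk, smul_eq_mul, Prod.mk_add_mk, Prod.mk.injEq, h1, h2, hf t ht, and_true]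
    ring

theorem segment_eq_upright {x z a b : ℝ} (hab : a ≤ b) :
    segment ℝ ((x, a, z) : Space) (x, b, z) = upright x z a b :=
  segment_eq_column (f := fun _ => z) hab fun t _ => by ring

theorem segment_eq_flat {y z a b : ℝ} (hab : a ≤ b) :
    segment ℝ ((a, y, z) : Space) (b, y, z) = {p | p.1 ∈ Set.Icc a b ∧ p.2.1 = y ∧ p.2.2 = z} := by
  ext ⟨x', y', z'⟩
  rw [segment_eq_image]
  constructor
  · rintro ⟨t, ht, h⟩
    simp only [Prod.smul_mk, smul_eq_mul, Prod.mk_add_mk, Prod.mk.injEq] at h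
    obtain ⟨rfl, rfl, rfl⟩ := h
    exact ⟨⟨by nlinarith [ht.1], by nlinarith [ht.2]⟩, by simp only; ring, by simp only; ring⟩
  · rintro ⟨hy, h1, h2⟩
    simp only at h1 hy h2
    rw [← segment_eq_Icc hab, segment_eq_image] at hy
    obtain ⟨t, ht, rfl⟩ := hy
    refine ⟨t, ht, ?_⟩
    simp only [Prod.smul_mk, smul_eq_mul, Prod.mk_add_mk, Prod.mk.injEq, h1, h2]
    exact ⟨trivial, by ring, by ring⟩

/-- The tent function is linear between integers. -/
theorem tent_affine (k n : ℤ) {t : ℝ} (ht : t ∈ Set.Icc (0 : ℝ) 1) :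
    tent ((1 - t) * n + t * (n + 1) - k) = (1 - t) * tent (n - k) + t * tent (n + 1 - k) := by
  have e : (1 - t) * n + t * (n + 1) - k = (n - k : ℝ) + t := by ring
  rw [e, show (n : ℝ) + 1 - k = (n - k) + 1 by ring]
  rcases le_or_gt k n with h | h
  · have h' : (0 : ℝ) ≤ n - k := by exact_mod_cast Int.sub_nonneg.2 h
    rw [tent_of_one_le (x := (n - k : ℝ) + 1) (by rw [abs_of_nonneg] <;> linarith)]
    rcases h.eq_or_lt with rfl | h
    · simp [tent, abs_of_nonneg ht.1, ht.2]
    · have h2 : (k : ℝ) + 1 ≤ n := by exact_mod_cast h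
      rw [tent_of_one_le (by rw [abs_of_nonneg] <;> linarith [ht.1]),
        tent_of_one_le (by rw [abs_of_nonneg] <;> linarith)]
      ring
  · have h' : (n : ℝ) + 1 ≤ k := by exact_mod_cast h
    rw [tent_of_one_le (x := (n - k : ℝ)) (by rw [abs_of_nonpos] <;> linarith)]
    rcases (show n + 1 ≤ k from h).eq_or_lt with rfl | h
    · push_cast
      have e1 : (n : ℝ) - (n + 1) + t = -(1 - t) := by ring
      have e2 : (n : ℝ) - (n + 1) + 1 = 0 := by ring
      rw [e1, e2]
      simp [tent, abs_of_nonpos (by linarith [ht.2] : t - 1 ≤ 0), ht.1]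
    · have h2 : (n : ℝ) + 1 + 1 ≤ k := by exact_mod_cast h
      rw [tent_of_one_le (by rw [abs_of_nonpos] <;> linarith [ht.2]),
        tent_of_one_le (by rw [abs_of_nonpos] <;> linarith)]
      ring

/-! ### The curve of a word -/

/-- The direction of a step. -/
def WeftStep.dir (s : WeftStep) : ℝ := if s.toRight then 1 else -1

theorem WeftStep.next_eq {s : WeftStep} {g : ℕ} (h : 1 ≤ s.crossed g) :
    (s.next g : ℝ) = g + s.dir := by
  rcases s with ⟨_ | _, o⟩
  · simp only [WeftStep.next, WeftStep.crossed, WeftStep.dir, Bool.false_eq_true, if_false] at h ⊢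
    rw [Nat.cast_sub h, Nat.cast_one]; ring
  · simp [WeftStep.next, WeftStep.dir]

theorem WeftStep.crossed_eq (s : WeftStep) (g : ℕ) :
    (s.crossed g : ℝ) = g + 1 / 2 + s.dir / 2 := by
  rcases s with ⟨_ | _, o⟩
  · simp [WeftStep.crossed, WeftStep.dir]; ring
  · simp [WeftStep.crossed, WeftStep.dir]; ring

theorem WeftStep.dir_mul_self (s : WeftStep) : s.dir * s.dir = 1 := by
  rcases s with ⟨_ | _, o⟩ <;> simp [WeftStep.dir]

theorem WeftStep.le_of_crossed {s : WeftStep} {g n : ℕ} (h : s.crossed g ≤ n) : g ≤ n := by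
  rcases s with ⟨_ | _, o⟩
  · simpa [WeftStep.crossed] using h
  · simp only [WeftStep.crossed, if_true] at h; omega

theorem WeftStep.next_le_of_crossed {s : WeftStep} {g n : ℕ} (h : s.crossed g ≤ n) :
    s.next g ≤ n := by
  rcases s with ⟨_ | _, o⟩
  · simp only [WeftStep.crossed, WeftStep.next, Bool.false_eq_true, if_false] at h ⊢; omega
  · simpa [WeftStep.crossed, WeftStep.next] using h

/-- The weft with the given steps, from the gap `g` on, as a curve in the plane.  Every step takes a
half of a unit of time, and is followed by a rest. -/
def wordCurve : ℕ → List WeftStep → ℝ → ℝ × ℝ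
  | g, [], y => (g + 1 / 2 - clamp 0 (1 / 2) y, 0)
  | g, s :: l, y =>
      if y ≤ 1 then (g + 1 / 2 + s.dir * clamp 0 1 (2 * y),
        level s.isOver * tent (2 * clamp 0 1 (2 * y) - 1))
      else wordCurve (s.next g) l (y - 1)

theorem wordCurve_of_nonpos (g : ℕ) (l : List WeftStep) {y : ℝ} (hy : y ≤ 0) :
    wordCurve g l y = ((g + 1 / 2 : ℝ), 0) := by
  rcases l with _ | ⟨s, l⟩
  · rw [wordCurve, clamp_of_le hy, sub_zero]
  · rw [wordCurve, if_pos (by linarith), clamp_of_le (by linarith), tent_of_one_le (by norm_num)]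
    simp

theorem wordCurve_cons_of_ge {n g : ℕ} {s : WeftStep} {l : List WeftStep}
    (h : IsWeft n g (s :: l)) {y : ℝ} (hy : 1 ≤ y) :
    wordCurve g (s :: l) y = wordCurve (s.next g) l (y - 1) := by
  rcases hy.eq_or_lt with rfl | hy
  · rw [wordCurve, if_pos le_rfl, sub_self, wordCurve_of_nonpos _ _ le_rfl, clamp_of_ge (by norm_num)
      (by norm_num), WeftStep.next_eq h.1.1, tent_of_one_le (by norm_num)]
    ext <;> simp
    ring
  · rw [wordCurve, if_neg (by linarith)]

theorem wordCurve_cons_of_le {g : ℕ} {s : WeftStep} {l : List WeftStep} {y : ℝ} (hy : y ≤ 1) :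
    wordCurve g (s :: l) y = (g + 1 / 2 + s.dir * clamp 0 1 (2 * y),
        level s.isOver * tent (2 * clamp 0 1 (2 * y) - 1)) := by
  rw [wordCurve, if_pos hy]

theorem continuous_wordCurve {n g : ℕ} {l : List WeftStep} (h : IsWeft n g l) :
    Continuous (wordCurve g l) := by
  induction l generalizing g with
  | nil =>
    have : wordCurve g [] = fun y => ((g + 1 / 2 - clamp 0 (1 / 2) y : ℝ), (0 : ℝ)) := by
      funext y; rw [wordCurve]
    rw [this]; fun_prop
  | cons s l ih =>
    have h1 := ih h.2
    have : wordCurve g (s :: l) = fun y => if y ≤ 1 then (g + 1 / 2 + s.dir * clamp 0 1 (2 * y),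
        level s.isOver * tent (2 * clamp 0 1 (2 * y) - 1)) else wordCurve (s.next g) l (y - 1) := by
      funext y; rw [wordCurve]
    rw [this]
    refine Continuous.if_le (by fun_prop) (by fun_prop) continuous_id continuous_const ?_
    rintro y rfl
    rw [← wordCurve_cons_of_le (l := l) le_rfl, wordCurve_cons_of_ge h le_rfl]

theorem wordCurve_end {n g : ℕ} {l : List WeftStep} (h : IsWeft n g l) {y : ℝ}
    (hy : l.length + 1 / 2 ≤ y) : wordCurve g l y = (0, 0) := by
  induction l generalizing g y with
  | nil =>
    have hg : g = 0 := h
    subst hg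
    simp only [List.length_nil, Nat.cast_zero, zero_add] at hy
    rw [wordCurve, clamp_of_ge (by norm_num) hy]; simp
  | cons s l ih =>
    simp only [List.length_cons, Nat.cast_add, Nat.cast_one] at hy
    have : (0 : ℝ) ≤ l.length := Nat.cast_nonneg _
    rw [wordCurve_cons_of_ge h (by linarith)]
    exact ih h.2 (by linarith)

theorem step_mem_halfPlane {m g : ℕ} {s : WeftStep} (h1 : 1 ≤ s.crossed g) {c : ℝ} (h0 : 0 ≤ c)
    (hc : c ≤ 1 / 2) : ((g + 1 / 2 + s.dir * c : ℝ), level s.isOver * tent (2 * c - 1)) ∈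
      halfPlane m s.isOver g := by
  rcases h0.eq_or_lt with rfl | h0
  · have := anchor_mem_halfPlane m g s.isOver
    rw [tent_of_one_le (by norm_num), mul_zero, mul_zero, add_zero]
    exact this
  · have hd := WeftStep.next_eq h1
    have h2 : (0 : ℝ) ≤ s.next g := Nat.cast_nonneg _
    have h3 : (0 : ℝ) ≤ g := Nat.cast_nonneg _
    refine ⟨by simp only; nlinarith, Or.inl ?_⟩
    simp only
    rw [← mul_assoc, level_sq, one_mul, tent, abs_of_nonpos (by linarith)]
    exact lt_max_of_lt_right (by linarith)

theorem step_mem_halfPlane_next {m g : ℕ} {s : WeftStep} (h1 : 1 ≤ s.crossed g) {c : ℝ}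
    (h0 : 1 / 2 ≤ c) (hc : c ≤ 1) :
    ((g + 1 / 2 + s.dir * c : ℝ), level s.isOver * tent (2 * c - 1)) ∈
      halfPlane m s.isOver (s.next g) := by
  have hd := WeftStep.next_eq h1
  rcases hc.eq_or_lt with rfl | hc
  · have := anchor_mem_halfPlane m (s.next g) s.isOver
    rw [tent_of_one_le (by norm_num), mul_zero, mul_one]
    simp only [anchor] at this
    rw [hd] at this
    convert this using 2
    ring
  · have h2 : (0 : ℝ) ≤ s.next g := Nat.cast_nonneg _
    have h3 : (0 : ℝ) ≤ g := Nat.cast_nonneg _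
    refine ⟨by simp only; nlinarith, Or.inl ?_⟩
    simp only
    rw [← mul_assoc, level_sq, one_mul, tent, abs_of_nonneg (by linarith)]
    exact lt_max_of_lt_right (by linarith)

theorem near_origin_mem_strip (m : ℕ) {x : ℝ} (h0 : 0 ≤ x) (h1 : x ≤ 1 / 2) :
    ((x, 0) : ℝ × ℝ) ∈ strip m 0 :=
  ⟨by simp only; linarith, fun h => absurd h (by norm_num), fun _ => by simp only; norm_num; linarith⟩

theorem clamp_mem {a b : ℝ} (hab : a ≤ b) (x : ℝ) : a ≤ clamp a b x ∧ clamp a b x ≤ b :=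
  ⟨le_clamp a b x, clamp_le hab x⟩

theorem wordCurve_nil_mem (m : ℕ) (y : ℝ) : wordCurve 0 [] y ∈ strip m 0 := by
  have := clamp_mem (a := 0) (b := 1 / 2) (by norm_num) y
  rw [wordCurve]
  exact near_origin_mem_strip m (by simp only [Nat.cast_zero]; linarith)
    (by simp only [Nat.cast_zero]; linarith)

theorem wordCurve_mem {m g : ℕ} {l : List WeftStep} (h : IsWeft (2 * m) g l) (y : ℝ) :
    wordCurve g l y ∈ plane m := by
  induction l generalizing g y with
  | nil =>
    have hg : g = 0 := h
    subst hg
    exact strip_subset (by omega) (wordCurve_nil_mem m y)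
  | cons s l ih =>
    rcases le_total y 1 with hy | hy
    · rw [wordCurve_cons_of_le hy]
      have hc := clamp_mem zero_le_one (2 * y)
      rcases le_total (clamp 0 1 (2 * y)) (1 / 2) with h' | h'
      · exact halfPlane_subset (WeftStep.le_of_crossed h.1.2) _ (step_mem_halfPlane h.1.1 hc.1 h')
      · exact halfPlane_subset (WeftStep.next_le_of_crossed h.1.2) _
          (step_mem_halfPlane_next h.1.1 h' hc.2)
    · rw [wordCurve_cons_of_ge h hy]
      exact ih h.2 _

/-- The curve of a word as a curve in the complement of the straight strands. -/
def wordPath {m g : ℕ} {l : List WeftStep} (h : IsWeft (2 * m) g l) : C(ℝ, plane m) :=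
  ⟨fun y => ⟨wordCurve g l y, wordCurve_mem h y⟩, by
    have := continuous_wordCurve h; fun_prop⟩

theorem wordPath_zero {m g : ℕ} {l : List WeftStep} (h : IsWeft (2 * m) g l) :
    wordPath h 0 = anchor m g := Subtype.ext (wordCurve_of_nonpos g l le_rfl)

theorem wordPath_end {m g : ℕ} {l : List WeftStep} (h : IsWeft (2 * m) g l) :
    wordPath h (l.length + 1 / 2) = origin m := Subtype.ext (wordCurve_end h le_rfl)

/-- A word determines its class, and `wordCurve` represents it: each step occupies one unit of time,
is at its peak at time 1/4, and has arrived in the next gap at time 1. The two halves run in convex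
half planes, hence are homotopic to straight paths. -/
theorem IsWord.unique {m g : ℕ} {l : List WeftStep}
    {q : Path.Homotopic.Quotient (anchor m g) (origin m)} (hq : IsWord m g l q) :
    arcClass (wordPath hq.isWeft) (wordPath_zero _) (wordPath_end _) = q := by
  induction hq with
  | nil h =>
    exact arcClass_eq_lineClass (convex_strip m 0) (strip_subset (by omega)) _ (by positivity)
      (fun s _ => wordCurve_nil_mem m s) _ _ h
  | @cons g s l q h h1 h2 hq ih =>
    have hw : IsWeft (2 * m) g (s :: l) := ⟨h, hq.isWeft⟩
    have e1 : wordPath hw (1 / 4) = peak m (s.crossed g) s.isOver := by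
      refine Subtype.ext ?_
      change wordCurve _ _ _ = ((s.crossed g : ℝ), level s.isOver)
      rw [wordCurve_cons_of_le (by norm_num), clamp_of_mem (by norm_num) (by norm_num),
        WeftStep.crossed_eq, show (2 * (2 * (1 / 4 : ℝ)) - 1) = 0 by norm_num, tent_zero, mul_one]
      norm_num; ring
    have e2 : wordPath hw 1 = anchor m (s.next g) := by
      refine Subtype.ext ?_
      change wordCurve _ _ _ = _
      rw [wordCurve_cons_of_ge hw le_rfl, sub_self, wordCurve_of_nonpos _ _ le_rfl]; rfl
    rw [← arcClass_trans _ _ e1, ← arcClass_trans _ e1 e2 (wordPath_end _)]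
    congr 1
    · refine arcClass_eq_lineClass (convex_halfPlane m s.isOver g)
        (halfPlane_subset (WeftStep.le_of_crossed h.2) _) _ (by norm_num) (fun t ht => ?_) _ _ h1
      change wordCurve _ _ _ ∈ _
      rw [wordCurve_cons_of_le (by linarith [ht.2])]
      refine step_mem_halfPlane h.1 (le_clamp _ _ _) ?_
      rw [clamp_of_mem (by linarith [ht.1]) (by linarith [ht.2])]
      linarith [ht.2]
    · congr 1
      · refine arcClass_eq_lineClass (convex_halfPlane m s.isOver (s.next g))
          (halfPlane_subset (WeftStep.next_le_of_crossed h.2) _) _ (by norm_num)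
          (fun t ht => ?_) _ _ h2
        change wordCurve _ _ _ ∈ _
        rw [wordCurve_cons_of_le ht.2]
        refine step_mem_halfPlane_next h.1 ?_ (clamp_le zero_le_one _)
        have := monotone_clamp 0 1 (show (1 / 2 : ℝ) ≤ 2 * t by linarith [ht.1])
        rwa [clamp_of_mem (by norm_num) (by norm_num)] at this
      · rw [← ih]
        refine congrArg Path.Homotopic.Quotient.mk (Path.ext (funext fun t => Subtype.ext ?_))
        have ht := t.2.1
        have hl : (0 : ℝ) ≤ l.length := Nat.cast_nonneg _
        change wordCurve _ _ (1 + (t : ℝ) * (((s :: l).length : ℝ) + 1 / 2 - 1)) =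
          wordCurve _ _ (0 + (t : ℝ) * ((l.length : ℝ) + 1 / 2 - 0))
        rw [List.length_cons, Nat.cast_add, Nat.cast_one, wordCurve_cons_of_ge hw (by nlinarith)]
        congr 1
        ring

/-- The weft of a knotholder after its rows have been tilted. -/
def knotCurve (l : List WeftStep) (y : ℝ) : ℝ × ℝ :=
  if y ≤ 1 then (-2 + 8 * clamp 0 (1 / 4) y + 2 * clamp 0 (1 / 4) (y - 1 / 4), 0)
  else wordCurve 0 l (y - 1)

section knotCurve

variable {l : List WeftStep}

theorem knotCurve_of_le {y : ℝ} (h : y ≤ 1) : knotCurve l y =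
    (-2 + 8 * clamp 0 (1 / 4) y + 2 * clamp 0 (1 / 4) (y - 1 / 4), 0) := if_pos h

theorem knotCurve_of_ge {y : ℝ} (h : 1 ≤ y) : knotCurve l y = wordCurve 0 l (y - 1) := by
  rcases h.eq_or_lt with rfl | h
  · rw [knotCurve_of_le le_rfl, sub_self, wordCurve_of_nonpos _ _ le_rfl, clamp_of_ge (by norm_num)
      (by norm_num), clamp_of_ge (by norm_num) (by norm_num)]
    norm_num
  · rw [knotCurve, if_neg (by linarith)]

theorem continuous_knotCurve {n : ℕ} (h : IsWeft n 0 l) : Continuous (knotCurve l) := by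
  have := continuous_wordCurve h
  unfold knotCurve
  refine Continuous.if_le (by fun_prop) (by fun_prop) continuous_id continuous_const ?_
  rintro y rfl
  rw [← knotCurve_of_le (l := l) le_rfl, knotCurve_of_ge le_rfl]

theorem knotCurve_mem_strip (m : ℕ) {y : ℝ} (h : 1 / 4 ≤ y) (h' : y ≤ 1) :
    knotCurve l y ∈ strip m 0 := by
  have := clamp_mem (a := 0) (b := 1 / 4) (by norm_num) (y - 1 / 4)
  rw [knotCurve_of_le h', clamp_of_ge (by norm_num) h]
  exact near_origin_mem_strip m (by linarith) (by linarith)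

theorem knotCurve_mem {m : ℕ} (h : IsWeft (2 * m) 0 l) {y : ℝ} (hy : 1 / 4 ≤ y) :
    knotCurve l y ∈ plane m := by
  rcases le_total y 1 with h' | h'
  · exact strip_subset (by omega) (knotCurve_mem_strip m hy h')
  · rw [knotCurve_of_ge h']; exact wordCurve_mem h _

/-- The part of the tilted weft of a knotholder that moves among the straight strands. -/
def knotPath {m : ℕ} (h : IsWeft (2 * m) 0 l) : C(ℝ, plane m) :=
  ⟨fun y => ⟨knotCurve l (max (1 / 4) y), knotCurve_mem h (le_max_left _ _)⟩, by
    have := continuous_knotCurve h; fun_prop⟩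

theorem knotPath_apply {m : ℕ} (h : IsWeft (2 * m) 0 l) {y : ℝ} (hy : 1 / 4 ≤ y) :
    (knotPath h y : ℝ × ℝ) = knotCurve l y := by
  simp only [knotPath, ContinuousMap.coe_mk]; rw [max_eq_right hy]

theorem knotPath_start {m : ℕ} (h : IsWeft (2 * m) 0 l) : knotPath h (1 / 4) = origin m := by
  refine Subtype.ext ?_
  rw [knotPath_apply h le_rfl, knotCurve_of_le (by norm_num), clamp_of_ge (by norm_num) le_rfl,
    clamp_of_le (by norm_num)]
  norm_num [origin]

theorem knotPath_end {m : ℕ} (h : IsWeft (2 * m) 0 l) :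
    knotPath h (1 + (l.length + 1 / 2)) = origin m := by
  have hl : (0 : ℝ) ≤ l.length := Nat.cast_nonneg _
  refine Subtype.ext ?_
  rw [knotPath_apply h (by linarith), knotCurve_of_ge (by linarith), add_sub_cancel_left]
  exact wordCurve_end h le_rfl

/-- Before time 1 the curve stays in the strip 0, where it is equivalent to the straight path to the
first gap; from then on it is the curve of the word. -/
theorem arcClass_knotPath {m : ℕ} {q : Path.Homotopic.Quotient (anchor m 0) (origin m)}
    (hq : IsWord m 0 l q) (h : segment ℝ (origin m : ℝ × ℝ) (anchor m 0) ⊆ plane m) :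
    arcClass (knotPath hq.isWeft) (knotPath_start _) (knotPath_end _) = (lineClass h).trans q := by
  have e : knotPath hq.isWeft 1 = anchor m 0 := by
    refine Subtype.ext ?_
    rw [knotPath_apply _ (by norm_num), knotCurve_of_ge le_rfl, sub_self,
      wordCurve_of_nonpos _ _ le_rfl]
    rfl
  rw [← arcClass_trans _ _ e]
  congr 1
  · refine arcClass_eq_lineClass (convex_strip m 0) (strip_subset (by omega)) _ (by norm_num)
      (fun t ht => ?_) _ _ h
    rw [knotPath_apply _ ht.1]
    exact knotCurve_mem_strip m ht.1 ht.2
  · refine Eq.trans (congrArg Path.Homotopic.Quotient.mk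
      (Path.ext (funext fun t => Subtype.ext ?_))) hq.unique
    have ht := t.2.1
    have hl : (0 : ℝ) ≤ l.length := Nat.cast_nonneg _
    have h1 : 1 ≤ 1 + (t : ℝ) * (1 + ((l.length : ℝ) + 1 / 2) - 1) := by nlinarith
    change (knotPath hq.isWeft (1 + (t : ℝ) * (1 + ((l.length : ℝ) + 1 / 2) - 1)) : ℝ × ℝ) =
      wordCurve _ _ (0 + (t : ℝ) * ((l.length : ℝ) + 1 / 2 - 0))
    rw [knotPath_apply _ (by linarith), knotCurve_of_ge h1]
    congr 1
    ring

end knotCurve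

/-! ### Tilting the rows of a knotholder -/

/-- The amounts by which the rows of the weft are tilted, followed by the one for the arm. -/
def rowTilt (e : ℝ → ℝ) : ℕ → List WeftStep → ℕ → ℝ → ℝ
  | g, [], 0 => fun x => clamp 0 (1 / 2) (g + 1 / 2 - x)
  | _, [], _ + 1 => e
  | g, s :: _, 0 => fun x => clamp 0 (1 / 2) (s.dir * (x - (g + 1 / 2)) / 2)
  | g, s :: l, i + 1 => rowTilt e (s.next g) l i

theorem continuous_rowTilt {e : ℝ → ℝ} (he : Continuous e) (g : ℕ) (l : List WeftStep) (i : ℕ) :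
    Continuous (rowTilt e g l i) := by
  induction l generalizing g i with
  | nil =>
    rcases i with _ | i
    · rw [rowTilt]; fun_prop
    · rwa [rowTilt]
  | cons s l ih =>
    rcases i with _ | i
    · rw [rowTilt]; fun_prop
    · rw [rowTilt]; exact ih _ _

theorem rowTilt_mem {e : ℝ → ℝ} (he : ∀ x, 0 ≤ e x ∧ e x ≤ 1 / 2) (g : ℕ) (l : List WeftStep)
    (i : ℕ) (x : ℝ) : 0 ≤ rowTilt e g l i x ∧ rowTilt e g l i x ≤ 1 / 2 := by
  induction l generalizing g i with
  | nil =>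
    rcases i with _ | i
    · rw [rowTilt]; exact clamp_mem (by norm_num) _
    · rw [rowTilt]; exact he x
  | cons s l ih =>
    rcases i with _ | i
    · rw [rowTilt]; exact clamp_mem (by norm_num) _
    · rw [rowTilt]; exact ih _ _

theorem rowTilt_zero_anchor (e : ℝ → ℝ) (g : ℕ) (l : List WeftStep) :
    rowTilt e g l 0 (g + 1 / 2) = 0 := by
  rcases l with _ | ⟨s, l⟩
  · rw [rowTilt]; exact clamp_of_le (by simp)
  · rw [rowTilt]; exact clamp_of_le (by simp)

theorem rowTilt_length (e : ℝ → ℝ) (g : ℕ) (l : List WeftStep) :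
    rowTilt e g l (l.length + 1) = e := by
  induction l generalizing g with
  | nil => rw [List.length_nil, rowTilt]
  | cons s l ih => rw [List.length_cons, rowTilt, ih]

theorem rowTilt_length_origin (e : ℝ → ℝ) {n g : ℕ} {l : List WeftStep} (h : IsWeft n g l) :
    rowTilt e g l l.length 0 = 1 / 2 := by
  induction l generalizing g with
  | nil =>
    have hg : g = 0 := h
    subst hg
    rw [List.length_nil, rowTilt]; exact clamp_of_ge (by norm_num) (by norm_num)
  | cons s l ih => rw [List.length_cons, rowTilt, ih h.2]

theorem rowTilt_cons_zero (e : ℝ → ℝ) (g : ℕ) (s : WeftStep) (l : List WeftStep) {c : ℝ}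
    (h0 : 0 ≤ c) (h1 : c ≤ 1) : rowTilt e g (s :: l) 0 (g + 1 / 2 + s.dir * c) = c / 2 := by
  rw [rowTilt]
  have : s.dir * ((g : ℝ) + 1 / 2 + s.dir * c - (g + 1 / 2)) / 2 = c / 2 := by
    linear_combination (c / 2) * s.dir_mul_self
  simp only [this]
  exact clamp_of_mem (by linarith) (by linarith)

theorem weftFrom_eq_cons (g y : ℕ) (l : List WeftStep) :
    ∃ l', weftFrom g y l = ((g + 1 / 2 : ℝ), (y : ℝ), (0 : ℝ)) :: l' := by
  rcases l with _ | ⟨s, l⟩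
  · exact ⟨[], by rw [weftFrom]⟩
  · exact ⟨_, by rw [weftFrom]⟩

theorem moveY_tiltShift_nat {n : ℕ} {v : ℕ → ℝ → ℝ} {i : ℕ} (hi : i < n) (x z : ℝ) :
    moveY (tiltShift n v) (x, (i : ℝ), z) = (x, i + v i x, z) := by
  simp only [moveY]; rw [tiltShift_nat hi]

/-- The rows of the polygon are horizontal, so it is not yet a strand. The tilt raises each row by
c/2 after the fraction c of its way. The row then climbs by 1/2, and the vertical connection to the
next row shrinks to the remaining half unit. -/
theorem image_tilt_weftFrom {n N : ℕ} {v : ℕ → ℝ → ℝ} (hv : ∀ i, Continuous (v i))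
    (hv0 : ∀ i x, 0 ≤ v i x) (hv1 : ∀ i x, v i x ≤ 1 / 2) {e : ℝ → ℝ} {g y : ℕ} {l : List WeftStep}
    (h : IsWeft N g l) (hvl : ∀ i, v (y + i) = rowTilt e g l i) (hn : y + l.length < n) :
    moveY (tiltShift n v) '' polyline (weftFrom g y l ++ [((0 : ℝ), (y + l.length : ℝ), (0 : ℝ))]) =
      strand (fun t => wordCurve g l (t - y)) (Set.Icc (y : ℝ) (y + l.length + 1 / 2)) := by
  induction l generalizing g y with
  | nil =>
    have hg : g = 0 := h
    subst hg
    have h0 := hvl 0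
    rw [add_zero] at h0
    simp only [weftFrom, List.cons_append, List.nil_append, polyline, List.length_nil, Nat.cast_zero,
      add_zero]
    rw [Set.union_eq_self_of_subset_right (Set.singleton_subset_iff.2 (right_mem_segment ℝ _ _))]
    refine image_segment_eq_strand (θ := fun t => y + t / 2) (by fun_prop) (by simp) (by simp)
      (fun t ht => ⟨by linarith [ht.1], by linarith [ht.2]⟩) (fun t ht => ?_)
    have e1 : (1 - t) • (((0 : ℝ) + 1 / 2, (y : ℝ), (0 : ℝ)) : Space) + t • ((0 : ℝ), (y : ℝ), (0 : ℝ))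
        = ((1 - t) / 2, (y : ℝ), 0) := by
      simp only [Prod.smul_mk, smul_eq_mul, Prod.mk_add_mk, Prod.mk.injEq]
      exact ⟨by ring, by ring, by ring⟩
    have e2 : rowTilt e 0 [] 0 ((1 - t) / 2) = t / 2 := by
      rw [rowTilt]
      simp only [Nat.cast_zero]
      rw [clamp_of_mem (by linarith [ht.1]) (by linarith [ht.2])]; ring
    rw [e1, moveY_tiltShift_nat (by simpa using hn), h0, e2, wordCurve, add_sub_cancel_left,
      clamp_of_mem (by linarith [ht.1]) (by linarith [ht.2])]
    simp only [Prod.mk.injEq, Nat.cast_zero, and_true]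
    ring
  | cons s l ih =>
    have h0 := hvl 0
    rw [add_zero] at h0
    have hvl' : ∀ i, v (y + 1 + i) = rowTilt e (s.next g) l i := fun i => by
      rw [show y + 1 + i = y + (i + 1) by omega, hvl, rowTilt]
    rw [List.length_cons] at hn
    have IH := ih h.2 hvl' (by omega)
    obtain ⟨l', hl'⟩ := weftFrom_eq_cons (s.next g) (y + 1) l
    have hd := WeftStep.next_eq h.1.1
    have hcr := WeftStep.crossed_eq s g
    rw [hl'] at IH
    simp only [weftFrom, List.cons_append, polyline, hl', List.length_cons] at IH ⊢
    have hlen : (y : ℝ) + ((l.length + 1 : ℕ) : ℝ) = ((y + 1 : ℕ) : ℝ) + l.length := by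
      push_cast; ring
    rw [hlen, Set.image_union, Set.image_union, Set.image_union, IH]
    have hl0 : (0 : ℝ) ≤ l.length := Nat.cast_nonneg _
    have hsplit : ∀ C : ℝ → ℝ × ℝ, strand C (Set.Icc (y : ℝ) (((y + 1 : ℕ) : ℝ) + l.length + 1 / 2)) =
        strand C (Set.Icc (y : ℝ) (y + 1 / 4)) ∪ (strand C (Set.Icc (y + 1 / 4 : ℝ) (y + 1 / 2)) ∪
          (strand C (Set.Icc (y + 1 / 2 : ℝ) (y + 1 : ℕ)) ∪
            strand C (Set.Icc ((y + 1 : ℕ) : ℝ) (((y + 1 : ℕ) : ℝ) + l.length + 1 / 2)))) := by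
      intro C
      rw [strand_union (by push_cast; linarith) (by linarith),
        strand_union (by linarith) (by push_cast; linarith),
        strand_union (by linarith) (by push_cast; linarith)]
    -- The four pieces are the way to the crossing, the way from it to the next gap, the vertical
    -- connection, and the rest of the word.
    rw [hsplit]
    congr 1
    · refine image_segment_eq_strand (θ := fun t => y + t / 4) (by fun_prop) (by simp) (by simp)
        (fun t ht => ⟨by linarith [ht.1], by linarith [ht.2]⟩) (fun t ht => ?_)
      have e1 : (1 - t) • (((g : ℝ) + 1 / 2, (y : ℝ), (0 : ℝ)) : Space) +
          t • ((s.crossed g : ℝ), (y : ℝ), level s.isOver)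
          = (g + 1 / 2 + s.dir * (t / 2), (y : ℝ), t * level s.isOver) := by
        simp only [Prod.smul_mk, smul_eq_mul, Prod.mk_add_mk, Prod.mk.injEq, hcr]
        exact ⟨by ring, by ring, by ring⟩
      rw [e1, moveY_tiltShift_nat (by omega), h0, rowTilt_cons_zero _ _ _ _ (by linarith [ht.1])
        (by linarith [ht.2]), add_sub_cancel_left, wordCurve_cons_of_le (by linarith [ht.2]),
        clamp_of_mem (by linarith [ht.1]) (by linarith [ht.2]), tent,
        abs_of_nonpos (by linarith [ht.2]), max_eq_right (by linarith [ht.1])]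
      simp only [Prod.mk.injEq]
      exact ⟨by ring, by ring, by ring⟩
    · congr 1
      · refine image_segment_eq_strand (θ := fun t => y + 1 / 4 + t / 4) (by fun_prop) (by simp)
          (by norm_num; ring) (fun t ht => ⟨by linarith [ht.1], by linarith [ht.2]⟩) (fun t ht => ?_)
        have e1 : (1 - t) • (((s.crossed g : ℝ), (y : ℝ), level s.isOver) : Space) +
            t • ((s.next g : ℝ) + 1 / 2, (y : ℝ), (0 : ℝ))
            = (g + 1 / 2 + s.dir * ((1 + t) / 2), (y : ℝ), (1 - t) * level s.isOver) := by
          simp only [Prod.smul_mk, smul_eq_mul, Prod.mk_add_mk, Prod.mk.injEq, hcr, hd]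
          exact ⟨by ring, by ring, by ring⟩
        rw [e1, moveY_tiltShift_nat (by omega), h0, rowTilt_cons_zero _ _ _ _ (by linarith [ht.1])
          (by linarith [ht.2]), add_assoc (y : ℝ), add_sub_cancel_left,
          wordCurve_cons_of_le (by linarith [ht.2]),
          clamp_of_mem (by linarith [ht.1]) (by linarith [ht.2]), tent,
          abs_of_nonneg (by linarith [ht.1]), max_eq_right (by linarith [ht.2])]
        simp only [Prod.mk.injEq]
        exact ⟨by ring, by ring, by ring⟩
      · congr 1
        · rw [segment_eq_upright (by push_cast; linarith), image_moveY_upright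
            (continuous_tiltShift hv) (strictMono_tiltShift hv0 hv1) _ _ (by push_cast; linarith),
            tiltShift_nat (by omega), tiltShift_nat (by omega)]
          have e1 : v y (s.next g + 1 / 2) = 1 / 2 := by
            have := rowTilt_cons_zero e g s l zero_le_one le_rfl
            rwa [mul_one, add_right_comm, ← hd, ← h0] at this
          have e2 : v (y + 1) (s.next g + 1 / 2) = 0 := by
            have := hvl' 0
            rw [add_zero] at this
            rw [this, rowTilt_zero_anchor]
          rw [e1, e2, add_zero]
          refine upright_eq_strand fun t ht => ?_
          push_cast at ht
          rw [wordCurve_cons_of_le (by linarith [ht.2]), clamp_of_ge (by norm_num)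
            (by linarith [ht.1]), tent_of_one_le (by norm_num), hd]
          simp only [Prod.mk.injEq]
          exact ⟨by ring, by ring⟩
        · refine strand_congr fun t ht => ?_
          have := ht.1
          push_cast at this
          rw [wordCurve_cons_of_ge h (by linarith)]
          congr 1
          push_cast; ring

/-! ### The polygon of a knotholder -/

/-- The height of a strand that goes up across an arm at the height `h`. -/
def bump (b : Bool) (h y : ℝ) : ℝ := level b * tent (y - h)

theorem bump_of_le {b : Bool} {h y : ℝ} (hy : y ≤ h - 1) : bump b h y = 0 := by
  rw [bump, tent_of_one_le (by rw [abs_of_nonpos] <;> linarith), mul_zero]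

theorem segment_bump_lower (x h : ℝ) (b : Bool) :
    segment ℝ ((x, h - 1, 0) : Space) (x, h, level b) = column x (bump b h) (h - 1) h := by
  have e0 : bump b h (h - 1) = 0 := bump_of_le le_rfl
  have e1 : bump b h h = level b := by simp [bump, tent_zero]
  rw [← segment_eq_column (by linarith), e0, e1]
  intro t ht
  rw [e0, e1, bump, show (1 - t) * (h - 1) + t * h - h = t - 1 by ring, tent,
    abs_of_nonpos (by linarith [ht.2]), max_eq_right (by linarith [ht.1])]
  ring

theorem segment_bump_upper (x h : ℝ) (b : Bool) :
    segment ℝ ((x, h, level b) : Space) (x, h + 1, 0) = column x (bump b h) h (h + 1) := by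
  have e0 : bump b h (h + 1) = 0 := by
    rw [bump, tent_of_one_le (by simp), mul_zero]
  have e1 : bump b h h = level b := by simp [bump, tent_zero]
  rw [← segment_eq_column (by linarith), e0, e1]
  intro t ht
  rw [e0, e1, bump, show (1 - t) * h + t * (h + 1) - h = t by ring, tent,
    abs_of_nonneg (by linarith [ht.1]), max_eq_right (by linarith [ht.2])]
  ring

/-- A horizontal segment at height `y` in the drawing plane. -/
def flat (y a b : ℝ) : Set Space := {p | p.1 ∈ Set.Icc a b ∧ p.2.1 = y ∧ p.2.2 = 0}

namespace KnotholderDiagram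

variable {m : ℕ} (D : KnotholderDiagram m)

/-- Whether the vertical strand at `x = k` passes over the arm. -/
def strandOver (k : ℕ) : Bool := D.verticalOver (2 * m - k)

theorem one_le_armHeight : 1 ≤ D.armHeight := by
  have : (0 : ℝ) ≤ D.weaver.steps.length := Nat.cast_nonneg _
  unfold armHeight; linarith

/-- The union of a cap, a cup, and the strands next to them. -/
def arch (j : ℕ) : Set Space :=
  column ((2 * j : ℕ) : ℝ) (bump (D.strandOver (2 * j)) D.armHeight) (D.armHeight - 1)
      (D.armHeight + 1) ∪ flat (D.armHeight + 1) (2 * j) (2 * j + 1) ∪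
    column ((2 * j + 1 : ℕ) : ℝ) (bump (D.strandOver (2 * j + 1)) D.armHeight) (-1)
      (D.armHeight + 1) ∪ flat (-1) (2 * j + 1) (2 * j + 2)

theorem polyline_capCup (j : ℕ) {e : ℝ} (he : -1 ≤ e) :
    polyline (D.capCup j ++ [((2 * j + 2 : ℝ), e, (0 : ℝ))]) =
      D.arch j ∪ upright (2 * j + 2) 0 (-1) e := by
  have hh := D.one_le_armHeight
  simp only [capCup, crossingPoint, List.cons_append, List.nil_append, polyline, arch]
  rw [Set.union_eq_self_of_subset_right (Set.singleton_subset_iff.2 (right_mem_segment ℝ _ _)),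
    segment_eq_upright he, segment_eq_flat (by linarith), segment_eq_flat (by linarith)]
  have c1 : ((2 * j : ℕ) : ℝ) = 2 * j := by push_cast; ring
  have c2 : ((2 * j + 1 : ℕ) : ℝ) = 2 * j + 1 := by push_cast; ring
  have e1 : column ((2 * j : ℕ) : ℝ) (bump (D.strandOver (2 * j)) D.armHeight) (D.armHeight - 1)
      (D.armHeight + 1) = segment ℝ ((2 * j : ℝ), D.armHeight - 1, (0 : ℝ))
        (((2 * j : ℕ) : ℝ), D.armHeight, level (D.verticalOver (2 * m - 2 * j))) ∪
      segment ℝ (((2 * j : ℕ) : ℝ), D.armHeight, level (D.verticalOver (2 * m - 2 * j)))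
        ((2 * j : ℝ), D.armHeight + 1, (0 : ℝ)) := by
    rw [c1, segment_bump_lower, segment_bump_upper, column_union _ _ (by linarith) (by linarith)]
    rfl
  have e2 : column ((2 * j + 1 : ℕ) : ℝ) (bump (D.strandOver (2 * j + 1)) D.armHeight) (-1)
      (D.armHeight + 1) = segment ℝ ((2 * j + 1 : ℝ), D.armHeight + 1, (0 : ℝ))
        (((2 * j + 1 : ℕ) : ℝ), D.armHeight, level (D.verticalOver (2 * m - (2 * j + 1)))) ∪
      (segment ℝ (((2 * j + 1 : ℕ) : ℝ), D.armHeight, level (D.verticalOver (2 * m - (2 * j + 1))))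
        ((2 * j + 1 : ℝ), D.armHeight - 1, (0 : ℝ)) ∪
      segment ℝ ((2 * j + 1 : ℝ), D.armHeight - 1, (0 : ℝ)) ((2 * j + 1 : ℝ), -1, (0 : ℝ))) := by
    rw [c2, segment_symm, segment_bump_upper, segment_symm _ _ ((2 * j + 1 : ℝ), D.armHeight - 1, _),
      segment_bump_lower, segment_symm, segment_eq_upright (by linarith),
      ← column_union _ _ (b := D.armHeight) (by linarith) (by linarith),
      ← column_union _ _ (b := D.armHeight - 1) (by linarith) (by linarith),
      Set.union_comm, Set.union_comm (column _ _ (-1) _)]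
    congr 2
    exact column_congr fun y hy => bump_of_le hy.2
  rw [e1, e2]
  simp only [flat, Set.union_assoc]

theorem polyline_flatMap_capCup_succ (j : ℕ) {e : ℝ} (he : -1 ≤ e) :
    polyline ((List.range (j + 1)).flatMap D.capCup ++ [((2 * j + 2 : ℝ), e, (0 : ℝ))]) =
      polyline ((List.range j).flatMap D.capCup ++ [((2 * j : ℝ), D.armHeight - 1, (0 : ℝ))]) ∪
        (D.arch j ∪ upright (2 * j + 2) 0 (-1) e) := by
  rw [List.range_succ, List.flatMap_append, List.flatMap_singleton, List.append_assoc,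
    ← D.polyline_capCup j he]
  obtain ⟨l, hl⟩ : ∃ l, D.capCup j = ((2 * j : ℝ), D.armHeight - 1, (0 : ℝ)) :: l := ⟨_, rfl⟩
  rw [hl, List.cons_append, polyline_append_cons]

theorem mem_polyline_flatMap_capCup (j : ℕ) (p : Space) :
    p ∈ polyline ((List.range j).flatMap D.capCup ++ [((2 * j : ℝ), D.armHeight - 1, (0 : ℝ))]) ↔
      p = ((0 : ℝ), D.armHeight - 1, (0 : ℝ)) ∨
        ∃ i < j, p ∈ D.arch i ∨ p ∈ upright (2 * i + 2) 0 (-1) (D.armHeight - 1) := by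
  induction j with
  | zero => simp [polyline]
  | succ j ih =>
    have e : ((2 * ((j + 1 : ℕ) : ℝ) : ℝ), D.armHeight - 1, (0 : ℝ)) =
        ((2 * j + 2 : ℝ), D.armHeight - 1, (0 : ℝ)) := by push_cast; ring_nf
    rw [e, D.polyline_flatMap_capCup_succ j (by linarith [D.one_le_armHeight]), Set.mem_union, ih,
      Set.mem_union]
    constructor
    · rintro ((h | ⟨i, hi, h⟩) | h)
      · exact Or.inl h
      · exact Or.inr ⟨i, by omega, h⟩
      · exact Or.inr ⟨j, by omega, h⟩
    · rintro (h | ⟨i, hi, h⟩)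
      · exact Or.inl (Or.inl h)
      · rcases Nat.lt_succ_iff_lt_or_eq.1 hi with hi | rfl
        · exact Or.inl (Or.inr ⟨i, hi, h⟩)
        · exact Or.inr h

/-- The straight strands, caps, and cups of a knotholder. -/
def skeleton : Set Space :=
  {p | (∃ k : ℕ, (1 ≤ k ∧ k < 2 * m) ∧
      p ∈ column k (bump (D.strandOver k) D.armHeight) (-1) (D.armHeight + 1)) ∨
    (∃ j : ℕ, (1 ≤ j ∧ j ≤ m) ∧ p ∈ flat (-1) (2 * j - 1) (2 * j)) ∨
    (∃ j : ℕ, j < m ∧ p ∈ flat (D.armHeight + 1) (2 * j) (2 * j + 1))}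

/-- The polygon lists its pieces in the order of traversal; here they are regrouped by kind, as in
the frame of the normal form. Upright pieces on either side of a cup end at different heights in the
list and are glued along the way. -/
theorem polyline_strands (hm : 1 ≤ m) :
    polyline ((List.range m).flatMap D.capCup ++ [((2 * m : ℝ), D.armHeight, (0 : ℝ))]) =
      D.skeleton ∪ column 0 (bump (D.strandOver 0) D.armHeight) (D.armHeight - 1)
        (D.armHeight + 1) ∪ upright (2 * m) 0 (-1) D.armHeight := by
  obtain ⟨n, rfl⟩ : ∃ n, m = n + 1 := ⟨m - 1, by omega⟩
  have hh := D.one_le_armHeight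
  have e : ((2 * ((n + 1 : ℕ) : ℝ) : ℝ), D.armHeight, (0 : ℝ)) =
      ((2 * n + 2 : ℝ), D.armHeight, (0 : ℝ)) := by push_cast; ring_nf
  have e' : (2 * ((n + 1 : ℕ) : ℝ) : ℝ) = 2 * n + 2 := by push_cast; ring
  rw [e, e', D.polyline_flatMap_capCup_succ n (by linarith)]
  have hcol : ∀ i : ℕ, column ((2 * (i + 1) : ℕ) : ℝ) (bump (D.strandOver (2 * (i + 1))) D.armHeight)
      (-1) (D.armHeight + 1) = upright (2 * i + 2) 0 (-1) (D.armHeight - 1) ∪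
        column ((2 * (i + 1) : ℕ) : ℝ) (bump (D.strandOver (2 * (i + 1))) D.armHeight)
          (D.armHeight - 1) (D.armHeight + 1) := by
    intro i
    rw [← column_union _ _ (b := D.armHeight - 1) (by linarith) (by linarith)]
    congr 1
    rw [show ((2 * (i + 1) : ℕ) : ℝ) = 2 * i + 2 by push_cast; ring]
    exact column_congr fun y hy => bump_of_le hy.2
  ext p
  rw [Set.mem_union, mem_polyline_flatMap_capCup, Set.mem_union, Set.mem_union, Set.mem_union]
  have harch : ∀ i < n + 1, p ∈ D.arch i → p ∈ D.skeleton ∨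
      p ∈ column 0 (bump (D.strandOver 0) D.armHeight) (D.armHeight - 1) (D.armHeight + 1) := by
    rintro i hi (((h | h) | h) | h)
    · rcases Nat.eq_zero_or_pos i with rfl | hi0
      · right; simpa using h
      · left; left
        obtain ⟨i, rfl⟩ : ∃ i', i = i' + 1 := ⟨i - 1, by omega⟩
        refine ⟨2 * (i + 1), by omega, ?_⟩
        rw [hcol]; exact Or.inr h
    · left; right; right; exact ⟨i, hi, h⟩
    · left; left; exact ⟨2 * i + 1, by omega, h⟩
    · left; right; left
      refine ⟨i + 1, by omega, ?_⟩
      convert h using 2 <;> push_cast <;> ring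
  constructor
  · rintro ((h | ⟨i, hi, h | h⟩) | (h | h))
    · left; right
      subst h
      exact ⟨rfl, ⟨le_rfl, by simp only; linarith⟩, (bump_of_le le_rfl).symm⟩
    · exact Or.inl (harch i (by omega) h)
    · left; left; left
      refine ⟨2 * (i + 1), by omega, ?_⟩
      rw [hcol]; exact Or.inl h
    · exact Or.inl (harch n (by omega) h)
    · exact Or.inr h
  · have hback : ∀ i < n + 1, p ∈ D.arch i →
        (p = ((0 : ℝ), D.armHeight - 1, (0 : ℝ)) ∨ ∃ i < n, p ∈ D.arch i ∨
          p ∈ upright (2 * i + 2) 0 (-1) (D.armHeight - 1)) ∨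
        (p ∈ D.arch n ∨ p ∈ upright (2 * n + 2) 0 (-1) D.armHeight) := by
      intro i hi h
      rcases Nat.lt_succ_iff_lt_or_eq.1 hi with hi | rfl
      · exact Or.inl (Or.inr ⟨i, hi, Or.inl h⟩)
      · exact Or.inr (Or.inl h)
    rintro (((⟨k, hk, h⟩ | ⟨j, hj, h⟩ | ⟨j, hj, h⟩) | h) | h)
    · rcases Nat.even_or_odd' k with ⟨i, rfl | rfl⟩
      · obtain ⟨i, rfl⟩ : ∃ i', i = i' + 1 := ⟨i - 1, by omega⟩
        rw [hcol] at h
        rcases h with h | h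
        · exact Or.inl (Or.inr ⟨i, by omega, Or.inr h⟩)
        · exact hback (i + 1) (by omega) (Or.inl (Or.inl (Or.inl h)))
      · exact hback i (by omega) (Or.inl (Or.inr h))
    · obtain ⟨j, rfl⟩ : ∃ j', j = j' + 1 := ⟨j - 1, by omega⟩
      refine hback j (by omega) (Or.inr ?_)
      convert h using 2 <;> push_cast <;> ring
    · exact hback j hj (Or.inl (Or.inl (Or.inr h)))
    · exact hback 0 (by omega) (Or.inl (Or.inl (Or.inl (by simpa using h))))
    · exact Or.inr (Or.inr h)

/-- The polygon of the weft, from its first crossing on. -/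
def weftLine : Set Space :=
  polyline (weftFrom 0 1 D.weaver.steps ++ [((0 : ℝ), (D.weaver.steps.length + 1 : ℝ), (0 : ℝ))])

theorem realization_eq (hm : 1 ≤ m) : D.realization =
    upright (-1) 0 0 D.armHeight ∪
      (segment ℝ ((-1 : ℝ), (0 : ℝ), (0 : ℝ)) ((0 : ℝ), (0 : ℝ), (0 : ℝ)) ∪
      (segment ℝ ((0 : ℝ), (0 : ℝ), (0 : ℝ)) ((1 / 2 : ℝ), (0 : ℝ), (0 : ℝ)) ∪
      (upright (1 / 2) 0 0 1 ∪ D.weftLine))) ∪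
    (D.skeleton ∪ column 0 (bump (D.strandOver 0) D.armHeight) (D.armHeight - 1)
        (D.armHeight + 1) ∪ upright (2 * m) 0 (-1) D.armHeight) ∪
    segment ℝ ((2 * m : ℝ), D.armHeight, (0 : ℝ)) ((-1 : ℝ), D.armHeight, (0 : ℝ)) := by
  have hh := D.one_le_armHeight
  obtain ⟨l, hl⟩ := weftFrom_eq_cons 0 1 D.weaver.steps
  obtain ⟨r, hr⟩ : ∃ r, (List.range m).flatMap D.capCup =
      ((0 : ℝ), D.armHeight - 1, (0 : ℝ)) :: r := by
    obtain ⟨n, rfl⟩ : ∃ n, m = n + 1 := ⟨m - 1, by omega⟩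
    rw [List.range_succ_eq_map, List.flatMap_cons]
    refine ⟨(D.capCup 0).tail ++ ((List.range n).map Nat.succ).flatMap D.capCup, ?_⟩
    rw [show D.capCup 0 = ((0 : ℝ), D.armHeight - 1, (0 : ℝ)) :: (D.capCup 0).tail by
      simp [capCup], List.cons_append, List.tail_cons]
  have hN : D.armHeight - 1 = (D.weaver.steps.length + 1 : ℝ) := by unfold armHeight; ring
  rw [← polyline_strands D hm, realization, vertices, WeaverDiagram.weft, weftLine, hl, hr, hN]
  have key : ∀ (a b c d f g z : Space) (l r : List Space),
      polyline ([a, b] ++ ([c, d] ++ (f :: l) ++ [g]) ++ (g :: r) ++ [z, a]) =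
        segment ℝ a b ∪ (segment ℝ b c ∪ (segment ℝ c d ∪ (segment ℝ d f ∪
          polyline ((f :: l) ++ [g])))) ∪ polyline ((g :: r) ++ [z]) ∪ segment ℝ z a := by
    intro a b c d f g z l r
    have e1 : [a, b] ++ ([c, d] ++ (f :: l) ++ [g]) ++ (g :: r) ++ [z, a] =
        (a :: b :: c :: d :: f :: l) ++ g :: (g :: r ++ [z, a]) := by simp
    have e2 : polyline (g :: r ++ [z, a]) = polyline (g :: r ++ [z]) ∪ segment ℝ z a := by
      rw [polyline_append_cons (g :: r) z [a]]
      congr 1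
      exact Set.union_eq_self_of_subset_right
        (Set.singleton_subset_iff.2 (right_mem_segment ℝ z a))
    -- The upper end of the weft is listed twice, as the last point of the weft and as the first
    -- point of the first cap; the segment between them is degenerate.
    have e3 : polyline (g :: (g :: r ++ [z, a])) = polyline (g :: r ++ [z, a]) := by
      rcases r with _ | ⟨q, r⟩
      · simp only [List.cons_append, List.nil_append, polyline, segment_same]
        exact Set.union_eq_self_of_subset_left (Set.singleton_subset_iff.2
          (Or.inl (left_mem_segment ℝ g z)))
      · simp only [List.cons_append, polyline, segment_same]
        exact Set.union_eq_self_of_subset_left (Set.singleton_subset_iff.2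
          (Or.inl (left_mem_segment ℝ g q)))
    rw [e1, polyline_append_cons, e3, e2]
    simp only [List.cons_append, polyline, Set.union_assoc]
  rw [key, segment_symm, segment_eq_upright (by linarith)]
  simp only [Nat.cast_zero, zero_add, Nat.cast_one]
  rw [segment_eq_upright zero_le_one]

end KnotholderDiagram

/-! ### The normal form of a knotholder diagram -/

/-- Stretch the left half space and straighten the vertical strands. -/
def straighten (m : ℕ) (P : ℕ → Bool) (h : ℝ) (p : Space) : Space :=
  -- The stretch takes x = -1 to x = -2 and fixes x ≥ 0. The shear at the height of the arm flattens
  -- the strands, which bulge by ±1 there, and gives the flat arm the opposite bulges.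
  (p.1 + clamp (-1) 0 p.1, p.2.1, p.2.2 + -amp m P (p.1 + clamp (-1) 0 p.1) * tent (p.2.1 - h))

section straighten

variable {m : ℕ} {P : ℕ → Bool} {h : ℝ}

theorem isotopic_straighten (A : Set Space) : AmbientIsotopic A (straighten m P h '' A) := by
  have i1 := isotopic_moveX (u := fun p => clamp (-1) 0 p.1) (by fun_prop) (M := 1)
    (fun p => abs_le.2 ⟨le_clamp _ _ _, (clamp_le (by norm_num) _).trans zero_le_one⟩)
    (fun y z x x' hx => by
      have := monotone_clamp (-1) 0 hx.le
      simp only; linarith) A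
  have i2 := isotopic_shearZ (f := fun x y => -amp m P x * tent (y - h)) (by fun_prop) (M := 1)
    (fun x y => by
      rw [abs_mul, abs_neg, abs_of_nonneg (tent_nonneg _)]
      have := abs_amp_le (m := m) (P := P) x
      nlinarith [tent_nonneg (y - h), tent_le_one (y - h), abs_nonneg (amp m P x)])
    (moveX (fun p => clamp (-1) 0 p.1) '' A)
  have := i1.trans i2
  rwa [Set.image_image] at this

theorem straighten_of_tent {x y z : ℝ} (hx : 0 ≤ x) (h0 : amp m P x * tent (y - h) = 0) :
    straighten m P h (x, y, z) = (x, y, z) := by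
  simp only [straighten]
  rw [clamp_of_ge (by norm_num) hx, add_zero, neg_mul, h0, neg_zero, add_zero]

theorem straighten_of_far {x y z : ℝ} (hx : 0 ≤ x) (hy : y ≤ h - 1 ∨ h + 1 ≤ y) :
    straighten m P h (x, y, z) = (x, y, z) := by
  refine straighten_of_tent hx ?_
  rw [tent_of_one_le, mul_zero]
  rcases hy with hy | hy
  · exact le_abs.2 (Or.inr (by linarith))
  · exact le_abs.2 (Or.inl (by linarith))

theorem image_straighten_column {k : ℕ} (hk : k < 2 * m) (a b : ℝ) :
    straighten m P h '' column k (bump (P k) h) a b = upright k 0 a b := by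
  have hs : ∀ y z, straighten m P h ((k : ℝ), y, z) = ((k : ℝ), y, z - bump (P k) h y) := by
    intro y z
    simp only [straighten]
    rw [clamp_of_ge (by norm_num) (Nat.cast_nonneg k), add_zero, amp_nat hk, bump]
    ring_nf
  ext ⟨x, y, z⟩
  constructor
  · rintro ⟨⟨x', y', z'⟩, ⟨h1, h2, h3⟩, he⟩
    simp only at h1 h2 h3
    subst h1 h3
    rw [hs, sub_self] at he
    simp only [Prod.mk.injEq] at he
    obtain ⟨rfl, rfl, rfl⟩ := he
    exact ⟨rfl, h2, rfl⟩
  · rintro ⟨h1, h2, h3⟩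
    simp only at h1 h2 h3
    subst h1 h3
    exact ⟨(k, y, bump (P k) h y), ⟨rfl, h2, rfl⟩, by rw [hs, sub_self]⟩

theorem image_eq_self {f : Space → Space} {A : Set Space} (hf : ∀ p ∈ A, f p = p) : f '' A = A := by
  rw [Set.image_congr (g := id) hf, Set.image_id]

end straighten

/-- The amount by which the arm is tilted. -/
def armTilt (m : ℕ) (x : ℝ) : ℝ :=
  -- The height change `knotShift` has slope 2 at these heights. The climb 3/8 over [-1, 2m] becomes
  -- the climb from 3/2 to 9/4 in `highArm`, and the climb 1/8 over [-2, -1] becomes the one from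
  -- 9/4 to 5/2 in `armTail`.
  3 / 8 * clamp 0 1 ((2 * m - x) / (2 * m + 1)) + 1 / 8 * clamp 0 1 (-1 - x)

/-- The amount by which the beginning of the weft is tilted. -/
def startTilt (x : ℝ) : ℝ := clamp 0 (1 / 4) ((x + 2) / 8) + clamp 0 (1 / 4) (x / 2)

/-- The amounts by which the horizontal parts of a knotholder are tilted. -/
def knotTilt (m : ℕ) (l : List WeftStep) : ℕ → ℝ → ℝ
  | 0 => startTilt
  | i + 1 => rowTilt (armTilt m) 0 l i

theorem armTilt_mem (m : ℕ) (x : ℝ) : 0 ≤ armTilt m x ∧ armTilt m x ≤ 1 / 2 := by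
  have h1 := clamp_mem zero_le_one ((2 * m - x) / (2 * m + 1))
  have h2 := clamp_mem zero_le_one (-1 - x)
  unfold armTilt
  constructor <;> linarith

theorem startTilt_mem (x : ℝ) : 0 ≤ startTilt x ∧ startTilt x ≤ 1 / 2 := by
  have h1 := clamp_mem (by norm_num : (0 : ℝ) ≤ 1 / 4) ((x + 2) / 8)
  have h2 := clamp_mem (by norm_num : (0 : ℝ) ≤ 1 / 4) (x / 2)
  unfold startTilt
  constructor <;> linarith

@[fun_prop] theorem continuous_armTilt (m : ℕ) : Continuous (armTilt m) := by
  unfold armTilt; fun_prop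

@[fun_prop] theorem continuous_startTilt : Continuous startTilt := by unfold startTilt; fun_prop

theorem continuous_knotTilt (m : ℕ) (l : List WeftStep) (i : ℕ) : Continuous (knotTilt m l i) := by
  rcases i with _ | i
  · exact continuous_startTilt
  · exact continuous_rowTilt (continuous_armTilt m) _ _ _

theorem knotTilt_mem (m : ℕ) (l : List WeftStep) (i : ℕ) (x : ℝ) :
    0 ≤ knotTilt m l i x ∧ knotTilt m l i x ≤ 1 / 2 := by
  rcases i with _ | i
  · exact startTilt_mem x
  · exact rowTilt_mem (armTilt_mem m) _ _ _ _

/-- The arm that results from tilting. -/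
theorem highArm_armTilt {m : ℕ} {x : ℝ} (h : -2 ≤ x) (h' : x ≤ 2 * m) :
    highArm m (3 / 2 + 2 * armTilt m x) - armTail (3 / 2 + 2 * armTilt m x) = x := by
  have hm : (0 : ℝ) ≤ m := Nat.cast_nonneg m
  have hm' : (0 : ℝ) < 2 * m + 1 := by linarith
  rcases le_total (-1) x with hx | hx
  · have h1 : (0 : ℝ) ≤ (2 * m - x) / (2 * m + 1) := div_nonneg (by linarith) hm'.le
    have h2 : (2 * m - x) / (2 * m + 1) ≤ 1 := (div_le_one hm').2 (by linarith)
    rw [armTilt, clamp_of_mem h1 h2, clamp_of_le (by linarith), armTail_of_le (by linarith), highArm,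
      ramp_of_mem (by norm_num) (by linarith) (by linarith)]
    field_simp
    ring
  · have h1 : 1 ≤ (2 * m - x) / (2 * m + 1) := (one_le_div hm').2 (by linarith)
    rw [armTilt, clamp_of_ge zero_le_one h1, clamp_of_mem (by linarith) (by linarith),
      highArm_of_ge (by linarith), armTail, ramp_of_mem (by norm_num) (by linarith) (by linarith)]
    ring

theorem armTilt_right (m : ℕ) : armTilt m (2 * m) = 0 := by
  have hm : (0 : ℝ) ≤ m := Nat.cast_nonneg m
  rw [armTilt, clamp_of_le (by simp), clamp_of_le (by linarith)]; ring

theorem armTilt_left (m : ℕ) : armTilt m (-2) = 1 / 2 := by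
  have hm : (0 : ℝ) ≤ m := Nat.cast_nonneg m
  rw [armTilt, clamp_of_ge zero_le_one ((one_le_div (by linarith)).2 (by linarith)),
    clamp_of_ge zero_le_one (by norm_num)]; norm_num

/-- Heights in a tilted knotholder with `n` steps. -/
def knotNode (n : ℕ) : ℕ → ℝ
  -- In order: the cups; the start of the weft; its arrival at x = 0; its return to x = 0 after the
  -- last crossing; the beginning of the arm's way to the left; the end of the arm; the caps.
  | 0 => -1
  | 1 => 0
  | 2 => 1 / 4
  | 3 => n + 3 / 2
  | 4 => n + 2
  | 5 => n + 5 / 2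
  | _ => n + 3

/-- Heights in the normal form. -/
def formNode : ℕ → ℝ
  | 0 => -1
  | 1 => -3 / 4
  | 2 => -1 / 2
  | 3 => 1
  | 4 => 3 / 2
  | 5 => 5 / 2
  | _ => 3

theorem knotNode_lt (n : ℕ) : ∀ i < 6, knotNode n i < knotNode n (i + 1) := by
  have : (0 : ℝ) ≤ n := Nat.cast_nonneg n
  intro i hi
  interval_cases i <;> simp only [knotNode] <;> linarith

theorem formNode_lt : ∀ i < 6, formNode i < formNode (i + 1) := by
  intro i hi
  interval_cases i <;> simp only [formNode] <;> norm_num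

/-- The displacement that takes the heights in a tilted knotholder to the ones in the normal form. -/
def knotShift (n : ℕ) (y : ℝ) : ℝ := plShift 6 (knotNode n) formNode y

theorem knotShift_node (n : ℕ) {i : ℕ} (hi : i ≤ 6) :
    knotNode n i + knotShift n (knotNode n i) = formNode i := by
  rcases hi.lt_or_eq with hi | rfl
  · rw [knotShift, add_plShift (b := formNode) (knotNode_lt n) rfl hi le_rfl (knotNode_lt n i hi).le]; simp
  · have h := knotNode_lt n 5 (by norm_num)
    rw [knotShift, add_plShift (b := formNode) (knotNode_lt n) rfl (by norm_num : 5 < 6) h.le le_rfl,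
      div_self (by linarith)]
    ring

theorem continuous_knotShift (n : ℕ) : Continuous (knotShift n) := continuous_plShift

theorem strictMono_knotShift (n : ℕ) : StrictMono fun y => y + knotShift n y :=
  strictMono_plShift (knotNode_lt n) formNode_lt

theorem isotopic_knotShift (n : ℕ) (A : Set Space) :
    AmbientIsotopic A (moveY (fun p => knotShift n p.2.1) '' A) :=
  isotopic_moveY (u := fun p => knotShift n p.2.1) (by have := continuous_knotShift n; fun_prop)
    (fun p => abs_plShift_le _ _ _ _) (fun _ _ => strictMono_knotShift n) A

theorem polyline_subset {U : Set Space} (hU : Convex ℝ U) {l : List Space} (h : ∀ p ∈ l, p ∈ U) :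
    polyline l ⊆ U := by
  induction l with
  | nil => exact Set.empty_subset U
  | cons p l ih =>
    rcases l with _ | ⟨q, l⟩
    · exact Set.singleton_subset_iff.2 (h p (by simp))
    · exact Set.union_subset (hU.segment_subset (h p (by simp)) (h q (by simp)))
        (ih fun r hr => h r (List.mem_cons_of_mem _ hr))

theorem weftFrom_bounds (g y : ℕ) (l : List WeftStep) :
    ∀ p ∈ weftFrom g y l, 0 ≤ p.1 ∧ p.2.1 ≤ y + l.length := by
  induction l generalizing g y with
  | nil =>
    intro p hp
    simp only [weftFrom, List.mem_singleton] at hp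
    subst hp
    exact ⟨by positivity, by simp⟩
  | cons s l ih =>
    intro p hp
    have hl : (0 : ℝ) ≤ l.length := Nat.cast_nonneg _
    simp only [weftFrom, List.mem_cons] at hp
    rw [List.length_cons, Nat.cast_add, Nat.cast_one]
    rcases hp with rfl | rfl | rfl | hp
    · exact ⟨by positivity, by simp only; linarith⟩
    · exact ⟨by positivity, by simp only; linarith⟩
    · exact ⟨by positivity, by simp only; linarith⟩
    · have := ih _ _ p hp
      push_cast at this
      exact ⟨this.1, by linarith [this.2]⟩

namespace KnotholderDiagram

variable {m : ℕ} (D : KnotholderDiagram m)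

theorem weftLine_bounds {p : Space} (hp : p ∈ D.weftLine) :
    0 ≤ p.1 ∧ p.2.1 ≤ D.armHeight - 1 := by
  have hU : Convex ℝ {p : Space | 0 ≤ p.1 ∧ p.2.1 ≤ D.armHeight - 1} := by
    have h1 : Convex ℝ {p : Space | 0 ≤ p.1} :=
      convex_halfSpace_ge (f := fun p : Space => p.1) ⟨fun _ _ => rfl, fun _ _ => rfl⟩ 0
    have h2 : Convex ℝ {p : Space | p.2.1 ≤ D.armHeight - 1} :=
      convex_halfSpace_le (f := fun p : Space => p.2.1) ⟨fun _ _ => rfl, fun _ _ => rfl⟩ _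
    exact h1.inter h2
  refine polyline_subset hU (fun q hq => ?_) hp
  have hh : D.armHeight - 1 = 1 + D.weaver.steps.length := by unfold armHeight; ring
  rcases List.mem_append.1 hq with hq | hq
  · have := weftFrom_bounds 0 1 _ q hq
    rw [Nat.cast_one] at this
    exact ⟨this.1, by rw [hh]; exact this.2⟩
  · rw [List.mem_singleton] at hq
    subst hq
    exact ⟨le_rfl, by simp only; linarith⟩

/-- The isotopy that tilts a straightened knotholder. -/
def tilt (p : Space) : Space :=
  moveY (tiltShift (D.weaver.steps.length + 3) (knotTilt m D.weaver.steps)) p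

/-- The isotopy that takes a knotholder to its normal form. -/
def normalize (p : Space) : Space :=
  moveY (fun p => knotShift D.weaver.steps.length p.2.1)
    (D.tilt (straighten m D.strandOver D.armHeight p))

theorem isotopic_normalize (A : Set Space) : AmbientIsotopic A (D.normalize '' A) := by
  have i1 := isotopic_straighten (m := m) (P := D.strandOver) (h := D.armHeight) A
  have i2 := isotopic_tilt (n := D.weaver.steps.length + 3) (continuous_knotTilt m D.weaver.steps)
    (fun i x => (knotTilt_mem _ _ i x).1) (fun i x => (knotTilt_mem _ _ i x).2)
    (straighten m D.strandOver D.armHeight '' A)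
  have := (i1.trans i2).trans (isotopic_knotShift D.weaver.steps.length _)
  rwa [Set.image_image, Set.image_image] at this

theorem image_normalize (A : Set Space) : D.normalize '' A =
    moveY (fun p => knotShift D.weaver.steps.length p.2.1) ''
      (D.tilt '' (straighten m D.strandOver D.armHeight '' A)) := by
  rw [Set.image_image, Set.image_image]; rfl

theorem image_tilt_upright (x : ℝ) {a b : ℝ} (hab : a ≤ b) :
    D.tilt '' upright x 0 a b = upright x 0
      (a + tiltShift (D.weaver.steps.length + 3) (knotTilt m D.weaver.steps) (x, a, 0))
      (b + tiltShift (D.weaver.steps.length + 3) (knotTilt m D.weaver.steps) (x, b, 0)) :=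
  image_moveY_upright (continuous_tiltShift (continuous_knotTilt m _))
    (strictMono_tiltShift (fun i x => (knotTilt_mem _ _ i x).1)
      fun i x => (knotTilt_mem _ _ i x).2) x 0 hab

theorem image_shift_upright (x : ℝ) {i j : ℕ} (hij : i ≤ j) (hj : j ≤ 6) :
    moveY (fun p => knotShift D.weaver.steps.length p.2.1) ''
      upright x 0 (knotNode D.weaver.steps.length i) (knotNode D.weaver.steps.length j) =
        upright x 0 (formNode i) (formNode j) := by
  have hmono : ∀ l, i ≤ l → l ≤ 6 → knotNode D.weaver.steps.length i ≤
      knotNode D.weaver.steps.length l := by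
    intro l hl
    induction l, hl using Nat.le_induction with
    | base => exact fun _ => le_rfl
    | succ l hl ih => exact fun hln => (ih (by omega)).trans (knotNode_lt _ l (by omega)).le
  rw [image_moveY_upright (u := fun p => knotShift _ p.2.1)
    (by have := continuous_knotShift D.weaver.steps.length; fun_prop)
    (fun _ _ => strictMono_knotShift _) _ _ (hmono j hij hj)]
  simp only [knotShift_node _ hj, knotShift_node _ (hij.trans hj)]

theorem armHeight_eq : D.armHeight = ((D.weaver.steps.length + 2 : ℕ) : ℝ) := by
  unfold armHeight; push_cast; ring

theorem tiltShift_bottom (x z : ℝ) :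
    tiltShift (D.weaver.steps.length + 3) (knotTilt m D.weaver.steps) (x, -1, z) = 0 :=
  tiltShift_of_le le_rfl

theorem tiltShift_top (x z : ℝ) : tiltShift (D.weaver.steps.length + 3)
    (knotTilt m D.weaver.steps) (x, D.armHeight + 1, z) = 0 :=
  tiltShift_of_ge (by simp only [armHeight]; push_cast; linarith)

theorem tiltShift_arm (x z : ℝ) : tiltShift (D.weaver.steps.length + 3)
    (knotTilt m D.weaver.steps) (x, D.armHeight, z) = armTilt m x := by
  rw [armHeight_eq, tiltShift_nat (by omega), knotTilt, rowTilt_length]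

theorem tiltShift_start (x z : ℝ) : tiltShift (D.weaver.steps.length + 3)
    (knotTilt m D.weaver.steps) (x, 0, z) = startTilt x := by
  have := tiltShift_nat (n := D.weaver.steps.length + 3) (v := knotTilt m D.weaver.steps) (i := 0)
    (by omega) x z
  rw [Nat.cast_zero] at this
  rw [this, knotTilt]

theorem normalize_bottom {x : ℝ} (hx : 0 ≤ x) : D.normalize (x, -1, 0) = (x, -1, 0) := by
  have hh := D.one_le_armHeight
  have := knotShift_node D.weaver.steps.length (Nat.zero_le 6)
  simp only [knotNode, formNode] at this
  rw [normalize, straighten_of_far hx (Or.inl (by linarith)), tilt]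
  simp only [moveY]
  rw [tiltShift_bottom, add_zero, this]

theorem normalize_top {x : ℝ} (hx : 0 ≤ x) :
    D.normalize (x, D.armHeight + 1, 0) = (x, 3, 0) := by
  have := knotShift_node D.weaver.steps.length (le_refl 6)
  simp only [knotNode, formNode] at this
  have e : D.armHeight + 1 = D.weaver.steps.length + 3 := by unfold armHeight; ring
  rw [normalize, straighten_of_far hx (Or.inr le_rfl), tilt]
  simp only [moveY]
  rw [tiltShift_top, add_zero, e, this]

theorem image_normalize_skeleton : D.normalize '' D.skeleton =
    {p : Space | (∃ k : ℕ, (1 ≤ k ∧ k < 2 * m) ∧ p.1 = k ∧ p.2.1 ∈ Set.Icc (-1 : ℝ) 3 ∧ p.2.2 = 0) ∨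
    (∃ j : ℕ, (1 ≤ j ∧ j ≤ m) ∧ p.1 ∈ Set.Icc (2 * j - 1 : ℝ) (2 * j) ∧ p.2.1 = -1 ∧ p.2.2 = 0) ∨
    (∃ j : ℕ, j < m ∧ p.1 ∈ Set.Icc (2 * j : ℝ) (2 * j + 1) ∧ p.2.1 = 3 ∧ p.2.2 = 0)} := by
  have hh := D.one_le_armHeight
  have hcol : ∀ k < 2 * m, D.normalize '' column k (bump (D.strandOver k) D.armHeight) (-1)
      (D.armHeight + 1) = upright k 0 (-1) 3 := by
    intro k hk
    have e : D.armHeight + 1 = knotNode D.weaver.steps.length 6 := by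
      simp only [knotNode]; unfold armHeight; ring
    rw [image_normalize, image_straighten_column hk, image_tilt_upright _ _ (by linarith),
      tiltShift_bottom, tiltShift_top, add_zero, add_zero, e]
    exact D.image_shift_upright k (Nat.zero_le 6) le_rfl
  ext q
  constructor
  · rintro ⟨p, ⟨k, hk, hp⟩ | ⟨j, hj, hp⟩ | ⟨j, hj, hp⟩, rfl⟩
    · left
      have : D.normalize p ∈ upright k 0 (-1) 3 := by rw [← hcol k hk.2]; exact ⟨p, hp, rfl⟩
      exact ⟨k, hk, this⟩
    · right; left
      obtain ⟨x, y, z⟩ := p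
      obtain ⟨h1, h2, h3⟩ := hp
      simp only at h1 h2 h3
      subst h2 h3
      have : (1 : ℝ) ≤ j := by exact_mod_cast hj.1
      rw [D.normalize_bottom (by linarith [h1.1])]
      exact ⟨j, hj, h1, rfl, rfl⟩
    · right; right
      obtain ⟨x, y, z⟩ := p
      obtain ⟨h1, h2, h3⟩ := hp
      simp only at h1 h2 h3
      subst h2 h3
      have : (0 : ℝ) ≤ j := Nat.cast_nonneg j
      rw [D.normalize_top (by linarith [h1.1])]
      exact ⟨j, hj, h1, rfl, rfl⟩
  · rintro (⟨k, hk, hp⟩ | ⟨j, hj, h1, h2, h3⟩ | ⟨j, hj, h1, h2, h3⟩)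
    · have : q ∈ upright k 0 (-1) 3 := hp
      rw [← hcol k hk.2] at this
      obtain ⟨p, hp', rfl⟩ := this
      exact ⟨p, Or.inl ⟨k, hk, hp'⟩, rfl⟩
    · obtain ⟨x, y, z⟩ := q
      simp only at h1 h2 h3
      subst h2 h3
      have : (1 : ℝ) ≤ j := by exact_mod_cast hj.1
      exact ⟨(x, -1, 0), Or.inr (Or.inl ⟨j, hj, h1, rfl, rfl⟩),
        D.normalize_bottom (by linarith [h1.1])⟩
    · obtain ⟨x, y, z⟩ := q
      simp only at h1 h2 h3
      subst h2 h3
      have : (0 : ℝ) ≤ j := Nat.cast_nonneg j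
      exact ⟨(x, D.armHeight + 1, 0), Or.inr (Or.inr ⟨j, hj, h1, rfl, rfl⟩),
        D.normalize_top (by linarith [h1.1])⟩

theorem image_normalize_left : D.normalize '' upright (-1) 0 0 D.armHeight =
    {p : Space | p.1 = -2 ∧ p.2.1 ∈ Set.Icc (-3 / 4 : ℝ) (5 / 2) ∧ p.2.2 = 0} := by
  have hh := D.one_le_armHeight
  have h1 : straighten m D.strandOver D.armHeight '' upright (-1) 0 0 D.armHeight =
      upright (-2) 0 0 D.armHeight := by
    have hs : ∀ y, straighten m D.strandOver D.armHeight (-1, y, 0) = (-2, y, 0) := fun y => by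
      simp only [straighten]
      rw [clamp_of_le le_rfl, show (-1 : ℝ) + -1 = -2 by norm_num, amp_of_le (by norm_num)]
      simp
    ext ⟨x, y, z⟩
    constructor
    · rintro ⟨⟨x', y', z'⟩, ⟨h1, h2, h3⟩, he⟩
      simp only at h1 h2 h3
      subst h1 h3
      rw [hs] at he
      simp only [Prod.mk.injEq] at he
      obtain ⟨rfl, rfl, rfl⟩ := he
      exact ⟨rfl, h2, rfl⟩
    · rintro ⟨h1, h2, h3⟩
      simp only at h1 h2 h3
      subst h1 h3
      exact ⟨(-1, y, 0), ⟨rfl, h2, rfl⟩, hs y⟩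
  have e1 : D.armHeight + 1 / 2 = knotNode D.weaver.steps.length 5 := by
    simp only [knotNode]; unfold armHeight; ring
  have e2 : startTilt (-2) = 0 := by
    rw [startTilt, clamp_of_le (by norm_num), clamp_of_le (by norm_num), add_zero]
  rw [image_normalize, h1, image_tilt_upright _ _ (by linarith), tiltShift_start, tiltShift_arm, e2,
    armTilt_left, e1, add_zero]
  exact D.image_shift_upright (-2) (by norm_num : 1 ≤ 5) (by norm_num)

theorem image_normalize_arm : D.normalize '' (upright (2 * m) 0 (-1) D.armHeight ∪
      segment ℝ ((2 * m : ℝ), D.armHeight, (0 : ℝ)) ((-1 : ℝ), D.armHeight, (0 : ℝ))) =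
    strand (arm m D.strandOver (highArm m)) (Set.Icc (-1) (5 / 2)) := by
  have hh := D.one_le_armHeight
  have hm : (0 : ℝ) ≤ m := Nat.cast_nonneg m
  rw [Set.image_union, ← strand_union (b := 3 / 2) (by norm_num) (by norm_num)]
  congr 1
  · have h1 : straighten m D.strandOver D.armHeight '' upright (2 * m) 0 (-1) D.armHeight =
        upright (2 * m) 0 (-1) D.armHeight := by
      refine image_eq_self ?_
      rintro ⟨x, y, z⟩ ⟨h1, -, -⟩
      simp only at h1
      exact straighten_of_tent (by rw [h1]; linarith) (by rw [amp_of_ge h1.ge, zero_mul])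
    have e1 : D.armHeight = knotNode D.weaver.steps.length 4 := by
      simp only [knotNode]; unfold armHeight; ring
    rw [image_normalize, h1, image_tilt_upright _ _ (by linarith), tiltShift_bottom, tiltShift_arm,
      armTilt_right, add_zero, add_zero, e1]
    refine (D.image_shift_upright _ (Nat.zero_le 4) (by norm_num)).trans (upright_eq_strand ?_)
    intro y hy
    simp only [formNode] at hy
    rw [arm, highArm_of_le hy.2, armTail_of_le (by linarith [hy.2]), sub_zero, armPt_two_mul]
  -- ξ is the x-coordinate on the horizontal segment after the left half space has been stretched;
  -- it runs from 2m to -2.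
  · let ξ : ℝ → ℝ := fun t => 2 * m - t * (2 * m + 1) + clamp (-1) 0 (2 * m - t * (2 * m + 1))
    have hξ : ∀ t ∈ Set.Icc (0 : ℝ) 1, -2 ≤ ξ t ∧ ξ t ≤ 2 * m := by
      intro t ht
      have h1 := clamp_mem (by norm_num : (-1 : ℝ) ≤ 0) (2 * m - t * (2 * m + 1))
      simp only [ξ]
      constructor <;> nlinarith [ht.1, ht.2]
    have h0 : ξ 0 = 2 * m := by
      simp only [ξ]; rw [clamp_of_ge (by norm_num) (by simp)]; ring
    have h1 : ξ 1 = -2 := by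
      simp only [ξ]; rw [clamp_of_le (by linarith)]; ring
    refine image_segment_eq_strand (θ := fun t => 3 / 2 + 2 * armTilt m (ξ t)) (by fun_prop)
      (by rw [h0, armTilt_right]; norm_num) (by rw [h1, armTilt_left]; norm_num)
      (fun t ht => ?_) (fun t ht => ?_)
    · have := armTilt_mem m (ξ t)
      exact ⟨by linarith [this.1], by linarith [this.2]⟩
    · have e1 : (1 - t) • (((2 * m : ℝ), D.armHeight, (0 : ℝ)) : Space) +
          t • ((-1 : ℝ), D.armHeight, (0 : ℝ)) = (2 * m - t * (2 * m + 1), D.armHeight, 0) := by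
        simp only [Prod.smul_mk, smul_eq_mul, Prod.mk_add_mk, Prod.mk.injEq]
        exact ⟨by ring, by ring, by ring⟩
      have e2 : straighten m D.strandOver D.armHeight (2 * m - t * (2 * m + 1), D.armHeight, 0) =
          (ξ t, D.armHeight, -amp m D.strandOver (ξ t)) := by
        simp only [straighten, sub_self, tent_zero, ξ]
        simp
      have e3 : D.armHeight + armTilt m (ξ t) + knotShift D.weaver.steps.length
          (D.armHeight + armTilt m (ξ t)) = 3 / 2 + 2 * armTilt m (ξ t) := by
        have := armTilt_mem m (ξ t)
        have e4 : D.armHeight = D.weaver.steps.length + 2 := rfl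
        rw [knotShift, add_plShift (b := formNode) (knotNode_lt _) rfl (by norm_num : 4 < 6)
          (by simp only [knotNode]; linarith) (by simp only [knotNode]; linarith)]
        simp only [knotNode, formNode, e4]
        ring
      rw [e1, normalize, e2, tilt]
      simp only [moveY]
      rw [tiltShift_arm, e3]
      simp only [arm]
      rw [highArm_armTilt (hξ t ht).1 (hξ t ht).2]
      rfl

theorem tilt_start (x : ℝ) : D.tilt (x, 0, 0) = (x, startTilt x, 0) := by
  simp only [tilt, moveY]
  rw [tiltShift_start, zero_add]

theorem image_tilt_start : D.tilt '' (straighten m D.strandOver D.armHeight ''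
      (segment ℝ ((-1 : ℝ), (0 : ℝ), (0 : ℝ)) ((0 : ℝ), (0 : ℝ), (0 : ℝ)) ∪
        segment ℝ ((0 : ℝ), (0 : ℝ), (0 : ℝ)) ((1 / 2 : ℝ), (0 : ℝ), (0 : ℝ)))) =
    strand (knotCurve D.weaver.steps) (Set.Icc 0 (1 / 2)) := by
  have hh : (2 : ℝ) ≤ D.armHeight := by
    have : (0 : ℝ) ≤ D.weaver.steps.length := Nat.cast_nonneg _
    unfold armHeight; linarith
  have h0 : tent (0 - D.armHeight) = 0 := tent_of_one_le (le_abs.2 (Or.inr (by linarith)))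
  rw [Set.image_image, Set.image_union, ← strand_union (b := 1 / 4) (by norm_num) (by norm_num)]
  congr 1
  · refine image_segment_eq_strand (θ := fun t => t / 4) (by fun_prop) (by norm_num) (by norm_num)
      (fun t ht => ⟨by linarith [ht.1], by linarith [ht.2]⟩) fun t ht => ?_
    have e1 : (1 - t) • (((-1 : ℝ), (0 : ℝ), (0 : ℝ)) : Space) + t • ((0 : ℝ), (0 : ℝ), (0 : ℝ)) =
        (t - 1, 0, 0) := by
      simp only [Prod.smul_mk, smul_eq_mul, Prod.mk_add_mk, Prod.mk.injEq]
      exact ⟨by ring, by ring, by ring⟩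
    have e2 : straighten m D.strandOver D.armHeight (t - 1, 0, 0) = (2 * t - 2, 0, 0) := by
      simp only [straighten]
      rw [h0, clamp_of_mem (by linarith [ht.1]) (by linarith [ht.2]), mul_zero, add_zero]
      ring_nf
    have e3 : startTilt (2 * t - 2) = t / 4 := by
      rw [startTilt, clamp_of_mem (by linarith [ht.1]) (by linarith [ht.2]),
        clamp_of_le (by linarith [ht.2])]
      ring
    rw [e1, e2, tilt_start, e3, knotCurve_of_le (by linarith [ht.2]),
      clamp_of_mem (by linarith [ht.1]) (by linarith [ht.2]), clamp_of_le (by linarith [ht.2])]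
    ring_nf
  · refine image_segment_eq_strand (θ := fun t => 1 / 4 + t / 4) (by fun_prop) (by norm_num)
      (by norm_num) (fun t ht => ⟨by linarith [ht.1], by linarith [ht.2]⟩) fun t ht => ?_
    have e1 : (1 - t) • (((0 : ℝ), (0 : ℝ), (0 : ℝ)) : Space) +
        t • ((1 / 2 : ℝ), (0 : ℝ), (0 : ℝ)) = (t / 2, 0, 0) := by
      simp only [Prod.smul_mk, smul_eq_mul, Prod.mk_add_mk, Prod.mk.injEq]
      exact ⟨by ring, by ring, by ring⟩
    have e3 : startTilt (t / 2) = 1 / 4 + t / 4 := by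
      rw [startTilt, clamp_of_ge (by norm_num) (by linarith [ht.1]),
        clamp_of_mem (by linarith [ht.1]) (by linarith [ht.2])]
      ring
    rw [e1, straighten_of_far (by linarith [ht.1]) (Or.inl (by linarith)), tilt_start, e3,
      knotCurve_of_le (by linarith [ht.2]), clamp_of_ge (by norm_num) (by linarith [ht.1]),
      clamp_of_mem (by linarith [ht.1]) (by linarith [ht.2])]
    ring_nf

theorem image_tilt_rise : D.tilt '' (straighten m D.strandOver D.armHeight ''
      upright (1 / 2) 0 0 1) = strand (knotCurve D.weaver.steps) (Set.Icc (1 / 2) 1) := by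
  have hh : (2 : ℝ) ≤ D.armHeight := by
    have : (0 : ℝ) ≤ D.weaver.steps.length := Nat.cast_nonneg _
    unfold armHeight; linarith
  have h1 : straighten m D.strandOver D.armHeight '' upright (1 / 2) 0 0 1 =
      upright (1 / 2) 0 0 1 := by
    refine image_eq_self ?_
    rintro ⟨x, y, z⟩ ⟨h1, h2, -⟩
    simp only at h1
    exact straighten_of_far (by rw [h1]; norm_num) (Or.inl (by linarith [h2.2]))
  have e1 : tiltShift (D.weaver.steps.length + 3) (knotTilt m D.weaver.steps)
      ((1 / 2 : ℝ), (1 : ℝ), (0 : ℝ)) = 0 := by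
    have h := tiltShift_nat (n := D.weaver.steps.length + 3) (v := knotTilt m D.weaver.steps)
      (i := 1) (by omega) (1 / 2) 0
    rw [Nat.cast_one] at h
    rw [h, knotTilt]
    simpa using rowTilt_zero_anchor (armTilt m) 0 D.weaver.steps
  have e2 : startTilt (1 / 2) = 1 / 2 := by
    rw [startTilt, clamp_of_ge (by norm_num) (by norm_num), clamp_of_mem (by norm_num) (by norm_num)]
    norm_num
  rw [h1, image_tilt_upright _ _ zero_le_one, tiltShift_start, e1, e2, zero_add, add_zero]
  refine upright_eq_strand fun y hy => ?_
  rw [knotCurve_of_le hy.2, clamp_of_ge (by norm_num) (by linarith [hy.1]),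
    clamp_of_ge (by norm_num) (by linarith [hy.1])]
  norm_num

theorem image_tilt_weftLine : D.tilt '' (straighten m D.strandOver D.armHeight '' D.weftLine) =
    strand (knotCurve D.weaver.steps) (Set.Icc 1 (D.weaver.steps.length + 3 / 2)) := by
  have h1 : straighten m D.strandOver D.armHeight '' D.weftLine = D.weftLine := by
    refine image_eq_self ?_
    rintro ⟨x, y, z⟩ h
    have := D.weftLine_bounds h
    exact straighten_of_far this.1 (Or.inl this.2)
  have h2 := image_tilt_weftFrom (n := D.weaver.steps.length + 3) (v := knotTilt m D.weaver.steps)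
    (continuous_knotTilt m _) (fun i x => (knotTilt_mem _ _ i x).1)
    (fun i x => (knotTilt_mem _ _ i x).2) (y := 1) (e := armTilt m) D.weaver.isWeft
    (fun i => by rw [add_comm 1 i, knotTilt]) (by omega)
  rw [Nat.cast_one, add_comm (1 : ℝ)] at h2
  rw [h1]
  refine h2.trans ?_
  rw [show (D.weaver.steps.length : ℝ) + 1 + 1 / 2 = D.weaver.steps.length + 3 / 2 by ring]
  refine Set.image_congr fun y hy => ?_
  rw [knotCurve_of_ge hy.1]

theorem image_tilt_last (hm : 1 ≤ m) : D.tilt '' (straighten m D.strandOver D.armHeight ''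
      column 0 (bump (D.strandOver 0) D.armHeight) (D.armHeight - 1) (D.armHeight + 1)) =
    strand (knotCurve D.weaver.steps)
      (Set.Icc (D.weaver.steps.length + 3 / 2) (D.weaver.steps.length + 3)) := by
  have h1 := image_straighten_column (m := m) (P := D.strandOver) (h := D.armHeight) (k := 0)
    (by omega) (D.armHeight - 1) (D.armHeight + 1)
  rw [Nat.cast_zero] at h1
  have e1 : tiltShift (D.weaver.steps.length + 3) (knotTilt m D.weaver.steps)
      ((0 : ℝ), D.armHeight - 1, (0 : ℝ)) = 1 / 2 := by
    have h := tiltShift_nat (n := D.weaver.steps.length + 3) (v := knotTilt m D.weaver.steps)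
      (i := D.weaver.steps.length + 1) (by omega) 0 0
    rw [knotTilt, rowTilt_length_origin _ D.weaver.isWeft] at h
    rw [← h]
    congr 2
    unfold armHeight; push_cast; ring_nf
  rw [h1, image_tilt_upright _ _ (by linarith), e1, tiltShift_top,
    show D.armHeight - 1 + 1 / 2 = D.weaver.steps.length + 3 / 2 by unfold armHeight; ring,
    show D.armHeight + 1 + 0 = D.weaver.steps.length + 3 by unfold armHeight; ring]
  have hl : (0 : ℝ) ≤ D.weaver.steps.length := Nat.cast_nonneg _
  refine upright_eq_strand fun y hy => ?_
  rw [knotCurve_of_ge (by linarith [hy.1])]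
  exact wordCurve_end D.weaver.isWeft (by linarith [hy.1])

theorem image_tilt_weft (hm : 1 ≤ m) : D.tilt '' (straighten m D.strandOver D.armHeight ''
      (segment ℝ ((-1 : ℝ), (0 : ℝ), (0 : ℝ)) ((0 : ℝ), (0 : ℝ), (0 : ℝ)) ∪
      segment ℝ ((0 : ℝ), (0 : ℝ), (0 : ℝ)) ((1 / 2 : ℝ), (0 : ℝ), (0 : ℝ)) ∪
      upright (1 / 2) 0 0 1 ∪ D.weftLine ∪
        column 0 (bump (D.strandOver 0) D.armHeight) (D.armHeight - 1) (D.armHeight + 1))) =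
    strand (knotCurve D.weaver.steps) (Set.Icc 0 (D.weaver.steps.length + 3)) := by
  have hl : (0 : ℝ) ≤ D.weaver.steps.length := Nat.cast_nonneg _
  rw [Set.image_union, Set.image_union, Set.image_union, Set.image_union, Set.image_union,
    Set.image_union, image_tilt_start, image_tilt_rise, image_tilt_weftLine, image_tilt_last D hm,
    strand_union (by norm_num) (by norm_num), strand_union zero_le_one (by linarith),
    strand_union (by linarith) (by linarith)]

/-- After straightening, tilting and changing heights, every piece of the polygon is a piece of the
normal form. The weft is `knotCurve`, reparametrized by the inverse `ψ` of the change of heights. -/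
theorem exists_image_normalize (hm : 1 ≤ m) : ∃ ψ : C(ℝ, ℝ),
    (∀ y, ψ (y + knotShift D.weaver.steps.length y) = y) ∧ Monotone ψ ∧
    D.normalize '' D.realization =
      form m (arm m D.strandOver (highArm m)) (fun y => knotCurve D.weaver.steps (ψ y)) := by
  have hl : (0 : ℝ) ≤ D.weaver.steps.length := Nat.cast_nonneg _
  obtain ⟨ψ, hψ, hψ'⟩ := exists_inverse (continuous_knotShift D.weaver.steps.length)
    (abs_plShift_le _ _ _) (strictMono_knotShift D.weaver.steps.length)
  refine ⟨ψ, hψ, fun y y' h => ?_, ?_⟩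
  · by_contra! hlt
    have := strictMono_knotShift D.weaver.steps.length hlt
    simp only [hψ'] at this
    linarith
  have e : D.realization = (D.skeleton ∪ upright (-1) 0 0 D.armHeight) ∪
      (upright (2 * m) 0 (-1) D.armHeight ∪
      segment ℝ ((2 * m : ℝ), D.armHeight, (0 : ℝ)) ((-1 : ℝ), D.armHeight, (0 : ℝ))) ∪
      (segment ℝ ((-1 : ℝ), (0 : ℝ), (0 : ℝ)) ((0 : ℝ), (0 : ℝ), (0 : ℝ)) ∪
      segment ℝ ((0 : ℝ), (0 : ℝ), (0 : ℝ)) ((1 / 2 : ℝ), (0 : ℝ), (0 : ℝ)) ∪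
      upright (1 / 2) 0 0 1 ∪ D.weftLine ∪
        column 0 (bump (D.strandOver 0) D.armHeight) (D.armHeight - 1) (D.armHeight + 1)) := by
    rw [D.realization_eq hm]
    ac_rfl
  have hw : D.normalize '' (segment ℝ ((-1 : ℝ), (0 : ℝ), (0 : ℝ)) ((0 : ℝ), (0 : ℝ), (0 : ℝ)) ∪
      segment ℝ ((0 : ℝ), (0 : ℝ), (0 : ℝ)) ((1 / 2 : ℝ), (0 : ℝ), (0 : ℝ)) ∪
      upright (1 / 2) 0 0 1 ∪ D.weftLine ∪
        column 0 (bump (D.strandOver 0) D.armHeight) (D.armHeight - 1) (D.armHeight + 1)) =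
      strand (fun y => knotCurve D.weaver.steps (ψ y)) (Set.Icc (-3 / 4) 3) := by
    rw [image_normalize, D.image_tilt_weft hm, image_moveY_strand
      (continuous_knotShift D.weaver.steps.length) (strictMono_knotShift D.weaver.steps.length) hψ _
      (by linarith)]
    have e1 := knotShift_node D.weaver.steps.length (i := 1) (by norm_num)
    have e2 := knotShift_node D.weaver.steps.length (i := 6) (by norm_num)
    simp only [knotNode, formNode] at e1 e2
    rw [e1, e2]
  rw [e, Set.image_union, Set.image_union, hw, image_normalize_arm, Set.image_union,
    image_normalize_skeleton, image_normalize_left, form]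
  congr 2
  ext p
  simp only [frame, Set.mem_union, Set.mem_ofPred_eq, or_assoc]

end KnotholderDiagram

/-! ### From the normal form to a knotholder -/

theorem IsFreeWeft.mem_plane {m : ℕ} {C : ℝ → ℝ × ℝ} (hC : IsFreeWeft (warpPts m) 1 C) {y : ℝ}
    (hy : y ∈ Set.Icc (-1 / 2 : ℝ) 1) : C y ∈ plane m := by
  rcases le_total y 0 with h | h
  · rw [hC.eq_start y h, weftStart_of_ge hy.1]
    exact (origin m).2
  · exact ⟨hC.lt_fst y ⟨h, hy.2⟩, hC.avoid y ⟨h, hy.2⟩⟩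

/-- A knot in normal form is a knotholder. -/
theorem HasForm.exists_knotholder {m : ℕ} (hm : 1 ≤ m) {V : ℕ → Bool}
    (hV : ∀ i, 1 ≤ i → i ≤ m → armSign (2 * i - 1) (V (2 * i - 1)) = armSign (2 * i) (V (2 * i)))
    {S : Set Space} (h : HasForm m (fun k => V (2 * m - k)) S) :
    ∃ D : KnotholderDiagram m, D.verticalOver = V ∧ AmbientIsotopic S D.realization := by
  obtain ⟨C, hC, hS⟩ := h
  have hab : (-1 / 2 : ℝ) ≤ 1 := by norm_num
  have hp : ∀ y ∈ Set.Icc (-1 / 2 : ℝ) 1, C y ∈ plane m := fun y hy => hC.mem_plane hy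
  have h1 : planeCurve hab hC.continuous hp (-1 / 2) = origin m := by
    refine Subtype.ext ?_
    rw [planeCurve_apply _ _ _ ⟨le_rfl, hab⟩, hC.eq_start _ (by norm_num), weftStart_of_ge le_rfl]
    rfl
  have h2 : planeCurve hab hC.continuous hp 1 = origin m := by
    refine Subtype.ext ?_
    rw [planeCurve_apply _ _ _ ⟨hab, le_rfl⟩, hC.eq_zero _ le_rfl]
    rfl
  -- The word of the given weft is the weaver diagram of the knotholder. It remains to compare two
  -- wefts with the same arm.
  obtain ⟨l, q, hq, hs, hcl⟩ := exists_isWord hab (planeCurve hab hC.continuous hp) rfl h1 h2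
  let D : KnotholderDiagram m := ⟨⟨l, hq.isWeft⟩, V, hV⟩
  obtain ⟨ψ, hψ, hmono, him⟩ := D.exists_image_normalize hm
  refine ⟨D, rfl, hS.trans (AmbientIsotopic.trans ?_ (D.isotopic_normalize _).symm)⟩
  rw [him]
  have hl : (0 : ℝ) ≤ l.length := Nat.cast_nonneg _
  have s1 : ψ (-1 / 2) = 1 / 4 := by
    have := hψ (1 / 4)
    have e := knotShift_node l.length (i := 2) (by norm_num)
    simp only [knotNode, formNode] at e
    change ψ (1 / 4 + knotShift l.length (1 / 4)) = _ at this
    rwa [e] at this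
  have s2 : ψ 1 = 1 + (l.length + 1 / 2) := by
    have := hψ (l.length + 3 / 2)
    have e := knotShift_node l.length (i := 3) (by norm_num)
    simp only [knotNode, formNode] at e
    change ψ (l.length + 3 / 2 + knotShift l.length (l.length + 3 / 2)) = _ at this
    rw [e] at this
    rw [this]; ring
  -- Here the change of heights is a translation by 3/4, so the first part of the knotholder's weft
  -- is literally `weftStart` and no homotopy is needed.
  have s3 : ∀ y ∈ Set.Icc (-3 / 4 : ℝ) (-1 / 2), ψ y = y + 3 / 4 := by
    intro y hy
    have := hψ (y + 3 / 4)
    change ψ (y + 3 / 4 + plShift 6 (knotNode l.length) formNode (y + 3 / 4)) = _ at this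
    rw [add_plShift (b := formNode) (knotNode_lt _) rfl (by norm_num : 1 < 6)
      (by simp only [knotNode]; linarith [hy.1]) (by simp only [knotNode]; linarith [hy.2])] at this
    simp only [knotNode, formNode] at this
    rw [← this]
    congr 1
    ring
  have hc : Continuous fun y => knotCurve l (ψ y) := (continuous_knotCurve hq.isWeft).comp ψ.continuous
  have hp' : ∀ y ∈ Set.Icc (-1 / 2 : ℝ) 1, knotCurve l (ψ y) ∈ plane m := fun y hy =>
    knotCurve_mem hq.isWeft (s1 ▸ hmono hy.1)
  let ψ' : C(ℝ, ℝ) := ⟨fun y => ψ (clamp (-1 / 2) 1 y), by fun_prop⟩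
  have hψ' : planeCurve hab hc hp' = (knotPath hq.isWeft).comp ψ' := by
    ext1 y
    refine Subtype.ext ?_
    rw [ContinuousMap.comp_apply, knotPath_apply]
    · rfl
    · rw [← s1]; exact hmono (le_clamp _ _ _)
  have t1 : ψ' (-1 / 2) = 1 / 4 := by
    simp only [ψ', ContinuousMap.coe_mk]; rw [clamp_of_le le_rfl, s1]
  have t2 : ψ' 1 = 1 + (l.length + 1 / 2) := by
    simp only [ψ', ContinuousMap.coe_mk]; rw [clamp_of_ge hab le_rfl, s2]
  have u1 : planeCurve hab hc hp' (-1 / 2) = origin m := by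
    rw [hψ', ContinuousMap.comp_apply, t1, knotPath_start]
  have u2 : planeCurve hab hc hp' 1 = origin m := by
    rw [hψ', ContinuousMap.comp_apply, t2, knotPath_end]
  refine isotopic_form_of_arcClass_eq (continuous_arm (by fun_prop)) (a := -1 / 2) (b := 1)
    (by norm_num) (by norm_num) hab ?_ hm hC.continuous hc ?_ hp hp' h1 h2 u1 u2 ?_
  · intro y hy
    rw [arm, highArm_of_le (by linarith [hy.2]), armTail_of_le (by linarith [hy.2]), sub_zero,
      armPt_two_mul]
    push_cast; rfl
  · intro y hy hn
    rcases lt_or_ge y (-1 / 2) with hlt | hge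
    · rw [hC.eq_start y (by linarith), s3 y ⟨hy.1, hlt.le⟩, knotCurve_of_le (by linarith), weftStart,
        clamp_of_le (x := y + 3 / 4 - 1 / 4) (by linarith), mul_zero, add_zero]
    · have hgt : 1 < y := not_le.1 fun h => hn ⟨hge, h⟩
      have := hmono hgt.le
      rw [s2] at this
      rw [hC.eq_zero y hgt.le, knotCurve_of_ge (by linarith),
        wordCurve_end hq.isWeft (by linarith)]
      rfl
  -- Both wefts are in the class of the word; the one of the knotholder only after the
  -- reparametrization `ψ'`, which does not affect homotopy classes.
  · rw [hcl, ← arcClass_knotPath hq hs]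
    have key : ∀ (c : C(ℝ, plane m)) (e : c = (knotPath hq.isWeft).comp ψ')
        (u1 : c (-1 / 2) = origin m) (u2 : c 1 = origin m),
        arcClass (knotPath hq.isWeft) (knotPath_start _) (knotPath_end _) = arcClass c u1 u2 := by
      rintro c rfl u1 u2
      exact (arcClass_comp _ ψ' t1 t2 _ _ u1 u2).symm
    exact key _ hψ' u1 u2

/-! ### Pulling an arm out of a closed lace -/

/-- The frame without the strand on the left. -/
def warpFrame (m : ℕ) : Set Space :=
  {p | (∃ k : ℕ, (1 ≤ k ∧ k < 2 * m) ∧ p.1 = k ∧ p.2.1 ∈ Set.Icc (-1 : ℝ) 3 ∧ p.2.2 = 0) ∨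
    (∃ j : ℕ, (1 ≤ j ∧ j ≤ m) ∧ p.1 ∈ Set.Icc (2 * j - 1 : ℝ) (2 * j) ∧ p.2.1 = -1 ∧ p.2.2 = 0) ∨
    (∃ j : ℕ, j < m ∧ p.1 ∈ Set.Icc (2 * j : ℝ) (2 * j + 1) ∧ p.2.1 = 3 ∧ p.2.2 = 0)}

theorem frame_eq (m : ℕ) : frame m = warpFrame m ∪ upright (-2) 0 (-3 / 4) (5 / 2) := by
  ext p
  simp only [frame, warpFrame, upright, Set.mem_union, Set.mem_ofPred_eq, or_assoc]

theorem warpFrame_bounds {m : ℕ} {p : Space} (hp : p ∈ warpFrame m) : 0 ≤ p.1 ∧ p.2.2 = 0 := by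
  rcases hp with (⟨k, hk, h, -, h'⟩ | ⟨j, hj, h, -, h'⟩ | ⟨j, -, h, -, h'⟩)
  · exact ⟨by rw [h]; positivity, h'⟩
  · have : (1 : ℝ) ≤ j := by exact_mod_cast hj.1
    exact ⟨by linarith [h.1], h'⟩
  · have : (0 : ℝ) ≤ j := Nat.cast_nonneg j
    exact ⟨by linarith [h.1], h'⟩

theorem isClosed_warpFrame (m : ℕ) : IsClosed (warpFrame m) := by
  have : warpFrame m = frame m ∩ {p : Space | 0 ≤ p.1} := by
    ext p
    rw [frame_eq]
    constructor
    · exact fun h => ⟨Or.inl h, (warpFrame_bounds h).1⟩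
    · rintro ⟨h | h, h'⟩
      · exact h
      · have h1 : p.1 = -2 := h.1
        have h2 : 0 ≤ p.1 := h'
        linarith
  rw [this]
  exact (isClosed_frame m).inter (isClosed_le continuous_const continuous_fst)

theorem warpFrame_avoid {m : ℕ} {x y z : ℝ} (h1 : -1 < y) (h2 : y < 3)
    (hv : ∀ k : ℕ, 1 ≤ k → k < 2 * m → x = k → z ≠ 0) : (x, y, z) ∉ warpFrame m := by
  rintro (⟨k, hk, h, -, h'⟩ | ⟨j, -, -, h, -⟩ | ⟨j, -, -, h, -⟩)
  · exact hv k hk.1 hk.2 h h'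
  · simp only at h; linarith
  · simp only at h; linarith

/-- A strand that runs between the straight strands from the last to the first. -/
structure IsLace (m : ℕ) (X Z : ℝ → ℝ) : Prop where
  continuous_fst : Continuous X
  continuous_snd : Continuous Z
  fst_of_le : ∀ y ≤ 1 / 2, X y = 2 * m
  snd_of_le : ∀ y ≤ 1 / 2, Z y = 0
  fst_of_ge : ∀ y, 1 ≤ y → X y = 0
  snd_of_ge : ∀ y, 1 ≤ y → Z y = 0
  fst_nonneg : ∀ y, 0 ≤ X y
  snd_le : ∀ y, Z y ≤ 1
  avoid : ∀ y, ∀ k : ℕ, 1 ≤ k → k < 2 * m → X y = k → Z y ≠ 0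

/-- The position of the arm. -/
def armPos (m : ℕ) (y : ℝ) : ℝ := highArm m y - armTail y

/-- The position of the finger at the level `z`. -/
def fingerPos (m : ℕ) (z : ℝ) : ℝ :=
  -- As z decreases from 13 to 11/2 the finger follows the arm to x = -2. It stays there down to
  -- 9/4, reaches -1 at 11/8, and is back at 2m - 1/2 for z = 1.
  armPos m ((13 - z) / 3) + ramp (-9 / 4) (-11 / 8) (-z) + (2 * m + 1 / 2) * ramp (-11 / 8) (-1) (-z)

/-- The height of the finger at the level `z` when it is pulled out. -/
def fingerLow (z : ℝ) : ℝ := 1 / 4 * ramp (-13) (-1) (-z)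

/-- The height of the finger at the level `z` after it has been unfolded. -/
def fingerHigh (z : ℝ) : ℝ :=
  -- The terms unfold the finger piece by piece with decreasing z: the arm rises from 0 to 5/2, the
  -- strand at x = -2 descends to -3/4, and the beginning of the weft rises to -5/8 and then to 1/4.
  5 / 2 * ramp (-13) (-11 / 2) (-z) - 13 / 4 * ramp (-11 / 2) (-9 / 4) (-z) +
    1 / 8 * ramp (-9 / 4) (-11 / 8) (-z) + 7 / 8 * ramp (-11 / 8) (-1) (-z)

/-- A lace after a finger has been pulled out of it. -/
def fingerLace (m : ℕ) (X Z : ℝ → ℝ) (y : ℝ) : ℝ × ℝ :=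
  -- The finger occupies 0 ≤ y ≤ 1/4, where z decreases from 13 to 1; before that the strand rises
  -- to z = 13 at x = 2m, and afterwards it sinks back to the lace. Capping x at 2m - 1/2 keeps the
  -- rest away from the future arm at 2m.
  (fingerPos m (13 - 12 * ramp 0 (1 / 4) y) + (min (X y) (2 * m - 1 / 2) - (2 * m - 1 / 2)),
    13 * ramp (-15 / 16) (-7 / 8) y - 12 * ramp 0 (1 / 4) y - ramp (1 / 4) (1 / 2) y + Z y)

@[fun_prop] theorem continuous_armPos (m : ℕ) : Continuous (armPos m) := by
  unfold armPos; fun_prop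

@[fun_prop] theorem continuous_fingerPos (m : ℕ) : Continuous (fingerPos m) := by
  unfold fingerPos; fun_prop

@[fun_prop] theorem continuous_fingerLow : Continuous fingerLow := by unfold fingerLow; fun_prop

@[fun_prop] theorem continuous_fingerHigh : Continuous fingerHigh := by unfold fingerHigh; fun_prop

theorem armPos_of_le {m : ℕ} {y : ℝ} (h : y ≤ 3 / 2) : armPos m y = 2 * m := by
  rw [armPos, highArm_of_le h, armTail_of_le (by linarith), sub_zero]

theorem armPos_of_ge {m : ℕ} {y : ℝ} (h : 5 / 2 ≤ y) : armPos m y = -2 := by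
  rw [armPos, highArm_of_ge (by linarith), armTail, ramp_of_ge (by norm_num) h]; norm_num

theorem armPos_tail {m : ℕ} {y : ℝ} (h : 9 / 4 ≤ y) (h' : y ≤ 5 / 2) : armPos m y = 8 - 4 * y := by
  rw [armPos, highArm_of_ge (by linarith), armTail, ramp_of_mem (by norm_num) h h']; ring

theorem fingerPos_start (m : ℕ) : fingerPos m 13 = 2 * m := by
  rw [fingerPos, armPos_of_le (by norm_num), ramp_of_le (by norm_num) (by norm_num),
    ramp_of_le (by norm_num) (by norm_num)]
  ring

theorem fingerPos_end (m : ℕ) : fingerPos m 1 = 2 * m - 1 / 2 := by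
  rw [fingerPos, armPos_of_ge (by norm_num), ramp_of_ge (by norm_num) (by norm_num),
    ramp_of_ge (by norm_num) (by norm_num)]
  ring

section fingerHigh

variable {z : ℝ}

theorem fingerHigh_arm (h : 11 / 2 ≤ z) (h' : z ≤ 13) : fingerHigh z = (13 - z) / 3 := by
  rw [fingerHigh, ramp_of_mem (by norm_num) (by linarith) (by linarith),
    ramp_of_le (a := -11 / 2) (by norm_num) (by linarith),
    ramp_of_le (a := -9 / 4) (by norm_num) (by linarith),
    ramp_of_le (a := -11 / 8) (by norm_num) (by linarith)]
  ring

theorem fingerHigh_middle (h : 9 / 4 ≤ z) (h' : z ≤ 11 / 2) : fingerHigh z = z - 3 := by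
  rw [fingerHigh, ramp_of_ge (by norm_num) (by linarith),
    ramp_of_mem (a := -11 / 2) (by norm_num) (by linarith) (by linarith),
    ramp_of_le (a := -9 / 4) (by norm_num) (by linarith),
    ramp_of_le (a := -11 / 8) (by norm_num) (by linarith)]
  ring

theorem fingerHigh_head (h : 11 / 8 ≤ z) (h' : z ≤ 9 / 4) : fingerHigh z = -(z + 3) / 7 := by
  rw [fingerHigh, ramp_of_ge (by norm_num) (by linarith),
    ramp_of_ge (a := -11 / 2) (by norm_num) (by linarith),
    ramp_of_mem (a := -9 / 4) (by norm_num) (by linarith) (by linarith),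
    ramp_of_le (a := -11 / 8) (by norm_num) (by linarith)]
  ring

theorem fingerHigh_weft (h : 1 ≤ z) (h' : z ≤ 11 / 8) :
    fingerHigh z = -5 / 8 + 7 / 3 * (11 / 8 - z) := by
  rw [fingerHigh, ramp_of_ge (by norm_num) (by linarith),
    ramp_of_ge (a := -11 / 2) (by norm_num) (by linarith),
    ramp_of_ge (a := -9 / 4) (by norm_num) (by linarith),
    ramp_of_mem (a := -11 / 8) (by norm_num) (by linarith) (by linarith)]
  ring

theorem fingerHigh_of_le (h : z ≤ 1) : fingerHigh z = 1 / 4 := by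
  rw [fingerHigh, ramp_of_ge (by norm_num) (by linarith),
    ramp_of_ge (a := -11 / 2) (by norm_num) (by linarith),
    ramp_of_ge (a := -9 / 4) (by norm_num) (by linarith),
    ramp_of_ge (a := -11 / 8) (by norm_num) (by linarith)]
  norm_num

theorem fingerHigh_of_ge (h : 13 ≤ z) : fingerHigh z = 0 := by
  rw [fingerHigh, ramp_of_le (by norm_num) (by linarith),
    ramp_of_le (a := -11 / 2) (by norm_num) (by linarith),
    ramp_of_le (a := -9 / 4) (by norm_num) (by linarith),
    ramp_of_le (a := -11 / 8) (by norm_num) (by linarith)]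
  norm_num

theorem fingerHigh_mem (z : ℝ) : -3 / 4 ≤ fingerHigh z ∧ fingerHigh z ≤ 5 / 2 := by
  rcases le_total z 1 with h1 | h1
  · rw [fingerHigh_of_le h1]; norm_num
  rcases le_total z (11 / 8) with h2 | h2
  · rw [fingerHigh_weft h1 h2]; constructor <;> linarith
  rcases le_total z (9 / 4) with h3 | h3
  · rw [fingerHigh_head h2 h3]; constructor <;> linarith
  rcases le_total z (11 / 2) with h4 | h4
  · rw [fingerHigh_middle h3 h4]; constructor <;> linarith
  rcases le_total z 13 with h5 | h5
  · rw [fingerHigh_arm h4 h5]; constructor <;> linarith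
  · rw [fingerHigh_of_ge h5]; norm_num

theorem fingerLow_mem (z : ℝ) : 0 ≤ fingerLow z ∧ fingerLow z ≤ 1 / 4 := by
  have h0 := ramp_nonneg (-13) (-1) (-z)
  have h1 := ramp_le_one (-13) (-1) (-z)
  unfold fingerLow
  constructor <;> linarith

theorem fingerLow_of_mem (h : 1 ≤ z) (h' : z ≤ 13) : fingerLow z = (13 - z) / 48 := by
  rw [fingerLow, ramp_of_mem (by norm_num) (by linarith) (by linarith)]; ring

theorem fingerLow_of_le (h : z ≤ 1) : fingerLow z = 1 / 4 := by
  rw [fingerLow, ramp_of_ge (by norm_num) (by linarith)]; ring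

theorem fingerLow_of_ge (h : 13 ≤ z) : fingerLow z = 0 := by
  rw [fingerLow, ramp_of_le (by norm_num) (by linarith)]; ring

end fingerHigh

section lace

variable {m : ℕ} {X Z : ℝ → ℝ}

theorem fingerLace_of_nonpos (h : IsLace m X Z) {y : ℝ} (hy : y ≤ 0) :
    fingerLace m X Z y = ((2 * m : ℝ), 13 * ramp (-15 / 16) (-7 / 8) y) := by
  rw [fingerLace, h.fst_of_le y (by linarith), h.snd_of_le y (by linarith),
    ramp_of_le (a := 0) (by norm_num) hy, ramp_of_le (a := 1 / 4) (by norm_num) (by linarith),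
    min_eq_right (by linarith), mul_zero, sub_zero, fingerPos_start]
  ring_nf

theorem fingerLace_of_mem (h : IsLace m X Z) {y : ℝ} (hy : 0 ≤ y) (hy' : y ≤ 1 / 4) :
    fingerLace m X Z y = (fingerPos m (13 - 48 * y), 13 - 48 * y) := by
  rw [fingerLace, h.fst_of_le y (by linarith), h.snd_of_le y (by linarith),
    ramp_of_mem (a := 0) (by norm_num) hy hy', ramp_of_le (a := 1 / 4) (by norm_num) (by linarith),
    ramp_of_ge (a := -15 / 16) (by norm_num) (by linarith), min_eq_right (by linarith)]
  ring_nf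

theorem fingerLace_of_ge {y : ℝ} (hy : 1 / 4 ≤ y) : fingerLace m X Z y =
    (min (X y) (2 * m - 1 / 2), 1 - ramp (1 / 4) (1 / 2) y + Z y) := by
  rw [fingerLace, ramp_of_ge (a := 0) (by norm_num) hy,
    ramp_of_ge (a := -15 / 16) (by norm_num) (by linarith), mul_one,
    show (13 : ℝ) - 12 = 1 by norm_num, fingerPos_end]
  ring_nf

theorem continuous_fingerLace (h : IsLace m X Z) : Continuous (fingerLace m X Z) := by
  have := h.continuous_fst
  have := h.continuous_snd
  unfold fingerLace; fun_prop

/-- A finger can be pulled out of the lower end of a lace. -/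
theorem isotopic_fingerLace (hm : 1 ≤ m) (h : IsLace m X Z) :
    AmbientIsotopic (warpFrame m ∪ strand (fun y => (X y, Z y)) (Set.Icc (-1) 3))
      (warpFrame m ∪ strand (fingerLace m X Z) (Set.Icc (-1) 3)) := by
  have hX := h.continuous_fst
  have hZ := h.continuous_snd
  have hF := continuous_fingerLace h
  have hm' : (1 : ℝ) ≤ m := by exact_mod_cast hm
  -- The straight-line homotopy works: up to height 0 the strand keeps x = 2m, and the finger is
  -- pulled out in front of the straight strands, at positive z for positive time.
  let c : ℝ → ℝ → ℝ × ℝ := fun t y => (X y + t * ((fingerLace m X Z y).1 - X y),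
    Z y + t * ((fingerLace m X Z y).2 - Z y))
  have h0 : c 0 = fun y => (X y, Z y) := by funext y; simp [c]
  have h1 : c 1 = fingerLace m X Z := by funext y; simp [c]
  rw [← h0, ← h1]
  refine isotopic_strand_of_homotopy (isClosed_warpFrame m) (a := -15 / 16) (b := 1) (by fun_prop)
    (fun t _ y hy => ?_) (fun t ht y hy => ?_)
  · have e : fingerLace m X Z y = (X y, Z y) := by
      rcases lt_or_ge y (-15 / 16) with hlt | hge
      · rw [fingerLace_of_nonpos h (by linarith), h.fst_of_le y (by linarith),
          h.snd_of_le y (by linarith), ramp_of_le (by norm_num) hlt.le, mul_zero]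
      · have hgt : 1 < y := not_le.1 fun h => hy ⟨hge, h⟩
        rw [fingerLace_of_ge (by linarith), ramp_of_ge (by norm_num) (by linarith),
          h.fst_of_ge y hgt.le, h.snd_of_ge y hgt.le, min_eq_left (by linarith)]
        norm_num
    simp [c, e]
  · refine warpFrame_avoid (by linarith [hy.1]) (by linarith [hy.2]) fun k hk hk' hx => ?_
    have hk2 := cast_le_sub_one hk'
    push_cast at hk2
    simp only [c] at hx ⊢
    rcases le_total y (1 / 4) with h4 | h4
    · rw [h.fst_of_le y (by linarith)] at hx
      rw [h.snd_of_le y (by linarith)]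
      rcases le_total y 0 with h5 | h5
      · rw [fingerLace_of_nonpos h h5] at hx
        simp only at hx
        linarith
      · rcases ht.1.eq_or_lt with rfl | ht0
        · linarith
        · rw [fingerLace_of_mem h h5 h4]
          have : 0 < t * (13 - 48 * y - 0) := mul_pos ht0 (by linarith)
          simp only
          linarith
    · rw [fingerLace_of_ge h4] at hx ⊢
      simp only at hx ⊢
      -- Where the cap at 2m - 1/2 is effective, the strand stays to the right of all straight
      -- strands. Elsewhere y > 1/2, so the additional z has died out and nothing moves.
      rcases le_total (2 * m - 1 / 2 : ℝ) (X y) with h5 | h5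
      · rw [min_eq_right h5] at hx
        nlinarith [ht.1, ht.2]
      · have h6 : 1 / 2 < y := by
          by_contra! h6
          rw [h.fst_of_le y h6] at h5
          linarith
        rw [min_eq_left h5, sub_self, mul_zero, add_zero] at hx
        rw [ramp_of_ge (by norm_num) h6.le]
        have := h.avoid y k hk hk' hx
        simpa using this

end lace

/-- The amount by which the unfolded finger is pressed down on the left. -/
def press (x y : ℝ) : ℝ :=
  -- For x ≤ -1 this is exactly the level at which the unfolded finger lies: y + 3 on the strand at
  -- x = -2, 13 - 3y on the tail of the arm, and correspondingly with the opposite sign of the last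
  -- term on the beginning of the weft. All of these are brought to level 0.
  clamp 0 1 (-x) * (clamp (-3 / 4) (5 / 2) y + 3 + clamp 0 2 (x + 2) * (2 * ramp 0 1 y - 1))

theorem press_of_nonneg {x : ℝ} (hx : 0 ≤ x) (y : ℝ) : press x y = 0 := by
  rw [press, clamp_of_le (by linarith), zero_mul]

@[fun_prop] theorem continuous_press : Continuous fun q : ℝ × ℝ => press q.1 q.2 := by
  unfold press; fun_prop

theorem abs_press_le (x y : ℝ) : |press x y| ≤ 8 := by
  have h1 := clamp_mem zero_le_one (-x)
  have h2 := clamp_mem (by norm_num : (-3 / 4 : ℝ) ≤ 5 / 2) y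
  have h3 := clamp_mem (zero_le_two (α := ℝ)) (x + 2)
  have h4 := ramp_nonneg 0 1 y
  have h5 := ramp_le_one 0 1 y
  rw [press, abs_mul, abs_of_nonneg h1.1]
  have h6 : |clamp (-3 / 4) (5 / 2) y + 3 + clamp 0 2 (x + 2) * (2 * ramp 0 1 y - 1)| ≤ 8 := by
    rw [abs_le]; constructor <;> nlinarith
  nlinarith [abs_nonneg (clamp (-3 / 4) (5 / 2) y + 3 + clamp 0 2 (x + 2) * (2 * ramp 0 1 y - 1))]

/-- The homeomorphism that unfolds the finger. -/
def unfold (p : Space) : Space :=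
  -- The vertical motion depends on the level z. At z ≤ 1, where the frame and the rest of the lace
  -- lie, the low and the high position agree and nothing moves; different parts of the finger lie
  -- at different levels and can be moved independently.
  moveZ (fun p => -press p.1 p.2.1)
    (moveY (fun p => slide (-7 / 8) 4 (fingerLow p.2.2) (fingerHigh p.2.2) p.2.1) p)

theorem isotopic_unfold (A : Set Space) : AmbientIsotopic A (unfold '' A) := by
  have hl : ∀ z, -7 / 8 < fingerLow z := fun z => by linarith [(fingerLow_mem z).1]
  have hl' : ∀ z, fingerLow z < 4 := fun z => by linarith [(fingerLow_mem z).2]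
  have hh : ∀ z, -7 / 8 < fingerHigh z := fun z => by linarith [(fingerHigh_mem z).1]
  have hh' : ∀ z, fingerHigh z < 4 := fun z => by linarith [(fingerHigh_mem z).2]
  have i1 := isotopic_moveY
    (u := fun p => slide (-7 / 8) 4 (fingerLow p.2.2) (fingerHigh p.2.2) p.2.1)
    (continuous_slide (by fun_prop) (by fun_prop) (by fun_prop) (fun _ => hl _) (fun _ => hl' _))
    (fun p => abs_slide_le (hl _) (hl' _) (hh _) (hh' _) _)
    (fun x z => strictMono_slide (hl _) (hl' _) (hh _) (hh' _)) A
  have i2 := isotopic_shearZ (f := fun x y => -press x y) (by fun_prop) (M := 8)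
    (fun x y => by rw [abs_neg]; exact abs_press_le x y)
    (moveY (fun p => slide (-7 / 8) 4 (fingerLow p.2.2) (fingerHigh p.2.2) p.2.1) '' A)
  have := i1.trans i2
  rwa [Set.image_image] at this

theorem unfold_of_slide {x y z : ℝ} (h : slide (-7 / 8) 4 (fingerLow z) (fingerHigh z) y = 0) :
    unfold (x, y, z) = (x, y, z - press x y) := by
  simp only [unfold, moveY, moveZ]
  rw [h, add_zero]; rfl

theorem unfold_of_le {x y z : ℝ} (h : z ≤ 1) : unfold (x, y, z) = (x, y, z - press x y) :=
  unfold_of_slide (by rw [fingerLow_of_le h, fingerHigh_of_le h, slide_same])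

theorem unfold_finger {x y z : ℝ} (h : 1 ≤ z) (h' : z ≤ 13) (hy : y = (13 - z) / 48) :
    unfold (x, y, z) = (x, fingerHigh z, z - press x (fingerHigh z)) := by
  simp only [unfold, moveY, moveZ]
  rw [hy, ← fingerLow_of_mem h h', slide_self (by linarith [(fingerLow_mem z).1])
    (by linarith [(fingerLow_mem z).2]), add_sub_cancel]; rfl

theorem image_strand_eq {f : Space → Space} {c c' : ℝ → ℝ × ℝ} {a b a' b' : ℝ} {φ : ℝ → ℝ}
    (hab : a ≤ b) (hφ : Continuous φ) (ha : φ a = a') (hb : φ b = b')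
    (hmem : ∀ y ∈ Set.Icc a b, φ y ∈ Set.Icc a' b')
    (h : ∀ y ∈ Set.Icc a b, f ((c y).1, y, (c y).2) = ((c' (φ y)).1, φ y, (c' (φ y)).2)) :
    f '' strand c (Set.Icc a b) = strand c' (Set.Icc a' b') := by
  rw [strand, Set.image_image, Set.image_congr h, strand]
  have : φ '' Set.Icc a b = Set.Icc a' b' := by
    refine Set.Subset.antisymm (Set.image_subset_iff.2 hmem) ?_
    have := intermediate_value_Icc hab hφ.continuousOn
    rwa [ha, hb] at this
  rw [← this, Set.image_image]

/-- The unfolded arm. -/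
def armLift (m : ℕ) (y : ℝ) : ℝ × ℝ :=
  (armPos m y, 13 * ramp (-15 / 16) (-7 / 8) y - 3 * clamp 0 (5 / 2) y - press (armPos m y) y)

/-- The position of the unfolded weft. -/
def weftPos (m : ℕ) (X : ℝ → ℝ) (y : ℝ) : ℝ :=
  -2 + ramp (-3 / 4) (-5 / 8) y + (2 * m + 1 / 2) * ramp (-5 / 8) (1 / 4) y +
    (min (X y) (2 * m - 1 / 2) - (2 * m - 1 / 2))

/-- The unfolded weft. -/
def weftLift (m : ℕ) (X Z : ℝ → ℝ) (y : ℝ) : ℝ × ℝ :=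
  (weftPos m X y, 9 / 4 - 7 / 8 * ramp (-3 / 4) (-5 / 8) y - 3 / 8 * ramp (-5 / 8) (1 / 4) y -
    ramp (1 / 4) (1 / 2) y + Z y - press (weftPos m X y) y)

section lace

variable {m : ℕ} {X Z : ℝ → ℝ}

theorem continuous_weftLift (h : IsLace m X Z) : Continuous (weftLift m X Z) := by
  have := h.continuous_fst
  have := h.continuous_snd
  unfold weftLift weftPos press; fun_prop

theorem image_unfold_arm_lower (h : IsLace m X Z) :
    unfold '' strand (fingerLace m X Z) (Set.Icc (-1) 0) =
      strand (armLift m) (Set.Icc (-1) 0) := by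
  refine image_strand_eq (φ := fun y => y) (by norm_num) continuous_id rfl rfl (fun y hy => hy)
    fun y hy => ?_
  have hm : (0 : ℝ) ≤ 2 * m := by positivity
  rw [fingerLace_of_nonpos h hy.2, unfold_of_slide, armLift, armPos_of_le (by linarith [hy.2]),
    clamp_of_le hy.2]
  · simp
  · rcases le_total y (-7 / 8) with h1 | h1
    · exact slide_of_le (by linarith [(fingerLow_mem (13 * ramp (-15 / 16) (-7 / 8) y)).1]) h1
    · rw [ramp_of_ge (by norm_num) h1, fingerLow_of_ge (by norm_num),
        fingerHigh_of_ge (by norm_num), slide_same]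

theorem image_unfold_arm_upper (h : IsLace m X Z) :
    unfold '' strand (fingerLace m X Z) (Set.Icc 0 (5 / 32)) =
      strand (armLift m) (Set.Icc 0 (5 / 2)) := by
  refine image_strand_eq (φ := fun y => 16 * y) (by norm_num) (by fun_prop) (by norm_num)
    (by norm_num) (fun y hy => ⟨by linarith [hy.1], by linarith [hy.2]⟩) fun y ⟨hy, hy'⟩ => ?_
  rw [fingerLace_of_mem h hy (by linarith), unfold_finger (by linarith) (by linarith) (by ring),
    fingerHigh_arm (by linarith) (by linarith), fingerPos, armLift, clamp_of_mem (by linarith) (by linarith),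
    ramp_of_le (a := -9 / 4) (by norm_num) (by linarith),
    ramp_of_le (a := -11 / 8) (by norm_num) (by linarith),
    ramp_of_ge (a := -15 / 16) (by norm_num) (by linarith)]
  simp only [mul_zero, add_zero]
  rw [show (13 - (13 - 48 * y)) / 3 = 16 * y by ring]
  ring_nf

theorem image_unfold_left (h : IsLace m X Z) :
    unfold '' strand (fingerLace m X Z) (Set.Icc (5 / 32) (43 / 192)) =
      upright (-2) 0 (-3 / 4) (5 / 2) := by
  have key : ∀ y ∈ Set.Icc (5 / 32 : ℝ) (43 / 192), unfold ((fingerLace m X Z y).1, y,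
      (fingerLace m X Z y).2) = (-2, 10 - 48 * y, 0) := by
    rintro y ⟨hy, hy'⟩
    rw [fingerLace_of_mem h (by linarith) (by linarith),
      unfold_finger (by linarith) (by linarith) (by ring),
      fingerHigh_middle (by linarith) (by linarith), fingerPos, armPos_of_ge (by linarith),
      ramp_of_le (a := -9 / 4) (by norm_num) (by linarith),
      ramp_of_le (a := -11 / 8) (by norm_num) (by linarith), mul_zero, add_zero, add_zero,
      press, clamp_of_ge zero_le_one (by norm_num), clamp_of_mem (by linarith) (by linarith),
      clamp_of_le (by norm_num)]
    ring_nf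
  rw [strand, Set.image_image, Set.image_congr key]
  ext ⟨x, y, z⟩
  constructor
  · rintro ⟨y', hy', he⟩
    simp only [Prod.mk.injEq] at he
    obtain ⟨rfl, rfl, rfl⟩ := he
    exact ⟨rfl, ⟨by linarith [hy'.2], by linarith [hy'.1]⟩, rfl⟩
  · rintro ⟨h1, h2, h3⟩
    simp only at h1 h2 h3
    subst h1 h3
    refine ⟨(10 - y) / 48, ⟨by linarith [h2.2], by linarith [h2.1]⟩, ?_⟩
    simp only [Prod.mk.injEq, true_and, and_true]
    ring

theorem image_unfold_weft_head (h : IsLace m X Z) :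
    unfold '' strand (fingerLace m X Z) (Set.Icc (43 / 192) (31 / 128)) =
      strand (weftLift m X Z) (Set.Icc (-3 / 4) (-5 / 8)) := by
  refine image_strand_eq (φ := fun y => (48 * y - 16) / 7) (by norm_num) (by fun_prop) (by norm_num)
    (by norm_num) (fun y hy => ⟨by linarith [hy.1], by linarith [hy.2]⟩) fun y ⟨hy, hy'⟩ => ?_
  have e : weftPos m X ((48 * y - 16) / 7) = fingerPos m (13 - 48 * y) := by
    rw [weftPos, fingerPos, h.fst_of_le _ (by linarith), min_eq_right (by linarith),
      armPos_of_ge (by linarith),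
      ramp_of_mem (a := -9 / 4) (by norm_num) (by linarith) (by linarith),
      ramp_of_le (a := -11 / 8) (by norm_num) (by linarith),
      ramp_of_mem (a := -3 / 4) (by norm_num) (by linarith) (by linarith),
      ramp_of_le (a := -5 / 8) (by norm_num) (by linarith)]
    ring
  rw [fingerLace_of_mem h (by linarith) (by linarith),
    unfold_finger (by linarith) (by linarith) (by ring),
    fingerHigh_head (by linarith) (by linarith), weftLift, e, h.snd_of_le _ (by linarith),
    ramp_of_mem (a := -3 / 4) (by norm_num) (by linarith) (by linarith),
    ramp_of_le (a := -5 / 8) (by norm_num) (by linarith),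
    ramp_of_le (a := 1 / 4) (by norm_num) (by linarith)]
  rw [show -(13 - 48 * y + 3) / 7 = (48 * y - 16) / 7 by ring]
  ring_nf

theorem image_unfold_weft_middle (h : IsLace m X Z) :
    unfold '' strand (fingerLace m X Z) (Set.Icc (31 / 128) (1 / 4)) =
      strand (weftLift m X Z) (Set.Icc (-5 / 8) (1 / 4)) := by
  refine image_strand_eq (φ := fun y => -5 / 8 + 7 / 3 * (11 / 8 - (13 - 48 * y))) (by norm_num)
    (by fun_prop) (by norm_num) (by norm_num)
    (fun y hy => ⟨by linarith [hy.1], by linarith [hy.2]⟩) fun y ⟨hy, hy'⟩ => ?_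
  have e : weftPos m X (-5 / 8 + 7 / 3 * (11 / 8 - (13 - 48 * y))) = fingerPos m (13 - 48 * y) := by
    rw [weftPos, fingerPos, h.fst_of_le _ (by linarith), min_eq_right (by linarith),
      armPos_of_ge (by linarith),
      ramp_of_ge (a := -9 / 4) (by norm_num) (by linarith),
      ramp_of_mem (a := -11 / 8) (by norm_num) (by linarith) (by linarith),
      ramp_of_ge (a := -3 / 4) (by norm_num) (by linarith),
      ramp_of_mem (a := -5 / 8) (by norm_num) (by linarith) (by linarith)]
    ring
  rw [fingerLace_of_mem h (by linarith) (by linarith),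
    unfold_finger (by linarith) (by linarith) (by ring),
    fingerHigh_weft (by linarith) (by linarith), weftLift, e, h.snd_of_le _ (by linarith),
    ramp_of_ge (a := -3 / 4) (by norm_num) (by linarith),
    ramp_of_mem (a := -5 / 8) (by norm_num) (by linarith) (by linarith),
    ramp_of_le (a := 1 / 4) (by norm_num) (by linarith)]
  ring_nf

theorem weftPos_of_ge {y : ℝ} (hy : 1 / 4 ≤ y) : weftPos m X y = min (X y) (2 * m - 1 / 2) := by
  rw [weftPos, ramp_of_ge (a := -3 / 4) (by norm_num) (by linarith),
    ramp_of_ge (a := -5 / 8) (by norm_num) hy]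
  ring

theorem image_unfold_weft_upper (h : IsLace m X Z) :
    unfold '' strand (fingerLace m X Z) (Set.Icc (1 / 4) 3) =
      strand (weftLift m X Z) (Set.Icc (1 / 4) 3) := by
  refine image_strand_eq (φ := fun y => y) (by norm_num) continuous_id rfl rfl (fun y hy => hy)
    fun y ⟨hy, hy'⟩ => ?_
  have hz : 1 - ramp (1 / 4) (1 / 2) y + Z y ≤ 1 := by
    rcases le_total y (1 / 2) with h1 | h1
    · rw [h.snd_of_le y h1]; linarith [ramp_nonneg (1 / 4) (1 / 2) y]
    · rw [ramp_of_ge (by norm_num) h1]; linarith [h.snd_le y]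
  rw [fingerLace_of_ge hy, unfold_of_le hz, weftLift, weftPos_of_ge hy,
    ramp_of_ge (a := -3 / 4) (by norm_num) (by linarith),
    ramp_of_ge (a := -5 / 8) (by norm_num) hy]
  ring_nf

/-- The lace is cut at the heights where the finger turns. On 0 ≤ y ≤ 1/4 one has z = 13 - 48y, so
the cuts 5/32, 43/192 and 31/128 correspond to the levels 11/2, 9/4 and 11/8. -/
theorem image_unfold (h : IsLace m X Z) :
    unfold '' (warpFrame m ∪ strand (fingerLace m X Z) (Set.Icc (-1) 3)) =
      form m (armLift m) (weftLift m X Z) := by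
  have h1 : unfold '' warpFrame m = warpFrame m := by
    refine image_eq_self ?_
    rintro ⟨x, y, z⟩ hp
    obtain ⟨hx, hz⟩ := warpFrame_bounds hp
    simp only at hx hz
    rw [hz, unfold_of_le zero_le_one, press_of_nonneg hx, sub_zero]
  rw [← strand_union (b := 0) (by norm_num) (by norm_num),
    ← strand_union (b := 5 / 32) (c := 3) (by norm_num) (by norm_num),
    ← strand_union (b := 43 / 192) (c := 3) (by norm_num) (by norm_num),
    ← strand_union (b := 31 / 128) (c := 3) (by norm_num) (by norm_num),
    ← strand_union (b := 1 / 4) (c := 3) (by norm_num) (by norm_num)]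
  simp only [Set.image_union]
  rw [h1, image_unfold_arm_lower h, image_unfold_arm_upper h, image_unfold_left h,
    image_unfold_weft_head h, image_unfold_weft_middle h, image_unfold_weft_upper h,
    strand_union (by norm_num) (by norm_num), strand_union (by norm_num) (by norm_num), form,
    frame_eq, ← strand_union (a := -1) (b := 0) (c := 5 / 2) (by norm_num) (by norm_num)]
  ac_rfl

theorem weftPos_le (y : ℝ) : weftPos m X y ≤ 2 * m - 1 / 2 := by
  have hm : (0 : ℝ) ≤ m := Nat.cast_nonneg m
  have h1 := ramp_le_one (-3 / 4) (-5 / 8) y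
  have h2 := ramp_le_one (-5 / 8) (1 / 4) y
  have h3 := min_le_right (X y) (2 * m - 1 / 2)
  rw [weftPos]
  nlinarith

theorem weftLift_of_ge (hm : 1 ≤ m) (h : IsLace m X Z) {y : ℝ} (hy : 1 / 4 ≤ y) : weftLift m X Z y =
    (min (X y) (2 * m - 1 / 2), 1 - ramp (1 / 4) (1 / 2) y + Z y) := by
  have hm' : (1 : ℝ) ≤ m := by exact_mod_cast hm
  rw [weftLift, weftPos_of_ge hy, press_of_nonneg (le_min (h.fst_nonneg y) (by linarith)),
    ramp_of_ge (a := -3 / 4) (by norm_num) (by linarith),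
    ramp_of_ge (a := -5 / 8) (by norm_num) hy]
  ring_nf

theorem weftLift_of_one_le (hm : 1 ≤ m) (h : IsLace m X Z) {y : ℝ} (hy : 1 ≤ y) :
    weftLift m X Z y = (0, 0) := by
  have hm' : (1 : ℝ) ≤ m := by exact_mod_cast hm
  rw [weftLift_of_ge hm h (by linarith), h.fst_of_ge y hy, h.snd_of_ge y hy,
    ramp_of_ge (by norm_num) (by linarith), min_eq_left (by linarith)]
  norm_num

/-- Unfolded, the arm crosses every straight strand at the positive level 13 - 3y, and the standard
arm with all crossings in front crosses it at level 1. Interpolation between positive levels meets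
no strand. -/
theorem isotopic_armLift (hm : 1 ≤ m) (h : IsLace m X Z) :
    AmbientIsotopic (form m (armLift m) (weftLift m X Z))
      (form m (arm m (fun _ => false) (highArm m)) (weftLift m X Z)) := by
  let c : ℝ → ℝ → ℝ × ℝ := fun t y => (armPos m y, (armLift m y).2 +
    t * (-amp m (fun _ => false) (armPos m y) - (armLift m y).2))
  have h0 : c 0 = armLift m := by
    funext y; simp only [c, zero_mul, add_zero]; rfl
  have h1 : c 1 = arm m (fun _ => false) (highArm m) := by
    funext y; simp only [c, one_mul, add_sub_cancel]; rfl
  rw [← h0, ← h1]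
  have hpos : ∀ t ∈ Set.Icc (0 : ℝ) 1, ∀ y ∈ Set.Icc (-15 / 16 : ℝ) (9 / 4), ∀ k : ℕ, k < 2 * m →
      c t y ≠ ((k : ℝ), 0) := by
    intro t ht y hy k hk he
    simp only [c, Prod.mk.injEq] at he
    have hy1 : 3 / 2 < y := by
      by_contra! hy1
      rw [armPos_of_le hy1] at he
      have := cast_le_sub_one hk
      push_cast at this
      linarith [he.1]
    have e1 : (armLift m y).2 = 13 - 3 * y := by
      rw [armLift, he.1, press_of_nonneg (Nat.cast_nonneg k), ramp_of_ge (by norm_num) (by linarith),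
        clamp_of_mem (by linarith) (by linarith [hy.2])]
      ring
    have e2 := he.2
    rw [e1, he.1, amp_nat hk] at e2
    simp only [level, Bool.false_eq_true, if_false] at e2
    nlinarith [ht.1, ht.2, hy.2]
  refine isotopic_form_arm (continuous_weftLift h) (a := -15 / 16) (b := 9 / 4) (by norm_num)
    (by norm_num) (by fun_prop) (fun t _ y hy => ?_) (fun t _ y hy => ?_)
    (fun t ht y hy k _ hk => hpos t ht y hy k hk) (fun t ht y hy _ => ?_)
  · have e : (armLift m y).2 = 0 ∧ amp m (fun _ => false) (armPos m y) = 0 := by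
      rcases lt_or_ge y (-15 / 16) with hlt | hge
      · rw [armLift, armPos_of_le (by linarith), amp_of_ge le_rfl, press_of_nonneg (by positivity),
          ramp_of_le (by norm_num) hlt.le, clamp_of_le (by linarith)]
        simp
      · have hgt : 9 / 4 < y := not_le.1 fun h => hy ⟨hge, h⟩
        rcases le_total y (5 / 2) with h2 | h2
        · rw [armLift, armPos_tail hgt.le h2, amp_of_le (by linarith), press,
            clamp_of_ge zero_le_one (by linarith), clamp_of_mem (a := 0) (b := 5 / 2) (by linarith) h2,
            clamp_of_mem (a := -3 / 4) (by linarith) h2,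
            clamp_of_mem (b := 2) (by linarith) (by linarith),
            ramp_of_ge (a := 0) (by norm_num) (by linarith),
            ramp_of_ge (by norm_num) (by linarith)]
          exact ⟨by ring, rfl⟩
        · rw [armLift, armPos_of_ge h2, amp_of_le (by norm_num), press,
            clamp_of_ge zero_le_one (by norm_num), clamp_of_ge (a := 0) (b := 5 / 2) (by norm_num) h2,
            clamp_of_ge (a := -3 / 4) (by norm_num) h2, clamp_of_le (b := 2) (by norm_num),
            ramp_of_ge (a := -15 / 16) (by norm_num) (by linarith)]
          exact ⟨by ring, rfl⟩
    simp only [c, e.1, e.2]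
    norm_num
  · simp only [c, armPos]
    rw [armTail_of_le hy.2]
    linarith [(highArm_mem m y).1]
  -- Up to 3/2 the arm stands at 2m, to the right of the weft. Later the weft is at rest at the
  -- origin and is avoided as the strand k = 0.
  · rcases le_total y (3 / 2) with h2 | h2
    · intro he
      have e := congrArg Prod.fst he
      simp only [c, weftLift] at e
      rw [armPos_of_le h2] at e
      linarith [weftPos_le (m := m) (X := X) y]
    · rw [weftLift_of_one_le hm h (by linarith)]
      simpa using hpos t ht y hy 0 (by omega)

/-- The weft that results from unfolding. -/
def laceWeft (m : ℕ) (X Z : ℝ → ℝ) (y : ℝ) : ℝ × ℝ :=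
  ((weftStart y).1 + (2 * m - 1 / 2) * ramp 0 (1 / 4) y +
      (min (X y) (2 * m - 1 / 2) - (2 * m - 1 / 2)),
    ramp 0 (1 / 4) y - ramp (1 / 4) (1 / 2) y + Z y)

theorem laceWeft_of_nonpos (h : IsLace m X Z) {y : ℝ} (hy : y ≤ 0) :
    laceWeft m X Z y = weftStart y := by
  rw [laceWeft, h.fst_of_le y (by linarith), h.snd_of_le y (by linarith),
    ramp_of_le (by norm_num) hy, ramp_of_le (by norm_num) (by linarith), min_eq_right (by linarith)]
  simp [weftStart]

theorem laceWeft_of_mem (h : IsLace m X Z) {y : ℝ} (hy : 0 ≤ y) (hy' : y ≤ 1 / 4) :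
    laceWeft m X Z y = ((2 * m - 1 / 2) * (4 * y), 4 * y) := by
  rw [laceWeft, h.fst_of_le y (by linarith), h.snd_of_le y (by linarith),
    ramp_of_mem (by norm_num) hy hy', ramp_of_le (by norm_num) (by linarith),
    min_eq_right (by linarith), weftStart_of_ge (by linarith)]
  ring_nf

theorem laceWeft_of_ge {y : ℝ} (hy : 1 / 4 ≤ y) : laceWeft m X Z y =
    (min (X y) (2 * m - 1 / 2), 1 - ramp (1 / 4) (1 / 2) y + Z y) := by
  rw [laceWeft, weftStart_of_ge (by linarith), ramp_of_ge (a := 0) (by norm_num) hy]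
  ring_nf

theorem continuous_laceWeft (h : IsLace m X Z) : Continuous (laceWeft m X Z) := by
  have := h.continuous_fst
  have := h.continuous_snd
  unfold laceWeft weftStart; fun_prop

theorem isFreeWeft_laceWeft (hm : 1 ≤ m) (h : IsLace m X Z) :
    IsFreeWeft (warpPts m) 1 (laceWeft m X Z) where
  continuous := continuous_laceWeft h
  eq_start y hy := laceWeft_of_nonpos h hy
  eq_zero y hy := by
    rw [laceWeft_of_ge (by linarith), ← weftLift_of_ge hm h (by linarith),
      weftLift_of_one_le hm h hy]
    rfl
  lt_fst y hy := by
    have hm' : (1 : ℝ) ≤ m := by exact_mod_cast hm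
    rcases le_total y (1 / 4) with h4 | h4
    · rw [laceWeft_of_mem h hy.1 h4]
      have : 0 ≤ (2 * m - 1 / 2) * (4 * y) := mul_nonneg (by linarith) (by linarith [hy.1])
      simp only
      linarith
    · rw [laceWeft_of_ge h4]
      exact lt_min (by linarith [h.fst_nonneg y]) (by linarith)
  avoid y hy := by
    rintro ⟨k, hk, hk', he⟩
    have hk1 : (1 : ℝ) ≤ k := by exact_mod_cast hk
    rcases le_total y (1 / 4) with h4 | h4
    · rw [laceWeft_of_mem h hy.1 h4, Prod.mk.injEq] at he
      have : y = 0 := by linarith [he.2]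
      rw [this] at he
      linarith [he.1]
    · rw [laceWeft_of_ge h4, Prod.mk.injEq] at he
      have hk2 : (k : ℝ) ≤ 2 * m - 1 / 2 := he.1 ▸ min_le_right _ _
      have hk3 : k < 2 * m := by
        rcases hk'.lt_or_eq with hlt | heq
        · exact hlt
        · rw [heq] at hk2; push_cast at hk2; linarith
      have hk4 := cast_le_sub_one hk3
      push_cast at hk4
      have hX : X y = k := by
        rcases le_total (X y) (2 * m - 1 / 2) with hle | hle
        · rw [← he.1, min_eq_left hle]
        · rw [min_eq_right hle] at he; linarith [he.1]
      have h6 : 1 / 2 < y := by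
        by_contra! h6
        rw [h.fst_of_le y h6] at hX
        linarith
      rw [ramp_of_ge (by norm_num) h6.le] at he
      exact h.avoid y k hk hk3 hX (by linarith [he.2])

/-- On its way back from x = -1 the unfolded weft never goes behind level 0, and it is strictly in
front once x ≥ 0. Thus it can be pushed around without meeting a straight strand. -/
theorem weftLift_of_mem (hm : 1 ≤ m) (h : IsLace m X Z) {y : ℝ} (hy : -5 / 8 ≤ y) (hy' : y ≤ 1 / 4) :
    -1 ≤ (weftLift m X Z y).1 ∧ 0 ≤ (weftLift m X Z y).2 ∧
      ((weftLift m X Z y).1 < 0 ∨ 0 < (weftLift m X Z y).2) := by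
  have hm' : (1 : ℝ) ≤ m := by exact_mod_cast hm
  obtain ⟨τ, hτ⟩ : ∃ τ, τ = (y + 5 / 8) * (8 / 7) := ⟨_, rfl⟩
  have hτ0 : 0 ≤ τ := by rw [hτ]; linarith
  have hτ1 : τ ≤ 1 := by rw [hτ]; linarith
  have er : ramp (-5 / 8) (1 / 4) y = τ := by
    rw [ramp_of_mem (by norm_num) hy hy', hτ]; ring
  have e1 : (weftLift m X Z y).1 = -1 + (2 * m + 1 / 2) * τ := by
    rw [weftLift, weftPos, h.fst_of_le y (by linarith), min_eq_right (by linarith),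
      ramp_of_ge (a := -3 / 4) (by norm_num) hy, er]
    ring
  have e2 : (weftLift m X Z y).2 = 11 / 8 - 3 / 8 * τ - press (weftLift m X Z y).1 y := by
    rw [weftLift, h.snd_of_le y (by linarith), ramp_of_ge (a := -3 / 4) (by norm_num) hy, er,
      ramp_of_le (a := 1 / 4) (by norm_num) hy']
    ring
  refine ⟨by rw [e1]; nlinarith, ?_⟩
  rcases le_or_gt 0 (weftLift m X Z y).1 with hx | hx
  · rw [press_of_nonneg hx] at e2
    exact ⟨by linarith, Or.inr (by linarith)⟩
  · refine ⟨?_, Or.inl hx⟩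
    -- δ is the distance from x = -1. Since m ≥ 1, it grows at least 5/2 times as fast as the
    -- parameter τ; this is what makes the quadratic inequality for the pressed level true.
    obtain ⟨δ, hδ⟩ : ∃ δ, δ = (2 * m + 1 / 2) * τ := ⟨_, rfl⟩
    have hδ1 : 5 / 2 * τ ≤ δ := by rw [hδ]; nlinarith
    rw [e1, ← hδ] at e2 hx
    have hy0 : y ≤ 0 := by linarith
    rw [e2, press, clamp_of_mem (by linarith) (by linarith), clamp_of_mem (by linarith) (by linarith),
      clamp_of_mem (by linarith) (by linarith), ramp_of_le (by norm_num) hy0]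
    nlinarith

theorem weftLift_of_le (h : IsLace m X Z) {y : ℝ} (hy : y ≤ -5 / 8) :
    weftLift m X Z y = weftStart y := by
  have e1 : weftPos m X y = -2 + ramp (-3 / 4) (-5 / 8) y := by
    rw [weftPos, h.fst_of_le y (by linarith), min_eq_right (by linarith),
      ramp_of_le (a := -5 / 8) (by norm_num) hy]
    ring
  rw [weftLift, e1, h.snd_of_le y (by linarith), ramp_of_le (a := -5 / 8) (by norm_num) hy,
    ramp_of_le (a := 1 / 4) (by norm_num) (by linarith), press,
    ramp_of_le (a := 0) (by norm_num) (by linarith), weftStart]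
  rcases le_total y (-3 / 4) with h1 | h1
  · rw [ramp_of_le (by norm_num) h1, clamp_of_ge zero_le_one (by norm_num), clamp_of_le h1,
      clamp_of_le (by norm_num), clamp_of_le (by linarith)]
    norm_num
  · have e2 : ramp (-3 / 4) (-5 / 8) y = 8 * y + 6 := by
      rw [ramp_of_mem (by norm_num) h1 hy]; ring
    rw [e2, clamp_of_ge zero_le_one (by linarith), clamp_of_mem h1 (by linarith), clamp_of_mem (by linarith) (by linarith),
      clamp_of_mem (by linarith) (by linarith)]
    ring_nf

/-- Both wefts stay at z ≥ 0 and, wherever x is positive, strictly in front. A convex combination of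
two such points is never on a straight strand, so the straight-line homotopy is admissible; the arm
at 2m is out of reach. -/
theorem isotopic_weftLift (hm : 1 ≤ m) (h : IsLace m X Z) (P : ℕ → Bool) :
    AmbientIsotopic (form m (arm m P (highArm m)) (weftLift m X Z))
      (form m (arm m P (highArm m)) (laceWeft m X Z)) := by
  have hm' : (1 : ℝ) ≤ m := by exact_mod_cast hm
  let c : ℝ → ℝ → ℝ × ℝ := fun t y => weftLift m X Z y + t • (laceWeft m X Z y - weftLift m X Z y)
  have h0 : c 0 = weftLift m X Z := by funext y; simp [c]
  have h1 : c 1 = laceWeft m X Z := by funext y; simp [c]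
  have hc := continuous_weftLift h
  have hc' := continuous_laceWeft h
  rw [← h0, ← h1]
  have hl : ∀ y ∈ Set.Icc (-5 / 8 : ℝ) (1 / 4), -1 ≤ (laceWeft m X Z y).1 ∧
      (laceWeft m X Z y).1 ≤ 2 * m - 1 / 2 ∧ 0 ≤ (laceWeft m X Z y).2 ∧
      ((laceWeft m X Z y).1 ≤ 0 ∨ 0 < (laceWeft m X Z y).2) := by
    rintro y ⟨hy, hy'⟩
    rcases le_or_gt y 0 with hy0 | hy0
    · rw [laceWeft_of_nonpos h hy0]
      have := weftStart_fst_le y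
      refine ⟨?_, by linarith, le_rfl, Or.inl this⟩
      have := monotone_clamp 0 (1 / 4) (show 1 / 8 ≤ y + 3 / 4 by linarith)
      rw [clamp_of_mem (by norm_num) (by norm_num)] at this
      simp only [weftStart]
      linarith
    · rw [laceWeft_of_mem h hy0.le hy']
      exact ⟨by simp only; nlinarith, by simp only; nlinarith, by simp only; linarith,
        Or.inr (by simp only; linarith)⟩
  refine isotopic_form_weft (continuous_arm (by fun_prop)) (a := -5 / 8) (b := 1 / 4) (by norm_num)
    (by norm_num) (by fun_prop) (fun t _ y hy => ?_) (fun t ht y hy => ?_) (fun t ht y hy k hk _ => ?_)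
    (fun t ht y hy => ?_)
  · have e : laceWeft m X Z y = weftLift m X Z y := by
      rcases lt_or_ge y (-5 / 8) with hlt | hge
      · rw [laceWeft_of_nonpos h (by linarith), weftLift_of_le h hlt.le]
      · have hgt : 1 / 4 < y := not_le.1 fun h => hy ⟨hge, h⟩
        rw [laceWeft_of_ge hgt.le, weftLift_of_ge hm h hgt.le]
    simp [c, e]
  · have h2 := (hl y hy).1
    have h3 := (weftLift_of_mem hm h hy.1 hy.2).1
    simp only [c, Prod.fst_add, Prod.smul_fst, Prod.fst_sub, smul_eq_mul]
    nlinarith [ht.1, ht.2]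
  · intro he
    have hk1 : (1 : ℝ) ≤ k := by exact_mod_cast hk
    have ex : (weftLift m X Z y).1 + t * ((laceWeft m X Z y).1 - (weftLift m X Z y).1) = k :=
      congrArg Prod.fst he
    have ez : (weftLift m X Z y).2 + t * ((laceWeft m X Z y).2 - (weftLift m X Z y).2) = 0 :=
      congrArg Prod.snd he
    obtain ⟨-, hz0, h0'⟩ := weftLift_of_mem hm h hy.1 hy.2
    obtain ⟨-, -, hz1, h1'⟩ := hl y hy
    obtain ⟨ht0, ht1⟩ := ht
    rcases h0' with h0' | h0' <;> rcases h1' with h1' | h1'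
    · nlinarith
    · have : t = 0 := by nlinarith
      rw [this] at ex; linarith
    · have : t = 1 := by nlinarith
      rw [this] at ex; linarith
    · rcases ht1.eq_or_lt with rfl | ht1
      · linarith
      · nlinarith [mul_pos (sub_pos.2 ht1) h0', mul_nonneg ht0 hz1]
  · intro he
    have e := congrArg Prod.fst he
    have h2 := (hl y hy).2.1
    have h3 : (weftLift m X Z y).1 ≤ 2 * m - 1 / 2 := weftPos_le y
    rw [arm, highArm_of_le (by linarith [hy.2]), armTail_of_le (by linarith [hy.2]), sub_zero,
      armPt_two_mul] at e
    simp only [c, Prod.fst_add, Prod.smul_fst, Prod.fst_sub, smul_eq_mul] at e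
    nlinarith [ht.1, ht.2]

/-- A closed lace has a normal form. -/
theorem IsLace.hasForm (hm : 1 ≤ m) (h : IsLace m X Z) : HasForm m (fun _ => false)
    (warpFrame m ∪ strand (fun y => (X y, Z y)) (Set.Icc (-1) 3)) := by
  refine ⟨laceWeft m X Z, isFreeWeft_laceWeft hm h, ?_⟩
  have h1 := (isotopic_fingerLace hm h).trans (isotopic_unfold _)
  rw [image_unfold h] at h1
  exact (h1.trans (isotopic_armLift hm h)).trans (isotopic_weftLift hm h _)

end lace

/-! ### The polygon of a potholder -/

theorem polyline_reverse (l : List Space) : polyline l.reverse = polyline l := by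
  induction l with
  | nil => rfl
  | cons p l ih =>
    rcases l with _ | ⟨q, l⟩
    · rfl
    · rw [List.reverse_cons] at ih
      rw [List.reverse_cons, List.reverse_cons, List.append_assoc, List.singleton_append,
        polyline_append_cons, ih, polyline, polyline, polyline, segment_symm, Set.union_comm]
      congr 1
      exact Set.union_eq_self_of_subset_right
        (Set.singleton_subset_iff.2 (left_mem_segment ℝ p q))

theorem polyline_map_range (x : ℝ) (f : ℝ → ℝ) (n : ℕ)
    (hf : ∀ k < n, ∀ t ∈ Set.Icc (0 : ℝ) 1,
      f ((1 - t) * k + t * (k + 1 : ℕ)) = (1 - t) * f k + t * f (k + 1 : ℕ)) :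
    polyline ((List.range (n + 1)).map fun k : ℕ => (x, (k : ℝ), f k)) = column x f 0 n := by
  induction n with
  | zero =>
    simp only [zero_add, List.range_one, List.map_cons, List.map_nil, polyline, Nat.cast_zero]
    ext ⟨x', y', z'⟩
    simp only [column, Set.mem_singleton_iff, Prod.mk.injEq, Set.Icc_self, Set.mem_ofPred_eq]
    constructor
    · rintro ⟨rfl, rfl, rfl⟩; exact ⟨rfl, rfl, rfl⟩
    · rintro ⟨rfl, rfl, rfl⟩; exact ⟨rfl, rfl, rfl⟩
  | succ n ih =>
    have ih := ih fun k hk => hf k (by omega)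
    rw [List.range_succ, List.map_append] at ih
    rw [List.range_succ, List.range_succ, List.map_append, List.map_append, List.append_assoc,
      List.map_singleton, List.singleton_append, polyline_append_cons]
    rw [List.map_singleton] at ih
    rw [ih, List.map_singleton, polyline, polyline, Set.union_eq_self_of_subset_right
      (Set.singleton_subset_iff.2 (right_mem_segment ℝ _ _)),
      segment_eq_column (by exact_mod_cast n.le_succ) (hf n (by omega)),
      column_union _ _ (Nat.cast_nonneg n) (by exact_mod_cast n.le_succ)]

section weave

variable (V : ℕ → ℕ → Bool) (w h : ℕ)

/-- The level of the `i`-th vertical segment of a potholder at the height `y`. -/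
def colLevel (i : ℕ) (y : ℝ) : ℝ := ∑ j ∈ Finset.range h, level (V i j) * tent (y - 1 - j)

/-- The interpolation of the levels of the vertical segments of a potholder. -/
def weave (x y : ℝ) : ℝ := ∑ i ∈ Finset.range w, tent (x - 1 - i) * colLevel V h i y

@[fun_prop] theorem continuous_colLevel (i : ℕ) : Continuous (colLevel V h i) := by
  unfold colLevel; fun_prop

theorem continuous_weave : Continuous fun q : ℝ × ℝ => weave V w h q.1 q.2 := by
  unfold weave; fun_prop

theorem abs_colLevel_le (i : ℕ) (y : ℝ) : |colLevel V h i y| ≤ 1 := by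
  refine (Finset.abs_sum_le_sum_abs _ _).trans (le_trans (le_of_eq ?_) (sum_tent_le_one h (y - 1)))
  refine Finset.sum_congr rfl fun k _ => ?_
  rw [abs_mul, abs_level, one_mul, abs_of_nonneg (tent_nonneg _)]

theorem abs_weave_le (x y : ℝ) : |weave V w h x y| ≤ 1 := by
  refine (Finset.abs_sum_le_sum_abs _ _).trans (le_trans ?_ (sum_tent_le_one w (x - 1)))
  refine Finset.sum_le_sum fun k _ => ?_
  rw [abs_mul, abs_of_nonneg (tent_nonneg _)]
  exact mul_le_of_le_one_right (tent_nonneg _) (abs_colLevel_le V h k y)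

variable {V w h}

theorem colLevel_of_le {i : ℕ} {y : ℝ} (hy : y ≤ 0) : colLevel V h i y = 0 := by
  refine Finset.sum_eq_zero fun j _ => ?_
  have : (0 : ℝ) ≤ j := Nat.cast_nonneg j
  rw [tent_of_one_le (by rw [abs_of_nonpos] <;> linarith), mul_zero]

theorem colLevel_of_ge {i : ℕ} {y : ℝ} (hy : h + 1 ≤ y) : colLevel V h i y = 0 := by
  refine Finset.sum_eq_zero fun j hj => ?_
  have := cast_le_sub_one (Finset.mem_range.1 hj)
  rw [tent_of_one_le (by rw [abs_of_nonneg] <;> linarith), mul_zero]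

theorem colLevel_succ {i j : ℕ} (hj : j < h) : colLevel V h i (j + 1) = level (V i j) := by
  unfold colLevel
  rw [add_sub_cancel_right, Finset.sum_eq_single j]
  · simp [tent_zero]
  · intro l _ h; rw [tent_sub_nat h, mul_zero]
  · intro h; exact absurd (Finset.mem_range.2 hj) h

theorem weave_succ {i : ℕ} (hi : i < w) (y : ℝ) : weave V w h (i + 1) y = colLevel V h i y := by
  unfold weave
  rw [add_sub_cancel_right, Finset.sum_eq_single i]
  · simp [tent_zero]
  · intro l _ h; rw [tent_sub_nat h, zero_mul]
  · intro h; exact absurd (Finset.mem_range.2 hi) h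

theorem weave_left {x : ℝ} (hx : x ≤ 0) (y : ℝ) : weave V w h x y = 0 := by
  refine Finset.sum_eq_zero fun j _ => ?_
  have : (0 : ℝ) ≤ j := Nat.cast_nonneg j
  rw [tent_of_one_le (by rw [abs_of_nonpos] <;> linarith), zero_mul]

theorem weave_right {x : ℝ} (hx : w + 1 ≤ x) (y : ℝ) : weave V w h x y = 0 := by
  refine Finset.sum_eq_zero fun j hj => ?_
  have := cast_le_sub_one (Finset.mem_range.1 hj)
  rw [tent_of_one_le (by rw [abs_of_nonneg] <;> linarith), zero_mul]

theorem weave_lower {y : ℝ} (hy : y ≤ 0) (x : ℝ) : weave V w h x y = 0 :=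
  Finset.sum_eq_zero fun j _ => by rw [colLevel_of_le hy, mul_zero]

theorem weave_upper {y : ℝ} (hy : h + 1 ≤ y) (x : ℝ) : weave V w h x y = 0 :=
  Finset.sum_eq_zero fun j _ => by rw [colLevel_of_ge hy, mul_zero]

theorem colLevel_affine (i k : ℕ) {t : ℝ} (ht : t ∈ Set.Icc (0 : ℝ) 1) :
    colLevel V h i ((1 - t) * k + t * (k + 1 : ℕ)) =
      (1 - t) * colLevel V h i k + t * colLevel V h i (k + 1 : ℕ) := by
  unfold colLevel
  rw [Finset.mul_sum, Finset.mul_sum, ← Finset.sum_add_distrib]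
  refine Finset.sum_congr rfl fun j _ => ?_
  have := tent_affine (j + 1) k ht
  push_cast at this ⊢
  rw [show (1 - t) * (k : ℝ) + t * (k + 1) - 1 - j = (1 - t) * k + t * (k + 1) - (j + 1) by ring,
    this, show (k : ℝ) - 1 - j = k - (j + 1) by ring,
    show (k : ℝ) + 1 - 1 - j = k + 1 - (j + 1) by ring]
  ring

variable (V h)

/-- The points of the `i`-th vertical segment of a potholder, listed upwards. -/
def columnPts (i : ℕ) : List Space :=
  (List.range (h + 2)).map fun k : ℕ => ((i + 1 : ℝ), (k : ℝ), colLevel V h i k)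

theorem polyline_columnPts (i : ℕ) :
    polyline (columnPts V h i) = column (i + 1) (colLevel V h i) 0 (h + 1) := by
  rw [columnPts, polyline_map_range _ _ _ fun k _ t ht => colLevel_affine i k ht]
  push_cast; rfl

theorem columnPts_eq (i : ℕ) : columnPts V h i = [((i + 1 : ℝ), (0 : ℝ), (0 : ℝ))] ++
    ((List.range h).map fun j : ℕ => ((i + 1 : ℝ), (j + 1 : ℝ), level (V i j))) ++
      [((i + 1 : ℝ), (h + 1 : ℝ), (0 : ℝ))] := by
  rw [columnPts, List.range_succ_eq_map, List.range_succ]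
  simp only [List.map_append, List.map_cons, List.map_nil, List.map_map, Nat.cast_zero,
    Nat.succ_eq_add_one, Nat.cast_add, Nat.cast_one]
  rw [colLevel_of_le le_rfl, colLevel_of_ge le_rfl]
  simp only [List.cons_append, List.nil_append, List.cons.injEq, true_and]
  congr 1
  refine List.map_congr_left fun j hj => ?_
  simp only [Function.comp_apply, Nat.cast_succ]
  rw [colLevel_succ (List.mem_range.1 hj)]

/-- The height of the start of the `i`-th vertical segment of a potholder. -/
def bend (i : ℕ) : ℝ := if Even i then 0 else h + 1

/-- The points of the `i`-th vertical segment of a potholder. -/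
def zigzagColumn (i : ℕ) : List Space :=
  if Even i then columnPts V h i else (columnPts V h i).reverse

theorem polyline_zigzagColumn (i : ℕ) :
    polyline (zigzagColumn V h i) = column (i + 1) (colLevel V h i) 0 (h + 1) := by
  unfold zigzagColumn
  split_ifs
  · exact polyline_columnPts V h i
  · rw [polyline_reverse, polyline_columnPts]

theorem zigzagColumn_eq_cons (i : ℕ) :
    ∃ l, zigzagColumn V h i = ((i + 1 : ℝ), bend h i, (0 : ℝ)) :: l := by
  unfold zigzagColumn bend
  split_ifs
  · exact ⟨_, by rw [columnPts_eq]; rfl⟩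
  · exact ⟨_, by rw [columnPts_eq, List.reverse_append]; rfl⟩

theorem zigzagColumn_eq_append (i : ℕ) :
    ∃ l, zigzagColumn V h i = l ++ [((i + 1 : ℝ), bend h (i + 1), (0 : ℝ))] := by
  unfold zigzagColumn bend
  by_cases hi : Even i
  · rw [if_pos hi, if_neg (by simpa [Nat.even_add_one] using hi)]
    exact ⟨_, by rw [columnPts_eq]⟩
  · rw [if_neg hi, if_pos (by simpa [Nat.even_add_one] using hi)]
    exact ⟨_, by rw [columnPts_eq, List.append_assoc, List.reverse_append]; rfl⟩

/-- As a set, the zigzag does not remember its direction: it is the union of the vertical segments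
and of the connections between neighbors, which lie at the bottom or at the top according to parity.
-/
theorem mem_polyline_zigzagColumn (n : ℕ) (p : Space) :
    p ∈ polyline ([((0 : ℝ), (0 : ℝ), (0 : ℝ))] ++ (List.range n).flatMap (zigzagColumn V h) ++
        [((n + 1 : ℝ), bend h n, (0 : ℝ))]) ↔
      (∃ i < n, p ∈ column (i + 1) (colLevel V h i) 0 (h + 1)) ∨
        ∃ i ≤ n, p ∈ flat (bend h i) i (i + 1) := by
  induction n with
  | zero =>
    simp only [List.range_zero, List.flatMap_nil, List.append_nil, List.cons_append, List.nil_append,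
      polyline, Nat.cast_zero, zero_add]
    rw [show bend h 0 = 0 from if_pos (by simp), Set.union_eq_self_of_subset_right
      (Set.singleton_subset_iff.2 (right_mem_segment ℝ _ _)), segment_eq_flat zero_le_one]
    constructor
    · intro hp
      refine Or.inr ⟨0, le_rfl, ?_⟩
      rw [show bend h 0 = 0 from if_pos (by simp)]
      simpa [flat] using hp
    · rintro (⟨i, hi, -⟩ | ⟨i, hi, hp⟩)
      · omega
      · obtain rfl : i = 0 := by omega
        rw [show bend h 0 = 0 from if_pos (by simp)] at hp
        simpa [flat] using hp
  | succ n ih =>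
    obtain ⟨l, hl⟩ := zigzagColumn_eq_cons V h n
    obtain ⟨l', hl'⟩ := zigzagColumn_eq_append V h n
    have e : ∀ q : Space, [((0 : ℝ), (0 : ℝ), (0 : ℝ))] ++
        (List.range (n + 1)).flatMap (zigzagColumn V h) ++ [q] =
          ([((0 : ℝ), (0 : ℝ), (0 : ℝ))] ++ (List.range n).flatMap (zigzagColumn V h)) ++
            ((n + 1 : ℝ), bend h n, (0 : ℝ)) :: (l ++ [q]) := by
      intro q
      rw [List.range_succ, List.flatMap_append, List.flatMap_singleton, hl]
      simp
    rw [e, polyline_append_cons, Set.mem_union, ih, ← List.cons_append, ← hl, hl', List.append_assoc, List.singleton_append,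
      polyline_append_cons, ← hl', polyline_zigzagColumn, Set.mem_union, polyline, polyline,
      Set.union_eq_self_of_subset_right (Set.singleton_subset_iff.2 (right_mem_segment ℝ _ _)),
      segment_eq_flat (by push_cast; linarith)]
    push_cast
    constructor
    · rintro ((⟨i, hi, hp⟩ | ⟨i, hi, hp⟩) | (hp | hp))
      · exact Or.inl ⟨i, by omega, hp⟩
      · exact Or.inr ⟨i, by omega, hp⟩
      · exact Or.inl ⟨n, by omega, hp⟩
      · exact Or.inr ⟨n + 1, le_rfl, by push_cast; exact hp⟩
    · rintro (⟨i, hi, hp⟩ | ⟨i, hi, hp⟩)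
      · rcases Nat.lt_succ_iff_lt_or_eq.1 hi with hi | rfl
        · exact Or.inl (Or.inl ⟨i, hi, hp⟩)
        · exact Or.inr (Or.inl hp)
      · rcases hi.lt_or_eq with hi | rfl
        · exact Or.inl (Or.inr ⟨i, by omega, hp⟩)
        · push_cast at hp; exact Or.inr (Or.inr hp)

end weave

namespace PotholderDiagram

variable {w h : ℕ} (D : PotholderDiagram w h)

/-- The crossings of a potholder, indexed by natural numbers. -/
def crossings (i j : ℕ) : Bool :=
  if hij : i < w ∧ j < h then D.verticalOver ⟨i, hij.1⟩ ⟨j, hij.2⟩ else false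

theorem crossings_val (i : Fin w) (j : Fin h) : D.crossings i j = D.verticalOver i j := by
  rw [crossings, dif_pos ⟨i.2, j.2⟩]

theorem column_eq (i : Fin w) : D.column i = zigzagColumn D.crossings h i := by
  have e : D.columnUp i = columnPts D.crossings h i := by
    rw [columnUp, columnPts_eq, ← List.map_coe_finRange_eq_range (n := h), List.map_map]
    congr 2
    refine List.map_congr_left fun j _ => ?_
    simp only [Function.comp_apply]
    rw [crossings_val]
  rw [column, zigzagColumn, e]

theorem mem_polyline_columnPath (p : Space) : p ∈ polyline D.columnPath ↔
    (∃ i < w, p ∈ Knotholder.column (i + 1) (colLevel D.crossings h i) 0 (h + 1)) ∨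
      ∃ i ≤ w, p ∈ flat (bend h i) i (i + 1) := by
  have e : (List.finRange w).flatMap D.column = (List.range w).flatMap (zigzagColumn D.crossings h) := by
    rw [← List.map_coe_finRange_eq_range (n := w), List.flatMap_map]
    congr 1
    funext i
    exact D.column_eq i
  rw [columnPath, e, ← mem_polyline_zigzagColumn,
    show bend h w = h + 1 from if_neg (Nat.not_even_iff_odd.2 D.odd_width)]

end PotholderDiagram

/-! ### The horizontal zigzag of a potholder -/

/-- Each summand changes only during half a unit of height. Near the height of the row n, the
earlier summands are saturated, the later ones have not begun, and only the summand n may be in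
transition. -/
theorem sum_mul_clamp (c : ℕ → ℝ) (β : ℝ) {n h : ℕ} (hn : n < h) {y : ℝ}
    (h1 : -1 ≤ 2 * (y - n) - β) (h2 : 2 * (y - n) - β ≤ 2) :
    ∑ j ∈ Finset.range h, c j * clamp 0 1 (2 * (y - j) - β) =
      ∑ j ∈ Finset.range n, c j + c n * clamp 0 1 (2 * (y - n) - β) := by
  induction h with
  | zero => omega
  | succ h ih =>
    rw [Finset.sum_range_succ]
    rcases Nat.lt_succ_iff_lt_or_eq.1 hn with hn | rfl
    · have := cast_le_sub_one hn
      rw [ih hn, clamp_of_le (x := 2 * (y - h) - β) (by linarith), mul_zero, add_zero]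
    · congr 1
      refine Finset.sum_congr rfl fun j hj => ?_
      have := cast_le_sub_one (Finset.mem_range.1 hj)
      rw [clamp_of_ge zero_le_one (by linarith), mul_one]

/-- The end at which the `n`-th horizontal segment starts. -/
def parity (n : ℕ) : ℝ := if Even n then 0 else 1

theorem parity_eq (n : ℕ) : parity n = 0 ∨ parity n = 1 := by
  unfold parity; split_ifs <;> simp

theorem parity_succ (n : ℕ) : parity (n + 1) = 1 - parity n := by
  unfold parity
  by_cases hn : Even n
  · rw [if_neg (by simpa [Nat.even_add_one] using hn), if_pos hn]; norm_num
  · rw [if_pos (by simpa [Nat.even_add_one] using hn), if_neg hn]; norm_num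

theorem sum_parity (n : ℕ) : ∑ j ∈ Finset.range n, (1 - 2 * parity j) = parity n := by
  induction n with
  | zero => simp [parity]
  | succ n ih => rw [Finset.sum_range_succ, ih, parity_succ]; ring

/-- The relative horizontal position of the tilted horizontal zigzag. -/
def swing (h : ℕ) (y : ℝ) : ℝ :=
  ∑ j ∈ Finset.range h, (1 - 2 * parity j) * clamp 0 1 (2 * (y - j) - 2)

/-- The number of the horizontal segment at the height `y`. -/
def rank (h : ℕ) (y : ℝ) : ℝ := ∑ j ∈ Finset.range h, 1 * clamp 0 1 (2 * (y - j) - 1)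

section swing

variable {h n : ℕ} {y : ℝ}

@[fun_prop] theorem continuous_swing (h : ℕ) : Continuous (swing h) := by unfold swing; fun_prop

@[fun_prop] theorem continuous_rank (h : ℕ) : Continuous (rank h) := by unfold rank; fun_prop

theorem swing_of_mem (hn : n < h) (h1 : n + 1 ≤ y) (h2 : y ≤ n + 2) :
    swing h y = parity n + (1 - 2 * parity n) * clamp 0 1 (2 * (y - n) - 2) := by
  rw [swing, sum_mul_clamp _ _ hn (by linarith) (by linarith), sum_parity]

theorem rank_of_mem (hn : n < h) (h1 : n + 1 ≤ y) (h2 : y ≤ n + 3 / 2) : rank h y = n + 1 := by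
  rw [rank, sum_mul_clamp (fun _ => 1) 1 hn (by linarith) (by linarith),
    clamp_of_ge zero_le_one (by linarith)]
  simp

theorem swing_of_le (hy : y ≤ 1) : swing h y = 0 := by
  refine Finset.sum_eq_zero fun j _ => ?_
  have : (0 : ℝ) ≤ j := Nat.cast_nonneg j
  rw [clamp_of_le (by linarith), mul_zero]

theorem swing_of_ge (hy : h + 1 / 2 ≤ y) : swing h y = parity h := by
  rw [← sum_parity]
  refine Finset.sum_congr rfl fun j hj => ?_
  have := cast_le_sub_one (Finset.mem_range.1 hj)
  rw [clamp_of_ge zero_le_one (by linarith), mul_one]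

theorem swing_of_upper (hn : n < h) (h1 : n + 3 / 2 ≤ y) (h2 : y ≤ n + 2) :
    swing h y = parity (n + 1) := by
  rw [swing_of_mem hn (by linarith) h2, clamp_of_ge zero_le_one (by linarith), parity_succ]; ring

/-- The swing and the rank change during disjoint intervals of heights. Whenever the zigzag is in
the interior of a row, the rank is therefore an integer, and the crossings met there have honest
levels ±1. -/
theorem swing_cases (h : ℕ) (y : ℝ) : (swing h y = 0 ∨ swing h y = 1) ∨
    (0 ≤ swing h y ∧ swing h y ≤ 1) ∧ ∃ n < h, rank h y = n + 1 := by
  rcases le_total y 1 with h1 | h1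
  · exact Or.inl (Or.inl (swing_of_le h1))
  rcases le_total (h + 1 / 2 : ℝ) y with h2 | h2
  · rw [swing_of_ge h2]; exact Or.inl (parity_eq h)
  obtain ⟨n, hn⟩ : ∃ n, ⌊y⌋₊ = n + 1 :=
    Nat.exists_eq_succ_of_ne_zero (by rw [Ne, Nat.floor_eq_zero]; linarith)
  have h3 : (n + 1 : ℝ) ≤ y := by
    have := Nat.floor_le (by linarith : 0 ≤ y)
    rw [hn] at this
    exact_mod_cast this
  have h4 : y ≤ n + 2 := by
    have := Nat.lt_floor_add_one y
    rw [hn] at this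
    push_cast at this
    linarith
  have hn' : n < h := by
    have : (n : ℝ) < h := by linarith
    exact_mod_cast this
  rcases le_total y (n + 3 / 2) with h5 | h5
  · right
    refine ⟨?_, n, hn', rank_of_mem hn' h3 h5⟩
    have := clamp_mem zero_le_one (2 * (y - n) - 2)
    rw [swing_of_mem hn' h3 h4]
    rcases parity_eq n with e | e <;> rw [e] <;> constructor <;> linarith
  · rw [swing_of_upper hn' h5 h4]
    exact Or.inl (parity_eq _)

end swing

/-- The amounts by which the horizontal segments of a potholder are tilted. -/
def rowSlope (w : ℕ) : ℕ → ℝ → ℝ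
  | 0 => fun _ => 0
  -- The row j is at height j + 1. It climbs by 1/2 from its starting side, which is the left one
  -- for even j and the right one for odd j.
  | j + 1 => fun x => clamp 0 (1 / 2) ((1 - 2 * parity j) * (x / (w + 1) - parity j) / 2)

theorem continuous_rowSlope (w j : ℕ) : Continuous (rowSlope w j) := by
  rcases j with _ | j <;> unfold rowSlope <;> fun_prop

theorem rowSlope_mem (w j : ℕ) (x : ℝ) : 0 ≤ rowSlope w j x ∧ rowSlope w j x ≤ 1 / 2 := by
  rcases j with _ | j
  · simp [rowSlope]
  · exact clamp_mem (by norm_num) _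

theorem rowSlope_succ (w j : ℕ) {t : ℝ} (ht : t ∈ Set.Icc (0 : ℝ) 1) :
    rowSlope w (j + 1) ((w + 1) * (parity j + (1 - 2 * parity j) * t)) = t / 2 := by
  have hw : (w + 1 : ℝ) ≠ 0 := by positivity
  rw [rowSlope]
  simp only
  rw [mul_div_cancel_left₀ _ hw]
  have : (1 - 2 * parity j) * (parity j + (1 - 2 * parity j) * t - parity j) / 2 = t / 2 := by
    rcases parity_eq j with e | e <;> rw [e] <;> ring
  rw [this, clamp_of_mem (by linarith [ht.1]) (by linarith [ht.2])]

section comb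

variable (V : ℕ → ℕ → Bool) (w h : ℕ)

/-- The homeomorphism that straightens the vertical segments of a potholder and tilts the horizontal
ones. -/
def comb (p : Space) : Space :=
  moveY (tiltShift (h + 1) (rowSlope w)) (moveZ (fun p => -weave V w h p.1 p.2.1) p)

theorem isotopic_comb (A : Set Space) : AmbientIsotopic A (comb V w h '' A) := by
  have i1 := isotopic_shearZ (f := fun x y => -weave V w h x y) (continuous_weave V w h).neg (M := 1)
    (fun x y => by rw [abs_neg]; exact abs_weave_le V w h x y) A
  have i2 := isotopic_tilt (n := h + 1) (continuous_rowSlope w)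
    (fun i x => (rowSlope_mem w i x).1) (fun i x => (rowSlope_mem w i x).2)
    (moveZ (fun p => -weave V w h p.1 p.2.1) '' A)
  have := i1.trans i2
  rwa [Set.image_image] at this

theorem comb_apply (x y z : ℝ) : comb V w h (x, y, z) =
    (x, y + tiltShift (h + 1) (rowSlope w) (x, y, z - weave V w h x y), z - weave V w h x y) := rfl

/-- The tilted horizontal zigzag of a potholder. -/
def rowCurve (y : ℝ) : ℝ × ℝ :=
  ((w + 1) * swing h y, -weave V w h ((w + 1) * swing h y) (rank h y))

theorem weave_parity (n : ℕ) (y : ℝ) : weave V w h ((w + 1) * parity n) y = 0 := by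
  rcases parity_eq n with e | e <;> rw [e]
  · exact weave_left (by simp) y
  · exact weave_right (by simp) y

theorem image_comb_upright (n : ℕ) {a b : ℝ} (hab : a ≤ b) :
    comb V w h '' upright ((w + 1) * parity n) 0 a b = upright ((w + 1) * parity n) 0
      (a + tiltShift (h + 1) (rowSlope w) ((w + 1) * parity n, a, 0))
      (b + tiltShift (h + 1) (rowSlope w) ((w + 1) * parity n, b, 0)) := by
  rw [← image_moveY_upright (continuous_tiltShift (continuous_rowSlope w))
    (strictMono_tiltShift (fun i x => (rowSlope_mem w i x).1)
      fun i x => (rowSlope_mem w i x).2) _ 0 hab]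
  refine Set.image_congr ?_
  rintro ⟨x, y, z⟩ ⟨h1, -, -⟩
  simp only at h1
  rw [comb_apply, h1, weave_parity, sub_zero]
  rfl

theorem tiltShift_row_start {n : ℕ} (hn : n ≤ h) (z : ℝ) :
    tiltShift (h + 1) (rowSlope w) ((w + 1) * parity n, (n + 1 : ℝ), z) = 0 := by
  rcases hn.lt_or_eq with hn | rfl
  · have := tiltShift_nat (v := rowSlope w) (i := n + 1) (n := h + 1) (by omega)
      ((w + 1) * parity n) z
    rw [Nat.cast_add, Nat.cast_one] at this
    rw [this]
    have := rowSlope_succ w n (t := 0) ⟨le_rfl, zero_le_one⟩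
    simpa using this
  · exact tiltShift_of_ge (by simp)

/-- The tilt turns the fraction t of the row into the height t/2 above its start. The level of the
row becomes the negative of the interpolated level of the vertical segments, because these have been
sheared flat. -/
theorem image_comb_row {n : ℕ} (hn : n < h) : comb V w h ''
    segment ℝ (((w + 1) * parity n, (n + 1 : ℝ), (0 : ℝ)) : Space)
      ((w + 1) * parity (n + 1), (n + 1 : ℝ), (0 : ℝ)) =
    strand (rowCurve V w h) (Set.Icc (n + 1) (n + 3 / 2)) := by
  refine image_segment_eq_strand (θ := fun t => n + 1 + t / 2) (by fun_prop) (by ring) (by ring)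
    (fun t ht => ⟨by linarith [ht.1], by linarith [ht.2]⟩) fun t ht => ?_
  have e1 : (1 - t) • (((w + 1) * parity n, (n + 1 : ℝ), (0 : ℝ)) : Space) +
      t • ((w + 1) * parity (n + 1), (n + 1 : ℝ), (0 : ℝ)) =
        ((w + 1) * (parity n + (1 - 2 * parity n) * t), (n + 1 : ℝ), (0 : ℝ)) := by
    rw [parity_succ]
    simp only [Prod.smul_mk, smul_eq_mul, Prod.mk_add_mk, Prod.mk.injEq]
    exact ⟨by ring, by ring, by ring⟩
  have e2 : ∀ z, tiltShift (h + 1) (rowSlope w)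
      ((w + 1) * (parity n + (1 - 2 * parity n) * t), (n + 1 : ℝ), z) = t / 2 := by
    intro z
    have := tiltShift_nat (v := rowSlope w) (i := n + 1) (n := h + 1) (by omega)
      ((w + 1) * (parity n + (1 - 2 * parity n) * t)) z
    rw [Nat.cast_add, Nat.cast_one] at this
    rw [this, rowSlope_succ w n ht]
  have e3 : swing h (n + 1 + t / 2) = parity n + (1 - 2 * parity n) * t := by
    rw [swing_of_mem hn (by linarith [ht.1]) (by linarith [ht.2]),
      clamp_of_mem (by linarith [ht.1]) (by linarith [ht.2])]
    ring
  rw [e1, comb_apply, e2, rowCurve, e3, rank_of_mem hn (by linarith [ht.1]) (by linarith [ht.2]),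
    zero_sub]

theorem image_comb_turn {n : ℕ} (hn : n < h) : comb V w h ''
    upright ((w + 1) * parity (n + 1)) 0 (n + 1) (n + 2) =
    strand (rowCurve V w h) (Set.Icc (n + 3 / 2) (n + 2)) := by
  have e1 : tiltShift (h + 1) (rowSlope w) ((w + 1) * parity (n + 1), (n + 1 : ℝ), 0) = 1 / 2 := by
    have := tiltShift_nat (v := rowSlope w) (i := n + 1) (n := h + 1) (by omega)
      ((w + 1) * parity (n + 1)) 0
    rw [Nat.cast_add, Nat.cast_one] at this
    rw [this]
    have := rowSlope_succ w n (t := 1) ⟨zero_le_one, le_rfl⟩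
    rw [show parity n + (1 - 2 * parity n) * 1 = parity (n + 1) by rw [parity_succ]; ring] at this
    exact this
  have e2 : tiltShift (h + 1) (rowSlope w) ((w + 1) * parity (n + 1), (n + 2 : ℝ), 0) = 0 := by
    rw [show (n : ℝ) + 2 = ((n + 1 : ℕ) : ℝ) + 1 by push_cast; ring]
    exact tiltShift_row_start w h hn 0
  rw [image_comb_upright _ _ _ _ (by linarith), e1, e2, add_zero,
    show (n : ℝ) + 1 + 1 / 2 = n + 3 / 2 by ring]
  refine upright_eq_strand fun y hy => ?_
  rw [rowCurve, swing_of_upper hn hy.1 hy.2, weave_parity, neg_zero]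

theorem row_eq (j : ℕ) : PotholderDiagram.row w j =
    [((w + 1) * parity j, (j + 1 : ℝ), (0 : ℝ)), ((w + 1) * parity (j + 1), (j + 1 : ℝ), (0 : ℝ))] := by
  rw [PotholderDiagram.row, parity_succ, parity]
  split_ifs <;> simp

theorem image_comb_rows {n : ℕ} (hn : n ≤ h) : comb V w h '' polyline
    ([((0 : ℝ), (0 : ℝ), (0 : ℝ))] ++ (List.range n).flatMap (PotholderDiagram.row w) ++
      [((w + 1) * parity n, (n + 1 : ℝ), (0 : ℝ))]) =
    strand (rowCurve V w h) (Set.Icc 0 (n + 1)) := by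
  induction n with
  | zero =>
    have e0 : (w + 1 : ℝ) * parity 0 = 0 := by simp [parity]
    have e1 : tiltShift (h + 1) (rowSlope w) ((w + 1) * parity 0, (0 : ℝ), 0) = 0 := by
      have := tiltShift_nat (v := rowSlope w) (i := 0) (n := h + 1) (by omega)
        ((w + 1) * parity 0) 0
      rw [Nat.cast_zero] at this
      rw [this, rowSlope]
    have e2 := tiltShift_row_start w h (n := 0) (Nat.zero_le h) 0
    have e3 := image_comb_upright V w h 0 (a := 0) (b := 1) zero_le_one
    rw [Nat.cast_zero, zero_add] at e2
    rw [e1, e2, e0] at e3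
    simp only [List.range_zero, List.flatMap_nil, List.append_nil, List.cons_append, List.nil_append,
      polyline, Nat.cast_zero, zero_add]
    rw [e0, Set.union_eq_self_of_subset_right
      (Set.singleton_subset_iff.2 (right_mem_segment ℝ _ _)), segment_eq_upright zero_le_one, e3,
      zero_add, add_zero]
    refine upright_eq_strand fun y hy => ?_
    rw [rowCurve, swing_of_le hy.2, mul_zero, weave_left le_rfl, neg_zero]
  | succ n ih =>
    have e : ∀ q : Space, [((0 : ℝ), (0 : ℝ), (0 : ℝ))] ++
        (List.range (n + 1)).flatMap (PotholderDiagram.row w) ++ [q] =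
          ([((0 : ℝ), (0 : ℝ), (0 : ℝ))] ++ (List.range n).flatMap (PotholderDiagram.row w)) ++
            ((w + 1) * parity n, (n + 1 : ℝ), (0 : ℝ)) ::
              [((w + 1) * parity (n + 1), (n + 1 : ℝ), (0 : ℝ)), q] := by
      intro q
      rw [List.range_succ, List.flatMap_append, List.flatMap_singleton, row_eq]
      simp
    have hn0 : (0 : ℝ) ≤ n := Nat.cast_nonneg n
    rw [e, polyline_append_cons, Set.image_union, ih (by omega), polyline, polyline, polyline,
      Set.union_eq_self_of_subset_right (Set.singleton_subset_iff.2 (right_mem_segment ℝ _ _)),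
      Set.image_union, image_comb_row V w h hn,
      show ((n + 1 : ℕ) : ℝ) + 1 = n + 2 by push_cast; ring, segment_eq_upright (by linarith),
      image_comb_turn V w h hn, strand_union (by linarith) (by linarith),
      strand_union (by linarith) (by linarith)]

end comb

theorem PotholderDiagram.image_comb_rowPath {w h : ℕ} (D : PotholderDiagram w h) :
    comb D.crossings w h '' polyline (rowPath w h) =
      strand (rowCurve D.crossings w h) (Set.Icc 0 (h + 1)) := by
  rw [← image_comb_rows D.crossings w h le_rfl, rowPath,
    show parity h = 1 from if_neg (Nat.not_even_iff_odd.2 D.odd_height), mul_one]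

/-! ### The normal form of a potholder -/

/-- Heights in a tilted potholder. -/
def potNode (h : ℕ) : ℕ → ℝ
  -- The node -5 serves only as a common starting value, as the interpolation requires the first
  -- nodes to agree. The others are the bottom, the start of the first row, the end of the last row,
  -- and the top.
  | 0 => -5
  | 1 => 0
  | 2 => 1
  | 3 => h + 1 / 2
  | _ => h + 1

/-- Heights of a lace. -/
def laceNode : ℕ → ℝ
  | 0 => -5
  | 1 => -1
  | 2 => 1 / 2
  | 3 => 1
  | _ => 3

theorem potNode_lt {h : ℕ} (hh : 1 ≤ h) : ∀ i < 4, potNode h i < potNode h (i + 1) := by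
  have : (1 : ℝ) ≤ h := by exact_mod_cast hh
  intro i hi
  interval_cases i <;> simp only [potNode] <;> linarith

theorem laceNode_lt : ∀ i < 4, laceNode i < laceNode (i + 1) := by
  intro i hi
  interval_cases i <;> simp only [laceNode] <;> norm_num

/-- The displacement that takes the heights in a tilted potholder to the ones of a lace. -/
def potShift (h : ℕ) (y : ℝ) : ℝ := plShift 4 (potNode h) laceNode y

theorem potShift_node {h : ℕ} (hh : 1 ≤ h) {i : ℕ} (hi : i < 4) :
    potNode h (i + 1) + potShift h (potNode h (i + 1)) = laceNode (i + 1) := by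
  have h1 := potNode_lt hh i hi
  rw [potShift, add_plShift (b := laceNode) (potNode_lt hh) rfl hi h1.le le_rfl,
    div_self (by linarith)]
  ring

theorem continuous_potShift (h : ℕ) : Continuous (potShift h) := continuous_plShift

theorem strictMono_potShift {h : ℕ} (hh : 1 ≤ h) : StrictMono fun y => y + potShift h y :=
  strictMono_plShift (potNode_lt hh) laceNode_lt

namespace PotholderDiagram

theorem one_le_height {w h : ℕ} (D : PotholderDiagram w h) : 1 ≤ h := D.odd_height.pos

variable {w h : ℕ} (D : PotholderDiagram w h)

/-- The homeomorphism that takes a potholder to a lace with its frame. -/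
def lay (p : Space) : Space :=
  -- The horizontal zigzag runs from the left to the right, but a lace starts at x = 2m. A half turn
  -- exchanges the sides without reflecting the knot.
  (fun p : Space => (w + 1 - p.1, p.2.1, -p.2.2))
    (moveY (fun p => potShift h p.2.1) (comb D.crossings w h p))

theorem isotopic_lay (A : Set Space) : AmbientIsotopic A (D.lay '' A) := by
  have i1 := isotopic_comb D.crossings w h A
  have i2 := isotopic_moveY (u := fun p => potShift h p.2.1)
    (by have := continuous_potShift h; fun_prop) (fun p => abs_plShift_le _ _ _ _)
    (fun _ _ => strictMono_potShift D.one_le_height) (comb D.crossings w h '' A)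
  have := (i1.trans i2).trans (isotopic_halfTurn (w + 1) _)
  rwa [Set.image_image, Set.image_image] at this

theorem image_lay (A : Set Space) : D.lay '' A = (fun p : Space => (w + 1 - p.1, p.2.1, -p.2.2)) ''
    (moveY (fun p => potShift h p.2.1) '' (comb D.crossings w h '' A)) := by
  rw [Set.image_image, Set.image_image]; rfl

theorem tiltShift_bottom (x z : ℝ) : tiltShift (h + 1) (rowSlope w) (x, 0, z) = 0 := by
  have := tiltShift_nat (v := rowSlope w) (i := 0) (n := h + 1) (by omega) x z
  rw [Nat.cast_zero] at this
  rw [this, rowSlope]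

theorem tiltShift_top (x z : ℝ) : tiltShift (h + 1) (rowSlope w) (x, h + 1, z) = 0 :=
  tiltShift_of_ge (by simp)

theorem lay_bottom (x : ℝ) : D.lay (x, 0, 0) = (w + 1 - x, -1, 0) := by
  have e := potShift_node D.one_le_height (i := 0) (by norm_num)
  simp only [potNode, laceNode, zero_add] at e
  simp only [lay, comb_apply, moveY]
  rw [weave_lower le_rfl, sub_zero, tiltShift_bottom, add_zero, zero_add, e, neg_zero]

theorem lay_top (x : ℝ) : D.lay (x, h + 1, 0) = (w + 1 - x, 3, 0) := by
  have e := potShift_node D.one_le_height (i := 3) (by norm_num)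
  simp only [potNode, laceNode] at e
  simp only [lay, comb_apply, moveY]
  rw [weave_upper le_rfl, sub_zero, tiltShift_top, add_zero, e, neg_zero]

theorem image_lay_column {i : ℕ} (hi : i < w) :
    D.lay '' Knotholder.column (i + 1) (colLevel D.crossings h i) 0 (h + 1) =
      upright (w - i) 0 (-1) 3 := by
  have h0 : (0 : ℝ) ≤ h + 1 := by positivity
  have h1 : moveZ (fun p => -weave D.crossings w h p.1 p.2.1) ''
      Knotholder.column (i + 1) (colLevel D.crossings h i) 0 (h + 1) =
        upright (i + 1) 0 0 (h + 1) := by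
    ext ⟨x, y, z⟩
    constructor
    · rintro ⟨⟨x', y', z'⟩, ⟨h1, h2, h3⟩, he⟩
      simp only at h1 h2 h3
      subst h1 h3
      simp only [moveZ, Prod.mk.injEq] at he
      obtain ⟨rfl, rfl, rfl⟩ := he
      exact ⟨rfl, h2, by simp only; rw [weave_succ hi]; ring⟩
    · rintro ⟨h1, h2, h3⟩
      simp only at h1 h2 h3
      subst h1 h3
      refine ⟨(i + 1, y, colLevel D.crossings h i y), ⟨rfl, h2, rfl⟩, ?_⟩
      simp only [moveZ, Prod.mk.injEq, true_and]
      rw [weave_succ hi]; ring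
  have h2 : comb D.crossings w h ''
      Knotholder.column (i + 1) (colLevel D.crossings h i) 0 (h + 1) =
        upright (i + 1) 0 0 (h + 1) := by
    have e : comb D.crossings w h '' Knotholder.column (i + 1) (colLevel D.crossings h i) 0 (h + 1) =
        moveY (tiltShift (h + 1) (rowSlope w)) ''
          (moveZ (fun p => -weave D.crossings w h p.1 p.2.1) ''
            Knotholder.column (i + 1) (colLevel D.crossings h i) 0 (h + 1)) := by
      rw [Set.image_image]; rfl
    rw [e, h1, image_moveY_upright (continuous_tiltShift (continuous_rowSlope w))
      (strictMono_tiltShift (fun i x => (rowSlope_mem w i x).1)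
        fun i x => (rowSlope_mem w i x).2) _ _ h0, tiltShift_bottom, tiltShift_top, add_zero, add_zero]
  have e1 := potShift_node D.one_le_height (i := 0) (by norm_num)
  have e2 := potShift_node D.one_le_height (i := 3) (by norm_num)
  simp only [potNode, laceNode, zero_add] at e1 e2
  rw [image_lay, h2, image_moveY_upright (u := fun p => potShift h p.2.1)
    (by have := continuous_potShift h; fun_prop)
    (fun _ _ => strictMono_potShift D.one_le_height) _ _ h0]
  simp only [zero_add, e1, e2]
  ext ⟨x, y, z⟩
  constructor
  · rintro ⟨⟨x', y', z'⟩, ⟨h1, h2, h3⟩, he⟩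
    simp only at h1 h2 h3
    subst h1 h3
    simp only [Prod.mk.injEq] at he
    obtain ⟨rfl, rfl, rfl⟩ := he
    exact ⟨by simp only; ring, h2, neg_zero⟩
  · rintro ⟨h1, h2, h3⟩
    simp only at h1 h2 h3
    subst h1 h3
    refine ⟨(i + 1, y, 0), ⟨rfl, h2, rfl⟩, ?_⟩
    simp only [neg_zero, Prod.mk.injEq, and_true]
    ring

/-- The half turn takes the vertical segment i to the strand w - i. Bottom connections become cups
and top connections caps; since w + 1 is even, the one at the bottom-left corner becomes the cup at
the foot of the lace, and the one at the top-right corner becomes the first cap. -/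
theorem image_lay_columnPath {m : ℕ} (hw : w + 1 = 2 * m) :
    D.lay '' polyline D.columnPath = warpFrame m := by
  have hw' : (w : ℝ) + 1 = 2 * m := by exact_mod_cast hw
  have bend_even : ∀ n, bend h (2 * n) = 0 := fun n => if_pos (by simp)
  have bend_odd : ∀ n, bend h (2 * n + 1) = h + 1 := fun n => if_neg (by simp)
  ext q
  constructor
  · rintro ⟨p, hp, rfl⟩
    rcases (D.mem_polyline_columnPath p).1 hp with ⟨i, hi, hp⟩ | ⟨i, hi, hp⟩
    · have : D.lay p ∈ upright (w - i) 0 (-1) 3 := by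
        rw [← D.image_lay_column hi]; exact ⟨p, hp, rfl⟩
      refine Or.inl ⟨w - i, by omega, ?_⟩
      rw [Nat.cast_sub hi.le]
      exact this
    · obtain ⟨x, y, z⟩ := p
      obtain ⟨h1, h2, h3⟩ := hp
      simp only at h1 h2 h3
      subst h2 h3
      rcases Nat.even_or_odd' i with ⟨n, rfl | rfl⟩
      · rw [bend_even, lay_bottom]
        refine Or.inr (Or.inl ⟨m - n, by omega, ?_, rfl, rfl⟩)
        rw [Nat.cast_sub (by omega)]
        push_cast at h1
        exact ⟨by linarith [h1.2], by linarith [h1.1]⟩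
      · rw [bend_odd, lay_top]
        refine Or.inr (Or.inr ⟨m - 1 - n, by omega, ?_, rfl, rfl⟩)
        rw [Nat.cast_sub (by omega), Nat.cast_sub (by omega)]
        push_cast at h1 ⊢
        exact ⟨by linarith [h1.2], by linarith [h1.1]⟩
  · obtain ⟨x, y, z⟩ := q
    rintro (⟨k, hk, hp⟩ | ⟨j, hj, h1, h2, h3⟩ | ⟨j, hj, h1, h2, h3⟩)
    · have : (x, y, z) ∈ upright (w - (w - k : ℕ)) 0 (-1) 3 := by
        rw [Nat.cast_sub (by omega), sub_sub_cancel]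
        exact hp
      rw [← D.image_lay_column (by omega)] at this
      obtain ⟨p, hp', e⟩ := this
      exact ⟨p, (D.mem_polyline_columnPath p).2 (Or.inl ⟨w - k, by omega, hp'⟩), e⟩
    · simp only at h1 h2 h3
      subst h2 h3
      refine ⟨(w + 1 - x, 0, 0), (D.mem_polyline_columnPath _).2 (Or.inr ⟨2 * (m - j), by omega, ?_⟩),
        by rw [lay_bottom, sub_sub_cancel]⟩
      rw [bend_even]
      push_cast [Nat.cast_sub hj.2]
      exact ⟨⟨by simp only; linarith [h1.2], by simp only; linarith [h1.1]⟩, rfl, rfl⟩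
    · simp only at h1 h2 h3
      subst h2 h3
      refine ⟨(w + 1 - x, h + 1, 0), (D.mem_polyline_columnPath _).2
        (Or.inr ⟨2 * (m - 1 - j) + 1, by omega, ?_⟩), by rw [lay_top, sub_sub_cancel]⟩
      rw [bend_odd]
      push_cast [Nat.cast_sub (show j ≤ m - 1 by omega), Nat.cast_sub (show 1 ≤ m by omega)]
      exact ⟨⟨by simp only; linarith [h1.2], by simp only; linarith [h1.1]⟩, rfl, rfl⟩

/-- A potholder is isotopic to a knot in normal form. -/
theorem hasForm {m : ℕ} (hm : 1 ≤ m) (hw : w + 1 = 2 * m) :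
    HasForm m (fun _ => false) D.realization := by
  have hw' : (w : ℝ) + 1 = 2 * m := by exact_mod_cast hw
  have hm' : (1 : ℝ) ≤ m := by exact_mod_cast hm
  have hh := D.one_le_height
  obtain ⟨ψ, hψ, hψ'⟩ := exists_inverse (continuous_potShift h) (abs_plShift_le _ _ _)
    (strictMono_potShift hh)
  have hmono : Monotone ψ := fun y y' h => by
    by_contra! hlt
    have := strictMono_potShift hh hlt
    simp only [hψ'] at this
    linarith
  have s1 : ψ (1 / 2) = 1 := by
    have := hψ 1
    have e := potShift_node hh (i := 1) (by norm_num)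
    simp only [potNode, laceNode] at e
    rwa [e] at this
  have s2 : ψ 1 = h + 1 / 2 := by
    have := hψ (h + 1 / 2)
    have e := potShift_node hh (i := 2) (by norm_num)
    simp only [potNode, laceNode] at e
    rwa [e] at this
  have hodd : parity h = 1 := if_neg (Nat.not_even_iff_odd.2 D.odd_height)
  -- These are the coordinates of the tilted horizontal zigzag after the half turn, which reverses x
  -- and cancels the sign of the level. Odd height makes the zigzag end on the side opposite to its
  -- start.
  let X : ℝ → ℝ := fun y => 2 * m - (w + 1) * swing h (ψ y)
  let Z : ℝ → ℝ := fun y => weave D.crossings w h ((w + 1) * swing h (ψ y)) (rank h (ψ y))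
  have l1 : ∀ y ≤ 1 / 2, swing h (ψ y) = 0 := fun y hy => swing_of_le (s1 ▸ hmono hy)
  have l2 : ∀ y, 1 ≤ y → swing h (ψ y) = 1 := fun y hy => hodd ▸ swing_of_ge (s2 ▸ hmono hy)
  have l3 : ∀ y, 0 ≤ swing h (ψ y) ∧ swing h (ψ y) ≤ 1 := fun y => by
    rcases swing_cases h (ψ y) with (e | e) | ⟨e, -⟩
    · rw [e]; norm_num
    · rw [e]; norm_num
    · exact e
  have hlace : IsLace m X Z :=
    { continuous_fst := by simp only [X]; fun_prop
      continuous_snd := (continuous_weave D.crossings w h).comp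
        (f := fun y => ((w + 1) * swing h (ψ y), rank h (ψ y))) (by fun_prop)
      fst_of_le := fun y hy => by simp only [X]; rw [l1 y hy]; ring
      snd_of_le := fun y hy => by simp only [Z]; rw [l1 y hy, mul_zero, weave_left le_rfl]
      fst_of_ge := fun y hy => by simp only [X]; rw [l2 y hy, hw']; ring
      snd_of_ge := fun y hy => by simp only [Z]; rw [l2 y hy, mul_one, weave_right le_rfl]
      fst_nonneg := fun y => by simp only [X]; rw [hw']; nlinarith [(l3 y).2]
      snd_le := fun y => (abs_le.1 (abs_weave_le _ _ _ _ _)).2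
      avoid := fun y k hk hk' hX => by
        have hk1 : (1 : ℝ) ≤ k := by exact_mod_cast hk
        have hk2 := cast_le_sub_one hk'
        push_cast at hk2
        simp only [X] at hX
        rcases swing_cases h (ψ y) with (e | e) | ⟨-, n, hn, e⟩
        · rw [e] at hX; linarith
        · rw [e] at hX; linarith
        · simp only [Z]
          -- The strand k comes from the vertical segment w - k. The lace meets its line only in the
          -- interior of a row, at level ±1.
          have e2 : (w + 1 : ℝ) * swing h (ψ y) = ((w - k : ℕ) : ℝ) + 1 := by
            rw [Nat.cast_sub (by omega)]; linarith
          rw [e, e2, weave_succ (by omega), colLevel_succ hn]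
          intro h0
          have := abs_level (D.crossings (w - k) n)
          rw [h0, abs_zero] at this
          norm_num at this }
  obtain ⟨C, hC, hS⟩ := hlace.hasForm hm
  have e1 := potShift_node hh (i := 0) (by norm_num)
  have e2 := potShift_node hh (i := 3) (by norm_num)
  simp only [potNode, laceNode, zero_add] at e1 e2
  have him : D.lay '' D.realization =
      warpFrame m ∪ strand (fun y => (X y, Z y)) (Set.Icc (-1) 3) := by
    rw [realization, Set.image_union, D.image_lay_columnPath hw, Set.union_comm, image_lay,
      D.image_comb_rowPath, image_moveY_strand (continuous_potShift h) (strictMono_potShift hh) hψ _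
        (by positivity), zero_add, e1, e2]
    congr 1
    rw [strand, strand, Set.image_image]
    refine Set.image_congr fun y _ => ?_
    simp only [rowCurve, X, Z, neg_neg, hw']
  rw [← him] at hS
  exact ⟨C, hC, (D.isotopic_lay _).trans hS⟩

end PotholderDiagram

/-! ### Realizing a prescribed sign tuple -/

theorem armSign_of_even {k : ℕ} (hk : Even k) (b : Bool) :
    armSign k b = if b then 1 else -1 := by
  cases b <;> simp [armSign, crossingSign, hk]

theorem armSign_of_odd {k : ℕ} (hk : ¬ Even k) (b : Bool) :
    armSign k b = if b then -1 else 1 := by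
  cases b <;> simp [armSign, crossingSign, hk]

/-- The choice of over- and undercrossings on the horizontal segment for which the crossings
`2 i - 1` and `2 i` have the sign with index `i - 1`. -/
def overOfSigns {m : ℕ} (ε : Fin m → SignType) (k : ℕ) : Bool :=
  if h : (k + 1) / 2 - 1 < m then
    if Even k then decide (ε ⟨(k + 1) / 2 - 1, h⟩ = 1) else decide (ε ⟨(k + 1) / 2 - 1, h⟩ ≠ 1)
  else false

variable {m : ℕ} {ε : Fin m → SignType}

theorem armSign_overOfSigns_even (hε : ∀ i, ε i = 1 ∨ ε i = -1) (i : Fin m) :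
    armSign (2 * (i + 1)) (overOfSigns ε (2 * (i + 1))) = ε i := by
  have he : Even (2 * ((i : ℕ) + 1)) := even_two_mul _
  have hi : (2 * ((i : ℕ) + 1) + 1) / 2 - 1 = i := by omega
  rw [armSign_of_even he]
  rcases hε i with h | h <;> simp [overOfSigns, hi, h]

theorem armSign_overOfSigns_odd (hε : ∀ i, ε i = 1 ∨ ε i = -1) (i : Fin m) :
    armSign (2 * (i + 1) - 1) (overOfSigns ε (2 * (i + 1) - 1)) = ε i := by
  have he : ¬ Even (2 * ((i : ℕ) + 1) - 1) := by
    rw [Nat.even_iff]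
    omega
  have hi : (2 * ((i : ℕ) + 1) - 1 + 1) / 2 - 1 = i := by omega
  rw [armSign_of_odd he]
  rcases hε i with h | h <;> simp [overOfSigns, hi, h, he]

theorem Knot.HasPotholderDiagram.hasKnotholderDiagram (hm : 1 ≤ m) {K : Knot}
    (hK : K.HasPotholderDiagram (2 * m - 1)) (hε : ∀ i, ε i = 1 ∨ ε i = -1) :
    K.HasKnotholderDiagram m ε := by
  obtain ⟨h, D, hD⟩ := hK
  -- Strands are numbered from the left beginning with 0 and crossings from the right beginning with
  -- 1, so the strand k carries the crossing 2m - k.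
  obtain ⟨E, hE, hiso⟩ := ((D.hasForm hm (by omega)).change hm
    (fun k => overOfSigns ε (2 * m - k))).exists_knotholder hm (by
      intro i h1 h2
      obtain ⟨j, rfl⟩ : ∃ j, i = j + 1 := ⟨i - 1, by omega⟩
      rw [armSign_overOfSigns_odd hε ⟨j, h2⟩, armSign_overOfSigns_even hε ⟨j, h2⟩])
  refine ⟨E, funext fun i => ?_, hD.trans hiso⟩
  rw [KnotholderDiagram.signTuple, hE, armSign_overOfSigns_even hε]

end Knotholder

end

theorem mainTheorem2 (m : ℕ) (hm : 1 ≤ m) (K : Knotholder.Knot)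
    (hK : K.HasPotholderDiagram (2 * m - 1))
    (ε : Fin m → SignType) (hε : ∀ i, ε i = 1 ∨ ε i = -1) :
    K.HasKnotholderDiagram m ε := by
  exact hK.hasKnotholderDiagram hm hε
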